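/- **Setting.** Let $T\in\mathbb N_0\cup\{\infty\}$ and let $\mathbb T=\{0,\dots,T\}$ if $T<\infty$, and $\mathbb T=\mathbb N_0$ or $\mathbb T=\mathbb N_0\cup\{\infty\}$ if $T=\infty$; put $\mathbb T_t=\{s\in\mathbb T: s\ge t\}$. Let $P$ be a probability measure on $(\Omega,\mathcal F)$ with a filtration $(\mathcal F_t)_{t\in\mathbb T\cap\mathbb N_0}$, $\mathcal F_0=\{\emptyset,\Omega\}$, and $\mathcal F_\infty=\sigma(\bigcup_n\mathcal F_n)$ if $T=\infty$. If $T=\infty$, assume that each $\mathcal F_t$, $t\in\mathbb N_0$, is $\sigma$-isomorphic to the Borel $\sigma$-field of a complete separable metric space and that $\bigcap_nA_n\ne\emptyset$ for every decreasing sequence of atoms $A_n$ of $\mathcal F_n$. Relations between random variables hold almost surely. Let $L^\infty_t=L^\infty(\Omega,\mathcal F_t,P)$, let $\mathcal R^\infty$ be the space of essentially bounded adapted processes $X=(X_s)_{s\in\mathbb T}$, $\pi_t(X)=(1_{\{t\le s\}}X_s)_{s\in\mathbb T}$ and $\mathcal R^\infty_t=\pi_t(\mathcal R^\infty)$. A *dynamic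 coherent risk measure* is a family of maps $\rho_t:\mathcal R_t^\infty\to L_t^\infty$, $t\in\mathbb T\cap\mathbb N_0$, such that for all $X,Y\in\mathcal R^\infty_t$: $\rho_t(X+m1_{\mathbb T_t})=\rho_t(X)-m$ for $m\in L_t^\infty$; $\rho_t(X)\ge\rho_t(Y)$ if $X\le Y$; $\rho_t(\lambda X+(1-\lambda)Y)\le\lambda\rho_t(X)+(1-\lambda)\rho_t(Y)$ for $\lambda\in L_t^\infty$, $0\le\lambda\le1$; $\rho_t(0)=0$; $\rho_t(\lambda X)=\lambda\rho_t(X)$ for $\lambda\in L_t^\infty$, $\lambda\ge 0$. For $X\in\mathcal R^\infty$ write $\rho_t(X)=\rho_t(\pi_t(X))$. It is *continuous from above* if, for each $t\in\mathbb T\cap\mathbb N_0$, $\rho_t(X^n)\nearrow\rho_t(X)$ whenever $X^n,X\in\mathcal R^\infty$ and $X^n_s\searrow X_s$ for all $s\in\mathbb T_t$. It is *time consistent* if for all $t\in\mathbb T$ with $t<T$ and all $X,Y\in\mathcal R^\infty$: $X_t=Y_t$ and $\rho_{t+1}(X)\le\rho_{t+1}(Y)$ imply $\rho_t(X)\le\rho_t(Y)$.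 Let $\bar\Omega=\Omega\times\mathbb T$, let $\bar{\mathcal F}$ be the $\sigma$-field generated by the sets $A\times\{t\}$, $A\in\mathcal F_t$, $t\in\mathbb T$, and let $\bar{\mathcal F}_t$ be generated by the sets $A\times\{j\}$, $A\in\mathcal F_j$, $j<t$, and $A\times\mathbb T_t$, $A\in\mathcal F_t$. Processes are identified with functions on $\bar\Omega$. For a probability measure $Q$ on $\mathcal F_T$ and a nonnegative adapted $\gamma$ let $Q\otimes\gamma$ be given by $E_{Q\otimes\gamma}[X]=E_Q[\sum_{s\in\mathbb T}\gamma_sX_s]$. Fix an adapted $\mu$ with $\mu_s>0$ and $\sum_{s\in\mathbb T}\mu_s=1$, and put $\bar P=P\otimes\mu$. Let $\mathcal M(\bar P)$ be the set of probability measures on $\bar{\mathcal F}$ that are absolutely continuous with respect to $\bar P$. Let $\mathcal M_{\rm loc}(P)$ be the set of probability measures $Q$ on $\mathcal F_T$ with $Q\ll P$ on $\mathcal F_t$ for all $t\in\mathbb T\cap\mathbb N_0$. For $Q\in\mathcal M_{\rm loc}(P)$ let $\Gamma(Q)$ be the set of adapted processes $\gamma\ge0$ with $\sum_{s\in\mathbb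 T}\gamma_s=1$ $Q$-a.s. and, if $\infty\in\mathbb T$, $\gamma_\infty=0$ $Q$-a.s. on $\{\lim_nM_n=\infty\}$, where $M$ is the density process of $Q$ with respect to $P$. Put $D_t=1-\sum_{s<t}\gamma_s$ and write $Q\otimes D=Q\otimes\gamma$. The measures in $\mathcal M(\bar P)$ are exactly the $Q\otimes\gamma$ with $Q\in\mathcal M_{\rm loc}(P)$, $\gamma\in\Gamma(Q)$. *Penalties.* Let $\mathcal A_t=\{X\in\mathcal R_t^\infty:\rho_t(X)\le0\}$ and $$\alpha_t(Q\otimes D)=Q\text{-}\operatorname*{ess\,sup}_{X\in\mathcal A_t}E_Q\Big[-\sum_{s\in\mathbb T_t}\tfrac{\gamma_s}{D_t}X_s\,\Big|\,\mathcal F_t\Big]\ \text{ on }\{D_t>0\},\qquad \alpha_t=\infty\ \text{ on }\{D_t=0\}.$$ Let $\bar\rho_t(X)=-\sum_{s<t}X_s1_{\{s\}}+\rho_t(X)1_{\mathbb T_t}$, $\bar{\mathcal A}_t=\{X\in\mathcal R^\infty:\bar\rho_t(X)\le0\}$, let $\bar{\mathcal A}_{t,t+1}$ be the set of $\bar{\mathcal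 F}_{t+1}$-measurable elements of $\bar{\mathcal A}_t$, and put $\bar\alpha_t(\bar R)=\bar R\text{-}\operatorname{ess\,sup}_{X\in\bar{\mathcal A}_t}E_{\bar R}[-X\mid\bar{\mathcal F}_t]$, $\bar\alpha_{t,t+1}(\bar R)=\bar R\text{-}\operatorname{ess\,sup}_{X\in\bar{\mathcal A}_{t,t+1}}E_{\bar R}[-X\mid\bar{\mathcal F}_t]$; thus $\bar\alpha_0=\alpha_0$. For a probability measure $\bar Q$ on $\bar{\mathcal F}$ or on some $\bar{\mathcal F}_r$, $r\ge t$, define $$\mathcal Q_t^0(\bar Q)=\{\bar R\in\mathcal M(\bar P):\bar R=\bar Q\text{ on }\bar{\mathcal F}_t,\ \bar\alpha_t(\bar R)=0\ \bar Q\text{-a.s.}\},$$ and let $\mathcal Q_{t,t+1}^0(\bar Q)$ be the set of probability measures $\bar R$ on $\bar{\mathcal F}_{t+1}$ with $\bar R\ll\bar P$ on $\bar{\mathcal F}_{t+1}$, $\bar R=\bar Q$ on $\bar{\mathcal F}_t$ and $\bar\alpha_{t,t+1}(\bar R)=0$ $\bar Q$-a.s. *Pasting.* If $\bar Q^1\ll\bar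 Q^2$ on $\bar{\mathcal F}_t$ and $B\in\bar{\mathcal F}_t$, put $\bar Q^1\oplus^t_B\bar Q^2(A)=E_{\bar Q^1}\big[E_{\bar Q^2}[1_A\mid\bar{\mathcal F}_t]1_B+1_{B^c}1_A\big]$, $A\in\bar{\mathcal F}$ (for $B=\bar\Omega$ it suffices that $\bar Q^1$ is defined on $\bar{\mathcal F}_t$). A set $\mathcal S\subseteq\mathcal M(\bar P)$ is *stable* if $\bar Q^1\oplus^t_B\bar Q^2\in\mathcal S$ for all $t\in\mathbb T\cap\mathbb N_0$, all $\bar Q^1,\bar Q^2\in\mathcal S$ with $\bar Q^1\ll\bar Q^2$ on $\bar{\mathcal F}_t$, and all $B\in\bar{\mathcal F}_t$. Let $\bar{\mathcal Q}^*$ be the set of probability measures $\bar Q\approx\bar P$ on $\bar{\mathcal F}$ with $\alpha_0(\bar Q)<\infty$. **Theorem 4.9.** Let $(\rho_t)_{t\in\mathbb T\cap\mathbb N_0}$ be a dynamic coherent risk measure that is continuous from above. The following are equivalent: 1. $(\rho_t)$ is time consistent. 2. For all $t\in\mathbb T$, $t<T$, and all $\bar Q\in\mathcal M(\bar P)$,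 $$\mathcal Q_t^0(\bar Q)=\{\bar Q^1\oplus^{t+1}_{\bar\Omega}\bar Q^2:\ \bar Q^1\in\mathcal Q^0_{t,t+1}(\bar Q),\ \bar Q^2\in\mathcal Q_{t+1}^0(\bar Q^1)\}.$$ 3. For all $t\in\mathbb T$, $t<T$, all $X\in\mathcal R^\infty$ and all $\bar Q=Q\otimes D\in\mathcal M(\bar P)$ with $\alpha_t(\bar Q)=0$ $Q$-a.s. on $\{D_t>0\}$, $$E_Q[D_{t+1}(X_t+\rho_{t+1}(X))\mid\mathcal F_t]\le D_t(X_t+\rho_t(X))\ \ Q\text{-a.s.}\quad\text{and}\quad\alpha_{t+1}(\bar Q)=0\ \ Q\text{-a.s. on }\{D_{t+1}>0\}.$$ If moreover $\bar{\mathcal Q}^*\ne\emptyset$, then time consistency is equivalent to each of the following: 4. $\bar{\mathcal Q}^*$ is stable and, for all $X\in\mathcal R^\infty$ and $t\in\mathbb T\cap\mathbb N_0$, $$\rho_t(X)=\operatorname*{ess\,sup}_{Q\otimes\gamma\in\bar{\mathcal Q}^*}\frac1{D_t}E_Q\Big[-\sum_{s\in\mathbb T_t}\gamma_sX_s\,\Big|\,\mathcal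 F_t\Big].\qquad(*)$$ 5. $(*)$ holds for all $X\in\mathcal R^\infty$ and $t\in\mathbb T\cap\mathbb N_0$, and for all $X\in\mathcal R^\infty$ and all $Q\otimes D\in\bar{\mathcal Q}^*$ the process $$D_t\rho_t(X-X_t1_{\mathbb T_t})-\sum_{s=0}^tD_s(X_s-X_{s-1}),\qquad t\in\mathbb T\cap\mathbb N_0\quad(X_{-1}:=0),$$ is a $Q$-supermartingale. -/

import Mathlib

open MeasureTheory ProbabilityTheory Filter Topology Set
open scoped ENNReal

namespace RiskProc

/-! ### Time horizon -/

/-- The three kinds of time sets: `{0, …, T}`, `ℕ₀`, and `ℕ₀ ∪ {∞}`. -/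
inductive Horizon where
  | finite (T : ℕ)
  | nat
  | natInfty

namespace Horizon

/-- The horizon `T ∈ ℕ ∪ {∞}`. -/
def last : Horizon → ℕ∞
  | finite T => (T : ℕ∞)
  | nat => ⊤
  | natInfty => ⊤

/-- The set `𝕋` of time points, as a subset of `ℕ ∪ {∞}`. -/
def times : Horizon → Set ℕ∞
  | finite T => {t | t ≤ (T : ℕ∞)}
  | nat => {t | t < ⊤}
  | natInfty => Set.univ

/-- The set `𝕋` as a type. -/
abbrev Time (H : Horizon) : Type := {t : ℕ∞ // t ∈ H.times}

end Horizon

universe u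

variable {Ω : Type u}

/-- Real-valued processes `(X_s)_{s ∈ 𝕋}`. -/
abbrev Proc (Ω : Type u) (H : Horizon) : Type u := H.Time → Ω → ℝ

/-- The product space `Ω × 𝕋`. -/
abbrev OmegaBar (Ω : Type u) (H : Horizon) : Type u := Ω × H.Time

open scoped Classical in
/-- The coordinate `X_n` of a process at a finite time `n` (it is used for `n ∈ 𝕋` only). -/
noncomputable def coord {H : Horizon} (X : Proc Ω H) (n : ℕ) : Ω → ℝ :=
  if h : (n : ℕ∞) ∈ H.times then X ⟨n, h⟩ else 0

/-- The increment `ΔX_n = X_n - X_{n-1}`, with `X_{-1} = 0`. -/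
noncomputable def incr {H : Horizon} (X : Proc Ω H) : ℕ → Ω → ℝ
  | 0 => coord X 0
  | n + 1 => coord X (n + 1) - coord X n

open scoped Classical in
/-- The process `m 1_{𝕋_t}`. -/
noncomputable def constFrom {H : Horizon} (t : ℕ) (m : Ω → ℝ) : Proc Ω H :=
  fun s ω => if (t : ℕ∞) ≤ s.1 then m ω else 0

open scoped Classical in
/-- The projection `π_{t,T}(X)_r = 1_{t ≤ r} X_r`. -/
noncomputable def proj {H : Horizon} (t : ℕ) (X : Proc Ω H) : Proc Ω H :=
  fun s ω => if (t : ℕ∞) ≤ s.1 then X s ω else 0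

/-- A process viewed as a function on the product space `Ω × 𝕋`. -/
def onProd {H : Horizon} (X : Proc Ω H) : OmegaBar Ω H → ℝ := fun p => X p.2 p.1

/-! ### Essential suprema of families -/

/-- `g` is the `μ`-essential supremum, among `m`-measurable functions, of the family `S`: the
smallest `m`-measurable function that dominates every member of `S` almost surely. -/
def IsEssSup {α : Type u} {m0 : MeasurableSpace α} (m : MeasurableSpace α) (μ : Measure[m0] α)
    (S : Set (α → EReal)) (g : α → EReal) : Prop :=
  Measurable[m] g ∧ (∀ f ∈ S, ∀ᵐ x ∂μ, f x ≤ g x) ∧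
    ∀ h : α → EReal, Measurable[m] h → (∀ f ∈ S, ∀ᵐ x ∂μ, f x ≤ h x) → ∀ᵐ x ∂μ, g x ≤ h x

/-- A version of the essential supremum of a family (see `isEssSup_essSupFam`). -/
noncomputable def essSupFam {α : Type u} {m0 : MeasurableSpace α} (m : MeasurableSpace α)
    (μ : Measure[m0] α) (S : Set (α → EReal)) : α → EReal :=
  Classical.epsilon (IsEssSup m μ S)

theorem isEssSup_essSupFam {α : Type u} {m0 : MeasurableSpace α} (m : MeasurableSpace α)
    (hm : m ≤ m0) (μ : Measure[m0] α) [IsFiniteMeasure μ] (S : Set (α → EReal)) :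
    IsEssSup m μ S (essSupFam m μ S) := by
  refine Classical.epsilon_spec ?_
  set φ : EReal → ℝ≥0∞ := fun x => (ENNReal.orderIsoIicOneBirational (EReal.exp x) : ℝ≥0∞) with hφ
  have hφs : StrictMono φ := fun x y hxy =>
    ENNReal.orderIsoIicOneBirational.strictMono (EReal.exp_strictMono hxy)
  have hφm : Measurable φ := hφs.monotone.measurable
  have hφ1 : ∀ x, φ x ≤ 1 := fun x => (ENNReal.orderIsoIicOneBirational (EReal.exp x)).2
  set U : Set (α → EReal) := {h | Measurable[m] h ∧ ∀ f ∈ S, ∀ᵐ x ∂μ, f x ≤ h x} with hU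
  have hUne : U.Nonempty := ⟨fun _ => ⊤, measurable_const, fun f _ => by simp⟩
  set I : Set ℝ≥0∞ := (fun h : α → EReal => ∫⁻ x, φ (h x) ∂μ) '' U with hI
  obtain ⟨v, -, hv, hvI⟩ := exists_seq_tendsto_sInf (hUne.image _ : I.Nonempty)
    (OrderBot.bddBelow I)
  choose k hkU hkv using hvI
  refine ⟨fun x => ⨅ n, k n x, Measurable.iInf fun n => (hkU n).1, fun f hf => ?_,
    fun h hh hfh => ?_⟩
  · have := ae_all_iff.2 fun n => (hkU n).2 f hf
    filter_upwards [this] with x hx using le_iInf hx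
  · set g : α → EReal := fun x => ⨅ n, k n x with hg
    have hgm : Measurable[m] g := Measurable.iInf fun n => (hkU n).1
    have hmin : (fun x => min (g x) (h x)) ∈ U := by
      refine ⟨hgm.min hh, fun f hf => ?_⟩
      have := ae_all_iff.2 fun n => (hkU n).2 f hf
      filter_upwards [this, hfh f hf] with x hx hx' using le_min (le_iInf hx) hx'
    have h1 : ∫⁻ x, φ (g x) ∂μ ≤ sInf I := by
      refine ge_of_tendsto' hv fun n => ?_
      rw [← hkv n]
      exact lintegral_mono fun x => hφs.monotone (iInf_le _ n)
    have h2 : ∫⁻ x, φ (g x) ∂μ ≤ ∫⁻ x, φ (min (g x) (h x)) ∂μ :=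
      h1.trans (sInf_le ⟨_, hmin, rfl⟩)
    have hfin : ∫⁻ x, φ (min (g x) (h x)) ∂μ ≠ ⊤ := by
      refine ((lintegral_mono fun x => hφ1 _).trans_lt ?_).ne
      simp
    have hae := ae_eq_of_ae_le_of_lintegral_le
      (ae_of_all μ fun x => hφs.monotone (min_le_left (g x) (h x))) hfin
      (hφm.comp (hgm.mono hm le_rfl)).aemeasurable h2
    filter_upwards [hae] with x hx
    exact min_eq_left_iff.1 (hφs.injective hx)

/-! ### σ-fields -/

/-- The σ-field `𝓕_t` for `t ∈ ℕ ∪ {∞}`, with `𝓕_∞ = σ(⋃ₙ 𝓕_n)`. -/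
abbrev sigmaAt {m0 : MeasurableSpace Ω} (𝓕 : Filtration ℕ m0) (t : ℕ∞) : MeasurableSpace Ω :=
  ⨆ (n : ℕ) (_ : (n : ℕ∞) ≤ t), 𝓕 n

theorem sigmaAt_coe {m0 : MeasurableSpace Ω} (𝓕 : Filtration ℕ m0) (t : ℕ) :
    sigmaAt 𝓕 t = 𝓕 t :=
  le_antisymm (iSup₂_le fun _ hn => 𝓕.mono (by exact_mod_cast hn))
    (le_iSup₂_of_le t le_rfl le_rfl)

theorem sigmaAt_top {m0 : MeasurableSpace Ω} (𝓕 : Filtration ℕ m0) :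
    sigmaAt 𝓕 ⊤ = ⨆ n, 𝓕 n := by
  simp [sigmaAt]

/-- The terminal σ-field `𝓕_T`. -/
abbrev sigmaEnd {m0 : MeasurableSpace Ω} (H : Horizon) (𝓕 : Filtration ℕ m0) :
    MeasurableSpace Ω :=
  sigmaAt 𝓕 H.last

/-- The optional σ-field on `Ω × 𝕋`, generated by the sets `A × {t}`, `A ∈ 𝓕_t`, `t ∈ 𝕋`. -/
abbrev optional {m0 : MeasurableSpace Ω} (H : Horizon) (𝓕 : Filtration ℕ m0) :
    MeasurableSpace (OmegaBar Ω H) :=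
  MeasurableSpace.generateFrom
    {E | ∃ (s : H.Time) (A : Set Ω), MeasurableSet[sigmaAt 𝓕 s.1] A ∧ E = A ×ˢ {s}}

/-- The optional filtration: its σ-field at time `t` is generated by the sets `A × {j}`,
`A ∈ 𝓕_j`, `j < t`, and `A × 𝕋_t`, `A ∈ 𝓕_t`. -/
abbrev optionalAt {m0 : MeasurableSpace Ω} (H : Horizon) (𝓕 : Filtration ℕ m0) (t : ℕ) :
    MeasurableSpace (OmegaBar Ω H) :=
  MeasurableSpace.generateFrom
    ({E | ∃ (s : H.Time) (A : Set Ω), s.1 < (t : ℕ∞) ∧ MeasurableSet[sigmaAt 𝓕 s.1] A ∧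
        E = A ×ˢ {s}} ∪
      {E | ∃ A : Set Ω, MeasurableSet[𝓕 t] A ∧ E = A ×ˢ {s : H.Time | (t : ℕ∞) ≤ s.1}})

/-- A σ-field is σ-isomorphic to the Borel σ-field of a complete separable metric space: there is
a bijection between the two σ-fields that preserves complements and countable unions. -/
def IsSigmaIsoPolish (m : MeasurableSpace Ω) : Prop :=
  ∃ (Y : Type) (_ : TopologicalSpace Y) (_ : PolishSpace Y)
    (e : {A : Set Ω // MeasurableSet[m] A} ≃ {B : Set Y // MeasurableSet[borel Y] B}),
    (∀ A A' : {A : Set Ω // MeasurableSet[m] A}, A'.1 = A.1ᶜ → (e A').1 = (e A).1ᶜ) ∧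
    (∀ (A : ℕ → {A : Set Ω // MeasurableSet[m] A}) (A' : {A : Set Ω // MeasurableSet[m] A}),
      A'.1 = ⋃ n, (A n).1 → (e A').1 = ⋃ n, (e (A n)).1)

/-- `A` is an atom of the σ-field `m`. -/
def IsSigmaAtom (m : MeasurableSpace Ω) (A : Set Ω) : Prop :=
  MeasurableSet[m] A ∧ A.Nonempty ∧ ∀ B, MeasurableSet[m] B → B ⊆ A → B = ∅ ∨ B = A

/-- The structural assumption on the filtration for the case `T = ∞`. -/
def FiltrationRegular {m0 : MeasurableSpace Ω} (𝓕 : Filtration ℕ m0) : Prop :=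
  (∀ t, IsSigmaIsoPolish (𝓕 t)) ∧
    ∀ A : ℕ → Set Ω, (∀ n, IsSigmaAtom (𝓕 n) (A n)) → Antitone A → (⋂ n, A n).Nonempty

/-! ### Spaces of random variables and of processes -/

/-- `f ∈ L^∞_t`. -/
def LInf {m0 : MeasurableSpace Ω} (𝓕 : Filtration ℕ m0) (P : Measure Ω) (t : ℕ) (f : Ω → ℝ) :
    Prop :=
  Measurable[𝓕 t] f ∧ ∃ C : ℝ, ∀ᵐ ω ∂P, |f ω| ≤ C

/-- The space `𝓡^∞` of essentially bounded adapted processes. -/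
def RInf {m0 : MeasurableSpace Ω} (H : Horizon) (𝓕 : Filtration ℕ m0) (P : Measure Ω) :
    Set (Proc Ω H) :=
  {X | (∀ s, Measurable[sigmaAt 𝓕 s.1] (X s)) ∧ ∃ C : ℝ, ∀ᵐ ω ∂P, ∀ s, |X s ω| ≤ C}

/-- The space `𝓡^∞_t = π_{t,T}(𝓡^∞)`. -/
def RInfFrom {m0 : MeasurableSpace Ω} (H : Horizon) (𝓕 : Filtration ℕ m0) (P : Measure Ω)
    (t : ℕ) : Set (Proc Ω H) :=
  proj t '' RInf H 𝓕 P

/-! ### Risk measures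

A conditional risk measure `ρ_t : 𝓡^∞_t → L^∞_t` is given on representatives; by monotonicity,
`P`-a.s. equal processes have `P`-a.s. equal risk. -/

/-- Conditional coherent risk measures for processes at time `t`. -/
structure IsCondCoherent {m0 : MeasurableSpace Ω} {H : Horizon} (𝓕 : Filtration ℕ m0)
    (P : Measure Ω) (t : ℕ) (ρ : Proc Ω H → Ω → ℝ) : Prop where
  maps : ∀ X ∈ RInfFrom H 𝓕 P t, LInf 𝓕 P t (ρ X)
  cash : ∀ X ∈ RInfFrom H 𝓕 P t, ∀ m, LInf 𝓕 P t m →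
    ∀ᵐ ω ∂P, ρ (X + constFrom t m) ω = ρ X ω - m ω
  mono : ∀ X ∈ RInfFrom H 𝓕 P t, ∀ Y ∈ RInfFrom H 𝓕 P t,
    (∀ᵐ ω ∂P, ∀ s, X s ω ≤ Y s ω) → ∀ᵐ ω ∂P, ρ Y ω ≤ ρ X ω
  convex : ∀ X ∈ RInfFrom H 𝓕 P t, ∀ Y ∈ RInfFrom H 𝓕 P t, ∀ l, LInf 𝓕 P t l →
    (∀ᵐ ω ∂P, 0 ≤ l ω ∧ l ω ≤ 1) →
    ∀ᵐ ω ∂P, ρ (fun s ω => l ω * X s ω + (1 - l ω) * Y s ω) ω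
      ≤ l ω * ρ X ω + (1 - l ω) * ρ Y ω
  normalized : ∀ᵐ ω ∂P, ρ 0 ω = 0
  posHom : ∀ X ∈ RInfFrom H 𝓕 P t, ∀ l, LInf 𝓕 P t l → (∀ᵐ ω ∂P, 0 ≤ l ω) →
    ∀ᵐ ω ∂P, ρ (fun s ω => l ω * X s ω) ω = l ω * ρ X ω

/-- `ρ_t(X) = ρ_t(π_{t,T}(X))` for `X ∈ 𝓡^∞`. -/
noncomputable def riskOf {H : Horizon} (ρ : ℕ → Proc Ω H → Ω → ℝ) (t : ℕ) (X : Proc Ω H) :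
    Ω → ℝ :=
  ρ t (proj t X)

/-- Dynamic coherent risk measures `(ρ_t)_{t ∈ 𝕋 ∩ ℕ₀}`. -/
def IsDynCoherent {m0 : MeasurableSpace Ω} {H : Horizon} (𝓕 : Filtration ℕ m0)
    (P : Measure Ω) (ρ : ℕ → Proc Ω H → Ω → ℝ) : Prop :=
  ∀ t : ℕ, (t : ℕ∞) ∈ H.times → IsCondCoherent 𝓕 P t (ρ t)

/-- Continuity from above of `ρ_t`. -/
def ContFromAbove {m0 : MeasurableSpace Ω} {H : Horizon} (𝓕 : Filtration ℕ m0)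
    (P : Measure Ω) (ρ : ℕ → Proc Ω H → Ω → ℝ) (t : ℕ) : Prop :=
  ∀ (X : ℕ → Proc Ω H) (Y : Proc Ω H), (∀ n, X n ∈ RInf H 𝓕 P) → Y ∈ RInf H 𝓕 P →
    (∀ s : H.Time, (t : ℕ∞) ≤ s.1 → ∀ᵐ ω ∂P,
      Antitone (fun n => X n s ω) ∧ Tendsto (fun n => X n s ω) atTop (𝓝 (Y s ω))) →
    ∀ᵐ ω ∂P, Monotone (fun n => riskOf ρ t (X n) ω) ∧
      Tendsto (fun n => riskOf ρ t (X n) ω) atTop (𝓝 (riskOf ρ t Y ω))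

/-- (Strong) time consistency. -/
def TimeConsistent {m0 : MeasurableSpace Ω} {H : Horizon} (𝓕 : Filtration ℕ m0)
    (P : Measure Ω) (ρ : ℕ → Proc Ω H → Ω → ℝ) : Prop :=
  ∀ t : ℕ, (t : ℕ∞) < H.last → ∀ X ∈ RInf H 𝓕 P, ∀ Y ∈ RInf H 𝓕 P,
    (∀ᵐ ω ∂P, coord X t ω = coord Y t ω) →
    (∀ᵐ ω ∂P, riskOf ρ (t + 1) X ω ≤ riskOf ρ (t + 1) Y ω) →
    ∀ᵐ ω ∂P, riskOf ρ t X ω ≤ riskOf ρ t Y ω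

/-! ### Measures on `Ω × 𝕋` and their decomposition -/

/-- The measure `Q ⊗ γ` on the optional σ-field, `E_{Q ⊗ γ}[X] = E_Q[∑_{s ∈ 𝕋} γ_s X_s]`. -/
noncomputable def tensor {m0 : MeasurableSpace Ω} {H : Horizon} (𝓕 : Filtration ℕ m0)
    {m : MeasurableSpace Ω} (Q : Measure[m] Ω) (γ : Proc Ω H) :
    Measure[optional H 𝓕] (OmegaBar Ω H) :=
  @Measure.sum (OmegaBar Ω H) H.Time (optional H 𝓕) fun s =>
    @Measure.map Ω (OmegaBar Ω H) m (optional H 𝓕) (fun ω => (ω, s))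
      (Q.withDensity fun ω => ENNReal.ofReal (γ s ω))

/-- The reference process `μ`: adapted, strictly positive, with `∑_{s ∈ 𝕋} μ_s = 1`. -/
structure IsReference {m0 : MeasurableSpace Ω} {H : Horizon} (𝓕 : Filtration ℕ m0)
    (P : Measure Ω) (μ : Proc Ω H) : Prop where
  adapted : ∀ s, Measurable[sigmaAt 𝓕 s.1] (μ s)
  pos : ∀ s, ∀ᵐ ω ∂P, 0 < μ s ω
  sum_one : ∀ᵐ ω ∂P, HasSum (fun s => μ s ω) 1

/-- `Q ∈ 𝓜_loc(P)`: probability measures on `𝓕_T` with `Q ≪ P` on each `𝓕_t`, `t ∈ 𝕋 ∩ ℕ₀`. -/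
def MLoc {m0 : MeasurableSpace Ω} (H : Horizon) (𝓕 : Filtration ℕ m0) (P : Measure Ω) :
    Set (Measure[sigmaEnd H 𝓕] Ω) :=
  {Q | IsProbabilityMeasure Q ∧
    ∀ t : ℕ, (t : ℕ∞) ∈ H.times → ∀ A, MeasurableSet[𝓕 t] A → P A = 0 → Q A = 0}

/-- `M` is the density process of `Q` with respect to `P` (for an infinite horizon). -/
def IsDensityProcess {m0 m : MeasurableSpace Ω} (𝓕 : Filtration ℕ m0) (P : Measure[m0] Ω)
    (Q : Measure[m] Ω) (M : ℕ → Ω → ℝ≥0∞) : Prop :=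
  ∀ n, Measurable[𝓕 n] (M n) ∧ ∀ A, MeasurableSet[𝓕 n] A → Q A = ∫⁻ ω in A, M n ω ∂P

/-- The set `Γ(Q)` of optional random measures normalized with respect to `Q`. -/
structure IsOptionalMeasure {m0 : MeasurableSpace Ω} {H : Horizon} (𝓕 : Filtration ℕ m0)
    (P : Measure Ω) (Q : Measure[sigmaEnd H 𝓕] Ω) (γ : Proc Ω H) : Prop where
  adapted : ∀ s, Measurable[sigmaAt 𝓕 s.1] (γ s)
  nonneg : ∀ s, ∀ᵐ ω ∂Q, 0 ≤ γ s ω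
  sum_one : ∀ᵐ ω ∂Q, HasSum (fun s => γ s ω) 1
  /-- If `∞ ∈ 𝕋`, then `γ_∞ = 0` `Q`-a.s. on `{M_∞ = ∞}`. -/
  infty : ∀ h : (⊤ : ℕ∞) ∈ H.times, ∃ M, IsDensityProcess 𝓕 P Q M ∧
    ∀ᵐ ω ∂Q, Tendsto (fun n => M n ω) atTop (𝓝 ⊤) → γ ⟨⊤, h⟩ ω = 0

/-- The pairs `(Q, γ)` with `Q ∈ 𝓜_loc(P)` and `γ ∈ Γ(Q)`. -/
def IsModel {m0 : MeasurableSpace Ω} {H : Horizon} (𝓕 : Filtration ℕ m0) (P : Measure Ω)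
    (Q : Measure[sigmaEnd H 𝓕] Ω) (γ : Proc Ω H) : Prop :=
  Q ∈ MLoc H 𝓕 P ∧ IsOptionalMeasure 𝓕 P Q γ

/-- The predictable discounting process `D_t = 1 - ∑_{s<t} γ_s` of `γ`, `t ∈ 𝕋 ∩ ℕ₀`. -/
noncomputable def disc {H : Horizon} (γ : Proc Ω H) (t : ℕ) : Ω → ℝ :=
  fun ω => 1 - ∑ s ∈ Finset.range t, coord γ s ω

/-- `𝓜(P̄)`, where `P̄ = P ⊗ μ`. -/
def MBar {m0 : MeasurableSpace Ω} {H : Horizon} (𝓕 : Filtration ℕ m0) (P : Measure Ω)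
    (μ : Proc Ω H) : Set (Measure[optional H 𝓕] (OmegaBar Ω H)) :=
  {R | IsProbabilityMeasure R ∧ R ≪ tensor 𝓕 P μ}

/-- Two measures coincide on the σ-field `m`. -/
def AgreeOn {α : Type u} (m : MeasurableSpace α) {m1 m2 : MeasurableSpace α}
    (Q₁ : Measure[m1] α) (Q₂ : Measure[m2] α) : Prop :=
  ∀ E, MeasurableSet[m] E → Q₁ E = Q₂ E

/-- `Q₁ ≪ Q₂` on the σ-field `m`. -/
def AbsContOn {α : Type u} (m : MeasurableSpace α) {m1 m2 : MeasurableSpace α}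
    (Q₁ : Measure[m1] α) (Q₂ : Measure[m2] α) : Prop :=
  ∀ E, MeasurableSet[m] E → Q₂ E = 0 → Q₁ E = 0

/-! ### Acceptance sets and minimal penalty functions -/

/-- The acceptance set `𝓐_t`. -/
def accept {m0 : MeasurableSpace Ω} {H : Horizon} (𝓕 : Filtration ℕ m0) (P : Measure Ω)
    (ρ : ℕ → Proc Ω H → Ω → ℝ) (t : ℕ) : Set (Proc Ω H) :=
  {X | X ∈ RInfFrom H 𝓕 P t ∧ ∀ᵐ ω ∂P, ρ t X ω ≤ 0}

/-- The random variable `E_Q[∑_{s ∈ 𝕋_t} γ_s X_s | 𝓕_t]`. -/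
noncomputable def condWeighted {m0 : MeasurableSpace Ω} {H : Horizon} (𝓕 : Filtration ℕ m0)
    {m : MeasurableSpace Ω} (Q : Measure[m] Ω) (γ X : Proc Ω H) (t : ℕ) : Ω → ℝ :=
  Q[fun ω => ∑' s : H.Time, proj t γ s ω * X s ω | 𝓕 t]

open scoped Classical in
/-- The minimal penalty `α_t(Q ⊗ γ)`: the `Q`-essential supremum over `X ∈ 𝓐_t` of
`E_Q[-∑_{s ∈ 𝕋_t} (γ_s / D_t) X_s | 𝓕_t]` on `{D_t > 0}`, and `∞` on `{D_t = 0}`. -/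
noncomputable def penalty {m0 : MeasurableSpace Ω} {H : Horizon} (𝓕 : Filtration ℕ m0)
    (P : Measure Ω) (ρ : ℕ → Proc Ω H → Ω → ℝ) (t : ℕ)
    {m : MeasurableSpace Ω} (Q : Measure[m] Ω) (γ : Proc Ω H) : Ω → EReal :=
  fun ω => if 0 < disc γ t ω then
    essSupFam (𝓕 t) Q
      {f | ∃ X ∈ accept 𝓕 P ρ t, f = fun ω =>
        ((condWeighted 𝓕 Q (fun s ω => γ s ω / disc γ t ω) (-X) t ω : ℝ) : EReal)} ω
    else ⊤

open scoped Classical in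
/-- The risk measure on the product space associated with `ρ_t`:
`ρ̄_t(X) = -X_0 1_{0} - … - X_{t-1} 1_{t-1} + ρ_t(X) 1_{𝕋_t}`. -/
noncomputable def rhoBar {H : Horizon} (ρ : ℕ → Proc Ω H → Ω → ℝ) (t : ℕ)
    (X : Proc Ω H) : Proc Ω H :=
  fun s ω => if (t : ℕ∞) ≤ s.1 then riskOf ρ t X ω else - X s ω

/-- The acceptance set of `ρ̄_t`. -/
def acceptBar {m0 : MeasurableSpace Ω} {H : Horizon} (𝓕 : Filtration ℕ m0) (P : Measure Ω)
    (μ : Proc Ω H) (ρ : ℕ → Proc Ω H → Ω → ℝ) (t : ℕ) : Set (Proc Ω H) :=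
  {X | X ∈ RInf H 𝓕 P ∧ ∀ᵐ p ∂(tensor 𝓕 P μ), onProd (rhoBar ρ t X) p ≤ 0}

/-- The acceptance set of `ρ̄_t` restricted to `L^∞` of the optional σ-field at time `r`. -/
def acceptBarStep {m0 : MeasurableSpace Ω} {H : Horizon} (𝓕 : Filtration ℕ m0)
    (P : Measure Ω) (μ : Proc Ω H) (ρ : ℕ → Proc Ω H → Ω → ℝ) (t r : ℕ) :
    Set (Proc Ω H) :=
  {X | X ∈ acceptBar 𝓕 P μ ρ t ∧ Measurable[optionalAt H 𝓕 r] (onProd X)}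

/-- The `R`-essential supremum of `E_R[-X | 𝓕̄_t]` over `X` in the set `S`. -/
noncomputable def penaltyOver {m0 : MeasurableSpace Ω} {H : Horizon} (𝓕 : Filtration ℕ m0)
    (t : ℕ) (S : Set (Proc Ω H)) {m : MeasurableSpace (OmegaBar Ω H)}
    (R : Measure[m] (OmegaBar Ω H)) : OmegaBar Ω H → EReal :=
  essSupFam (optionalAt H 𝓕 t) R
    {f | ∃ X ∈ S, f = fun p => ((R[onProd (-X) | optionalAt H 𝓕 t] p : ℝ) : EReal)}

/-- The minimal penalty `ᾱ_t(R)` of `ρ̄_t`. -/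
noncomputable def penaltyBar {m0 : MeasurableSpace Ω} {H : Horizon} (𝓕 : Filtration ℕ m0)
    (P : Measure Ω) (μ : Proc Ω H) (ρ : ℕ → Proc Ω H → Ω → ℝ) (t : ℕ)
    {m : MeasurableSpace (OmegaBar Ω H)} (R : Measure[m] (OmegaBar Ω H)) : OmegaBar Ω H → EReal :=
  penaltyOver 𝓕 t (acceptBar 𝓕 P μ ρ t) R

/-- The minimal penalty `ᾱ_{t,r}(R)` of `ρ̄_t` restricted to the optional σ-field at time `r`. -/
noncomputable def penaltyBarStep {m0 : MeasurableSpace Ω} {H : Horizon} (𝓕 : Filtration ℕ m0)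
    (P : Measure Ω) (μ : Proc Ω H) (ρ : ℕ → Proc Ω H → Ω → ℝ) (t r : ℕ)
    {m : MeasurableSpace (OmegaBar Ω H)} (R : Measure[m] (OmegaBar Ω H)) : OmegaBar Ω H → EReal :=
  penaltyOver 𝓕 t (acceptBarStep 𝓕 P μ ρ t r) R

/-! ### Zero-penalty sets, pasting, stability -/

/-- `𝓠_t^0(Q̄)`, for a measure `Q̄` on a σ-field `m` containing `𝓕̄_t`. -/
def zeroSet {m0 : MeasurableSpace Ω} {H : Horizon} (𝓕 : Filtration ℕ m0)
    (P : Measure Ω) (μ : Proc Ω H) (ρ : ℕ → Proc Ω H → Ω → ℝ) (t : ℕ)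
    {m : MeasurableSpace (OmegaBar Ω H)} (Qb : Measure[m] (OmegaBar Ω H)) :
    Set (Measure[optional H 𝓕] (OmegaBar Ω H)) :=
  {R | R ∈ MBar 𝓕 P μ ∧ AgreeOn (optionalAt H 𝓕 t) R Qb ∧
    ∀ᵐ p ∂Qb, penaltyBar 𝓕 P μ ρ t R p = 0}

/-- `𝓠_{t,r}^0(Q̄)`, a set of probability measures on `𝓕̄_r`. -/
def zeroSetStep {m0 : MeasurableSpace Ω} {H : Horizon} (𝓕 : Filtration ℕ m0)
    (P : Measure Ω) (μ : Proc Ω H) (ρ : ℕ → Proc Ω H → Ω → ℝ) (t r : ℕ)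
    {m : MeasurableSpace (OmegaBar Ω H)} (Qb : Measure[m] (OmegaBar Ω H)) :
    Set (Measure[optionalAt H 𝓕 r] (OmegaBar Ω H)) :=
  {R | IsProbabilityMeasure R ∧ AbsContOn (optionalAt H 𝓕 r) R (tensor 𝓕 P μ) ∧
    AgreeOn (optionalAt H 𝓕 t) R Qb ∧ ∀ᵐ p ∂Qb, penaltyBarStep 𝓕 P μ ρ t r R p = 0}

/-- `R` is the pasting of `Q₁` and `Q₂` in `t` via `B`:
`R(A) = E_{Q₁}[E_{Q₂}[1_A | 𝓕̄_t] 1_B + 1_{Bᶜ} 1_A]` for all optional sets `A`. If `B` is the whole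
space, it suffices that `Q₁` is defined on a σ-field `m` containing `𝓕̄_t`. -/
def IsPasting {m0 : MeasurableSpace Ω} {H : Horizon} (𝓕 : Filtration ℕ m0) (t : ℕ)
    (B : Set (OmegaBar Ω H)) {m : MeasurableSpace (OmegaBar Ω H)} (Q₁ : Measure[m] (OmegaBar Ω H))
    (Q₂ R : Measure[optional H 𝓕] (OmegaBar Ω H)) : Prop :=
  ∀ A, MeasurableSet[optional H 𝓕] A →
    R A = ENNReal.ofReal (∫ p, (B.indicator (Q₂[A.indicator 1 | optionalAt H 𝓕 t]) p
      + (Bᶜ ∩ A).indicator 1 p) ∂Q₁)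

/-- Stability of a set of measures under pasting. -/
def Stable {m0 : MeasurableSpace Ω} {H : Horizon} (𝓕 : Filtration ℕ m0)
    (S : Set (Measure[optional H 𝓕] (OmegaBar Ω H))) : Prop :=
  ∀ Q₁ ∈ S, ∀ Q₂ ∈ S, ∀ t : ℕ, (t : ℕ∞) ∈ H.times → AbsContOn (optionalAt H 𝓕 t) Q₁ Q₂ →
    ∀ B, MeasurableSet[optionalAt H 𝓕 t] B → ∃ R ∈ S, IsPasting 𝓕 t B Q₁ Q₂ R

/-- The set `𝓠̄*` of all `R ≈ P̄` with `α_0(R) < ∞` (note that `𝕋_0 = 𝕋`, so `ᾱ_0 = α_0`). -/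
def QStar {m0 : MeasurableSpace Ω} {H : Horizon} (𝓕 : Filtration ℕ m0)
    (P : Measure Ω) (μ : Proc Ω H) (ρ : ℕ → Proc Ω H → Ω → ℝ) :
    Set (Measure[optional H 𝓕] (OmegaBar Ω H)) :=
  {R | R ∈ MBar 𝓕 P μ ∧ tensor 𝓕 P μ ≪ R ∧ ∀ᵐ p ∂ R, penaltyBar 𝓕 P μ ρ 0 R p < ⊤}

/-- The robust representation of `(ρ_t)` over `𝓠̄*`: for all `t ∈ 𝕋 ∩ ℕ₀` and `X ∈ 𝓡^∞`, `ρ_t(X)`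
is the `P`-essential supremum of `(1 / D_t) E_Q[-∑_{s ∈ 𝕋_t} γ_s X_s | 𝓕_t]` over all
`Q ⊗ γ ∈ 𝓠̄*`. -/
def RepresentedByQStar {m0 : MeasurableSpace Ω} {H : Horizon} (𝓕 : Filtration ℕ m0)
    (P : Measure Ω) (μ : Proc Ω H) (ρ : ℕ → Proc Ω H → Ω → ℝ) : Prop :=
  ∀ t : ℕ, (t : ℕ∞) ∈ H.times → ∀ X ∈ RInf H 𝓕 P,
    IsEssSup (𝓕 t) P
      {f | ∃ (Q : Measure[sigmaEnd H 𝓕] Ω) (γ : Proc Ω H), IsModel 𝓕 P Q γ ∧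
        tensor 𝓕 Q γ ∈ QStar 𝓕 P μ ρ ∧
        f = fun ω => ((1 / disc γ t ω * condWeighted 𝓕 Q γ (-X) t ω : ℝ) : EReal)}
      (fun ω => ((riskOf ρ t X ω : ℝ) : EReal))

/-- `(V_t)_{t ∈ 𝕋 ∩ ℕ₀}` is a `Q`-supermartingale. -/
def IsSupermart {m0 : MeasurableSpace Ω} (H : Horizon) (𝓕 : Filtration ℕ m0)
    {m : MeasurableSpace Ω} (Q : Measure[m] Ω) (V : ℕ → Ω → ℝ) : Prop :=
  (∀ t : ℕ, (t : ℕ∞) ∈ H.times → Measurable[𝓕 t] (V t) ∧ Integrable (V t) Q) ∧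
    ∀ s t : ℕ, s ≤ t → (t : ℕ∞) ∈ H.times → ∀ᵐ ω ∂Q, (Q[V t | 𝓕 s]) ω ≤ V s ω

end RiskProc

/-! A process is a function on Ω̄ = Ω × 𝕋 and 𝓡^∞ is the space of essentially bounded functions for
P̄, so each ρ_t becomes a conditional risk measure ρ̄_t on Ω̄ with its filtration. By coherence its
acceptance set is a cone stable under 𝓕̄_t-indicators. Hence the penalty of R is a.s. finite only if
it vanishes a.s., and vanishing is one linear condition, `ZeroPenalty`: R charges Y 1_{𝕋_t}
nonnegatively whenever ρ_t(Y) ≤ 0.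

Duality rests on `IsCondCoherent.exists_zeroPenalty`: every R ≪ P̄ can be changed into some R' with
zero penalty at t, equal to R on 𝓕̄_t, for which E_{R'}[-X] is within ε of E_R[ρ̄_t(X)]. This comes
from `IsUpperExp.exists_density`, which represents the scalar functional g ↦ E_R[ρ̄_t(-g)] by
probability densities, through separation in L² and continuity from below. Therefore acceptability
at t can be tested on the measures with zero penalty at t
(`IsCondCoherent.riskOf_nonpos_of_zeroPenalty`).

Time consistency amounts to two one-step inclusions (`timeConsistent_iff`): a position acceptable at
t+1 and paying nothing at t is acceptable at t; and if X is acceptable at t, so is the position that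
pays X_t at t and -ρ_{t+1}(X) from t+1 on. Dually, the first says that zero penalty passes from t to
t+1, the second that zero penalty at t follows from zero penalty at t on 𝓕̄_{t+1} together with zero
penalty at t+1. That is statement 2, since pasting Q̄¹ with an element of 𝓠_{t+1}^0(Q̄¹) just
returns that element.

Under Q ⊗ γ, the position of the second inclusion has value D_t X_t - D_{t+1}(X_t + ρ_{t+1}(X))
because γ_t = D_t - D_{t+1}; this turns the inclusion into the inequality of statement 3. That every
measure in 𝓜(P̄) has the form Q ⊗ γ is `MBar.exists_isModel`: its densities on Ω × 𝕋_n factor into a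
martingale, which yields Q, and a predictable decreasing process, which yields γ.

For statements 4 and 5, only equivalent measures are allowed. Under time consistency, pasting an
element of 𝓠̄* at t with an equivalent measure of zero penalty at t stays in 𝓠̄*, and mixing in a
little of an element of 𝓠̄* makes any zero-penalty measure equivalent. So 𝓠̄* determines every ρ_t
(`DeterminedByQStar`), which is the content of (*). Conversely, stability makes the conditional
expectations of X over 𝓠̄* closed under minima, so that their essential infimum can be compared with
-ρ̄_{t+1}(X); this gives the second inclusion. The increments of the process in 5 are the
differences of the two sides in 3. -/

namespace RiskProc

/-! ### Representation of sublinear expectations that are continuous from below -/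

section Representation

variable {α : Type*} {m : MeasurableSpace α}

/-- Measurable functions that are essentially bounded. -/
def BddMeas (ν : Measure α) (g : α → ℝ) : Prop := Measurable g ∧ ∃ C : ℝ, ∀ᵐ x ∂ν, |g x| ≤ C

/-- Sublinear monotone cash-additive functionals that are continuous from below. -/
structure IsUpperExp (ν : Measure α) (ψ : (α → ℝ) → ℝ) : Prop where
  mono : ∀ f g, BddMeas ν f → BddMeas ν g → (∀ᵐ x ∂ν, f x ≤ g x) → ψ f ≤ ψ g
  add_const : ∀ f, BddMeas ν f → ∀ c : ℝ, ψ (fun x => f x + c) = ψ f + c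
  subadd : ∀ f g, BddMeas ν f → BddMeas ν g → ψ (fun x => f x + g x) ≤ ψ f + ψ g
  smul : ∀ f, BddMeas ν f → ∀ c : ℝ, 0 ≤ c → ψ (fun x => c * f x) = c * ψ f
  cont : ∀ (f : ℕ → α → ℝ) (g : α → ℝ), (∀ n, BddMeas ν (f n)) → BddMeas ν g →
    (∀ᵐ x ∂ν, Monotone (fun n => f n x) ∧ Tendsto (fun n => f n x) atTop (𝓝 (g x))) →
    Tendsto (fun n => ψ (f n)) atTop (𝓝 (ψ g))

variable {ν : Measure α}

theorem BddMeas.add {f g : α → ℝ} (hf : BddMeas ν f) (hg : BddMeas ν g) :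
    BddMeas ν (fun x => f x + g x) := by
  obtain ⟨hf, C, hC⟩ := hf
  obtain ⟨hg, D, hD⟩ := hg
  refine ⟨hf.add hg, C + D, ?_⟩
  filter_upwards [hC, hD] with x h1 h2 using (abs_add_le _ _).trans (add_le_add h1 h2)

theorem BddMeas.const (c : ℝ) : BddMeas ν (fun _ : α => c) :=
  ⟨measurable_const, |c|, by simp⟩

theorem BddMeas.const_mul {f : α → ℝ} (hf : BddMeas ν f) (c : ℝ) :
    BddMeas ν (fun x => c * f x) := by
  obtain ⟨hf, C, hC⟩ := hf
  refine ⟨hf.const_mul c, |c| * C, ?_⟩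
  filter_upwards [hC] with x h1
  rw [abs_mul]
  gcongr

theorem BddMeas.memLp {f : α → ℝ} [IsFiniteMeasure ν] (hf : BddMeas ν f) (p : ℝ≥0∞) :
    MemLp f p ν := by
  obtain ⟨hf, C, hC⟩ := hf
  exact MemLp.of_bound hf.aestronglyMeasurable C hC

theorem BddMeas.mul_integrable {f g : α → ℝ} (hf : BddMeas ν f) (hg : Integrable g ν) :
    Integrable (fun x => g x * f x) ν := by
  obtain ⟨hf, C, hC⟩ := hf
  exact hg.mul_bdd hf.aestronglyMeasurable hC

theorem BddMeas.indicator {f : α → ℝ} (hf : BddMeas ν f) {s : Set α} (hs : MeasurableSet s) :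
    BddMeas ν (s.indicator f) := by
  obtain ⟨hf, C, hC⟩ := hf
  refine ⟨hf.indicator hs, C, ?_⟩
  filter_upwards [hC] with x hx
  by_cases h : x ∈ s <;> simp [h, hx, (abs_nonneg _).trans hx]

/-- The truncation of the positive part at level `n`. -/
noncomputable def truncPos (n : ℕ) (g : α → ℝ) : α → ℝ := fun x => min (max (g x) 0) n

theorem truncPos_nonneg (n : ℕ) (g : α → ℝ) (x : α) : 0 ≤ truncPos n g x :=
  le_min (le_max_right _ _) (Nat.cast_nonneg n)

theorem truncPos_le (n : ℕ) (g : α → ℝ) (x : α) : truncPos n g x ≤ n := min_le_right _ _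

theorem bddMeas_truncPos (n : ℕ) {g : α → ℝ} (hg : Measurable g) : BddMeas ν (truncPos n g) :=
  ⟨(hg.max measurable_const).min measurable_const, n, ae_of_all _ fun x => by
    rw [abs_of_nonneg (truncPos_nonneg n g x)]; exact truncPos_le n g x⟩

namespace IsUpperExp

variable {ψ : (α → ℝ) → ℝ} (hψ : IsUpperExp ν ψ)
include hψ

theorem zero : ψ (fun _ => 0) = 0 := by
  have := hψ.smul (fun _ => 0) (BddMeas.const 0) 0 le_rfl
  simpa using this

theorem const (c : ℝ) : ψ (fun _ => c) = c := by
  have := hψ.add_const (fun _ => 0) (BddMeas.const 0) c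
  simpa [hψ.zero] using this

theorem congr {f g : α → ℝ} (hf : BddMeas ν f) (hg : BddMeas ν g) (h : ∀ᵐ x ∂ν, f x = g x) :
    ψ f = ψ g :=
  le_antisymm (hψ.mono f g hf hg (h.mono fun _ h => h.le))
    (hψ.mono g f hg hf (h.mono fun _ h => h.ge))

theorem nonneg {f : α → ℝ} (hf : BddMeas ν f) (h : ∀ᵐ x ∂ν, 0 ≤ f x) : 0 ≤ ψ f := by
  rw [← hψ.zero]
  exact hψ.mono _ _ (BddMeas.const 0) hf h

/-- The set of square integrable functions whose truncated positive parts have `ψ`-value at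
most `c`. -/
theorem convex_sublevel {c : ℝ} :
    Convex ℝ {G : Lp ℝ 2 ν | ∀ n, ψ (truncPos n G) ≤ c} := by
  intro G hG K hK a b ha hb hab n
  have hGm := (Lp.stronglyMeasurable G).measurable
  have hKm := (Lp.stronglyMeasurable K).measurable
  have hcoe : ∀ᵐ x ∂ν, (a • G + b • K : Lp ℝ 2 ν) x = a * G x + b * K x := by
    filter_upwards [Lp.coeFn_add (a • G) (b • K), Lp.coeFn_smul a G, Lp.coeFn_smul b K]
      with x h1 h2 h3
    rw [h1, Pi.add_apply, h2, h3, Pi.smul_apply, Pi.smul_apply, smul_eq_mul, smul_eq_mul]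
  -- Subadditivity is available for bounded functions only, so G and K are first cut at level k. The
  -- outer cap at n keeps the limit v bounded; at each point u k is eventually equal to v, and
  -- continuity from below passes to the limit.
  set u : ℕ → α → ℝ := fun k x => min (a * truncPos k G x + b * truncPos k K x) n with hu
  set v : α → ℝ := fun x => min (a * max (G x) 0 + b * max (K x) 0) n with hv
  have hum : ∀ k, BddMeas ν (u k) := fun k =>
    ⟨((((bddMeas_truncPos (ν := ν) k hGm).1.const_mul a).add
      ((bddMeas_truncPos (ν := ν) k hKm).1.const_mul b)).min measurable_const), n,
      ae_of_all _ fun x => by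
        rw [abs_of_nonneg]
        · exact min_le_right _ _
        · exact le_min (add_nonneg (mul_nonneg ha (truncPos_nonneg _ _ _))
            (mul_nonneg hb (truncPos_nonneg _ _ _))) (Nat.cast_nonneg n)⟩
  have hvm : BddMeas ν v :=
    ⟨((((hGm.max measurable_const).const_mul a).add
      ((hKm.max measurable_const).const_mul b)).min measurable_const), n,
      ae_of_all _ fun x => by
        rw [abs_of_nonneg]
        · exact min_le_right _ _
        · exact le_min (add_nonneg (mul_nonneg ha (le_max_right _ _))
            (mul_nonneg hb (le_max_right _ _))) (Nat.cast_nonneg n)⟩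
  have h1 : ψ (truncPos n (a • G + b • K : Lp ℝ 2 ν)) ≤ ψ v := by
    refine hψ.mono _ _ (bddMeas_truncPos n (Lp.stronglyMeasurable _).measurable) hvm ?_
    filter_upwards [hcoe] with x hx
    refine min_le_min_right _ ?_
    rw [hx]
    refine max_le (add_le_add (mul_le_mul_of_nonneg_left (le_max_left _ _) ha)
      (mul_le_mul_of_nonneg_left (le_max_left _ _) hb)) ?_
    exact add_nonneg (mul_nonneg ha (le_max_right _ _)) (mul_nonneg hb (le_max_right _ _))
  have h2 : Tendsto (fun k => ψ (u k)) atTop (𝓝 (ψ v)) := by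
    refine hψ.cont u v hum hvm (ae_of_all _ fun x => ⟨fun k l hkl => ?_, ?_⟩)
    · refine min_le_min_right _ (add_le_add (mul_le_mul_of_nonneg_left ?_ ha)
        (mul_le_mul_of_nonneg_left ?_ hb)) <;>
      exact min_le_min_left _ (by exact_mod_cast hkl)
    · refine tendsto_const_nhds.congr' ?_
      obtain ⟨N, hN⟩ := exists_nat_ge (max (max (G x) 0) (max (K x) 0))
      filter_upwards [eventually_ge_atTop N] with k hk
      have hk' : (N : ℝ) ≤ k := by exact_mod_cast hk
      simp only [hu, hv, truncPos]
      rw [min_eq_left ((le_max_left _ _).trans (hN.trans hk')),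
        min_eq_left ((le_max_right _ _).trans (hN.trans hk'))]
  refine h1.trans (le_of_tendsto' h2 fun k => ?_)
  have hGk := bddMeas_truncPos (ν := ν) k hGm
  have hKk := bddMeas_truncPos (ν := ν) k hKm
  calc ψ (u k) ≤ ψ (fun x => a * truncPos k G x + b * truncPos k K x) :=
        hψ.mono _ _ (hum k) ((hGk.const_mul a).add (hKk.const_mul b))
          (ae_of_all _ fun x => min_le_left _ _)
    _ ≤ a * ψ (truncPos k G) + b * ψ (truncPos k K) := by
        refine (hψ.subadd _ _ (hGk.const_mul a) (hKk.const_mul b)).trans (le_of_eq ?_)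
        rw [hψ.smul _ hGk a ha, hψ.smul _ hKk b hb]
    _ ≤ a * c + b * c := add_le_add (mul_le_mul_of_nonneg_left (hG k) ha)
        (mul_le_mul_of_nonneg_left (hK k) hb)
    _ = c := by rw [← add_mul, hab, one_mul]

/-- A Fatou argument: a subsequence converges a.e., and the infima of its tails, truncated at n,
increase to the truncated limit, so continuity from below carries the bound c over. -/
theorem isClosed_sublevel {c : ℝ} :
    IsClosed {G : Lp ℝ 2 ν | ∀ n, ψ (truncPos n G) ≤ c} := by
  refine IsSeqClosed.isClosed fun G K hG hGK n => ?_
  obtain ⟨ns, -, hns⟩ := (tendstoInMeasure_of_tendsto_Lp hGK).exists_seq_tendsto_ae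
  have hKm := (Lp.stronglyMeasurable K).measurable
  have hGm : ∀ k, Measurable (truncPos n (G (ns k))) := fun k =>
    (bddMeas_truncPos (ν := ν) n (Lp.stronglyMeasurable (G (ns k))).measurable).1
  set h : ℕ → α → ℝ := fun j x => ⨅ k, truncPos n (G (ns (j + k))) x with hh
  have hbdd : ∀ j x, BddBelow (range fun k => truncPos n (G (ns (j + k))) x) := fun j x =>
    ⟨0, by rintro _ ⟨k, rfl⟩; exact truncPos_nonneg _ _ _⟩
  have hle : ∀ j k x, h j x ≤ truncPos n (G (ns (j + k))) x := fun j k x => ciInf_le (hbdd j x) k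
  have hhm : ∀ j, BddMeas ν (h j) := fun j =>
    ⟨Measurable.iInf fun k => hGm _, n, ae_of_all _ fun x => by
      rw [abs_of_nonneg (le_ciInf fun k => truncPos_nonneg _ _ _)]
      exact (hle j 0 x).trans (truncPos_le _ _ _)⟩
  have hlim : Tendsto (fun j => ψ (h j)) atTop (𝓝 (ψ (truncPos n K))) := by
    refine hψ.cont h _ hhm (bddMeas_truncPos n hKm) ?_
    filter_upwards [hns] with x hx
    have hx' : Tendsto (fun i => truncPos n (G (ns i)) x) atTop (𝓝 (truncPos n K x)) :=
      (hx.max tendsto_const_nhds).min tendsto_const_nhds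
    constructor
    · refine monotone_nat_of_le_succ fun j => le_ciInf fun k => ?_
      have := hle j (1 + k) x
      rwa [← add_assoc] at this
    · rw [Metric.tendsto_atTop] at hx' ⊢
      intro ε hε
      obtain ⟨N, hN⟩ := hx' (ε / 2) (half_pos hε)
      refine ⟨N, fun j hj => ?_⟩
      rw [Real.dist_eq, abs_lt]
      have h1 : truncPos n K x - ε / 2 ≤ h j x := le_ciInf fun k => by
        have := hN (j + k) (by omega)
        rw [Real.dist_eq, abs_lt] at this
        linarith
      have h2 := hle j 0 x
      have h3 := hN (j + 0) (by omega)
      rw [Real.dist_eq, abs_lt] at h3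
      constructor <;> linarith
  refine le_of_tendsto' hlim fun j => (hψ.mono _ _ (hhm j) ?_ (ae_of_all _ fun x => hle j 0 x)).trans
    (hG (ns (j + 0)) n)
  exact bddMeas_truncPos n (Lp.stronglyMeasurable _).measurable

/-- Square integrable densities dominated by `ψ` on nonnegative functions. -/
def _root_.RiskProc.DomBy (ν : Measure α) (ψ : (α → ℝ) → ℝ) (Z : Lp ℝ 2 ν) : Prop :=
  (∀ᵐ x ∂ν, 0 ≤ Z x) ∧ ∀ g, BddMeas ν g → (∀ᵐ x ∂ν, 0 ≤ g x) → ∫ x, Z x * g x ∂ν ≤ ψ g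

/-- Since c < ψ g, the function g lies outside the closed convex set of G with ψ(min(G⁺, n)) ≤ c for
all n. A separating functional is integration against some Z in L² with bound u. Scaling a
nonnegative h until ψ reaches c places it in the set, which shows that (c/u) Z⁺ is dominated by ψ,
while strict separation of g gives a value above c. Positivity of c makes u positive. -/
theorem exists_domBy [IsProbabilityMeasure ν] {g : α → ℝ} (hg : BddMeas ν g)
    (hg0 : ∀ᵐ x ∂ν, 0 ≤ g x) {c : ℝ} (hc : 0 < c) (hcg : c < ψ g) :
    ∃ Z, DomBy ν ψ Z ∧ c < ∫ x, Z x * g x ∂ν := by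
  set B := {G : Lp ℝ 2 ν | ∀ n, ψ (truncPos n G) ≤ c} with hB
  have hnot : (hg.memLp 2).toLp g ∉ B := by
    intro h
    obtain ⟨C, hC⟩ := hg.2
    obtain ⟨n, hn⟩ := exists_nat_ge C
    have := h n
    rw [hψ.congr (bddMeas_truncPos n (Lp.stronglyMeasurable _).measurable) hg] at this
    · exact absurd this (not_le.2 hcg)
    · filter_upwards [(hg.memLp 2).coeFn_toLp, hC, hg0] with x h1 h2 h3
      simp only [truncPos, h1]
      rw [max_eq_left h3, min_eq_left (((le_abs_self _).trans h2).trans hn)]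
  obtain ⟨f, u, hfu, hu⟩ := geometric_hahn_banach_closed_point (hψ.convex_sublevel (c := c))
    hψ.isClosed_sublevel hnot
  set Z := (InnerProductSpace.toDual ℝ (Lp ℝ 2 ν)).symm f with hZ
  have hZf : ∀ {h : α → ℝ} (hh : MemLp h 2 ν), f (hh.toLp h) = ∫ x, Z x * h x ∂ν := by
    intro h hh
    rw [← InnerProductSpace.toDual_symm_apply, L2.inner_def]
    refine integral_congr_ae ?_
    filter_upwards [hh.coeFn_toLp] with x hx
    simp [hx, hZ, mul_comm]
  have hmem : ∀ {h k : α → ℝ} (hh : BddMeas ν h), BddMeas ν k → (∀ᵐ x ∂ν, 0 ≤ k x) →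
      (∀ᵐ x ∂ν, h x ≤ k x) → ψ k ≤ c → (hh.memLp 2).toLp h ∈ B := by
    intro h k hh hk hk0 hhk hkc n
    refine (hψ.mono _ k (bddMeas_truncPos n (Lp.stronglyMeasurable _).measurable) hk ?_).trans hkc
    filter_upwards [(hh.memLp 2).coeFn_toLp, hk0, hhk] with x h1 h2 h3
    simp only [truncPos, h1]
    exact (min_le_left _ _).trans (max_le h3 h2)
  have hu0 : 0 < u := by
    have := hfu _ (hmem (BddMeas.const 0) (BddMeas.const 0) (by simp) (by simp)
      (by rw [hψ.zero]; exact hc.le))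
    rwa [hZf, show (∫ x, Z x * 0 ∂ν) = 0 by simp] at this
  have hZi : Integrable Z ν := (Lp.memLp Z).integrable (by norm_num)
  have hZm := (Lp.stronglyMeasurable Z).measurable
  have hle : ∀ h, BddMeas ν h → (∀ᵐ x ∂ν, 0 ≤ h x) → c / u * ∫ x, max (Z x) 0 * h x ∂ν ≤ ψ h := by
    intro h hh hh0
    have hψ0 := hψ.nonneg hh hh0
    refine le_of_forall_pos_le_add fun δ hδ => ?_
    have hs : MeasurableSet {x | 0 ≤ Z x} := measurableSet_le measurable_const hZm
    -- The largest scale at which a·h has ψ-value at most c, with δ guarding against ψ h = 0. The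
    -- test function keeps h only where Z ≥ 0, so that Z may be replaced by Z⁺.
    set a := c / (ψ h + δ) with ha
    have ha0 : 0 < a := div_pos hc (by linarith)
    have := hfu _ (hmem ((hh.indicator hs).const_mul a) (hh.const_mul a)
      (hh0.mono fun x hx => mul_nonneg ha0.le hx) ?_ ?_)
    · rw [hZf] at this
      have h1 : ∫ x, Z x * (a * {x | 0 ≤ Z x}.indicator h x) ∂ν
          = a * ∫ x, max (Z x) 0 * h x ∂ν := by
        rw [← integral_const_mul]
        congr 1 with x
        by_cases hx : 0 ≤ Z x
        · rw [indicator_of_mem (by exact hx), max_eq_left hx]; ring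
        · rw [indicator_of_notMem (by exact hx), max_eq_right (not_le.1 hx).le]; ring
      rw [h1, ha, div_mul_eq_mul_div, div_lt_iff₀ (by linarith)] at this
      rw [div_mul_eq_mul_div, div_le_iff₀ hu0]
      nlinarith
    · filter_upwards [hh0] with x hx
      refine mul_le_mul_of_nonneg_left ?_ ha0.le
      exact indicator_le_self' (fun _ _ => hx) x
    · rw [hψ.smul _ hh a ha0.le, ha, div_mul_eq_mul_div, div_le_iff₀ (by linarith)]
      nlinarith
  have hZp : MemLp (fun x => c / u * max (Z x) 0) 2 ν := by
    exact (Lp.memLp Z).pos_part.const_mul (c / u)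
  refine ⟨hZp.toLp _, ⟨?_, fun h hh hh0 => ?_⟩, ?_⟩
  · filter_upwards [hZp.coeFn_toLp] with x hx
    rw [hx]
    exact mul_nonneg (div_pos hc hu0).le (le_max_right _ _)
  · refine le_trans (le_of_eq ?_) (hle h hh hh0)
    rw [← integral_const_mul]
    refine integral_congr_ae ?_
    filter_upwards [hZp.coeFn_toLp] with x hx
    rw [hx]; ring
  · rw [hZf] at hu
    have h1 : ∫ x, Z x * g x ∂ν ≤ ∫ x, max (Z x) 0 * g x ∂ν := by
      refine integral_mono_ae (hg.mul_integrable hZi)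
        (hg.mul_integrable (hZi.sup (integrable_zero α ℝ ν))) ?_
      filter_upwards [hg0] with x hx
      exact mul_le_mul_of_nonneg_right (le_max_left _ _) hx
    have h2 : ∫ x, (hZp.toLp _) x * g x ∂ν = c / u * ∫ x, max (Z x) 0 * g x ∂ν := by
      rw [← integral_const_mul]
      refine integral_congr_ae ?_
      filter_upwards [hZp.coeFn_toLp] with x hx
      rw [hx]; ring
    rw [h2, div_mul_eq_mul_div, lt_div_iff₀ hu0]
    nlinarith

omit hψ in
theorem integral_eq_inner [IsFiniteMeasure ν] (U : Lp ℝ 2 ν) :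
    ∫ x, U x ∂ν = inner ℝ (indicatorConstLp 2 MeasurableSet.univ (measure_ne_top ν univ) (1 : ℝ)) U := by
  rw [L2.inner_indicatorConstLp_one, setIntegral_univ]

omit hψ in
theorem _root_.RiskProc.DomBy.combo [IsFiniteMeasure ν] {Z K : Lp ℝ 2 ν} (hZ : DomBy ν ψ Z)
    (hK : DomBy ν ψ K) {a b : ℝ} (ha : 0 ≤ a) (hb : 0 ≤ b) (hab : a + b = 1) :
    DomBy ν ψ (a • Z + b • K) := by
  have hcoe : ∀ᵐ x ∂ν, (a • Z + b • K : Lp ℝ 2 ν) x = a * Z x + b * K x := by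
    filter_upwards [Lp.coeFn_add (a • Z) (b • K), Lp.coeFn_smul a Z, Lp.coeFn_smul b K]
      with x h1 h2 h3
    rw [h1, Pi.add_apply, h2, h3, Pi.smul_apply, Pi.smul_apply, smul_eq_mul, smul_eq_mul]
  refine ⟨?_, fun g hg hg0 => ?_⟩
  · filter_upwards [hcoe, hZ.1, hK.1] with x h1 h2 h3
    rw [h1]
    exact add_nonneg (mul_nonneg ha h2) (mul_nonneg hb h3)
  · have e : ∫ x, (a • Z + b • K : Lp ℝ 2 ν) x * g x ∂ν
        = a * ∫ x, Z x * g x ∂ν + b * ∫ x, K x * g x ∂ν := by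
      rw [← integral_const_mul, ← integral_const_mul, ← integral_add]
      · refine integral_congr_ae ?_
        filter_upwards [hcoe] with x hx
        rw [hx]; ring
      · exact (hg.mul_integrable ((Lp.memLp Z).integrable (by norm_num))).const_mul a
      · exact (hg.mul_integrable ((Lp.memLp K).integrable (by norm_num))).const_mul b
    rw [e]
    calc _ ≤ a * ψ g + b * ψ g := add_le_add (mul_le_mul_of_nonneg_left (hZ.2 g hg hg0) ha)
          (mul_le_mul_of_nonneg_left (hK.2 g hg hg0) hb)
      _ = ψ g := by rw [← add_mul, hab, one_mul]

/-- This lets a dominated density gain mass while hardly falling below Z₁ in L¹. If it failed, the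
pairs (Z₁ - Z, 1 - ∫Z) would avoid the open convex set ∫U⁺ + r < ε in L² × ℝ. A separating
functional amounts to l > 0 and 0 ≤ p ≤ l with ∫ Z(p + l) ≤ l + ∫ Z₁ p - lε for every dominated Z.
But ψ(p + l) = ψ(p) + l ≥ l + ∫ Z₁ p, and `exists_domBy` provides a Z that comes closer to ψ(p + l)
than lε. -/
theorem exists_domBy_near [IsProbabilityMeasure ν] {Z₁ : Lp ℝ 2 ν} (hZ₁ : DomBy ν ψ Z₁)
    {ε : ℝ} (hε : 0 < ε) :
    ∃ Z, DomBy ν ψ Z ∧ (1 - ∫ x, Z x ∂ν) + ∫ x, max (Z₁ x - Z x) 0 ∂ν ≤ ε := by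
  by_contra! hcon
  set F : Lp ℝ 2 ν → ℝ := fun U => ∫ x, max (U x) 0 ∂ν with hF
  have hint : ∀ U : Lp ℝ 2 ν, Integrable U ν := fun U => (Lp.memLp U).integrable (by norm_num)
  have hintp : ∀ U : Lp ℝ 2 ν, Integrable (fun x => max (U x) 0) ν := fun U =>
    (hint U).pos_part
  have hFc : Continuous F := by
    have : F = fun U => inner ℝ (indicatorConstLp 2 MeasurableSet.univ (measure_ne_top ν univ)
        (1 : ℝ)) (Lp.posPart U) := by
      ext U
      rw [← integral_eq_inner]
      refine integral_congr_ae ?_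
      filter_upwards [Lp.coeFn_posPart U] with x hx
      rw [hx]
    rw [this]
    exact continuous_const.inner Lp.continuous_posPart
  have hFcomb : ∀ U V : Lp ℝ 2 ν, ∀ a b : ℝ, 0 ≤ a → 0 ≤ b → F (a • U + b • V)
      ≤ a * F U + b * F V := by
    intro U V a b ha hb
    simp only [hF]
    rw [← integral_const_mul, ← integral_const_mul, ← integral_add
      ((hintp U).const_mul a) ((hintp V).const_mul b)]
    refine integral_mono_ae (hintp _) (((hintp U).const_mul a).add ((hintp V).const_mul b)) ?_
    filter_upwards [Lp.coeFn_add (a • U) (b • V), Lp.coeFn_smul a U, Lp.coeFn_smul b V]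
      with x h1 h2 h3
    rw [h1, Pi.add_apply, h2, h3, Pi.smul_apply, Pi.smul_apply, smul_eq_mul, smul_eq_mul]
    refine max_le (add_le_add (mul_le_mul_of_nonneg_left (le_max_left _ _) ha)
      (mul_le_mul_of_nonneg_left (le_max_left _ _) hb)) ?_
    exact add_nonneg (mul_nonneg ha (le_max_right _ _)) (mul_nonneg hb (le_max_right _ _))
  set s : Set (Lp ℝ 2 ν × ℝ) := {p | F p.1 + p.2 < ε} with hs
  set t : Set (Lp ℝ 2 ν × ℝ) := {p | ∃ Z, DomBy ν ψ Z ∧ p = (Z₁ - Z, 1 - ∫ x, Z x ∂ν)} with ht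
  have hsc : Convex ℝ s := by
    intro p hp q hq a b ha hb hab
    have := hFcomb p.1 q.1 a b ha hb
    simp only [hs, mem_ofPred_eq, Prod.fst_add, Prod.smul_fst, Prod.snd_add, Prod.smul_snd,
      smul_eq_mul] at hp hq ⊢
    rcases ha.eq_or_lt with rfl | ha'
    · have : b = 1 := by linarith
      subst this
      nlinarith
    · have h1 := mul_lt_mul_of_pos_left hp ha'
      have h2 := mul_le_mul_of_nonneg_left hq.le hb
      have : a * ε + b * ε = ε := by rw [← add_mul, hab, one_mul]
      nlinarith
  have hso : IsOpen s := isOpen_lt ((hFc.comp continuous_fst).add continuous_snd) continuous_const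
  have htc : Convex ℝ t := by
    rintro _ ⟨Z, hZ, rfl⟩ _ ⟨K, hK, rfl⟩ a b ha hb hab
    refine ⟨a • Z + b • K, hZ.combo hK ha hb hab, Prod.ext ?_ ?_⟩
    · simp only [Prod.fst_add, Prod.smul_fst]
      have : Z₁ = a • Z₁ + b • Z₁ := by rw [← add_smul, hab, one_smul]
      nth_rewrite 3 [this]
      module
    · simp only [Prod.snd_add, Prod.smul_snd, smul_eq_mul, integral_eq_inner, inner_add_right,
        inner_smul_right]
      linear_combination hab
  have hdisj : Disjoint s t := by
    rw [Set.disjoint_left]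
    rintro _ hp ⟨Z, hZ, rfl⟩
    have h1 := hcon Z hZ
    have h2 : F (Z₁ - Z) = ∫ x, max (Z₁ x - Z x) 0 ∂ν := by
      refine integral_congr_ae ?_
      filter_upwards [Lp.coeFn_sub Z₁ Z] with x hx
      rw [hx, Pi.sub_apply]
    simp only [hs, mem_ofPred_eq, h2] at hp
    linarith
  obtain ⟨f, u, hfu, hut⟩ := geometric_hahn_banach_open hsc hso htc hdisj
  have hsplit : ∀ (U : Lp ℝ 2 ν) (r : ℝ), f (U, r) = f (U, 0) + r * f (0, 1) := by
    intro U r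
    have : ((U, r) : Lp ℝ 2 ν × ℝ) = (U, 0) + r • (0, 1) := by simp
    rw [this, map_add, map_smul, smul_eq_mul]
  set l := f (0, 1) with hl
  have hS : ∀ U r, F U + r < ε → f (U, 0) + r * l < u := fun U r h => by
    rw [← hsplit]; exact hfu _ h
  have hF0 : F 0 = 0 := by
    have : F 0 = ∫ x, (0 : ℝ) ∂ν := by
      refine integral_congr_ae ?_
      filter_upwards [Lp.coeFn_zero ℝ 2 ν] with x hx
      rw [hx]; simp
    simpa using this
  have hf00 : f (0, 0) = 0 := by rw [show ((0, 0) : Lp ℝ 2 ν × ℝ) = 0 from rfl, map_zero]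
  have hfs : ∀ (c : ℝ) U, f (c • U, 0) = c * f (U, 0) := fun c U => by
    rw [← smul_eq_mul, ← map_smul]; simp
  obtain ⟨Zt, hZt⟩ : ∃ Z, DomBy ν ψ Z := ⟨_, hZ₁⟩
  -- If l < 0, a very negative second coordinate stays in s and violates the bound u. If l = 0, the
  -- functional is bounded above on all of L², hence zero, and cannot separate strictly.
  have hl0 : 0 < l := by
    by_contra! hl0
    rcases hl0.lt_or_eq with hneg | hzero
    · have := hS 0 (min 0 ((|u| + 1) / l)) (by
        rw [hF0]; have := min_le_left 0 ((|u| + 1) / l); linarith)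
      rw [hf00] at this
      have h3 : |u| + 1 ≤ min 0 ((|u| + 1) / l) * l := by
        rw [← div_mul_cancel₀ (|u| + 1) hneg.ne]
        exact mul_le_mul_of_nonpos_right (by rw [div_mul_cancel₀ _ hneg.ne]; exact min_le_right _ _)
          hneg.le
      have := le_abs_self u
      linarith
    · have hfz : ∀ U, f (U, 0) < u := fun U => by
        have := hS U (-F U) (by linarith)
        rw [hzero] at this
        linarith
      have hf0 : ∀ U, f (U, 0) = 0 := fun U => by
        by_contra hne
        have := hfz ((|u| / f (U, 0)) • U)
        rw [hfs, div_mul_cancel₀ _ hne] at this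
        exact absurd (le_abs_self u) (not_le.2 this)
      have h1 := hut _ ⟨Zt, hZt, rfl⟩
      rw [hsplit, hf0, hzero] at h1
      have h2 := hfz 0
      rw [hf0] at h2
      linarith
  have hu : l * ε ≤ u := by
    refine le_of_forall_pos_le_add fun δ hδ => ?_
    have := hS 0 (ε - δ / l) (by rw [hF0]; have := div_pos hδ hl0; linarith)
    rw [hf00, sub_mul, div_mul_cancel₀ _ hl0.ne'] at this
    linarith
  -- F is positively homogeneous while the bound u is fixed, so rescaling U removes u.
  have hup : ∀ U, f (U, 0) ≤ l * F U := by
    intro U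
    by_contra! hU
    set d := f (U, 0) - l * F U with hd
    have hd0 : 0 < d := by linarith
    set c := |u| / d with hc
    have hc0 : 0 ≤ c := div_nonneg (abs_nonneg _) hd0.le
    have h1 := hS (c • U) (-(c * F U)) (by
      have := hFcomb U 0 c 0 hc0 le_rfl
      rw [zero_smul, add_zero, zero_mul, add_zero] at this
      linarith)
    rw [hfs] at h1
    have : c * f (U, 0) + -(c * F U) * l = |u| := by
      rw [← div_mul_cancel₀ |u| hd0.ne', ← hc, hd]; ring
    rw [this] at h1
    exact absurd (le_abs_self u) (not_le.2 h1)
  set p := (InnerProductSpace.toDual ℝ (Lp ℝ 2 ν)).symm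
    (f.comp (ContinuousLinearMap.inl ℝ (Lp ℝ 2 ν) ℝ)) with hp
  have hpf : ∀ U : Lp ℝ 2 ν, f (U, 0) = ∫ x, p x * U x ∂ν := by
    intro U
    have : inner ℝ p U = f (U, 0) := by
      rw [hp, InnerProductSpace.toDual_symm_apply]; simp
    rw [← this, L2.inner_def]
    exact integral_congr_ae (ae_of_all _ fun x => by simp [mul_comm])
  have hpm := (Lp.stronglyMeasurable p).measurable
  have hind : ∀ (S : Set α) (hS : MeasurableSet S),
      f (indicatorConstLp 2 hS (measure_ne_top ν S) (1 : ℝ), 0) = ∫ x in S, p x ∂ν := by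
    intro S hS
    rw [hpf, ← integral_indicator hS]
    refine integral_congr_ae ?_
    filter_upwards [indicatorConstLp_coeFn (p := 2) (hs := hS) (hμs := measure_ne_top ν S)
      (c := (1 : ℝ))] with x hx
    rw [hx]
    by_cases h : x ∈ S <;> simp [h]
  -- Testing `hup` on -1_S gives p ≥ 0, and testing it on 1_S below gives p ≤ l.
  have hp0 : ∀ᵐ x ∂ν, 0 ≤ p x := by
    refine ae_nonneg_of_forall_setIntegral_nonneg (hint p) fun S hS _ => ?_
    rw [← hind S hS]
    set V := indicatorConstLp 2 hS (measure_ne_top ν S) (1 : ℝ) with hV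
    have h1 := hup ((-1 : ℝ) • V)
    rw [hfs] at h1
    have h2 : F ((-1 : ℝ) • V) = 0 := by
      have : F ((-1 : ℝ) • V) = ∫ x, (0 : ℝ) ∂ν := by
        refine integral_congr_ae ?_
        filter_upwards [indicatorConstLp_coeFn (p := 2) (hs := hS) (hμs := measure_ne_top ν S)
          (c := (1 : ℝ)), Lp.coeFn_smul (-1 : ℝ) V] with x hx h3
        rw [h3, Pi.smul_apply, hV, hx]
        by_cases h : x ∈ S <;> simp [h]
      simpa using this
    rw [h2] at h1
    linarith
  have hpl : ∀ᵐ x ∂ν, p x ≤ l := by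
    have : ∀ᵐ x ∂ν, 0 ≤ l - p x := by
      refine ae_nonneg_of_forall_setIntegral_nonneg ((integrable_const l).sub (hint p))
        fun S hS _ => ?_
      rw [integral_sub (integrable_const l).integrableOn (hint p).integrableOn, ← hind S hS]
      have h1 := hup (indicatorConstLp 2 hS (measure_ne_top ν S) (1 : ℝ))
      have h2 : F (indicatorConstLp 2 hS (measure_ne_top ν S) (1 : ℝ)) = ∫ x in S, (1 : ℝ) ∂ν := by
        rw [← integral_indicator hS]
        refine integral_congr_ae ?_
        filter_upwards [indicatorConstLp_coeFn (p := 2) (hs := hS) (hμs := measure_ne_top ν S)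
          (c := (1 : ℝ))] with x hx
        rw [hx]
        by_cases h : x ∈ S <;> simp [h]
      rw [h2] at h1
      simp only [integral_const, smul_eq_mul, mul_one] at h1 ⊢
      linarith
    filter_upwards [this] with x hx using by linarith
  have hpb : BddMeas ν p := ⟨hpm, l, by
    filter_upwards [hp0, hpl] with x h1 h2
    rwa [abs_of_nonneg h1]⟩
  have key : ∀ Z, DomBy ν ψ Z → ∫ x, Z x * (p x + l) ∂ν ≤ l + ∫ x, Z₁ x * p x ∂ν - l * ε := by
    intro Z hZ
    have h1 := hut _ ⟨Z, hZ, rfl⟩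
    rw [hsplit, hpf] at h1
    have h2 : ∫ x, p x * (Z₁ - Z : Lp ℝ 2 ν) x ∂ν = ∫ x, Z₁ x * p x ∂ν - ∫ x, Z x * p x ∂ν := by
      rw [← integral_sub (hpb.mul_integrable (hint Z₁)) (hpb.mul_integrable (hint Z))]
      refine integral_congr_ae ?_
      filter_upwards [Lp.coeFn_sub Z₁ Z] with x hx
      rw [hx, Pi.sub_apply]; ring
    have h3 : ∫ x, Z x * (p x + l) ∂ν = ∫ x, Z x * p x ∂ν + (∫ x, Z x ∂ν) * l := by
      rw [← integral_mul_const, ← integral_add (hpb.mul_integrable (hint Z)) ((hint Z).mul_const l)]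
      congr 1 with x
      ring
    rw [h2] at h1
    rw [h3]
    linarith
  have hgb : BddMeas ν (fun x => p x + l) := hpb.add (BddMeas.const l)
  have hg0 : ∀ᵐ x ∂ν, 0 ≤ p x + l := by
    filter_upwards [hp0] with x hx using by linarith
  have hψg : l + ∫ x, Z₁ x * p x ∂ν ≤ ψ (fun x => p x + l) := by
    rw [hψ.add_const p hpb l]
    linarith [hZ₁.2 p hpb hp0]
  have hpos : 0 ≤ ∫ x, Z₁ x * p x ∂ν := by
    refine integral_nonneg_of_ae ?_
    filter_upwards [hp0, hZ₁.1] with x h1 h2 using mul_nonneg h2 h1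
  have hle : 0 < l * ε := mul_pos hl0 hε
  obtain ⟨Z, hZ, hZg⟩ := hψ.exists_domBy hgb hg0
    (c := max (l / 2) (ψ (fun x => p x + l) - l * ε)) (lt_max_of_lt_left (by linarith))
    (max_lt (by linarith) (by linarith))
  have h1 := key Z hZ
  have h2 := le_max_right (l / 2) (ψ (fun x => p x + l) - l * ε)
  linarith

/-- A dominated density that nearly attains ψ may have mass below one. Iterating `exists_domBy_near`
with geometric errors pushes the mass to one and makes the negative parts of the increments
summable. The sequence is then Cauchy in L¹, and its limit has mass one, is still dominated and has
lost little. The representing measures so obtained are σ-additive by construction. -/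
theorem exists_density [IsProbabilityMeasure ν] {g : α → ℝ} (hg : BddMeas ν g)
    {ε : ℝ} (hε : 0 < ε) :
    ∃ Z : α → ℝ, Measurable Z ∧ Integrable Z ν ∧ (∀ᵐ x ∂ν, 0 ≤ Z x) ∧ ∫ x, Z x ∂ν = 1 ∧
      (∀ h, BddMeas ν h → ∫ x, Z x * h x ∂ν ≤ ψ h) ∧ ψ g - ε ≤ ∫ x, Z x * g x ∂ν := by
  obtain ⟨C, hC0, hC⟩ : ∃ C : ℝ, 0 ≤ C ∧ ∀ᵐ x ∂ν, |g x| ≤ C := by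
    obtain ⟨C, hC⟩ := hg.2
    exact ⟨|C|, abs_nonneg _, hC.mono fun x hx => hx.trans (le_abs_self _)⟩
  have hint : ∀ U : Lp ℝ 2 ν, Integrable U ν := fun U => (Lp.memLp U).integrable (by norm_num)
  set k : α → ℝ := fun x => g x + (C + 1) with hk
  have hkb : BddMeas ν k := hg.add (BddMeas.const _)
  have hk1 : ∀ᵐ x ∂ν, 1 ≤ k x := by
    filter_upwards [hC] with x hx
    have := (abs_le.1 hx).1
    simp only [hk]; linarith
  have hkC : ∀ᵐ x ∂ν, k x ≤ 2 * C + 2 := by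
    filter_upwards [hC] with x hx
    have := (abs_le.1 hx).2
    simp only [hk]; linarith
  have hk0 : ∀ᵐ x ∂ν, 0 ≤ k x := hk1.mono fun x hx => zero_le_one.trans hx
  have hψk : 1 ≤ ψ k := by
    rw [← hψ.const 1]
    exact hψ.mono _ _ (BddMeas.const 1) hkb hk1
  obtain ⟨Z₀, hZ₀, hZ₀k⟩ := hψ.exists_domBy hkb hk0 (c := max (1 / 2) (ψ k - ε / 2))
    (lt_max_of_lt_left (by norm_num)) (max_lt (by linarith) (by linarith))
  -- As k ≤ 2C + 2, step n costs at most (ε/4)·2⁻ⁿ, in total ε/2; the other ε/2 is spent in the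
  -- choice of Z₀.
  set δ : ℝ := ε / (4 * (2 * C + 2)) with hδ
  have hδ0 : 0 < δ := by positivity
  have hδn : ∀ n : ℕ, 0 < δ * (1 / 2) ^ n := fun n => by positivity
  choose! nxt hnxt hnear using fun (n : ℕ) (Z : Lp ℝ 2 ν) (hZ : DomBy ν ψ Z) =>
    hψ.exists_domBy_near hZ (hδn n)
  set Zs : ℕ → Lp ℝ 2 ν := fun n => Nat.rec Z₀ (fun n Z => nxt n Z) n with hZs
  have hZsD : ∀ n, DomBy ν ψ (Zs n) := by
    intro n
    induction n with
    | zero => exact hZ₀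
    | succ n ih => exact hnxt n _ ih
  have hstep : ∀ n, (1 - ∫ x, Zs (n + 1) x ∂ν) + ∫ x, max (Zs n x - Zs (n + 1) x) 0 ∂ν
      ≤ δ * (1 / 2) ^ n := fun n => hnear n _ (hZsD n)
  have hmass : ∀ n, ∫ x, Zs n x ∂ν ≤ 1 := fun n => by
    have := (hZsD n).2 (fun _ => 1) (BddMeas.const 1) (by simp)
    rwa [hψ.const, show (∫ x, Zs n x * 1 ∂ν) = ∫ x, Zs n x ∂ν by simp] at this
  have hsub : ∀ n, Integrable (fun x => Zs n x - Zs (n + 1) x) ν := fun n => (hint _).sub (hint _)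
  have hpos : ∀ n, 0 ≤ ∫ x, max (Zs n x - Zs (n + 1) x) 0 ∂ν := fun n =>
    integral_nonneg fun x => le_max_right _ _
  have hloss : ∀ n, (∫ x, Zs 0 x * k x ∂ν) - ε / 2 * (1 - (1 / 2) ^ n) ≤ ∫ x, Zs n x * k x ∂ν := by
    intro n
    induction n with
    | zero => simp
    | succ n ih =>
      have h1 : (∫ x, Zs n x * k x ∂ν) - ∫ x, Zs (n + 1) x * k x ∂ν
          ≤ ∫ x, (2 * C + 2) * max (Zs n x - Zs (n + 1) x) 0 ∂ν := by
        rw [← integral_sub (hkb.mul_integrable (hint _)) (hkb.mul_integrable (hint _))]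
        refine integral_mono_ae ((hkb.mul_integrable (hint _)).sub (hkb.mul_integrable (hint _)))
          ((hsub n).pos_part.const_mul _) ?_
        filter_upwards [hk0, hkC] with x h1 h2
        have h3 := le_max_left (Zs n x - Zs (n + 1) x) 0
        have h4 := le_max_right (Zs n x - Zs (n + 1) x) 0
        nlinarith
      rw [integral_const_mul] at h1
      have h2 : ∫ x, max (Zs n x - Zs (n + 1) x) 0 ∂ν ≤ δ * (1 / 2) ^ n := by
        linarith [hstep n, hmass (n + 1)]
      have h3 : (2 * C + 2) * (δ * (1 / 2) ^ n) = ε / 4 * (1 / 2) ^ n := by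
        rw [hδ]; field_simp
      have h4 : (2 * C + 2) * ∫ x, max (Zs n x - Zs (n + 1) x) 0 ∂ν ≤ ε / 4 * (1 / 2) ^ n := by
        rw [← h3]; exact mul_le_mul_of_nonneg_left h2 (by linarith)
      rw [pow_succ]
      linarith
  -- The index starts at one because the mass of Z₀ itself need not be close to one.
  set f : ℕ → Lp ℝ 1 ν := fun n => (hint (Zs (n + 1))).toL1 _ with hf
  have hcau : CauchySeq f := by
    refine cauchySeq_of_le_geometric (1 / 2) (2 * δ) (by norm_num) fun n => ?_
    have h1 : dist (f n) (f (n + 1)) = ∫ x, |Zs (n + 1) x - Zs (n + 2) x| ∂ν := by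
      rw [dist_eq_norm, L1.norm_eq_integral_norm]
      refine integral_congr_ae ?_
      filter_upwards [Lp.coeFn_sub (f n) (f (n + 1)), (hint (Zs (n + 1))).coeFn_toL1,
        (hint (Zs (n + 2))).coeFn_toL1] with x h1 h2 h3
      rw [h1, Pi.sub_apply, hf]
      simp only
      rw [h2, h3, Real.norm_eq_abs]
    -- The identity |a| = 2a⁺ - a reduces the L¹ distance to the positive part and to the change of
    -- mass, both controlled by `hstep`.
    have h2 : ∫ x, |Zs (n + 1) x - Zs (n + 2) x| ∂ν
        = 2 * ∫ x, max (Zs (n + 1) x - Zs (n + 2) x) 0 ∂ν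
          - (∫ x, Zs (n + 1) x ∂ν - ∫ x, Zs (n + 2) x ∂ν) := by
      rw [← integral_sub (hint _) (hint _), ← integral_const_mul,
        ← integral_sub ((hsub (n + 1)).pos_part.const_mul 2) (hsub (n + 1))]
      congr 1 with x
      rcases le_total 0 (Zs (n + 1) x - Zs (n + 2) x) with h | h
      · rw [abs_of_nonneg h, max_eq_left h]; ring
      · rw [abs_of_nonpos h, max_eq_right h]; ring
    rw [h1, h2]
    have h3 := hstep (n + 1)
    have h4 := hstep n
    have h5 := hpos n
    have h6 := hmass (n + 2)
    rw [pow_succ] at h3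
    linarith
  obtain ⟨Zl, hZl⟩ := cauchySeq_tendsto_of_complete hcau
  have hZli : Integrable Zl ν := L1.integrable_coeFn Zl
  have hlim : ∀ h, BddMeas ν h → Tendsto (fun n => ∫ x, Zs (n + 1) x * h x ∂ν) atTop
      (𝓝 (∫ x, Zl x * h x ∂ν)) := by
    intro h hh
    obtain ⟨K, hK⟩ := hh.2
    rw [tendsto_iff_dist_tendsto_zero]
    have h0 : Tendsto (fun n => dist (f n) Zl * K) atTop (𝓝 (0 * K)) :=
      (tendsto_iff_dist_tendsto_zero.1 hZl).mul_const K
    rw [zero_mul] at h0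
    refine squeeze_zero (fun _ => dist_nonneg) (fun n => ?_) h0
    have h1 : dist (f n) Zl = ∫ x, |Zs (n + 1) x - Zl x| ∂ν := by
      rw [dist_eq_norm, L1.norm_eq_integral_norm]
      refine integral_congr_ae ?_
      filter_upwards [Lp.coeFn_sub (f n) Zl, (hint (Zs (n + 1))).coeFn_toL1] with x h1 h2
      rw [h1, Pi.sub_apply, hf]
      simp only
      rw [h2, Real.norm_eq_abs]
    rw [h1, Real.dist_eq, ← integral_sub (hh.mul_integrable (hint _)) (hh.mul_integrable hZli),
      ← integral_mul_const]
    refine abs_integral_le_integral_abs.trans ?_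
    refine integral_mono_ae ((hh.mul_integrable (hint _)).sub (hh.mul_integrable hZli)).abs
      (((hint _).sub hZli).abs.mul_const K) ?_
    filter_upwards [hK] with x hx
    rw [← sub_mul, abs_mul]
    exact mul_le_mul_of_nonneg_left hx (abs_nonneg _)
  have hpow : Tendsto (fun n : ℕ => δ * (1 / 2 : ℝ) ^ n) atTop (𝓝 0) := by
    have := (tendsto_pow_atTop_nhds_zero_of_lt_one (r := (1 / 2 : ℝ)) (by norm_num)
      (by norm_num)).const_mul δ
    rwa [mul_zero] at this
  have hmass1 : ∫ x, Zl x ∂ν = 1 := by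
    have h1 := hlim (fun _ => 1) (BddMeas.const 1)
    simp only [mul_one] at h1
    refine tendsto_nhds_unique h1 ?_
    refine tendsto_of_tendsto_of_tendsto_of_le_of_le (g := fun n => 1 - δ * (1 / 2 : ℝ) ^ n) ?_
      tendsto_const_nhds (fun n => ?_) (fun n => hmass (n + 1))
    · have := (tendsto_const_nhds (x := (1 : ℝ))).sub hpow
      rwa [sub_zero] at this
    · have := hstep n
      have := hpos n
      simp only
      linarith
  have hnn : ∀ h, BddMeas ν h → (∀ᵐ x ∂ν, 0 ≤ h x) → ∫ x, Zl x * h x ∂ν ≤ ψ h :=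
    fun h hh hh0 => le_of_tendsto' (hlim h hh) fun n => (hZsD (n + 1)).2 h hh hh0
  have hZl0 : ∀ᵐ x ∂ν, 0 ≤ Zl x := by
    refine ae_nonneg_of_forall_setIntegral_nonneg hZli fun S hS _ => ?_
    rw [← integral_indicator hS]
    have h1 := hlim (S.indicator 1) ((BddMeas.const 1).indicator hS)
    have h2 : (fun x => Zl x * S.indicator 1 x) = S.indicator Zl := by
      ext x; by_cases hx : x ∈ S <;> simp [hx]
    rw [← h2]
    refine ge_of_tendsto' h1 fun n => integral_nonneg_of_ae ?_
    filter_upwards [(hZsD (n + 1)).1] with x hx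
    exact mul_nonneg hx (indicator_nonneg (fun _ _ => zero_le_one) x)
  have hshift : ∀ h, BddMeas ν h → ∀ c : ℝ, ∫ x, Zl x * (h x + c) ∂ν = ∫ x, Zl x * h x ∂ν + c := by
    intro h hh c
    have : ∫ x, Zl x * (h x + c) ∂ν = ∫ x, Zl x * h x ∂ν + (∫ x, Zl x ∂ν) * c := by
      rw [← integral_mul_const, ← integral_add (hh.mul_integrable hZli) (hZli.mul_const c)]
      congr 1 with x
      ring
    rw [this, hmass1, one_mul]
  refine ⟨Zl, (Lp.stronglyMeasurable Zl).measurable, hZli, hZl0, hmass1, fun h hh => ?_, ?_⟩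
  -- Mass exactly one is needed here: a shift by K reduces signed h to the nonnegative case, and
  -- both sides change by K.
  · obtain ⟨K, hK⟩ := hh.2
    have := hnn (fun x => h x + K) (hh.add (BddMeas.const K)) (by
      filter_upwards [hK] with x hx
      linarith [(abs_le.1 hx).1])
    rw [hshift h hh, hψ.add_const h hh] at this
    linarith
  · have h1 : ψ k - ε / 2 - ε / 2 ≤ ∫ x, Zl x * k x ∂ν := by
      refine ge_of_tendsto' (hlim k hkb) fun n => ?_
      have h2 := hloss (n + 1)
      have h3 := (le_max_right (1 / 2) (ψ k - ε / 2)).trans_lt hZ₀k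
      have h4 : 0 ≤ ε / 2 * (1 / 2 : ℝ) ^ (n + 1) := by positivity
      have h5 : ∫ x, Zs 0 x * k x ∂ν = ∫ x, Z₀ x * k x ∂ν := rfl
      linarith
    rw [hshift g hg, hψ.add_const g hg] at h1
    linarith

end IsUpperExp

end Representation

end RiskProc

namespace RiskProc

/-! ### Extension of consistent families of measures along regular filtrations -/

section Extension

universe u

variable {Ω : Type u}

/-- A σ-field that is σ-isomorphic to a standard Borel σ-field is generated by a surjection. -/
theorem IsSigmaIsoPolish.exists_map {m : MeasurableSpace Ω} (h : IsSigmaIsoPolish m) :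
    ∃ (Y : Type) (mY : MeasurableSpace Y) (_ : StandardBorelSpace Y) (φ : Ω → Y),
      Function.Surjective φ ∧ m = MeasurableSpace.comap φ mY := by
  obtain ⟨Y, tY, pY, e, hc, hu⟩ := h
  let mY : MeasurableSpace Y := borel Y
  have : BorelSpace Y := ⟨rfl⟩
  set E : {B : Set Y // MeasurableSet[borel Y] B} → Set Ω := fun B => (e.symm B).1 with hE
  have Em : ∀ B, MeasurableSet[m] (E B) := fun B => (e.symm B).2
  have Einj : ∀ B B', E B = E B' → B = B' := fun B B' h => e.symm.injective (Subtype.ext h)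
  have Ec : ∀ B B', B'.1 = B.1ᶜ → E B' = (E B)ᶜ := by
    intro B B' hB
    have h1 := hc (e.symm B) ⟨(E B)ᶜ, (Em B).compl⟩ rfl
    rw [e.apply_symm_apply] at h1
    have h2 : e ⟨(E B)ᶜ, (Em B).compl⟩ = B' := Subtype.ext (h1.trans hB.symm)
    simp only [hE, ← h2, e.symm_apply_apply]
  have Eu : ∀ (B : ℕ → {B : Set Y // MeasurableSet[borel Y] B}) B', B'.1 = ⋃ n, (B n).1 →
      E B' = ⋃ n, E (B n) := by
    intro B B' hB
    have h1 := hu (fun n => e.symm (B n)) ⟨⋃ n, E (B n), MeasurableSet.iUnion fun n => Em _⟩ rfl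
    simp only [e.apply_symm_apply] at h1
    have h2 : e ⟨⋃ n, E (B n), MeasurableSet.iUnion fun n => Em _⟩ = B' :=
      Subtype.ext (h1.trans hB.symm)
    simp only [hE, ← h2, e.symm_apply_apply]
  -- Only complements and countable unions are preserved, so the inclusion is read off from B' = B ∪
  -- B' ∪ B' ∪ ⋯.
  have Emono : ∀ B B', B.1 ⊆ B'.1 → E B ⊆ E B' := by
    intro B B' hB
    rw [Eu (fun n => if n = 0 then B else B') B' ?_]
    · exact subset_iUnion_of_subset 0 (by simp)
    · refine subset_antisymm (subset_iUnion_of_subset 1 (by simp)) (iUnion_subset fun n => ?_)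
      by_cases h : n = 0 <;> simp [h, hB]
  have Eempty : E ⟨∅, MeasurableSet.empty⟩ = ∅ := by
    have h1 := Ec ⟨∅, MeasurableSet.empty⟩ ⟨univ, MeasurableSet.univ⟩ (by simp)
    have h2 := Emono ⟨∅, MeasurableSet.empty⟩ ⟨univ, MeasurableSet.univ⟩ (by simp)
    rw [h1] at h2
    exact subset_empty_iff.1 fun x hx => h2 hx hx
  set Es : Y → Set Ω := fun y => E ⟨{y}, measurableSet_singleton y⟩ with hEs
  obtain ⟨S, hS, hsep⟩ := exists_seq_separating Y (p := MeasurableSet) MeasurableSet.empty univ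
  have hex : ∀ ω, ∃ y, ω ∈ Es y := by
    intro ω
    -- For each separating set S k, the point ω selects S k or its complement. The intersection of
    -- the selected sets still corresponds to a set containing ω, so it is nonempty, and separation
    -- leaves it a single point: the value φ ω.
    set T : ℕ → Set Y := fun k => {y | y ∈ S k ↔ ω ∈ E ⟨S k, hS k⟩} with hT
    have hTm : ∀ k, MeasurableSet (T k) := by
      intro k
      by_cases h : ω ∈ E ⟨S k, hS k⟩
      · have : T k = S k := by ext y; simp [hT, h]
        rw [this]; exact hS k
      · have : T k = (S k)ᶜ := by ext y; simp [hT, h]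
        rw [this]; exact (hS k).compl
    have hTω : ∀ k, ω ∈ E ⟨T k, hTm k⟩ := by
      intro k
      by_cases h : ω ∈ E ⟨S k, hS k⟩
      · exact Emono ⟨S k, hS k⟩ _ (fun y hy => by simp [hT, h, hy]) h
      · have h1 : ω ∈ E ⟨(S k)ᶜ, (hS k).compl⟩ := by
          rw [Ec ⟨S k, hS k⟩ ⟨(S k)ᶜ, (hS k).compl⟩ rfl]; exact h
        exact Emono ⟨(S k)ᶜ, (hS k).compl⟩ _ (fun y hy => by simpa [hT, h] using hy) h1
    have hall : ω ∈ E ⟨⋂ k, T k, MeasurableSet.iInter hTm⟩ := by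
      by_contra hn
      have h1 : ω ∈ E ⟨(⋂ k, T k)ᶜ, (MeasurableSet.iInter hTm).compl⟩ := by
        rw [Ec ⟨⋂ k, T k, MeasurableSet.iInter hTm⟩ _ rfl]; exact hn
      rw [Eu (fun k => ⟨(T k)ᶜ, (hTm k).compl⟩) _ (by simp [compl_iInter])] at h1
      obtain ⟨k, hk⟩ := mem_iUnion.1 h1
      rw [Ec ⟨T k, hTm k⟩ _ rfl] at hk
      exact hk (hTω k)
    obtain ⟨y, hy⟩ : (⋂ k, T k).Nonempty := by
      by_contra hne
      rw [not_nonempty_iff_eq_empty] at hne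
      have := Emono ⟨⋂ k, T k, MeasurableSet.iInter hTm⟩ ⟨∅, MeasurableSet.empty⟩ hne.subset hall
      rw [Eempty] at this
      exact this
    refine ⟨y, Emono _ _ (fun y' hy' => ?_) hall⟩
    refine hsep y' (mem_univ _) y (mem_univ _) fun k => ?_
    have h1 : y ∈ S k ↔ ω ∈ E ⟨S k, hS k⟩ := mem_iInter.1 hy k
    have h2 : y' ∈ S k ↔ ω ∈ E ⟨S k, hS k⟩ := mem_iInter.1 hy' k
    rw [h1, h2]
  choose φ hφ using hex
  have hpre : ∀ B : {B : Set Y // MeasurableSet[borel Y] B}, φ ⁻¹' B.1 = E B := by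
    intro B
    ext ω
    constructor
    · intro h
      exact Emono _ _ (singleton_subset_iff.2 (show φ ω ∈ B.1 from h)) (hφ ω)
    · intro h
      by_contra hn
      have h1 := Emono ⟨{φ ω}, measurableSet_singleton _⟩ ⟨B.1ᶜ, B.2.compl⟩
        (singleton_subset_iff.2 (show φ ω ∈ B.1ᶜ from hn)) (hφ ω)
      rw [Ec B _ rfl] at h1
      exact h1 h
  refine ⟨Y, mY, inferInstance, φ, fun y => ?_, ?_⟩
  · by_contra hne
    have h1 : Es y = ∅ := by
      rw [hEs]
      simp only
      rw [← hpre]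
      ext ω
      simp only [mem_preimage, mem_singleton_iff, mem_empty_iff_false, iff_false]
      exact fun h => hne ⟨ω, h⟩
    have h2 := Einj _ _ (h1.trans Eempty.symm)
    have h3 : ({y} : Set Y) = ∅ := congrArg Subtype.val h2
    exact (singleton_nonempty y).ne_empty h3
  · ext A
    rw [MeasurableSpace.measurableSet_comap]
    constructor
    · intro hA
      refine ⟨(e ⟨A, hA⟩).1, (e ⟨A, hA⟩).2, ?_⟩
      rw [hpre]
      simp [hE]
    · rintro ⟨B, hB, rfl⟩
      rw [hpre ⟨B, hB⟩]
      exact Em _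

/-- Existence of projective limits along a sequence of random variables. -/
theorem exists_measure_pi {m0 : MeasurableSpace Ω} (𝓕 : Filtration ℕ m0)
    {Y : ℕ → Type} [∀ n, MeasurableSpace (Y n)] [∀ n, StandardBorelSpace (Y n)]
    [∀ n, Nonempty (Y n)] (φ : ∀ n, Ω → Y n) (hφ : ∀ n, Measurable[𝓕 n] (φ n))
    (q : ∀ n, Measure[𝓕 n] Ω) (hq : ∀ n, IsProbabilityMeasure (q n))
    (hcons : ∀ n A, MeasurableSet[𝓕 n] A → q (n + 1) A = q n A) :
    ∃ ν : Measure (∀ n, Y n), IsProbabilityMeasure ν ∧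
      ∀ n (B : Set (∀ i : Finset.Iic n, Y i)), MeasurableSet B →
        ν (Preorder.frestrictLe n ⁻¹' B) = q n ((fun ω => (fun i => φ i.1 ω : ∀ i : Finset.Iic n, Y i)) ⁻¹' B) := by
  set Φ : ∀ n, Ω → ∀ i : Finset.Iic n, Y i := fun n ω i => φ i.1 ω with hΦ
  have hφ' : ∀ {i n}, i ≤ n → Measurable[𝓕 n] (φ i) := fun h => (hφ _).mono (𝓕.mono h) le_rfl
  have hΦm : ∀ {n k}, n ≤ k → Measurable[𝓕 k] (Φ n) := by
    intro n k hnk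
    let _ := 𝓕 k
    exact measurable_pi_lambda _ fun i => hφ' ((Finset.mem_Iic.1 i.2).trans hnk)
  set l : ∀ n, Measure (∀ i : Finset.Iic n, Y i) := fun n =>
    @Measure.map Ω _ (𝓕 n) _ (Φ n) (q n) with hl
  have hlp : ∀ n, IsProbabilityMeasure (l n) := fun n =>
    @Measure.isProbabilityMeasure_map Ω _ (𝓕 n) _ (q n) (hq n) _ (hΦm le_rfl).aemeasurable
  have hl1 : ∀ n, @Measure.map Ω _ (𝓕 (n + 1)) _ (Φ n) (q (n + 1)) = l n := by
    intro n
    refine Measure.ext fun B hB => ?_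
    rw [Measure.map_apply (hΦm n.le_succ) hB, hl, Measure.map_apply (hΦm le_rfl) hB]
    exact hcons n _ (hΦm le_rfl hB)
  -- The limit is an Ionescu-Tulcea measure: the transition kernels are the regular conditional laws
  -- of φ (n+1) given the earlier coordinates, computed under q (n+1).
  set κ : ∀ n, Kernel (∀ i : Finset.Iic n, Y i) (Y (n + 1)) := fun n =>
    condDistrib (φ (n + 1)) (Φ n) (q (n + 1)) with hκ
  have hκm : ∀ n, IsMarkovKernel (κ n) := fun n => by rw [hκ]; infer_instance
  have hcomp : ∀ n, l n ⊗ₘ κ n = @Measure.map Ω _ (𝓕 (n + 1)) _ (fun ω => (Φ n ω, φ (n + 1) ω))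
      (q (n + 1)) := by
    intro n
    rw [← hl1 n]
    exact compProd_map_condDistrib (hφ _).aemeasurable
  have hpt : ∀ n, Kernel.partialTraj κ 0 n ∘ₘ l 0 = l n := by
    intro n
    induction n with
    | zero => rw [Kernel.partialTraj_self, Measure.id_comp]
    | succ n ih =>
      rw [Kernel.partialTraj_succ_eq_comp (Nat.zero_le n), ← Measure.comp_assoc, ih,
        Kernel.partialTraj_succ_self, ← Measure.map_comp _ _ (by fun_prop)]
      have h1 : (Kernel.id ×ₖ (κ n).map (MeasurableEquiv.piSingleton n)) ∘ₘ l n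
          = (l n ⊗ₘ κ n).map (Prod.map id (MeasurableEquiv.piSingleton n)) := by
        rw [← Measure.compProd_eq_comp_prod]
        exact (Measure.compProd_map (MeasurableEquiv.measurable _))
      rw [h1, hcomp, Measure.map_map (by fun_prop) ((hΦm n.le_succ).prodMk (hφ _)),
        Measure.map_map (by fun_prop) (by
          exact (Measurable.prodMap measurable_id (MeasurableEquiv.measurable _)).comp
            ((hΦm n.le_succ).prodMk (hφ _)))]
      congr 1
      ext ω i
      simp only [Function.comp, Prod.map, id, IicProdIoc, MeasurableEquiv.piSingleton]
      split_ifs with h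
      · rfl
      · have : i.1 = n + 1 := by have := Finset.mem_Iic.1 i.2; omega
        obtain ⟨i, hi⟩ := i
        simp only at this
        subst this
        rfl
  refine ⟨Kernel.traj κ 0 ∘ₘ l 0, inferInstance, fun n B hB => ?_⟩
  rw [← Measure.map_apply (by fun_prop) hB, ← Measure.map_apply (hΦm le_rfl) hB]
  rw [Measure.map_comp _ _ (by fun_prop), Kernel.traj_map_frestrictLe, hpt]

/-- Consistent families of probability measures extend along regular filtrations. -/
theorem FiltrationRegular.exists_extension {m0 : MeasurableSpace Ω} {𝓕 : Filtration ℕ m0}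
    (h : FiltrationRegular 𝓕) (q : ∀ n, Measure[𝓕 n] Ω) (hq : ∀ n, IsProbabilityMeasure (q n))
    (hcons : ∀ n A, MeasurableSet[𝓕 n] A → q (n + 1) A = q n A) :
    ∃ Q : Measure[⨆ n, 𝓕 n] Ω, IsProbabilityMeasure Q ∧
      ∀ n A, MeasurableSet[𝓕 n] A → Q A = q n A := by
  obtain ⟨hiso, hatom⟩ := h
  choose Y mY sY φ hsurj hcomap using fun n => (hiso n).exists_map
  have hφ : ∀ n, Measurable[𝓕 n] (φ n) := fun n => by
    rw [hcomap n]; exact comap_measurable _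
  obtain ⟨ω₀⟩ : Nonempty Ω := by
    by_contra hne
    rw [not_nonempty_iff] at hne
    have h1 := (hq 0).measure_univ
    rw [Measure.eq_zero_of_isEmpty (q 0)] at h1
    simp at h1
  have hne : ∀ n, Nonempty (Y n) := fun n => ⟨φ n ω₀⟩
  -- Since φ n is 𝓕 (n+1)-measurable, it factors through φ (n+1). The maps p n form the projective
  -- system whose consistent sequences make up S below.
  choose p hp hpφ using fun n => Measurable.exists_eq_measurable_comp (Z := Y n) (f := φ (n + 1))
    (by rw [← hcomap (n + 1)]; exact (hφ n).mono (𝓕.mono n.le_succ) le_rfl)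
  obtain ⟨ν, hν, hνq⟩ := exists_measure_pi 𝓕 φ hφ q hq hcons
  set S : Set (∀ n, Y n) := ⋂ n, {y | p n (y (n + 1)) = y n} with hS
  have hSm1 : ∀ n, MeasurableSet {y : ∀ n, Y n | p n (y (n + 1)) = y n} := fun n =>
    measurableSet_eq_fun ((hp n).comp (measurable_pi_apply _)) (measurable_pi_apply _)
  have hSm : MeasurableSet S := MeasurableSet.iInter hSm1
  have hSν : ∀ᵐ y ∂ν, y ∈ S := by
    simp only [hS, mem_iInter]
    refine ae_all_iff.2 fun n => ?_
    have h1 : MeasurableSet {y : ∀ i : Finset.Iic (n + 1), Y i |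
        p n (y ⟨n + 1, by simp⟩) = y ⟨n, by simp⟩} :=
      measurableSet_eq_fun ((hp n).comp (measurable_pi_apply _)) (measurable_pi_apply _)
    have h2 := hνq (n + 1) _ h1
    rw [show ((fun ω => (fun i => φ i.1 ω : ∀ i : Finset.Iic (n + 1), Y i)) ⁻¹'
        {y : ∀ i : Finset.Iic (n + 1), Y i |
        p n (y ⟨n + 1, by simp⟩) = y ⟨n, by simp⟩}) = univ from ?_, (hq (n + 1)).measure_univ] at h2
    · exact (mem_ae_iff_prob_eq_one (hSm1 n)).2 h2
    · exact eq_univ_of_forall fun ω => (congrFun (hpφ n) ω).symm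
  -- The fibres of φ n over y n are atoms of 𝓕 n and decrease along a consistent sequence. The
  -- assumption on atoms thus provides a point of Ω that realizes y.
  have hex : ∀ y ∈ S, ∃ ω, ∀ n, φ n ω = y n := by
    intro y hy
    have hy' : ∀ n, p n (y (n + 1)) = y n := fun n => mem_iInter.1 hy n
    have hat : ∀ n, IsSigmaAtom (𝓕 n) (φ n ⁻¹' {y n}) := by
      refine fun n => ⟨hφ n (measurableSet_singleton _), ?_, fun B hB hBs => ?_⟩
      · obtain ⟨ω, hω⟩ := hsurj n (y n)
        exact ⟨ω, hω⟩
      · rw [hcomap n, MeasurableSpace.measurableSet_comap] at hB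
        obtain ⟨C, -, rfl⟩ := hB
        by_cases hc : y n ∈ C
        · exact Or.inr (subset_antisymm hBs fun ω hω => by
            have h1 : φ n ω = y n := hω
            simpa [h1] using hc)
        · refine Or.inl (eq_empty_of_forall_notMem fun ω hω => hc ?_)
          have h1 : φ n ω = y n := hBs hω
          rw [← h1]; exact hω
    have hanti : Antitone fun n => φ n ⁻¹' {y n} := by
      refine antitone_nat_of_succ_le fun n ω hω => ?_
      have h1 : φ (n + 1) ω = y (n + 1) := hω
      have h2 := congrFun (hpφ n) ω
      simp only [Function.comp, h1, hy'] at h2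
      exact h2
    obtain ⟨ω, hω⟩ := hatom _ hat hanti
    exact ⟨ω, fun n => mem_iInter.1 hω n⟩
  have : Nonempty Ω := ⟨ω₀⟩
  choose! g hg using hex
  classical
  set G : (∀ n, Y n) → Ω := fun y => if y ∈ S then g y else ω₀ with hG
  -- No measurability of the selection g is needed: for sets from 𝓕 n only the coordinate y n
  -- matters on S, and off S the map is constant.
  have hpre : ∀ n (C : Set (Y n)), G ⁻¹' (φ n ⁻¹' C)
      = (S ∩ {y | y n ∈ C}) ∪ (Sᶜ ∩ {_y | φ n ω₀ ∈ C}) := by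
    intro n C
    ext y
    by_cases hy : y ∈ S
    · simp [hG, hy, hg y hy n]
    · simp [hG, hy]
  have hGm : Measurable[MeasurableSpace.pi, ⨆ n, 𝓕 n] G := by
    rw [measurable_iff_comap_le, MeasurableSpace.comap_iSup]
    refine iSup_le fun n => ?_
    rintro _ ⟨A, hA, rfl⟩
    rw [hcomap n] at hA
    obtain ⟨C, hC, rfl⟩ := hA
    rw [hpre]
    exact (hSm.inter (measurable_pi_apply n hC)).union (hSm.compl.inter (MeasurableSet.const _))
  refine ⟨@Measure.map _ _ _ (⨆ n, 𝓕 n) G ν, ?_, fun n A hA => ?_⟩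
  · exact @Measure.isProbabilityMeasure_map _ _ _ (⨆ n, 𝓕 n) ν _ G
      (@Measurable.aemeasurable _ _ _ (⨆ n, 𝓕 n) G ν hGm)
  · rw [@Measure.map_apply _ _ _ (⨆ n, 𝓕 n) ν G hGm A (le_iSup (fun n => 𝓕 n) n A hA)]
    rw [hcomap n] at hA
    obtain ⟨C, hC, rfl⟩ := hA
    have h1 := hνq n {y | y ⟨n, by simp⟩ ∈ C}
      (measurable_pi_apply (⟨n, by simp⟩ : Finset.Iic n) hC)
    refine Eq.trans ?_ h1
    refine measure_congr ?_
    filter_upwards [hSν] with y hy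
    refine propext ?_
    change φ n (G y) ∈ C ↔ y n ∈ C
    simp [hG, hy, hg y hy n]

end Extension

end RiskProc

namespace RiskProc

/-! ### Measures on sub-σ-fields and conditional expectations -/

section Conditional

variable {α : Type*}

theorem AgreeOn.ae_iff {m m1 m2 : MeasurableSpace α} {Q₁ : Measure[m1] α} {Q₂ : Measure[m2] α}
    (h : AgreeOn m Q₁ Q₂) {p : α → Prop} (hp : MeasurableSet[m] {x | p x}) :
    (∀ᵐ x ∂Q₁, p x) ↔ ∀ᵐ x ∂Q₂, p x := by
  rw [MeasureTheory.ae_iff, MeasureTheory.ae_iff]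
  exact Eq.congr_left (h _ hp.compl)

theorem AbsContOn.ae {m m1 m2 : MeasurableSpace α} {Q₁ : Measure[m1] α} {Q₂ : Measure[m2] α}
    (h : AbsContOn m Q₁ Q₂) {p : α → Prop} (hp : MeasurableSet[m] {x | p x})
    (h2 : ∀ᵐ x ∂Q₂, p x) : ∀ᵐ x ∂Q₁, p x :=
  ae_iff.2 (h _ hp.compl (ae_iff.1 h2))

theorem AgreeOn.symm {m m1 m2 : MeasurableSpace α} {Q₁ : Measure[m1] α} {Q₂ : Measure[m2] α}
    (h : AgreeOn m Q₁ Q₂) : AgreeOn m Q₂ Q₁ := fun E hE => (h E hE).symm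

theorem AgreeOn.integral_eq {m m1 m2 : MeasurableSpace α} {Q₁ : Measure[m1] α}
    {Q₂ : Measure[m2] α} (h : AgreeOn m Q₁ Q₂) (h1 : m ≤ m1) (h2 : m ≤ m2) {f : α → ℝ}
    (hf : Measurable[m] f) : ∫ x, f x ∂Q₁ = ∫ x, f x ∂Q₂ := by
  have : Q₁.trim h1 = Q₂.trim h2 := by
    refine @Measure.ext _ m _ _ fun s hs => ?_
    rw [trim_measurableSet_eq h1 hs, trim_measurableSet_eq h2 hs, h s hs]
  rw [integral_trim h1 hf.stronglyMeasurable, integral_trim h2 hf.stronglyMeasurable, this]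

theorem setIntegral_withDensity_real {m : MeasurableSpace α} {ν : Measure α} {f : α → ℝ≥0∞}
    (hf : Measurable f) (hfin : ∀ᵐ x ∂ν, f x < ⊤) (g : α → ℝ) {s : Set α} (hs : MeasurableSet s) :
    ∫ x in s, g x ∂(ν.withDensity f) = ∫ x in s, (f x).toReal * g x ∂ν :=
  setIntegral_withDensity_eq_setIntegral_toReal_smul hf (ae_restrict_of_ae hfin) g hs

/-! ### Conditional inequalities and essential suprema of conditional expectations -/

variable {m m0 : MeasurableSpace α} {R : Measure α}

theorem ae_nonneg_of_setIntegral_nonneg_of_measurable (hm : m ≤ m0) [IsFiniteMeasure R] {f : α → ℝ}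
    (hf : Integrable f R) (hfm : StronglyMeasurable[m] f)
    (h : ∀ A, MeasurableSet[m] A → 0 ≤ ∫ x in A, f x ∂ R) : ∀ᵐ x ∂ R, 0 ≤ f x := by
  refine ae_of_ae_trim hm (ae_nonneg_of_forall_setIntegral_nonneg (hf.trim hm hfm) fun s hs _ => ?_)
  rw [← setIntegral_trim hm hfm hs]
  exact h s hs

theorem ae_le_of_setIntegral_le_of_measurable (hm : m ≤ m0) [IsFiniteMeasure R] {f g : α → ℝ}
    (hf : Integrable f R) (hfm : StronglyMeasurable[m] f) (hg : Integrable g R)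
    (hgm : StronglyMeasurable[m] g)
    (h : ∀ A, MeasurableSet[m] A → ∫ x in A, f x ∂ R ≤ ∫ x in A, g x ∂ R) :
    ∀ᵐ x ∂ R, f x ≤ g x := by
  have := ae_nonneg_of_setIntegral_nonneg_of_measurable hm (hg.sub hf) (hgm.sub hfm) fun A hA => by
    simp only [Pi.sub_apply]
    rw [integral_sub hg.integrableOn hf.integrableOn]
    linarith [h A hA]
  filter_upwards [this] with x hx
  exact sub_nonneg.1 hx

theorem condExp_le_iff (hm : m ≤ m0) [IsFiniteMeasure R] {f g : α → ℝ} (hf : Integrable f R)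
    (hg : Integrable g R) (hgm : StronglyMeasurable[m] g) :
    (∀ᵐ x ∂ R, (R[f | m]) x ≤ g x) ↔
      ∀ A, MeasurableSet[m] A → ∫ x in A, f x ∂ R ≤ ∫ x in A, g x ∂ R := by
  constructor
  · intro h A hA
    rw [← setIntegral_condExp hm hf hA]
    exact integral_mono_ae integrable_condExp.integrableOn hg.integrableOn (ae_restrict_of_ae h)
  · intro h
    refine ae_le_of_setIntegral_le_of_measurable hm integrable_condExp stronglyMeasurable_condExp
      hg hgm fun A hA => ?_
    rw [setIntegral_condExp hm hf hA]
    exact h A hA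

theorem condExp_nonpos_on_iff (hm : m ≤ m0) [IsFiniteMeasure R] {f : α → ℝ} (hf : Integrable f R)
    {E : Set α} (hE : MeasurableSet[m] E) :
    (∀ᵐ x ∂ R, x ∈ E → (R[f | m]) x ≤ 0) ↔
      ∀ A, MeasurableSet[m] A → ∫ x in A ∩ E, f x ∂ R ≤ 0 := by
  have h1 := condExp_le_iff hm (hf.indicator (hm _ hE)) (integrable_zero α ℝ R)
    stronglyMeasurable_zero
  have h2 : (∀ᵐ x ∂ R, x ∈ E → (R[f | m]) x ≤ 0) ↔ ∀ᵐ x ∂ R, (R[E.indicator f | m]) x ≤ 0 := by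
    have h3 := condExp_indicator hf hE
    constructor <;> intro h
    · filter_upwards [h, h3] with x h4 h5
      rw [h5]
      by_cases hx : x ∈ E <;> simp [hx, h4]
    · filter_upwards [h, h3] with x h4 h5 hx
      rwa [h5, indicator_of_mem hx] at h4
  rw [h2]
  refine h1.trans (forall₂_congr fun A hA => ?_)
  rw [setIntegral_indicator (hm _ hE)]
  simp

/-- The set of `𝓕`-conditional expectations `R[K X | m]`, `X ∈ S`, as extended random variables. -/
abbrev condFamily {ι : Type*} (m : MeasurableSpace α) {m0 : MeasurableSpace α} (R : Measure[m0] α)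
    (S : Set ι) (K : ι → α → ℝ) : Set (α → EReal) :=
  {f | ∃ X ∈ S, f = fun x => (((R[K X | m]) x : ℝ) : EReal)}

/-- The family contains zero up to null sets, so its essential supremum is nonnegative. Minimality
is applied to the function equal to 0 on E and ⊤ off E, since nothing is asserted outside E. -/
theorem essSupFam_condFamily_eq_zero_iff {ι : Type*} (hm : m ≤ m0) [IsFiniteMeasure R] {S : Set ι}
    {K : ι → α → ℝ} {E : Set α} (hE : MeasurableSet[m] E) (h0 : ∃ X ∈ S, K X =ᵐ[R] 0) :
    (∀ᵐ x ∂ R, x ∈ E → essSupFam m R (condFamily m R S K) x = 0) ↔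
      ∀ X ∈ S, ∀ᵐ x ∂ R, x ∈ E → (R[K X | m]) x ≤ 0 := by
  obtain ⟨hg, hub, hmin⟩ := isEssSup_essSupFam m hm R (condFamily m R S K)
  constructor
  · intro h X hX
    filter_upwards [h, hub _ ⟨X, hX, rfl⟩] with x h1 h2 hx
    rw [h1 hx] at h2
    exact_mod_cast h2
  · intro h
    classical
    have h1 := hmin (fun x => if x ∈ E then 0 else ⊤)
      (Measurable.ite hE measurable_const measurable_const) (by
        rintro _ ⟨X, hX, rfl⟩
        filter_upwards [h X hX] with x hx
        by_cases hxE : x ∈ E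
        · simpa [hxE] using hx hxE
        · simp [hxE])
    obtain ⟨X, hX, hX0⟩ := h0
    have h2 : R[K X | m] =ᵐ[R] 0 := (condExp_congr_ae hX0).trans (by rw [condExp_zero])
    filter_upwards [h1, hub _ ⟨X, hX, rfl⟩, h2] with x h1 h2 h3 hxE
    refine le_antisymm (by simpa [hxE] using h1) ?_
    rw [h3] at h2
    simpa using h2

/-- Closure under m-measurable indicators localizes: an unconditional inequality for all members
already contains the conditional one. -/
theorem essSupFam_condFamily_eq_zero_iff_integral {ι : Type*} (hm : m ≤ m0) [IsFiniteMeasure R]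
    {S : Set ι} {K : ι → α → ℝ} {E : Set α} (hE : MeasurableSet[m] E) (h0 : ∃ X ∈ S, K X =ᵐ[R] 0)
    (hint : ∀ X ∈ S, Integrable (K X) R)
    (hind : ∀ X ∈ S, ∀ A, MeasurableSet[m] A → ∃ Y ∈ S, K Y =ᵐ[R] A.indicator (K X)) :
    (∀ᵐ x ∂ R, x ∈ E → essSupFam m R (condFamily m R S K) x = 0) ↔
      ∀ X ∈ S, ∫ x in E, K X x ∂ R ≤ 0 := by
  rw [essSupFam_condFamily_eq_zero_iff hm hE h0]
  constructor
  · intro h X hX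
    have := (condExp_nonpos_on_iff hm (hint X hX) hE).1 (h X hX) univ MeasurableSet.univ
    rwa [univ_inter] at this
  · intro h X hX
    refine (condExp_nonpos_on_iff hm (hint X hX) hE).2 fun A hA => ?_
    obtain ⟨Y, hY, hYX⟩ := hind X hX A hA
    have h1 := h Y hY
    rw [integral_congr_ae (ae_restrict_of_ae hYX), setIntegral_indicator (hm _ hA)] at h1
    rwa [inter_comm]

/-- The dichotomy for cones: where some conditional expectation is positive, its multiples by
naturals drive the supremum to ⊤. So a.s. finite means a.s. zero. -/
theorem essSupFam_condFamily_lt_top_iff {ι : Type*} (hm : m ≤ m0) [IsFiniteMeasure R]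
    {S : Set ι} {K : ι → α → ℝ} (h0 : ∃ X ∈ S, K X =ᵐ[R] 0)
    (hint : ∀ X ∈ S, Integrable (K X) R)
    (hind : ∀ X ∈ S, ∀ A, MeasurableSet[m] A → ∃ Y ∈ S, K Y =ᵐ[R] A.indicator (K X))
    (hmul : ∀ X ∈ S, ∀ n : ℕ, ∃ Y ∈ S, K Y =ᵐ[R] fun x => n * K X x) :
    (∀ᵐ x ∂ R, essSupFam m R (condFamily m R S K) x < ⊤) ↔
      ∀ X ∈ S, ∫ x, K X x ∂ R ≤ 0 := by
  have key := essSupFam_condFamily_eq_zero_iff_integral hm (R := R) (E := univ)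
    MeasurableSet.univ h0 hint hind
  simp only [mem_univ, true_imp_iff, setIntegral_univ] at key
  rw [← key]
  refine ⟨fun h => ?_, fun h => h.mono fun x hx => by rw [hx]; exact EReal.zero_lt_top⟩
  have h1 := (essSupFam_condFamily_eq_zero_iff hm (R := R) (S := S) (K := K) (E := univ)
    MeasurableSet.univ h0).2
  simp only [mem_univ, true_imp_iff] at h1
  refine h1 fun X hX => ?_
  have hub := (isEssSup_essSupFam m hm R (condFamily m R S K)).2.1
  have h2 : ∀ᵐ x ∂ R, ∀ n : ℕ, (((n * (R[K X | m]) x : ℝ)) : EReal)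
      ≤ essSupFam m R (condFamily m R S K) x := by
    refine ae_all_iff.2 fun n => ?_
    obtain ⟨Y, hY, hYX⟩ := hmul X hX n
    have h3 : R[K Y | m] =ᵐ[R] fun x => n * (R[K X | m]) x :=
      (condExp_congr_ae hYX).trans (condExp_smul (n : ℝ) (K X) m)
    filter_upwards [hub _ ⟨Y, hY, rfl⟩, h3] with x h4 h5
    rwa [h5] at h4
  filter_upwards [h, h2] with x h3 h4
  by_contra! hpos
  refine h3.not_ge (le_of_forall_lt fun c hc => ?_)
  obtain ⟨r, hr⟩ : ∃ r : ℝ, c ≤ r := by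
    induction c with
    | bot => exact ⟨0, bot_le⟩
    | coe r => exact ⟨r, le_rfl⟩
    | top => exact absurd hc (lt_irrefl _)
  obtain ⟨n, hn⟩ := exists_nat_gt (r / (R[K X | m]) x)
  rw [div_lt_iff₀ hpos] at hn
  exact (hr.trans_lt (EReal.coe_lt_coe_iff.2 hn)).trans_le (h4 n)

/-- A family of uniformly bounded functions that is closed under minima and whose members have
nonnegative integrals has a lower bound with nonnegative integral. -/
theorem exists_lower_bound_integral_nonneg (hm : m ≤ m0) [IsFiniteMeasure R] {S : Set (α → ℝ)}
    (hne : S.Nonempty) (hS : ∀ f ∈ S, Measurable[m] f) {C : ℝ}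
    (hC : ∀ f ∈ S, ∀ᵐ x ∂ R, |f x| ≤ C)
    (hmin : ∀ f ∈ S, ∀ g ∈ S, ∃ k ∈ S, k =ᵐ[R] fun x => min (f x) (g x))
    (h0 : ∀ f ∈ S, 0 ≤ ∫ x, f x ∂ R) :
    ∃ h : α → ℝ, Measurable[m] h ∧ (∀ f ∈ S, ∀ᵐ x ∂ R, h x ≤ f x) ∧ (∀ᵐ x ∂ R, |h x| ≤ C) ∧
      0 ≤ ∫ x, h x ∂ R := by
  have hint : ∀ f ∈ S, Integrable f R := fun f hf =>
    Integrable.of_bound ((hS f hf).mono hm le_rfl).aestronglyMeasurable C (hC f hf)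
  set I : Set ℝ := (fun f : α → ℝ => ∫ x, f x ∂ R) '' S with hI
  have hIb : BddBelow I := ⟨0, by rintro _ ⟨f, hf, rfl⟩; exact h0 f hf⟩
  obtain ⟨v, -, hv, hvI⟩ := exists_seq_tendsto_sInf (hne.image _ : I.Nonempty) hIb
  choose f hfS hfv using hvI
  choose! mn hmnS hmn using hmin
  -- Running minima along a sequence whose integrals tend to the infimum I. They stay in S up to
  -- null sets and decrease to the lower bound h.
  set u : ℕ → α → ℝ := fun n => Nat.rec (f 0) (fun n k => mn k (f (n + 1))) n with hu
  have huS : ∀ n, u n ∈ S := by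
    intro n
    induction n with
    | zero => exact hfS 0
    | succ n ih => exact hmnS _ ih _ (hfS _)
  have husucc : ∀ n, u (n + 1) =ᵐ[R] fun x => min (u n x) (f (n + 1) x) := fun n =>
    hmn _ (huS n) _ (hfS _)
  have huC : ∀ᵐ x ∂ R, ∀ n, |u n x| ≤ C := ae_all_iff.2 fun n => hC _ (huS n)
  have huanti : ∀ᵐ x ∂ R, Antitone fun n => u n x := by
    filter_upwards [ae_all_iff.2 husucc] with x hx
    refine antitone_nat_of_succ_le fun n => ?_
    rw [hx n]; exact min_le_left _ _
  have huf : ∀ n, ∀ᵐ x ∂ R, u n x ≤ f n x := by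
    intro n
    cases n with
    | zero => exact ae_of_all _ fun x => le_rfl
    | succ n =>
      filter_upwards [husucc n] with x hx
      rw [hx]; exact min_le_right _ _
  set h : α → ℝ := fun x => ⨅ n, u n x with hh
  have hhm : Measurable[m] h := Measurable.iInf fun n => hS _ (huS n)
  have hbdd : ∀ᵐ x ∂ R, BddBelow (range fun n => u n x) := by
    filter_upwards [huC] with x hx
    exact ⟨-C, by rintro _ ⟨n, rfl⟩; exact (abs_le.1 (hx n)).1⟩
  have hlim : ∀ᵐ x ∂ R, Tendsto (fun n => u n x) atTop (𝓝 (h x)) := by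
    filter_upwards [hbdd, huanti] with x h1 h2 using tendsto_atTop_ciInf h2 h1
  have hhC : ∀ᵐ x ∂ R, |h x| ≤ C := by
    filter_upwards [hlim, huC] with x h1 h2
    exact le_of_tendsto' h1.abs h2
  -- Exhaustion: min(u n, g) agrees a.e. with a member of S, so its integral is at least the
  -- infimum. Hence replacing h by min(h, g) cannot lower the integral, which forces h ≤ g a.e.
  have hmax : ∀ g ∈ S, ∫ x, h x ∂ R ≤ ∫ x, min (h x) (g x) ∂ R := by
    intro g hg
    have hle : ∀ n, sInf I ≤ ∫ x, min (u n x) (g x) ∂ R := fun n => by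
      rw [← integral_congr_ae (hmn _ (huS n) _ hg)]
      exact csInf_le hIb ⟨_, hmnS _ (huS n) _ hg, rfl⟩
    have hup : ∀ n, ∫ x, h x ∂ R ≤ ∫ x, f n x ∂ R := fun n => by
      refine integral_mono_ae (Integrable.of_bound
        (hhm.mono hm le_rfl).aestronglyMeasurable C hhC) (hint _ (hfS n)) ?_
      filter_upwards [hbdd, huf n] with x h1 h2 using (ciInf_le h1 n).trans h2
    have h1 : ∫ x, h x ∂ R ≤ sInf I := ge_of_tendsto' hv fun n => by rw [← hfv]; exact hup n
    refine h1.trans (ge_of_tendsto' (f := fun n => ∫ x, min (u n x) (g x) ∂ R) (x := atTop) ?_ hle)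
    refine tendsto_integral_of_dominated_convergence (fun _ => C) (fun n => ?_)
      (integrable_const C) (fun n => ?_) ?_
    · exact (((hS _ (huS n)).mono hm le_rfl).min ((hS _ hg).mono hm le_rfl)).aestronglyMeasurable
    · filter_upwards [huC, hC g hg] with x h1 h2
      rw [Real.norm_eq_abs, abs_le]
      exact ⟨le_min (abs_le.1 (h1 n)).1 (abs_le.1 h2).1, (min_le_left _ _).trans (abs_le.1 (h1 n)).2⟩
    · filter_upwards [hlim] with x hx using hx.min tendsto_const_nhds
  have hhi : Integrable h R := Integrable.of_bound (hhm.mono hm le_rfl).aestronglyMeasurable C hhC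
  refine ⟨h, hhm, fun g hg => ?_, hhC, ?_⟩
  · have hgi := hint g hg
    have hmi : Integrable (fun x => min (h x) (g x)) R := hhi.inf hgi
    have h1 : ∫ x, (h x - min (h x) (g x)) ∂ R = 0 := by
      refine le_antisymm ?_ (integral_nonneg fun x => sub_nonneg.2 (min_le_left _ _))
      rw [integral_sub hhi hmi]
      linarith [hmax g hg]
    rw [integral_eq_zero_iff_of_nonneg (fun x => sub_nonneg.2 (min_le_left _ _)) (hhi.sub hmi)] at h1
    filter_upwards [h1] with x hx
    exact min_eq_left_iff.1 (sub_eq_zero.1 hx).symm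
  · have h1 : Tendsto (fun n => ∫ x, u n x ∂ R) atTop (𝓝 (∫ x, h x ∂ R)) := by
      refine tendsto_integral_of_dominated_convergence (fun _ => C)
        (fun n => (hint _ (huS n)).aestronglyMeasurable) (integrable_const C) (fun n => ?_) hlim
      filter_upwards [huC] with x hx using hx n
    exact ge_of_tendsto' h1 fun n => h0 _ (huS n)

/-- The pasting of two measures along a σ-field. -/
theorem exists_pasting (hm : m ≤ m0) {R₁ R₂ : Measure α} [IsProbabilityMeasure R₁]
    [IsProbabilityMeasure R₂] (hac : AbsContOn m R₁ R₂) {B : Set α} (hB : MeasurableSet[m] B) :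
    ∃ R : Measure α, IsProbabilityMeasure R ∧
      (∀ A, MeasurableSet A → R₁ A = 0 → R₂ A = 0 → R A = 0) ∧
      (R₁ ≪ R₂ → R₂ ≪ R₁ → R₁ ≪ R) ∧
      ∀ Y : α → ℝ, Integrable Y R₁ → BddMeas R₂ Y →
        ∫ x, Y x ∂ R = ∫ x in B, (R₂[Y | m]) x ∂ R₁ + ∫ x in Bᶜ, Y x ∂ R₁ := by
  have hB0 := hm _ hB
  -- The pasting is z·R₂ on B and R₁ on Bᶜ, where z is the density of R₁ with respect to R₂ on m
  -- only.
  set z : α → ℝ≥0∞ := (R₁.trim hm).rnDeriv (R₂.trim hm) with hz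
  have hzm : Measurable[m] z := Measure.measurable_rnDeriv _ _
  have hzm0 : Measurable z := hzm.mono hm le_rfl
  have htac : R₁.trim hm ≪ R₂.trim hm := by
    refine Measure.AbsolutelyContinuous.mk fun s hs h => ?_
    rw [trim_measurableSet_eq hm hs] at h ⊢
    exact hac s hs h
  have hzd : (R₂.trim hm).withDensity z = R₁.trim hm :=
    Measure.withDensity_rnDeriv_eq _ _ htac
  have hzA : ∀ A, MeasurableSet[m] A → ∫⁻ x in A, z x ∂ R₂ = R₁ A := by
    intro A hA
    rw [← trim_measurableSet_eq hm hA, ← hzd, withDensity_apply _ hA, restrict_trim hm _ hA,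
      lintegral_trim hm hzm]
  have hzfin : ∀ᵐ x ∂ R₂, z x < ⊤ := ae_of_ae_trim hm (Measure.rnDeriv_lt_top _ _)
  set R : Measure α := (R₂.withDensity z).restrict B + R₁.restrict Bᶜ with hR
  have hRA : ∀ A, MeasurableSet A → R A = ∫⁻ x in A ∩ B, z x ∂ R₂ + R₁ (A ∩ Bᶜ) := by
    intro A hA
    rw [hR, Measure.add_apply, Measure.restrict_apply hA, Measure.restrict_apply hA,
      withDensity_apply _ (hA.inter hB0)]
  have hRp : IsProbabilityMeasure R := ⟨by
    rw [hRA _ MeasurableSet.univ, univ_inter, univ_inter, hzA B hB,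
      measure_add_measure_compl hB0, measure_univ]⟩
  have hzfm : IsFiniteMeasure (R₂.withDensity z) := ⟨by
    rw [withDensity_apply _ MeasurableSet.univ, hzA _ MeasurableSet.univ]
    exact measure_lt_top _ _⟩
  have hzi : Integrable (fun x => (z x).toReal) R₂ :=
    integrable_toReal_of_lintegral_ne_top hzm0.aemeasurable (by
      have := hzA univ MeasurableSet.univ
      rw [setLIntegral_univ] at this
      rw [this]; exact measure_ne_top _ _)
  have hzint : ∀ g : α → ℝ, Measurable[m] g → ∀ A, MeasurableSet[m] A →
      ∫ x in A, (z x).toReal * g x ∂ R₂ = ∫ x in A, g x ∂ R₁ := by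
    intro g hg A hA
    rw [setIntegral_trim hm hg.stronglyMeasurable hA, ← hzd,
      setIntegral_withDensity_real hzm (Measure.rnDeriv_lt_top _ _) _ hA, setIntegral_trim hm _ hA]
    · exact (hzm.ennreal_toReal.mul hg).stronglyMeasurable
  refine ⟨R, hRp, fun A hA h1 h2 => ?_, fun h12 h21 => ?_, fun Y hY1 hY2 => ?_⟩
  · rw [hRA A hA, measure_mono_null inter_subset_left h1, add_zero]
    exact setLIntegral_measure_zero _ _ (measure_mono_null inter_subset_left h2)
  · refine Measure.AbsolutelyContinuous.mk fun A hA h => ?_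
    rw [hRA A hA, add_eq_zero] at h
    -- When R₁ and R₂ are equivalent, z cannot vanish on a set charged by R₂, because R₁ does not
    -- charge {z = 0}.
    have h3 : ∀ᵐ x ∂ R₂, z x ≠ 0 := by
      have h4 : R₁ {x | z x = 0} = 0 := by
        have h5 : MeasurableSet[m] {x | z x = 0} := hzm (measurableSet_singleton 0)
        rw [← hzA _ h5]
        exact (setLIntegral_congr_fun (hm _ h5) (fun x hx => hx)).trans (by simp)
      have := h21 h4
      simpa [ae_iff] using this
    have h4 : R₂ (A ∩ B) = 0 := by
      have h5 := h.1
      rw [setLIntegral_eq_zero_iff (hA.inter hB0) hzm0] at h5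
      have h6 : ∀ᵐ x ∂ R₂, x ∉ A ∩ B := by
        filter_upwards [h3, h5] with x h6 h7 h8 using h6 (h7 h8)
      simpa [ae_iff] using h6
    rw [← inter_union_compl A B]
    exact measure_union_null (h12 h4) h.2
  · have hYm := hY2.1
    have hYz : Integrable (fun x => (z x).toReal * Y x) R₂ := hY2.mul_integrable hzi
    have hYR : Integrable Y (R₂.withDensity z) := by
      rw [integrable_withDensity_iff hzm0 hzfin]
      simpa [mul_comm] using hYz
    have h1 : ∫ x in B, Y x ∂(R₂.withDensity z) = ∫ x in B, (R₂[Y | m]) x ∂ R₁ := by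
      rw [setIntegral_withDensity_real hzm0 hzfin _ hB0,
        ← hzint _ stronglyMeasurable_condExp.measurable B hB]
      -- As z is m-measurable, it can be taken out of the conditional expectation under R₂.
      have h2 := condExp_mul_of_stronglyMeasurable_left (μ := R₂)
        (hzm.ennreal_toReal.stronglyMeasurable) hYz (hY2.memLp 1 |>.integrable le_rfl)
      rw [← setIntegral_condExp hm hYz hB]
      exact integral_congr_ae (ae_restrict_of_ae h2)
    rw [hR, integral_add_measure hYR.integrableOn hY1.integrableOn, h1]

end Conditional

end RiskProc

namespace RiskProc

universe u

variable {Ω : Type u}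

/-! ### The optional σ-field and product measures -/

section Optional

theorem Horizon.mem_times_of_le {H : Horizon} {s t : ℕ∞} (hst : s ≤ t) (ht : t ∈ H.times)
    (hs : s ≠ ⊤) : s ∈ H.times := by
  cases H with
  | finite T => exact hst.trans ht
  | nat => exact lt_top_iff_ne_top.2 hs
  | natInfty => trivial

theorem Horizon.natCast_mem_times_of_le {H : Horizon} {s t : ℕ} (hst : s ≤ t)
    (ht : (t : ℕ∞) ∈ H.times) : (s : ℕ∞) ∈ H.times :=
  H.mem_times_of_le (by exact_mod_cast hst) ht (ENat.natCast_ne_top s)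

theorem Horizon.natCast_mem_times_of_lt_last {H : Horizon} {t : ℕ} (ht : (t : ℕ∞) < H.last) :
    ((t + 1 : ℕ) : ℕ∞) ∈ H.times := by
  cases H with
  | finite T =>
    have h1 : (t : ℕ∞) < (T : ℕ∞) := ht
    have h2 : t + 1 ≤ T := by exact_mod_cast h1
    change ((t + 1 : ℕ) : ℕ∞) ≤ (T : ℕ∞)
    exact_mod_cast h2
  | nat => exact ENat.natCast_lt_top _
  | natInfty => trivial

theorem Horizon.le_last {H : Horizon} {t : ℕ∞} (ht : t ∈ H.times) : t ≤ H.last := by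
  cases H with
  | finite T => exact ht
  | nat => exact le_top
  | natInfty => exact le_top

variable {m0 : MeasurableSpace Ω} {H : Horizon} {𝓕 : Filtration ℕ m0}

theorem sigmaAt_mono {s t : ℕ∞} (h : s ≤ t) : sigmaAt 𝓕 s ≤ sigmaAt 𝓕 t :=
  iSup₂_le fun n hn => le_iSup₂_of_le n (hn.trans h) le_rfl

theorem sigmaAt_le (t : ℕ∞) : sigmaAt 𝓕 t ≤ m0 := iSup₂_le fun n _ => 𝓕.le n

theorem filtration_le_sigmaAt {t : ℕ} {s : ℕ∞} (h : (t : ℕ∞) ≤ s) : 𝓕 t ≤ sigmaAt 𝓕 s :=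
  le_iSup₂_of_le t h le_rfl

theorem sigmaAt_le_sigmaEnd (s : H.Time) : sigmaAt 𝓕 s.1 ≤ sigmaEnd H 𝓕 :=
  sigmaAt_mono (Horizon.le_last s.2)

theorem filtration_le_sigmaEnd {t : ℕ} (ht : (t : ℕ∞) ∈ H.times) : 𝓕 t ≤ sigmaEnd H 𝓕 :=
  filtration_le_sigmaAt (Horizon.le_last ht)

theorem coord_eq (X : Proc Ω H) {t : ℕ} (ht : (t : ℕ∞) ∈ H.times) : coord X t = X ⟨t, ht⟩ :=
  dif_pos ht

/-- Because 𝕋 is countable, the generators A × {s} already yield every set with measurable sections;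
conversely such sets form a σ-field, an infimum of pushed-forward ones, containing the generators.
-/
theorem measurableSet_optional_iff {E : Set (OmegaBar Ω H)} :
    MeasurableSet[optional H 𝓕] E ↔
      ∀ s : H.Time, MeasurableSet[sigmaAt 𝓕 s.1] {ω | (ω, s) ∈ E} := by
  constructor
  · have h1 : optional H 𝓕 ≤ ⨅ s : H.Time,
        MeasurableSpace.map (fun ω => ((ω, s) : OmegaBar Ω H)) (sigmaAt 𝓕 s.1) := by
      refine MeasurableSpace.generateFrom_le ?_
      rintro _ ⟨s, A, hA, rfl⟩
      refine MeasurableSpace.measurableSet_iInf.2 fun r => ?_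
      rw [MeasurableSpace.map_def]
      by_cases h : r = s
      · subst h
        convert! hA using 1
        ext ω; simp
      · convert! MeasurableSet.empty using 1
        ext ω; simp [h]
    intro hE
    exact MeasurableSpace.measurableSet_iInf.1 (h1 E hE)
  · intro h
    have : E = ⋃ s : H.Time, {ω | (ω, s) ∈ E} ×ˢ {s} := by
      ext ⟨ω, s⟩
      simp only [mem_iUnion, mem_prod, mem_ofPred_eq, mem_singleton_iff]
      exact ⟨fun h => ⟨s, h, rfl⟩, fun ⟨_, h, e⟩ => e ▸ h⟩
    rw [this]
    refine @MeasurableSet.iUnion _ _ (optional H 𝓕) _ _ fun s => ?_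
    exact MeasurableSpace.measurableSet_generateFrom ⟨s, _, h s, rfl⟩

theorem measurable_optional_iff {X : Proc Ω H} :
    Measurable[optional H 𝓕] (onProd X) ↔ ∀ s : H.Time, Measurable[sigmaAt 𝓕 s.1] (X s) := by
  constructor
  · intro h s B hB
    exact measurableSet_optional_iff.1 (h hB) s
  · intro h B hB
    exact measurableSet_optional_iff.2 fun s => h s hB

/-- The σ-field at t cannot tell the times from t on apart: one event of 𝓕 t serves as the section
at all of them. -/
theorem measurableSet_optionalAt_iff {t : ℕ} {E : Set (OmegaBar Ω H)} :
    MeasurableSet[optionalAt H 𝓕 t] E ↔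
      (∀ s : H.Time, s.1 < t → MeasurableSet[sigmaAt 𝓕 s.1] {ω | (ω, s) ∈ E}) ∧
      ∃ A, MeasurableSet[𝓕 t] A ∧ ∀ s : H.Time, (t : ℕ∞) ≤ s.1 → {ω | (ω, s) ∈ E} = A := by
  constructor
  · intro hE
    induction E, hE using MeasurableSpace.generateFrom_induction with
    | hC E hE _ =>
      rcases hE with ⟨s, A, hst, hA, rfl⟩ | ⟨A, hA, rfl⟩
      · refine ⟨fun r _ => ?_, ∅, @MeasurableSet.empty _ (𝓕 t), fun r hr => ?_⟩
        · by_cases h : r = s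
          · subst h
            convert! hA using 1
            ext ω; simp
          · convert! MeasurableSet.empty using 1
            ext ω; simp [h]
        · have : r ≠ s := by rintro rfl; exact absurd hst (not_lt.2 hr)
          ext ω; simp [this]
      · refine ⟨fun r hr => ?_, A, hA, fun r hr => ?_⟩
        · convert! MeasurableSet.empty using 1
          ext ω; simp [not_le.2 hr]
        · ext ω; simp [hr]
    | empty => exact ⟨fun s _ => by simp, ∅, @MeasurableSet.empty _ (𝓕 t), fun s _ => by simp⟩
    | compl E _ ih =>
      obtain ⟨h1, A, hA, h2⟩ := ih
      refine ⟨fun s hs => (h1 s hs).compl, Aᶜ, hA.compl, fun s hs => ?_⟩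
      rw [← h2 s hs]; rfl
    | iUnion E _ ih =>
      choose h1 A hA h2 using ih
      refine ⟨fun s hs => ?_, ⋃ n, A n, MeasurableSet.iUnion hA, fun s hs => ?_⟩
      · have : {ω | (ω, s) ∈ ⋃ n, E n} = ⋃ n, {ω | (ω, s) ∈ E n} := by ext ω; simp
        rw [this]
        exact MeasurableSet.iUnion fun n => h1 n s hs
      · ext ω
        simp only [← h2 _ s hs]
        simp
  · rintro ⟨h1, A, hA, h2⟩
    have : E = (⋃ s : {s : H.Time // s.1 < t}, {ω | (ω, s.1) ∈ E} ×ˢ {s.1}) ∪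
        A ×ˢ {s : H.Time | (t : ℕ∞) ≤ s.1} := by
      ext ⟨ω, s⟩
      rcases lt_or_ge s.1 (t : ℕ∞) with hs | hs
      · simp [not_le.2 hs, hs]
      · have : (ω, s) ∈ E ↔ ω ∈ A := by rw [← h2 s hs]; rfl
        simp [this, hs]
    rw [this]
    refine @MeasurableSet.union _ (optionalAt H 𝓕 t) _ _
      (@MeasurableSet.iUnion _ _ (optionalAt H 𝓕 t) _ _ fun s => ?_) ?_
    · exact MeasurableSpace.measurableSet_generateFrom (Or.inl ⟨s.1, _, s.2, h1 s.1 s.2, rfl⟩)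
    · exact MeasurableSpace.measurableSet_generateFrom (Or.inr ⟨A, hA, rfl⟩)

theorem optionalAt_le {t : ℕ} : optionalAt H 𝓕 t ≤ optional H 𝓕 := by
  intro E hE
  obtain ⟨h1, A, hA, h2⟩ := measurableSet_optionalAt_iff.1 hE
  refine measurableSet_optional_iff.2 fun s => ?_
  rcases lt_or_ge s.1 (t : ℕ∞) with hs | hs
  · exact h1 s hs
  · rw [h2 s hs]
    exact filtration_le_sigmaAt hs _ hA

theorem optionalAt_mono {t r : ℕ} (h : t ≤ r) : optionalAt H 𝓕 t ≤ optionalAt H 𝓕 r := by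
  intro E hE
  obtain ⟨h1, A, hA, h2⟩ := measurableSet_optionalAt_iff.1 hE
  have htr : (t : ℕ∞) ≤ r := by exact_mod_cast h
  refine measurableSet_optionalAt_iff.2 ⟨fun s _ => ?_, A, 𝓕.mono h _ hA,
    fun s hs => h2 s (htr.trans hs)⟩
  rcases lt_or_ge s.1 (t : ℕ∞) with hs | hs
  · exact h1 s hs
  · rw [h2 s hs]
    exact filtration_le_sigmaAt hs _ hA

theorem measurable_optionalAt {t : ℕ} {X : Proc Ω H}
    (h1 : ∀ s : H.Time, s.1 < t → Measurable[sigmaAt 𝓕 s.1] (X s)) {g : Ω → ℝ}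
    (hg : Measurable[𝓕 t] g) (h2 : ∀ s : H.Time, (t : ℕ∞) ≤ s.1 → X s = g) :
    Measurable[optionalAt H 𝓕 t] (onProd X) := by
  intro B hB
  refine measurableSet_optionalAt_iff.2 ⟨fun s hs => h1 s hs hB, g ⁻¹' B, hg hB, fun s hs => ?_⟩
  rw [← h2 s hs]; rfl

theorem measurable_of_measurable_optionalAt {t : ℕ} (ht : (t : ℕ∞) ∈ H.times) {X : Proc Ω H}
    (h : Measurable[optionalAt H 𝓕 t] (onProd X)) :
    Measurable[𝓕 t] (X ⟨t, ht⟩) ∧ ∀ s : H.Time, (t : ℕ∞) ≤ s.1 → X s = X ⟨t, ht⟩ := by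
  constructor
  · intro B hB
    obtain ⟨-, A, hA, h2⟩ := measurableSet_optionalAt_iff.1 (h hB)
    have := h2 ⟨t, ht⟩ le_rfl
    rw [← this] at hA
    exact hA
  · intro s hs
    ext ω
    -- The preimage of the single value X s ω has the same section at s and at t, so X takes the
    -- same value at both times.
    obtain ⟨-, A, hA, h2⟩ := measurableSet_optionalAt_iff.1 (h (measurableSet_singleton (X s ω)))
    have h3 := (h2 ⟨t, ht⟩ le_rfl).trans (h2 s hs).symm
    have h4 : ω ∈ {ω' | (ω', s) ∈ onProd X ⁻¹' {X s ω}} := rfl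
    rw [← h3] at h4
    exact h4.symm

theorem measurableSet_prod_from {t : ℕ} {A : Set Ω} (hA : MeasurableSet[𝓕 t] A) :
    MeasurableSet[optionalAt H 𝓕 t] (A ×ˢ {s : H.Time | (t : ℕ∞) ≤ s.1}) :=
  MeasurableSpace.measurableSet_generateFrom (Or.inr ⟨A, hA, rfl⟩)

theorem measurable_prodMk {m : MeasurableSpace Ω} (s : H.Time) (hm : sigmaAt 𝓕 s.1 ≤ m) :
    Measurable[m, optional H 𝓕] (fun ω => ((ω, s) : OmegaBar Ω H)) := fun _ hE =>
  hm _ (measurableSet_optional_iff.1 hE s)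

/-! ### Null sets and integrals of `Q ⊗ γ` -/

variable {m : MeasurableSpace Ω} {Q : Measure[m] Ω} {γ : Proc Ω H}

theorem ae_map_iff_of_measurable {α β : Type*} {mα : MeasurableSpace α} {mβ : MeasurableSpace β}
    {ν : Measure α} {f : α → β} (hf : Measurable f) {p : β → Prop} (hp : MeasurableSet {y | p y}) :
    (∀ᵐ y ∂(ν.map f), p y) ↔ ∀ᵐ x ∂ν, p (f x) :=
  ae_map_iff hf.aemeasurable hp

theorem integral_map_of_measurable {α β : Type*} {mα : MeasurableSpace α} {mβ : MeasurableSpace β}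
    {ν : Measure α} {f : α → β} (hf : Measurable f) {g : β → ℝ} (hg : Measurable g) :
    ∫ y, g y ∂(ν.map f) = ∫ x, g (f x) ∂ν :=
  integral_map hf.aemeasurable hg.aestronglyMeasurable

theorem integrable_comp_of_map {α β : Type*} {mα : MeasurableSpace α} {mβ : MeasurableSpace β}
    {ν : Measure α} {f : α → β} (hf : Measurable f) {g : β → ℝ} (hg : Integrable g (ν.map f)) :
    Integrable (fun x => g (f x)) ν :=
  hg.comp_measurable hf

theorem ae_sum_iff' {α ι : Type*} [Countable ι] {m : MeasurableSpace α} (ν : ι → Measure α)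
    {p : α → Prop} : (∀ᵐ x ∂(Measure.sum ν), p x) ↔ ∀ i, ∀ᵐ x ∂(ν i), p x := by
  simp only [MeasureTheory.ae_iff, Measure.sum_apply_of_countable, ENNReal.tsum_eq_zero]

theorem tensor_apply (hm : ∀ s : H.Time, sigmaAt 𝓕 s.1 ≤ m)
    {E : Set (OmegaBar Ω H)} (hE : MeasurableSet[optional H 𝓕] E) :
    tensor 𝓕 Q γ E = ∑' s : H.Time, ∫⁻ ω in {ω | (ω, s) ∈ E}, ENNReal.ofReal (γ s ω) ∂Q := by
  rw [tensor, Measure.sum_apply _ hE]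
  congr 1 with s
  rw [Measure.map_apply (measurable_prodMk s (hm s)) hE,
    withDensity_apply _ (measurable_prodMk s (hm s) hE)]
  rfl

theorem ae_tensor_iff (hm : ∀ s : H.Time, sigmaAt 𝓕 s.1 ≤ m)
    (hγ : ∀ s : H.Time, Measurable[sigmaAt 𝓕 s.1] (γ s)) {p : OmegaBar Ω H → Prop}
    (hp : MeasurableSet[optional H 𝓕] {x | p x}) :
    (∀ᵐ x ∂(tensor 𝓕 Q γ), p x) ↔ ∀ s, ∀ᵐ ω ∂Q, 0 < γ s ω → p (ω, s) := by
  rw [tensor, ae_sum_iff']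
  refine forall_congr' fun s => ?_
  rw [ae_map_iff_of_measurable (measurable_prodMk s (hm s)) hp,
    ae_withDensity_iff ((hγ s).mono (hm s) le_rfl).ennreal_ofReal]
  simp

theorem hasSum_integral_tensor (hm : ∀ s : H.Time, sigmaAt 𝓕 s.1 ≤ m)
    (hγ : ∀ s : H.Time, Measurable[sigmaAt 𝓕 s.1] (γ s)) (hγ0 : ∀ s, ∀ᵐ ω ∂Q, 0 ≤ γ s ω)
    {X : Proc Ω H} (hX : ∀ s : H.Time, Measurable[sigmaAt 𝓕 s.1] (X s))
    (hi : Integrable (onProd X) (tensor 𝓕 Q γ)) :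
    (∀ s, Integrable (fun ω => γ s ω * X s ω) Q) ∧
    HasSum (fun s => ∫ ω, γ s ω * X s ω ∂Q) (∫ p, onProd X p ∂(tensor 𝓕 Q γ)) := by
  have hγm : ∀ s, Measurable[m] (fun ω => ENNReal.ofReal (γ s ω)) := fun s =>
    ((hγ s).mono (hm s) le_rfl).ennreal_ofReal
  have hXm := measurable_optional_iff.2 hX
  constructor
  · intro s
    have h1 := (hi.mono_measure (Measure.le_sum _ s))
    have h2 := integrable_comp_of_map (measurable_prodMk s (hm s)) h1
    rw [integrable_withDensity_iff (hγm s) (by simp)] at h2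
    refine h2.congr ?_
    filter_upwards [hγ0 s] with ω hω
    simp only [onProd, ENNReal.toReal_ofReal hω]
    ring
  · have h1 := hasSum_integral_measure hi
    convert! h1 using 2 with s
    rw [integral_map_of_measurable (measurable_prodMk s (hm s)) hXm,
      integral_withDensity_eq_integral_toReal_smul (hγm s) (by simp)]
    refine integral_congr_ae ?_
    filter_upwards [hγ0 s] with ω hω
    simp only [onProd, ENNReal.toReal_ofReal hω, smul_eq_mul]

theorem integral_tensor (hm : ∀ s : H.Time, sigmaAt 𝓕 s.1 ≤ m)
    (hγ : ∀ s : H.Time, Measurable[sigmaAt 𝓕 s.1] (γ s)) (hγ0 : ∀ s, ∀ᵐ ω ∂Q, 0 ≤ γ s ω)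
    {X : Proc Ω H} (hX : ∀ s : H.Time, Measurable[sigmaAt 𝓕 s.1] (X s))
    (hi : Integrable (onProd X) (tensor 𝓕 Q γ)) :
    ∫ p, onProd X p ∂(tensor 𝓕 Q γ) = ∫ ω, ∑' s, γ s ω * X s ω ∂Q := by
  obtain ⟨h1, h2⟩ := hasSum_integral_tensor hm hγ hγ0 hX hi
  have h3 := (hasSum_integral_tensor hm hγ hγ0 (X := fun s ω => |X s ω|)
    (fun s => continuous_abs.measurable.comp (hX s)) hi.abs).2.summable
  refine h2.unique (hasSum_integral_of_summable_integral_norm h1 (h3.congr fun s => ?_))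
  refine integral_congr_ae ?_
  filter_upwards [hγ0 s] with ω hω
  rw [Real.norm_eq_abs, abs_mul, abs_of_nonneg hω]

end Optional

end RiskProc

namespace RiskProc

universe u

variable {Ω : Type u}

/-! ### Bounded processes and risk measures -/

section Bounded

variable {m0 : MeasurableSpace Ω} {H : Horizon} {𝓕 : Filtration ℕ m0}

/-- The part of `Ω × 𝕋` over `A` from time `t` on. -/
abbrev slab (H : Horizon) (t : ℕ) (A : Set Ω) : Set (OmegaBar Ω H) :=
  A ×ˢ {s : H.Time | (t : ℕ∞) ≤ s.1}

open scoped Classical in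
/-- The process `1_A 1_{𝕋_t} X`. -/
noncomputable def restr (t : ℕ) (A : Set Ω) (X : Proc Ω H) : Proc Ω H :=
  fun s ω => if (t : ℕ∞) ≤ s.1 then A.indicator (X s) ω else 0

theorem onProd_restr (t : ℕ) (A : Set Ω) (X : Proc Ω H) :
    onProd (restr t A X) = (slab H t A).indicator (onProd X) := by
  classical
  ext ⟨ω, s⟩
  simp only [onProd, restr, indicator_apply, mem_prod, mem_ofPred_eq]
  split_ifs <;> simp_all

theorem restr_univ (t : ℕ) (X : Proc Ω H) : restr t univ X = proj t X := by
  ext s ω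
  simp [restr, proj]

theorem proj_restr_of_le {t r : ℕ} (h : t ≤ r) (A : Set Ω) (X : Proc Ω H) :
    proj t (restr r A X) = restr r A X := by
  ext s ω
  simp only [proj, restr]
  split_ifs with h1 h2 <;> try rfl
  rename_i h2
  exact absurd ((by exact_mod_cast h : (t : ℕ∞) ≤ r).trans h2) h1

theorem measurableSet_slab {t : ℕ} {A : Set Ω} (hA : MeasurableSet[𝓕 t] A) :
    MeasurableSet[optional H 𝓕] (slab H t A) := optionalAt_le _ (measurableSet_prod_from hA)

theorem isProbabilityMeasure_tensor {m : MeasurableSpace Ω} {Q : Measure[m] Ω}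
    [IsProbabilityMeasure Q] {γ : Proc Ω H} (hm : ∀ s : H.Time, sigmaAt 𝓕 s.1 ≤ m)
    (hγ : ∀ s : H.Time, Measurable[sigmaAt 𝓕 s.1] (γ s)) (hγ0 : ∀ s, ∀ᵐ ω ∂Q, 0 ≤ γ s ω)
    (hγ1 : ∀ᵐ ω ∂Q, HasSum (fun s => γ s ω) 1) :
    IsProbabilityMeasure (tensor 𝓕 Q γ) := by
  refine ⟨?_⟩
  rw [tensor_apply hm (@MeasurableSet.univ _ (optional H 𝓕))]
  simp only [mem_univ, ofPred_true, Measure.restrict_univ]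
  rw [← lintegral_tsum fun s => ((hγ s).mono (hm s) le_rfl).ennreal_ofReal.aemeasurable]
  rw [lintegral_congr_ae (g := fun _ => 1)]
  · simp
  · filter_upwards [hγ1, ae_all_iff.2 hγ0] with ω h1 h2
    rw [← ENNReal.ofReal_tsum_of_nonneg h2 h1.summable, h1.tsum_eq, ENNReal.ofReal_one]

variable {P : Measure Ω} {μ : Proc Ω H}

theorem IsReference.isProbabilityMeasure [IsProbabilityMeasure P] (hμ : IsReference 𝓕 P μ) :
    IsProbabilityMeasure (tensor 𝓕 P μ) :=
  isProbabilityMeasure_tensor (fun _ => sigmaAt_le _) hμ.adapted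
    (fun s => (hμ.pos s).mono fun _ h => h.le) hμ.sum_one

/-- Strict positivity of μ at every time, with 𝕋 countable, removes the weights from the description
of null sets. -/
theorem IsReference.ae_iff (hμ : IsReference 𝓕 P μ) {p : OmegaBar Ω H → Prop}
    (hp : MeasurableSet[optional H 𝓕] {x | p x}) :
    (∀ᵐ x ∂(tensor 𝓕 P μ), p x) ↔ ∀ᵐ ω ∂P, ∀ s, p (ω, s) := by
  rw [ae_tensor_iff (fun s => sigmaAt_le _) hμ.adapted hp, ae_all_iff]
  refine forall_congr' fun s => ⟨fun h => ?_, fun h => h.mono fun _ h _ => h⟩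
  filter_upwards [h, hμ.pos s] with ω h1 h2 using h1 h2

theorem measurableSet_setOf_abs_le {α : Type*} {m : MeasurableSpace α} {g : α → ℝ}
    (hg : Measurable g) (C : ℝ) : MeasurableSet {x | |g x| ≤ C} :=
  measurableSet_le (continuous_abs.measurable.comp hg) measurable_const

/-- This identification of 𝓡^∞ with bounded functions for P̄ allows the theory of a single space to
be applied to processes. -/
theorem IsReference.mem_RInf_iff (hμ : IsReference 𝓕 P μ) {X : Proc Ω H} :
    X ∈ RInf H 𝓕 P ↔ BddMeas (tensor 𝓕 P μ) (onProd X) := by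
  constructor
  · rintro ⟨h1, C, hC⟩
    have h2 := measurable_optional_iff.2 h1
    exact ⟨h2, C, (hμ.ae_iff (measurableSet_setOf_abs_le h2 C)).2 hC⟩
  · rintro ⟨h1, C, hC⟩
    exact ⟨measurable_optional_iff.1 h1, C,
      (hμ.ae_iff (measurableSet_setOf_abs_le h1 C)).1 hC⟩

theorem MBar.bddMeas {R : Measure[optional H 𝓕] (OmegaBar Ω H)} (hR : R ∈ MBar 𝓕 P μ)
    (hμ : IsReference 𝓕 P μ) {X : Proc Ω H} (hX : X ∈ RInf H 𝓕 P) : BddMeas R (onProd X) := by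
  obtain ⟨h1, C, hC⟩ := hμ.mem_RInf_iff.1 hX
  exact ⟨h1, C, hR.2 hC⟩

theorem MBar.integrable {R : Measure[optional H 𝓕] (OmegaBar Ω H)} (hR : R ∈ MBar 𝓕 P μ)
    (hμ : IsReference 𝓕 P μ) {X : Proc Ω H} (hX : X ∈ RInf H 𝓕 P) : Integrable (onProd X) R := by
  have := hR.1
  exact ((MBar.bddMeas hR hμ hX).memLp 1).integrable le_rfl

theorem LInf.mono {t r : ℕ} (h : t ≤ r) {f : Ω → ℝ} (hf : LInf 𝓕 P t f) : LInf 𝓕 P r f :=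
  ⟨hf.1.mono (𝓕.mono h) le_rfl, hf.2⟩

theorem LInf.const (t : ℕ) (c : ℝ) : LInf 𝓕 P t fun _ => c :=
  ⟨measurable_const, |c|, by simp⟩

theorem LInf.add {t : ℕ} {f g : Ω → ℝ} (hf : LInf 𝓕 P t f) (hg : LInf 𝓕 P t g) :
    LInf 𝓕 P t fun ω => f ω + g ω := by
  obtain ⟨hf, C, hC⟩ := hf
  obtain ⟨hg, D, hD⟩ := hg
  refine ⟨hf.add hg, C + D, ?_⟩
  filter_upwards [hC, hD] with x h1 h2 using (abs_add_le _ _).trans (add_le_add h1 h2)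

theorem LInf.neg {t : ℕ} {f : Ω → ℝ} (hf : LInf 𝓕 P t f) : LInf 𝓕 P t fun ω => -f ω := by
  obtain ⟨hf, C, hC⟩ := hf
  exact ⟨hf.neg, C, by simpa using hC⟩

theorem LInf.indicator {t : ℕ} {f : Ω → ℝ} (hf : LInf 𝓕 P t f) {A : Set Ω}
    (hA : MeasurableSet[𝓕 t] A) : LInf 𝓕 P t (A.indicator f) := by
  obtain ⟨hf, C, hC⟩ := hf
  refine ⟨hf.indicator hA, C, ?_⟩
  filter_upwards [hC] with x hx
  by_cases h : x ∈ A <;> simp [h, hx, (abs_nonneg _).trans hx]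

namespace RInf

theorem add {X Y : Proc Ω H} (hX : X ∈ RInf H 𝓕 P) (hY : Y ∈ RInf H 𝓕 P) :
    X + Y ∈ RInf H 𝓕 P := by
  obtain ⟨hX, C, hC⟩ := hX
  obtain ⟨hY, D, hD⟩ := hY
  refine ⟨fun s => (hX s).add (hY s), C + D, ?_⟩
  filter_upwards [hC, hD] with x h1 h2 s using (abs_add_le _ _).trans (add_le_add (h1 s) (h2 s))

theorem neg {X : Proc Ω H} (hX : X ∈ RInf H 𝓕 P) : -X ∈ RInf H 𝓕 P := by
  obtain ⟨hX, C, hC⟩ := hX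
  exact ⟨fun s => (hX s).neg, C, by simpa using hC⟩

theorem sub {X Y : Proc Ω H} (hX : X ∈ RInf H 𝓕 P) (hY : Y ∈ RInf H 𝓕 P) :
    X - Y ∈ RInf H 𝓕 P := sub_eq_add_neg X Y ▸ add hX (neg hY)

theorem smul {X : Proc Ω H} (hX : X ∈ RInf H 𝓕 P) (c : ℝ) : c • X ∈ RInf H 𝓕 P := by
  obtain ⟨hX, C, hC⟩ := hX
  refine ⟨fun s => (hX s).const_mul c, |c| * C, ?_⟩
  filter_upwards [hC] with x h1 s
  simp only [Pi.smul_apply, smul_eq_mul, abs_mul]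
  gcongr
  exact h1 s

theorem zero : (0 : Proc Ω H) ∈ RInf H 𝓕 P := ⟨fun _ => measurable_const, 0, by simp⟩

theorem constFrom {t : ℕ} {f : Ω → ℝ} (hf : LInf 𝓕 P t f) :
    (RiskProc.constFrom t f : Proc Ω H) ∈ RInf H 𝓕 P := by
  obtain ⟨hf, C, hC⟩ := hf
  refine ⟨fun s => ?_, C, ?_⟩
  · by_cases h : (t : ℕ∞) ≤ s.1
    · have : (RiskProc.constFrom t f : Proc Ω H) s = f := by
        ext ω; simp [RiskProc.constFrom, h]
      rw [this]
      exact hf.mono (filtration_le_sigmaAt h) le_rfl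
    · have : (RiskProc.constFrom t f : Proc Ω H) s = fun _ => 0 := by
        ext ω; simp only [RiskProc.constFrom]; rw [if_neg h]
      rw [this]
      exact measurable_const
  · filter_upwards [hC] with x hx s
    simp only [RiskProc.constFrom]
    split_ifs
    · exact hx
    · simpa using (abs_nonneg _).trans hx

theorem restr {X : Proc Ω H} (hX : X ∈ RInf H 𝓕 P) {t : ℕ} {A : Set Ω}
    (hA : MeasurableSet[𝓕 t] A) : restr t A X ∈ RInf H 𝓕 P := by
  obtain ⟨hX, C, hC⟩ := hX
  refine ⟨measurable_optional_iff.1 ?_, C, ?_⟩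
  · rw [onProd_restr]
    exact (measurable_optional_iff.2 hX).indicator (measurableSet_slab hA)
  · filter_upwards [hC] with ω h s
    simp only [RiskProc.restr]
    split_ifs
    · by_cases hω : ω ∈ A <;> simp [hω, h s, (abs_nonneg _).trans (h s)]
    · simpa using (abs_nonneg _).trans (h s)

theorem proj {X : Proc Ω H} (hX : X ∈ RInf H 𝓕 P) (t : ℕ) : proj t X ∈ RInf H 𝓕 P :=
  restr_univ t X ▸ restr hX (@MeasurableSet.univ _ (𝓕 t))

theorem coord {X : Proc Ω H} (hX : X ∈ RInf H 𝓕 P) {t : ℕ} (ht : (t : ℕ∞) ∈ H.times) :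
    LInf 𝓕 P t (coord X t) := by
  obtain ⟨hX, C, hC⟩ := hX
  rw [coord_eq X ht]
  refine ⟨?_, C, hC.mono fun ω h => h _⟩
  have := hX ⟨t, ht⟩
  rwa [sigmaAt_coe] at this

end RInf

theorem proj_mem {X : Proc Ω H} (hX : X ∈ RInf H 𝓕 P) (t : ℕ) :
    proj t X ∈ RInfFrom H 𝓕 P t := ⟨X, hX, rfl⟩

theorem proj_proj (t : ℕ) (X : Proc Ω H) : proj t (proj t X) = proj t X := by
  ext s ω
  simp only [proj]
  split_ifs <;> rfl

theorem mem_accept_iff {ρ : ℕ → Proc Ω H → Ω → ℝ} {t : ℕ} {X : Proc Ω H} :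
    X ∈ accept 𝓕 P ρ t ↔
      ∃ Y ∈ RInf H 𝓕 P, X = proj t Y ∧ ∀ᵐ ω ∂P, riskOf ρ t Y ω ≤ 0 := by
  constructor
  · rintro ⟨⟨Y, hY, rfl⟩, h⟩
    exact ⟨Y, hY, rfl, h⟩
  · rintro ⟨Y, hY, rfl, h⟩
    exact ⟨⟨Y, hY, rfl⟩, h⟩

section RiskOf

variable {ρ : ℕ → Proc Ω H → Ω → ℝ} {t : ℕ}

theorem riskOf_proj (X : Proc Ω H) : riskOf ρ t (proj t X) = riskOf ρ t X := by
  rw [riskOf, proj_proj, riskOf]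

namespace IsCondCoherent

variable (hρ : IsCondCoherent 𝓕 P t (ρ t))
include hρ

theorem linf {X : Proc Ω H} (hX : X ∈ RInf H 𝓕 P) : LInf 𝓕 P t (riskOf ρ t X) :=
  hρ.maps _ (proj_mem hX t)

theorem riskOf_mono {X Y : Proc Ω H} (hX : X ∈ RInf H 𝓕 P) (hY : Y ∈ RInf H 𝓕 P)
    (h : ∀ᵐ ω ∂P, ∀ s : H.Time, (t : ℕ∞) ≤ s.1 → X s ω ≤ Y s ω) :
    ∀ᵐ ω ∂P, riskOf ρ t Y ω ≤ riskOf ρ t X ω := by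
  refine hρ.mono _ (proj_mem hX t) _ (proj_mem hY t) ?_
  filter_upwards [h] with ω h s
  simp only [proj]
  split_ifs with h1
  · exact h s h1
  · exact le_rfl

theorem riskOf_congr {X Y : Proc Ω H} (hX : X ∈ RInf H 𝓕 P) (hY : Y ∈ RInf H 𝓕 P)
    (h : ∀ᵐ ω ∂P, ∀ s : H.Time, (t : ℕ∞) ≤ s.1 → X s ω = Y s ω) :
    ∀ᵐ ω ∂P, riskOf ρ t X ω = riskOf ρ t Y ω := by
  filter_upwards [hρ.riskOf_mono hX hY (h.mono fun _ h s hs => (h s hs).le),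
    hρ.riskOf_mono hY hX (h.mono fun _ h s hs => (h s hs).ge)] with ω h1 h2
  exact le_antisymm h2 h1

theorem riskOf_add_constFrom {X : Proc Ω H} (hX : X ∈ RInf H 𝓕 P) {f : Ω → ℝ}
    (hf : LInf 𝓕 P t f) :
    ∀ᵐ ω ∂P, riskOf ρ t (X + constFrom t f) ω = riskOf ρ t X ω - f ω := by
  have h1 : proj t (X + constFrom t f) = proj t X + constFrom t f := by
    ext s ω
    simp only [proj, constFrom, Pi.add_apply]
    split_ifs <;> simp
  rw [riskOf, h1]
  exact hρ.cash _ (proj_mem hX t) _ hf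

theorem riskOf_mul {X : Proc Ω H} (hX : X ∈ RInf H 𝓕 P) {f : Ω → ℝ} (hf : LInf 𝓕 P t f)
    (hf0 : ∀ᵐ ω ∂P, 0 ≤ f ω) :
    ∀ᵐ ω ∂P, riskOf ρ t (fun s ω => f ω * X s ω) ω = f ω * riskOf ρ t X ω := by
  have h1 : proj t (fun s ω => f ω * X s ω) = fun s ω => f ω * proj t X s ω := by
    ext s ω
    simp only [proj]
    split_ifs <;> simp
  rw [riskOf, h1]
  exact hρ.posHom _ (proj_mem hX t) _ hf hf0

theorem riskOf_smul {X : Proc Ω H} (hX : X ∈ RInf H 𝓕 P) {c : ℝ} (hc : 0 ≤ c) :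
    ∀ᵐ ω ∂P, riskOf ρ t (c • X) ω = c * riskOf ρ t X ω :=
  hρ.riskOf_mul hX (LInf.const t c) (ae_of_all _ fun _ => hc)

theorem riskOf_restr {X : Proc Ω H} (hX : X ∈ RInf H 𝓕 P) {A : Set Ω}
    (hA : MeasurableSet[𝓕 t] A) :
    ∀ᵐ ω ∂P, riskOf ρ t (restr t A X) ω = A.indicator (riskOf ρ t X) ω := by
  have h1 : restr t A X = proj t fun s ω => A.indicator (fun _ => (1 : ℝ)) ω * X s ω := by
    classical
    ext s ω
    simp only [restr, proj, indicator_apply]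
    split_ifs <;> simp
  rw [h1, riskOf_proj]
  filter_upwards [hρ.riskOf_mul hX ((LInf.const t 1).indicator hA)
    (ae_of_all _ fun ω => indicator_nonneg (fun _ _ => zero_le_one) ω)] with ω h
  rw [h]
  by_cases hω : ω ∈ A <;> simp [hω]

theorem riskOf_zero : ∀ᵐ ω ∂P, riskOf ρ t 0 ω = 0 := by
  have : proj t (0 : Proc Ω H) = 0 := by
    ext s ω; simp [proj]
  rw [riskOf, this]
  exact hρ.normalized

theorem riskOf_constFrom {f : Ω → ℝ} (hf : LInf 𝓕 P t f) :
    ∀ᵐ ω ∂P, riskOf ρ t (constFrom t f) ω = -f ω := by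
  have := hρ.riskOf_add_constFrom RInf.zero hf
  rw [zero_add] at this
  filter_upwards [this, hρ.riskOf_zero] with ω h1 h2
  rw [h1, h2, zero_sub]

theorem riskOf_add_le {X Y : Proc Ω H} (hX : X ∈ RInf H 𝓕 P) (hY : Y ∈ RInf H 𝓕 P) :
    ∀ᵐ ω ∂P, riskOf ρ t (X + Y) ω ≤ riskOf ρ t X ω + riskOf ρ t Y ω := by
  -- Subadditivity from convexity at weight 1/2 for 2X and 2Y; homogeneity cancels the factor 2.
  have h1 := hρ.convex _ (proj_mem (RInf.smul hX 2) t) _ (proj_mem (RInf.smul hY 2) t)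
    (fun _ => 1 / 2) (LInf.const t _) (ae_of_all _ fun _ => by norm_num)
  have h2 : (fun s ω => 1 / 2 * proj t ((2 : ℝ) • X) s ω + (1 - 1 / 2) * proj t ((2 : ℝ) • Y) s ω)
      = proj t (X + Y) := by
    ext s ω
    simp only [proj, Pi.smul_apply, Pi.add_apply, smul_eq_mul]
    split_ifs <;> ring
  rw [h2] at h1
  filter_upwards [h1, hρ.riskOf_smul hX (c := 2) zero_le_two,
    hρ.riskOf_smul hY (c := 2) zero_le_two] with ω h3 h4 h5
  rw [riskOf] at h4 h5
  rw [h4, h5] at h3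
  rw [riskOf]
  linarith

theorem rhoBar_mem {X : Proc Ω H} (hX : X ∈ RInf H 𝓕 P) : rhoBar ρ t X ∈ RInf H 𝓕 P := by
  have h1 : rhoBar ρ t X = -(X - proj t X) + constFrom t (riskOf ρ t X) := by
    ext s ω
    simp only [rhoBar, proj, constFrom, Pi.add_apply, Pi.neg_apply, Pi.sub_apply]
    split_ifs <;> simp
  rw [h1]
  exact RInf.add (RInf.neg (RInf.sub hX (RInf.proj hX t))) (RInf.constFrom (hρ.linf hX))

end IsCondCoherent

theorem measurable_onProd_rhoBar (hρ : IsCondCoherent 𝓕 P t (ρ t)) {X : Proc Ω H}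
    (hX : X ∈ RInf H 𝓕 P) : Measurable[optionalAt H 𝓕 t] (onProd (rhoBar ρ t X)) := by
  refine measurable_optionalAt (fun s hs => ?_) (hρ.linf hX).1 fun s hs => ?_
  · have : rhoBar ρ t X s = -(X s) := by
      ext ω
      simp [rhoBar, not_le.2 hs]
    rw [this]
    exact (hX.1 s).neg
  · ext ω
    simp [rhoBar, hs]

end RiskOf

end Bounded

end RiskProc

namespace RiskProc

universe u

variable {Ω : Type u}

/-! ### Models and the measures they induce -/

section Model

variable {m0 : MeasurableSpace Ω} {𝓕 : Filtration ℕ m0}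

/-- Split according to the first time k ≥ n with M_k ≤ K. On that 𝓕_k-event the density is at most
K, and the events are disjoint subsets of B. -/
theorem measure_inter_frequently_le {P : Measure Ω} {m : MeasurableSpace Ω}
    {Q : Measure[m] Ω} {M : ℕ → Ω → ℝ≥0∞} (hM : IsDensityProcess 𝓕 P Q M)
    (K : ℝ≥0∞) {n : ℕ} {B : Set Ω} (hB : MeasurableSet[𝓕 n] B) :
    Q (B ∩ {ω | ∃ᶠ k in atTop, M k ω ≤ K}) ≤ K * P B := by
  set S : ℕ → Set Ω := fun j => {ω | M (n + j) ω ≤ K} with hS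
  have hSm : ∀ j, MeasurableSet[𝓕 (n + j)] (S j) := fun j =>
    (hM (n + j)).1 measurableSet_Iic
  have hDm : ∀ j, MeasurableSet[𝓕 (n + j)] (B ∩ disjointed S j) := fun j => by
    refine MeasurableSet.inter (𝓕.mono (Nat.le_add_right _ _) _ hB) ?_
    rw [disjointed_eq_inter_compl]
    exact (hSm j).inter (MeasurableSet.iInter fun i => MeasurableSet.iInter fun hi =>
      (𝓕.mono (Nat.add_le_add_left hi.le n) _ (hSm i)).compl)
  have hdis : Pairwise (Function.onFun Disjoint fun j => B ∩ disjointed S j) := fun i j hij =>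
    (disjoint_disjointed S hij).mono inter_subset_right inter_subset_right
  have h1 : B ∩ {ω | ∃ᶠ k in atTop, M k ω ≤ K} ⊆ ⋃ j, B ∩ disjointed S j := by
    rintro ω ⟨hω, hf⟩
    obtain ⟨k, hk, hkK⟩ := (frequently_atTop.1 hf) n
    rw [← inter_iUnion, iUnion_disjointed]
    refine ⟨hω, mem_iUnion.2 ⟨k - n, ?_⟩⟩
    change M (n + (k - n)) ω ≤ K
    rwa [Nat.add_sub_cancel' hk]
  calc Q (B ∩ {ω | ∃ᶠ k in atTop, M k ω ≤ K}) ≤ Q (⋃ j, B ∩ disjointed S j) := measure_mono h1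
    _ ≤ ∑' j, Q (B ∩ disjointed S j) := measure_iUnion_le _
    _ ≤ ∑' j, K * P (B ∩ disjointed S j) := by
        refine ENNReal.tsum_le_tsum fun j => ?_
        rw [(hM (n + j)).2 _ (hDm j)]
        refine (setLIntegral_mono' (𝓕.le _ _ (hDm j)) (g := fun _ => K) fun ω hω => ?_).trans ?_
        · exact disjointed_subset S j hω.2
        · rw [setLIntegral_const]
    _ = K * P (⋃ j, B ∩ disjointed S j) := by
        rw [ENNReal.tsum_mul_left, measure_iUnion hdis fun j => 𝓕.le _ _ (hDm j)]
    _ ≤ K * P B := by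
        gcongr
        exact iUnion_subset fun j => inter_subset_left

open scoped symmDiff in
-- This is how the singular part of Q on 𝓕_∞ is located where M explodes. A P-null A is
-- approximated, in P and Q simultaneously, by events B from some 𝓕_n; the bound K P(B) for the part
-- of B on which M returns below K is then small.
theorem ae_tendsto_top_of_null {P : Measure Ω} [IsFiniteMeasure P] {m : MeasurableSpace Ω}
    {Q : Measure[m] Ω} [IsFiniteMeasure Q] (hm : m = ⨆ n, 𝓕 n) {M : ℕ → Ω → ℝ≥0∞}
    (hM : IsDensityProcess 𝓕 P Q M) {A : Set Ω} (hA : MeasurableSet[m] A) (hPA : P A = 0) :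
    ∀ᵐ ω ∂Q, ω ∈ A → Tendsto (fun n => M n ω) atTop (𝓝 ⊤) := by
  have hmn : ∀ n, 𝓕 n ≤ m := fun n => hm ▸ le_iSup (fun n => 𝓕 n) n
  have hm0 : m ≤ m0 := hm ▸ iSup_le fun n => 𝓕.le n
  set C : Set (Set Ω) := ⋃ n, {s | MeasurableSet[𝓕 n] s} with hC
  have hCring : IsSetRing C := by
    refine ⟨mem_iUnion.2 ⟨0, @MeasurableSet.empty _ (𝓕 0)⟩, ?_, ?_⟩
    · intro s t hs ht
      obtain ⟨i, hi⟩ := mem_iUnion.1 hs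
      obtain ⟨j, hj⟩ := mem_iUnion.1 ht
      exact mem_iUnion.2 ⟨max i j, MeasurableSet.union (𝓕.mono (le_max_left _ _) _ hi)
        (𝓕.mono (le_max_right _ _) _ hj)⟩
    · intro s t hs ht
      obtain ⟨i, hi⟩ := mem_iUnion.1 hs
      obtain ⟨j, hj⟩ := mem_iUnion.1 ht
      exact mem_iUnion.2 ⟨max i j, MeasurableSet.diff (𝓕.mono (le_max_left _ _) _ hi)
        (𝓕.mono (le_max_right _ _) _ hj)⟩
  have hgen : m = MeasurableSpace.generateFrom C :=
    hm.trans (MeasurableSpace.generateFrom_iUnion_measurableSet _).symm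
  have key : ∀ K : ℕ, Q (A ∩ {ω | ∃ᶠ k in atTop, M k ω ≤ K}) = 0 := by
    intro K
    refine le_antisymm (ENNReal.le_of_forall_pos_le_add fun ε hε _ => ?_) bot_le
    -- One such error comes from A \ B under Q, and K of them from P B; together they give ε.
    have hε' : (0 : ℝ≥0∞) < ε / (1 + K) := by
      refine ENNReal.div_pos (by exact_mod_cast hε.ne') ?_
      exact ENNReal.add_ne_top.2 ⟨ENNReal.one_ne_top, ENNReal.natCast_ne_top K⟩
    obtain ⟨B, hBC, hB⟩ := exists_measure_symmDiff_lt_of_generateFrom_isSetRing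
      (μ := P.trim hm0 + Q) hCring ⟨{univ}, countable_singleton _, show _ from
        singleton_subset_iff.2 (mem_iUnion.2 ⟨0, @MeasurableSet.univ _ (𝓕 0)⟩), by simp⟩
      hgen hA hε'
    obtain ⟨n, hBn⟩ := mem_iUnion.1 hBC
    have hBm : MeasurableSet[m] B := hmn n _ hBn
    have hsd : MeasurableSet[m] (B ∆ A) := (hBm.diff hA).union (hA.diff hBm)
    rw [Measure.add_apply, trim_measurableSet_eq hm0 hsd] at hB
    have hP : P B ≤ ε / (1 + K) := by
      calc P B ≤ P (B ∆ A ∪ A) := measure_mono fun x hx => by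
            by_cases h : x ∈ A
            · exact Or.inr h
            · exact Or.inl (Or.inl ⟨hx, h⟩)
        _ ≤ P (B ∆ A) + P A := measure_union_le _ _
        _ ≤ _ := by rw [hPA, add_zero]; exact (le_add_right le_rfl).trans hB.le
    have hQ : Q (A \ B) ≤ ε / (1 + K) := by
      calc Q (A \ B) ≤ Q (B ∆ A) := measure_mono fun x hx => Or.inr hx
        _ ≤ _ := (le_add_left le_rfl).trans hB.le
    calc Q (A ∩ {ω | ∃ᶠ k in atTop, M k ω ≤ K})
        ≤ Q (A \ B ∪ B ∩ {ω | ∃ᶠ k in atTop, M k ω ≤ K}) := measure_mono fun x hx => by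
          by_cases h : x ∈ B
          · exact Or.inr ⟨h, hx.2⟩
          · exact Or.inl ⟨hx.1, h⟩
      _ ≤ Q (A \ B) + Q (B ∩ {ω | ∃ᶠ k in atTop, M k ω ≤ K}) := measure_union_le _ _
      _ ≤ ε / (1 + K) + K * (ε / (1 + K)) := by
          gcongr
          exact (measure_inter_frequently_le hM K hBn).trans (by gcongr)
      _ = (1 + K) * (ε / (1 + K)) := by ring
      _ = ε := ENNReal.mul_div_cancel (by simp) (by simp)
      _ ≤ 0 + ε := by rw [zero_add]
  have key2 : ∀ᵐ ω ∂Q, ∀ K : ℕ, ω ∉ A ∩ {ω | ∃ᶠ k in atTop, M k ω ≤ K} :=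
    ae_all_iff.2 fun K => measure_eq_zero_iff_ae_notMem.1 (key K)
  filter_upwards [key2] with ω hω hωA
  rw [ENNReal.tendsto_nhds_top_iff_nat]
  intro K
  by_contra h
  refine hω K ⟨hωA, ?_⟩
  rw [Filter.not_eventually] at h
  exact h.mono fun k hk => not_lt.1 hk

variable {H : Horizon}

theorem disc_zero (γ : Proc Ω H) : disc γ 0 = fun _ => 1 := by ext; simp [disc]

theorem disc_succ (γ : Proc Ω H) (t : ℕ) (ω : Ω) :
    disc γ (t + 1) ω = disc γ t ω - coord γ t ω := by
  simp only [disc, Finset.sum_range_succ]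
  ring

theorem proj_zero (X : Proc Ω H) : proj 0 X = X := by
  ext s ω; simp [proj]

theorem proj_succ (γ : Proc Ω H) {t : ℕ} (ht : (t : ℕ∞) ∈ H.times) (ω : Ω) :
    (fun s => proj (t + 1) γ s ω) = Function.update (fun s => proj t γ s ω) ⟨t, ht⟩ 0 := by
  classical
  ext s
  rw [Function.update_apply]
  simp only [proj]
  have hs : ((t + 1 : ℕ) : ℕ∞) ≤ s.1 ↔ (t : ℕ∞) ≤ s.1 ∧ s ≠ ⟨t, ht⟩ := by
    rw [Nat.cast_add, Nat.cast_one, ENat.add_one_le_iff (ENat.natCast_ne_top t), lt_iff_le_and_ne]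
    refine and_congr_right fun _ => not_congr ?_
    rw [Subtype.ext_iff]
    exact eq_comm
  by_cases h1 : s = ⟨t, ht⟩
  · rw [if_neg (fun h => (hs.1 h).2 h1), if_pos h1]
  · rw [if_neg h1]
    by_cases h2 : (t : ℕ∞) ≤ s.1
    · rw [if_pos h2, if_pos (hs.2 ⟨h2, h1⟩)]
    · rw [if_neg h2, if_neg fun h => h2 (hs.1 h).1]

theorem hasSum_proj {γ : Proc Ω H} {ω : Ω} (h : HasSum (fun s => γ s ω) 1) {t : ℕ}
    (ht : (t : ℕ∞) ∈ H.times) : HasSum (fun s => proj t γ s ω) (disc γ t ω) := by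
  classical
  induction t with
  | zero => simpa [proj_zero, disc_zero] using h
  | succ t ih =>
    have ht' : (t : ℕ∞) ∈ H.times := H.natCast_mem_times_of_le (Nat.le_succ t) ht
    rw [proj_succ γ ht' ω, disc_succ]
    convert! (ih ht').update ⟨t, ht'⟩ 0 using 1
    rw [coord_eq γ ht']
    simp [proj]
    ring

variable {P : Measure Ω} {Q : Measure[sigmaEnd H 𝓕] Ω} {γ : Proc Ω H}

theorem coord_measurable (hγ : ∀ s : H.Time, Measurable[sigmaAt 𝓕 s.1] (γ s)) {t : ℕ}
    (ht : (t : ℕ∞) ∈ H.times) : Measurable[𝓕 t] (coord γ t) := by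
  have := hγ ⟨t, ht⟩
  rw [sigmaAt_coe] at this
  rwa [coord_eq γ ht]

theorem disc_succ_measurable (hγ : ∀ s : H.Time, Measurable[sigmaAt 𝓕 s.1] (γ s)) {t : ℕ}
    (ht : (t : ℕ∞) ∈ H.times) : Measurable[𝓕 t] (disc γ (t + 1)) := by
  refine Measurable.sub measurable_const (Finset.measurable_fun_sum _ fun k hk => ?_)
  have hk' : k ≤ t := Nat.lt_succ_iff.1 (Finset.mem_range.1 hk)
  exact (coord_measurable hγ (H.natCast_mem_times_of_le hk' ht)).mono (𝓕.mono hk') le_rfl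

theorem disc_measurable (hγ : ∀ s : H.Time, Measurable[sigmaAt 𝓕 s.1] (γ s)) {t : ℕ}
    (ht : (t : ℕ∞) ∈ H.times) : Measurable[𝓕 t] (disc γ t) := by
  cases t with
  | zero => rw [disc_zero]; exact measurable_const
  | succ t =>
    exact (disc_succ_measurable hγ (H.natCast_mem_times_of_le (Nat.le_succ t) ht)).mono
      (𝓕.mono (Nat.le_succ t)) le_rfl

theorem disc_mem_Icc_of_hasSum {γ : Proc Ω H} {ω : Ω} (h : HasSum (fun s => γ s ω) 1)
    (h0 : ∀ s, 0 ≤ γ s ω) {t : ℕ} (ht : (t : ℕ∞) ∈ H.times) :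
    0 ≤ disc γ t ω ∧ disc γ t ω ≤ 1 := by
  classical
  have hp : ∀ s, 0 ≤ proj t γ s ω := fun s => by
    simp only [proj]; split_ifs
    · exact h0 s
    · exact le_rfl
  refine ⟨(hasSum_proj h ht).nonneg hp, hasSum_le (fun s => ?_) (hasSum_proj h ht) h⟩
  simp only [proj]; split_ifs
  · exact le_rfl
  · exact h0 s

namespace IsModel

variable (hQ : IsModel 𝓕 P Q γ)
include hQ

theorem isProbabilityMeasure : IsProbabilityMeasure Q := hQ.1.1

theorem ae_hasSum : ∀ᵐ ω ∂Q, (∀ s, 0 ≤ γ s ω) ∧ HasSum (fun s => γ s ω) 1 := by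
  filter_upwards [ae_all_iff.2 hQ.2.nonneg, hQ.2.sum_one] with ω h1 h2 using ⟨h1, h2⟩

theorem ae_of_ae {t : ℕ} (ht : (t : ℕ∞) ∈ H.times) {p : Ω → Prop}
    (hp : MeasurableSet[𝓕 t] {ω | p ω}) (h : ∀ᵐ ω ∂P, p ω) : ∀ᵐ ω ∂Q, p ω := by
  rw [ae_iff] at h ⊢
  exact hQ.1.2 t ht _ hp.compl h

/-- At finite times this is Q ≪ P on 𝓕_n. At time ∞ the measure Q may be singular to P, but a P-null
event is charged by Q only where M tends to ∞, and there γ_∞ vanishes by assumption. -/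
theorem tensor_mem_MBar [IsProbabilityMeasure P] {μ : Proc Ω H} (hμ : IsReference 𝓕 P μ) :
    tensor 𝓕 Q γ ∈ MBar 𝓕 P μ := by
  have := hQ.isProbabilityMeasure
  refine ⟨isProbabilityMeasure_tensor sigmaAt_le_sigmaEnd hQ.2.adapted hQ.2.nonneg hQ.2.sum_one, ?_⟩
  refine Measure.AbsolutelyContinuous.mk fun E hE h => ?_
  have hEs := measurableSet_optional_iff.1 hE
  have h' : ∀ᵐ x ∂(tensor 𝓕 P μ), x ∉ E := measure_eq_zero_iff_ae_notMem.1 h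
  rw [hμ.ae_iff hE.compl, ae_all_iff] at h'
  refine measure_eq_zero_iff_ae_notMem.2 ?_
  rw [ae_tensor_iff sigmaAt_le_sigmaEnd hQ.2.adapted hE.compl]
  rintro ⟨s, hs⟩
  have h2 := h' ⟨s, hs⟩
  have h3 := hEs ⟨s, hs⟩
  induction s using ENat.recTopCoe with
  | coe n =>
    rw [sigmaAt_coe] at h3
    filter_upwards [hQ.ae_of_ae hs h3.compl h2] with ω hω _ using hω
  | top =>
    obtain ⟨M, hM, hM0⟩ := hQ.2.infty hs
    have hlast : H.last = ⊤ := top_le_iff.1 (Horizon.le_last hs)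
    have hm : sigmaEnd H 𝓕 = ⨆ n, 𝓕 n := by rw [sigmaEnd, hlast, sigmaAt_top]
    have h4 : MeasurableSet[sigmaEnd H 𝓕] {ω | (ω, (⟨⊤, hs⟩ : H.Time)) ∈ E} := by
      rw [sigmaEnd, hlast]; exact h3
    filter_upwards [ae_tendsto_top_of_null hm hM h4 (measure_eq_zero_iff_ae_notMem.2 h2), hM0]
      with ω h5 h6 h7 h8
    exact absurd (h6 (h5 h8)) h7.ne'

end IsModel

end Model

end RiskProc

namespace RiskProc

universe u

variable {Ω : Type u}

/-! ### Decomposition of measures on the optional σ-field -/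

section Decomposition

variable {m0 : MeasurableSpace Ω} {𝓕 : Filtration ℕ m0} {P : Measure Ω}

/-- An m-measurable weight sees only the measures that a and b induce on m, and these coincide. -/
theorem setLIntegral_mul_congr_of_le {m : MeasurableSpace Ω} (hm : m ≤ m0) {a b f : Ω → ℝ≥0∞}
    (ha : Measurable[m0] a) (hb : Measurable[m0] b) (hf : Measurable[m] f)
    (h : ∀ A, MeasurableSet[m] A → ∫⁻ ω in A, a ω ∂P = ∫⁻ ω in A, b ω ∂P) {A : Set Ω}
    (hA : MeasurableSet[m] A) : ∫⁻ ω in A, a ω * f ω ∂P = ∫⁻ ω in A, b ω * f ω ∂P := by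
  have h1 : (P.withDensity a).trim hm = (P.withDensity b).trim hm := by
    refine @Measure.ext _ m _ _ fun s hs => ?_
    rw [trim_measurableSet_eq hm hs, trim_measurableSet_eq hm hs, withDensity_apply _ (hm _ hs),
      withDensity_apply _ (hm _ hs), h s hs]
  have h2 : ∀ c : Ω → ℝ≥0∞, Measurable[m0] c →
      ∫⁻ ω in A, c ω * f ω ∂P = ∫⁻ ω, A.indicator f ω ∂((P.withDensity c).trim hm) := by
    intro c hc
    rw [lintegral_trim hm (hf.indicator hA),
      lintegral_withDensity_eq_lintegral_mul _ hc ((hf.indicator hA).mono hm le_rfl),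
      ← lintegral_indicator (hm _ hA)]
    refine lintegral_congr fun ω => ?_
    by_cases hω : ω ∈ A <;> simp [hω]
  rw [h2 a ha, h2 b hb, h1]

/-- The multiplicative decomposition of a nonnegative supermartingale u with one-step predictions w:
D is the product of the ratios w/u, hence predictable and decreasing, and M = u/D as long as D is
positive. -/
theorem exists_discount_density {u w : ℕ → Ω → ℝ≥0∞} (hu : ∀ n, Measurable[𝓕 n] (u n))
    (hw : ∀ n, Measurable[𝓕 n] (w n)) (hfin : ∀ n, ∀ᵐ ω ∂P, u n ω < ⊤)
    (hwu : ∀ n, ∀ᵐ ω ∂P, w n ω ≤ u n ω)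
    (huw : ∀ n A, MeasurableSet[𝓕 n] A → ∫⁻ ω in A, u (n + 1) ω ∂P = ∫⁻ ω in A, w n ω ∂P) :
    ∃ (D : ℕ → Ω → ℝ) (M : ℕ → Ω → ℝ≥0∞), D 0 = (fun _ => 1) ∧ M 0 = u 0 ∧
      (∀ n, Measurable[𝓕 n] (D (n + 1))) ∧ (∀ n ω, 0 ≤ D n ω) ∧
      (∀ n ω, D (n + 1) ω ≤ D n ω) ∧ (∀ n, Measurable[𝓕 n] (M n)) ∧
      (∀ n A, MeasurableSet[𝓕 n] A → ∫⁻ ω in A, M (n + 1) ω ∂P = ∫⁻ ω in A, M n ω ∂P) ∧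
      (∀ n, ∀ᵐ ω ∂P, ENNReal.ofReal (D n ω) * M n ω = u n ω) ∧
      ∀ n, ∀ᵐ ω ∂P, ENNReal.ofReal (D (n + 1) ω) * M n ω = w n ω := by
  classical
  -- The cap at 1 makes the bounds hold everywhere rather than almost surely. Where u n vanishes so
  -- does w n, and the value of the ratio is immaterial.
  set v : ℕ → Ω → ℝ := fun n ω => min 1 (w n ω / u n ω).toReal with hv
  have hv0 : ∀ n ω, 0 ≤ v n ω := fun n ω => le_min zero_le_one ENNReal.toReal_nonneg
  have hv1 : ∀ n ω, v n ω ≤ 1 := fun n ω => min_le_left _ _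
  have hvm : ∀ n, Measurable[𝓕 n] (v n) := fun n =>
    measurable_const.min ((hw n).div (hu n)).ennreal_toReal
  set D : ℕ → Ω → ℝ := fun n ω => ∏ k ∈ Finset.range n, v k ω with hD
  have hDs : ∀ n ω, D (n + 1) ω = D n ω * v n ω := fun n ω => Finset.prod_range_succ _ _
  have hD0 : ∀ n ω, 0 ≤ D n ω := fun n ω => Finset.prod_nonneg fun k _ => hv0 k ω
  have hDm : ∀ n, Measurable[𝓕 n] (D (n + 1)) := fun n =>
    Finset.measurable_fun_prod _ fun k hk =>
      (hvm k).mono (𝓕.mono (Nat.lt_succ_iff.1 (Finset.mem_range.1 hk))) le_rfl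
  -- Once D has reached zero, M is frozen; this keeps the martingale property and does not affect
  -- D·M = u.
  set M : ℕ → Ω → ℝ≥0∞ := fun n => Nat.rec (u 0)
    (fun k Mk ω => if 0 < D (k + 1) ω then u (k + 1) ω / ENNReal.ofReal (D (k + 1) ω) else Mk ω) n
    with hM
  have hMs : ∀ n ω, M (n + 1) ω = if 0 < D (n + 1) ω then
      u (n + 1) ω / ENNReal.ofReal (D (n + 1) ω) else M n ω := fun n ω => rfl
  have hpos : ∀ n, MeasurableSet[𝓕 n] {ω | 0 < D (n + 1) ω} := fun n => hDm n measurableSet_Ioi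
  have hMm : ∀ n, Measurable[𝓕 n] (M n) := by
    intro n
    induction n with
    | zero => exact hu 0
    | succ n ih =>
      exact Measurable.ite (𝓕.mono (Nat.le_succ n) _ (hpos n))
        ((hu (n + 1)).div ((hDm n).mono (𝓕.mono (Nat.le_succ n)) le_rfl).ennreal_ofReal)
        (ih.mono (𝓕.mono (Nat.le_succ n)) le_rfl)
  have hstep : ∀ n, (∀ᵐ ω ∂P, ENNReal.ofReal (D n ω) * M n ω = u n ω) →
      ∀ᵐ ω ∂P, ENNReal.ofReal (D (n + 1) ω) * M n ω = w n ω := by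
    intro n h
    filter_upwards [h, hfin n, hwu n] with ω h1 h2 h3
    rw [hDs, ENNReal.ofReal_mul (hD0 n ω), mul_right_comm, h1]
    rcases eq_or_ne (u n ω) 0 with h0 | h0
    · rw [h0, nonpos_iff_eq_zero] at h3
      rw [h0, h3, zero_mul]
    · have h4 : w n ω / u n ω ≤ 1 := ENNReal.div_le_of_le_mul (by rwa [one_mul])
      have h5 : v n ω = (w n ω / u n ω).toReal :=
        min_eq_right (ENNReal.toReal_le_of_le_ofReal zero_le_one (by simpa using h4))
      rw [h5, ENNReal.ofReal_toReal (h4.trans_lt ENNReal.one_lt_top).ne,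
        ENNReal.mul_div_cancel h0 h2.ne]
  have hDM : ∀ n, ∀ᵐ ω ∂P, ENNReal.ofReal (D n ω) * M n ω = u n ω := by
    intro n
    induction n with
    | zero =>
      refine ae_of_all _ fun ω => ?_
      simp [hD, hM]
    | succ n ih =>
      -- A nonnegative variable vanishes where its conditional expectation does; this settles the
      -- case D (n+1) = 0.
      have hz : ∀ᵐ ω ∂P, ω ∈ {ω | w n ω = 0} → u (n + 1) ω = 0 := by
        have hzm : MeasurableSet[𝓕 n] {ω | w n ω = 0} := hw n (measurableSet_singleton 0)
        have h1 := huw n _ hzm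
        rw [setLIntegral_congr_fun (𝓕.le n _ hzm) (g := fun _ => 0) (fun ω hω => hω),
          lintegral_zero, setLIntegral_eq_zero_iff (𝓕.le n _ hzm)
          ((hu (n + 1)).mono (𝓕.le _) le_rfl)] at h1
        exact h1
      filter_upwards [hstep n ih, hz] with ω h1 h2
      rw [hMs]
      split_ifs with h
      · exact ENNReal.mul_div_cancel (by simpa using h) ENNReal.ofReal_ne_top
      · have h3 : D (n + 1) ω = 0 := le_antisymm (not_lt.1 h) (hD0 _ _)
        rw [h3, ENNReal.ofReal_zero, zero_mul] at h1
        rw [h3, ENNReal.ofReal_zero, zero_mul, h2 h1.symm]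
  refine ⟨D, M, by ext; simp [hD], rfl, hDm, hD0, fun n ω => ?_, hMm, fun n A hA => ?_, hDM,
    fun n => hstep n (hDM n)⟩
  · rw [hDs]; exact mul_le_of_le_one_right (hD0 n ω) (hv1 n ω)
  · rw [← lintegral_inter_add_sdiff (μ := P) (M (n + 1)) A (𝓕.le n _ (hpos n)),
      ← lintegral_inter_add_sdiff (μ := P) (M n) A (𝓕.le n _ (hpos n))]
    congr 1
    · have hB := hA.inter (hpos n)
      calc ∫⁻ ω in A ∩ {ω | 0 < D (n + 1) ω}, M (n + 1) ω ∂P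
          = ∫⁻ ω in A ∩ {ω | 0 < D (n + 1) ω}, u (n + 1) ω * (ENNReal.ofReal (D (n + 1) ω))⁻¹ ∂P :=
            setLIntegral_congr_fun (𝓕.le n _ hB) fun ω hω => by
              rw [hMs, if_pos (show 0 < D (n + 1) ω from hω.2), div_eq_mul_inv]
        _ = ∫⁻ ω in A ∩ {ω | 0 < D (n + 1) ω}, w n ω * (ENNReal.ofReal (D (n + 1) ω))⁻¹ ∂P :=
            setLIntegral_mul_congr_of_le (𝓕.le n) ((hu (n + 1)).mono (𝓕.le _) le_rfl)
              ((hw n).mono (𝓕.le _) le_rfl) (hDm n).ennreal_ofReal.inv (huw n) hB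
        _ = ∫⁻ ω in A ∩ {ω | 0 < D (n + 1) ω}, M n ω ∂P := by
            refine setLIntegral_congr_fun_ae (𝓕.le n _ hB) ?_
            filter_upwards [hstep n (hDM n)] with ω h1 h2
            rw [← h1, mul_comm, ← mul_assoc, ENNReal.inv_mul_cancel (by simpa using h2.2)
              ENNReal.ofReal_ne_top, one_mul]
    · exact setLIntegral_congr_fun (𝓕.le n _ (hA.diff (hpos n))) fun ω hω => by
        rw [hMs, if_neg (show ¬ 0 < D (n + 1) ω from hω.2)]

theorem exists_slice_measure {H : Horizon} {R : Measure[optional H 𝓕] (OmegaBar Ω H)}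
    [IsFiniteMeasure R] (m : MeasurableSpace Ω) {S : Set H.Time}
    (hS : ∀ A, MeasurableSet[m] A → MeasurableSet[optional H 𝓕] (A ×ˢ S)) :
    ∃ κ : Measure[m] Ω, IsFiniteMeasure κ ∧ ∀ A, MeasurableSet[m] A → κ A = R (A ×ˢ S) := by
  set κ : Measure[m] Ω := @Measure.ofMeasurable Ω m (fun A _ => R (A ×ˢ S)) (by simp)
    (fun A hA hd => by
      rw [iUnion_prod_const, measure_iUnion _ fun i => hS _ (hA i)]
      exact fun i j hij => disjoint_left.2 fun p hp hq =>
        disjoint_left.1 (hd hij) hp.1 hq.1) with hκ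
  have hκA : ∀ A, MeasurableSet[m] A → κ A = R (A ×ˢ S) := fun A hA =>
    Measure.ofMeasurable_apply A hA
  exact ⟨κ, ⟨by rw [hκA _ MeasurableSet.univ]; exact measure_lt_top _ _⟩, hκA⟩

theorem exists_slice_density [IsFiniteMeasure P] {H : Horizon} {μ : Proc Ω H}
    (hμ : IsReference 𝓕 P μ) {R : Measure[optional H 𝓕] (OmegaBar Ω H)} [IsFiniteMeasure R]
    (hR : R ≪ tensor 𝓕 P μ)
    {m : MeasurableSpace Ω} (hm : m ≤ m0) {S : Set H.Time}
    (hS : ∀ A, MeasurableSet[m] A → MeasurableSet[optional H 𝓕] (A ×ˢ S)) :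
    ∃ u : Ω → ℝ≥0∞, Measurable[m] u ∧
      ∀ A, MeasurableSet[m] A → R (A ×ˢ S) = ∫⁻ ω in A, u ω ∂P := by
  obtain ⟨κ, hκf, hκA⟩ := exists_slice_measure (R := R) m hS
  have hac : κ ≪ P.trim hm := by
    refine Measure.AbsolutelyContinuous.mk fun A hA h => ?_
    rw [trim_measurableSet_eq hm hA] at h
    rw [hκA A hA]
    refine hR (measure_eq_zero_iff_ae_notMem.2 ?_)
    rw [hμ.ae_iff (hS A hA).compl]
    filter_upwards [measure_eq_zero_iff_ae_notMem.1 h] with ω hω s hs using hω hs.1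
  refine ⟨κ.rnDeriv (P.trim hm), Measure.measurable_rnDeriv _ _, fun A hA => ?_⟩
  rw [← hκA A hA, ← Measure.withDensity_rnDeriv_eq _ _ hac, withDensity_apply _ hA,
    Measure.withDensity_rnDeriv_eq _ _ hac, restrict_trim hm _ hA,
    lintegral_trim hm (Measure.measurable_rnDeriv _ _)]

/-- For a finite horizon the terminal density defines Q. For an infinite one M need not be uniformly
integrable, so Q is obtained as an extension of a consistent family. -/
theorem exists_measure_sigmaEnd [IsProbabilityMeasure P] {H : Horizon}
    (h𝓕 : H.last = ⊤ → FiltrationRegular 𝓕) {M : ℕ → Ω → ℝ≥0∞}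
    (hM : ∀ n, Measurable[𝓕 n] (M n)) (hM1 : ∫⁻ ω, M 0 ω ∂P = 1)
    (hmart : ∀ n A, MeasurableSet[𝓕 n] A → ∫⁻ ω in A, M (n + 1) ω ∂P = ∫⁻ ω in A, M n ω ∂P) :
    ∃ Q : Measure[sigmaEnd H 𝓕] Ω, IsProbabilityMeasure Q ∧
      ∀ n : ℕ, (n : ℕ∞) ∈ H.times → ∀ A, MeasurableSet[𝓕 n] A → Q A = ∫⁻ ω in A, M n ω ∂P := by
  have hmart' : ∀ n k A, MeasurableSet[𝓕 n] A →
      ∫⁻ ω in A, M (n + k) ω ∂P = ∫⁻ ω in A, M n ω ∂P := by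
    intro n k A hA
    induction k with
    | zero => rfl
    | succ k ih => rw [← add_assoc, hmart _ _ (𝓕.mono (Nat.le_add_right n k) _ hA), ih]
  have hone : ∀ n, ∫⁻ ω, M n ω ∂P = 1 := fun n => by
    have := hmart' 0 n univ (@MeasurableSet.univ _ (𝓕 0))
    simpa [hM1] using this
  have hq : ∀ (m : MeasurableSpace Ω) (hm : m ≤ m0) (n : ℕ), 𝓕 n ≤ m → ∀ A, MeasurableSet[m] A →
      (P.trim hm).withDensity (M n) A = ∫⁻ ω in A, M n ω ∂P := by
    intro m hm n hnm A hA
    rw [withDensity_apply _ hA, restrict_trim hm _ hA, lintegral_trim hm ((hM n).mono hnm le_rfl)]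
  by_cases hlast : H.last = ⊤
  · have hm : sigmaEnd H 𝓕 = ⨆ n, 𝓕 n := by rw [sigmaEnd, hlast, sigmaAt_top]
    rw [hm]
    obtain ⟨Q, hQ, hQA⟩ := (h𝓕 hlast).exists_extension
      (fun n => (P.trim (𝓕.le n)).withDensity (M n))
      (fun n => ⟨by rw [hq _ _ n le_rfl _ MeasurableSet.univ, setLIntegral_univ, hone]⟩)
      (fun n A hA => by
        rw [hq _ _ _ le_rfl _ (𝓕.mono (Nat.le_succ n) _ hA), hq _ _ _ le_rfl _ hA, hmart n A hA])
    exact ⟨Q, hQ, fun n _ A hA => by rw [hQA n A hA, hq _ _ _ le_rfl _ hA]⟩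
  · cases H with
    | finite T =>
      have hTm : (T : ℕ∞) ∈ (Horizon.finite T).times := le_refl (T : ℕ∞)
      have hT := hq (sigmaEnd (Horizon.finite T) 𝓕) (sigmaAt_le _) T (filtration_le_sigmaEnd hTm)
      refine ⟨_, ⟨(hT _ MeasurableSet.univ).trans (by rw [setLIntegral_univ, hone])⟩,
        fun n hn A hA => ?_⟩
      rw [hT A (filtration_le_sigmaEnd hn _ hA)]
      have hnT : n ≤ T := by
        have : (n : ℕ∞) ≤ (T : ℕ∞) := hn
        exact_mod_cast this
      obtain ⟨k, rfl⟩ := Nat.exists_eq_add_of_le hnT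
      exact hmart' n k A hA
    | nat => exact absurd rfl hlast
    | natInfty => exact absurd rfl hlast

/-- The value at ⊤ takes up the mass lost in the limit of the telescoping sum. -/
theorem hasSum_telescope {d : ℕ → ℝ} (h0 : ∀ n, 0 ≤ d n) (hd : Antitone d) :
    HasSum (fun s : ℕ∞ => ENat.recTopCoe (C := fun _ => ℝ) (⨅ n, d n)
      (fun n => d n - d (n + 1)) s) (d 0) := by
  have hlim : Tendsto d atTop (𝓝 (⨅ n, d n)) :=
    tendsto_atTop_ciInf hd ⟨0, by rintro _ ⟨n, rfl⟩; exact h0 n⟩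
  have h1 : HasSum (fun n => d n - d (n + 1)) (d 0 - ⨅ n, d n) := by
    rw [hasSum_iff_tendsto_nat_of_nonneg fun n => sub_nonneg.2 (hd (Nat.le_succ n))]
    simp only [Finset.sum_range_sub']
    exact hlim.const_sub _
  have h2 : HasSum (fun s : ℕ∞ => ENat.recTopCoe (C := fun _ => ℝ) 0
      (fun n => d n - d (n + 1)) s) (d 0 - ⨅ n, d n) := by
    refine (Function.Injective.hasSum_iff (g := ((↑) : ℕ → ℕ∞)) Nat.cast_injective
      fun s hs => ?_).1 (by simpa [Function.comp_def] using h1)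
    induction s using ENat.recTopCoe with
    | coe n => exact absurd ⟨n, rfl⟩ hs
    | top => rfl
  convert! h2.update ⊤ (⨅ n, d n) using 1
  · ext s
    induction s using ENat.recTopCoe with
    | coe n => simp
    | top => simp
  · simp

/-- On 𝓕_n, let u n be the density of R on Ω × 𝕋_n and w n that on Ω × 𝕋_{n+1}; w n is the
prediction of u (n+1). The factorization u = D M gives Q from M and γ from the decrements of D, with
γ_∞ = lim D. That Q ⊗ γ = R is checked section by section. -/
theorem MBar.exists_isModel [IsProbabilityMeasure P] {H : Horizon}
    (h𝓕 : H.last = ⊤ → FiltrationRegular 𝓕) {μ : Proc Ω H} (hμ : IsReference 𝓕 P μ)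
    {R : Measure[optional H 𝓕] (OmegaBar Ω H)} (hR : R ∈ MBar 𝓕 P μ) :
    ∃ (Q : Measure[sigmaEnd H 𝓕] Ω) (γ : Proc Ω H), IsModel 𝓕 P Q γ ∧ tensor 𝓕 Q γ = R := by
  classical
  have hRp := hR.1
  choose u hum hu using fun n => exists_slice_density hμ hR.2 (𝓕.le n)
    (S := {s : H.Time | (n : ℕ∞) ≤ s.1}) fun A hA => measurableSet_slab hA
  choose w hwm hw using fun n => exists_slice_density hμ hR.2 (𝓕.le n)
    (S := {s : H.Time | ((n + 1 : ℕ) : ℕ∞) ≤ s.1}) fun A hA =>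
      measurableSet_slab (𝓕.mono (Nat.le_succ n) _ hA)
  have hfin : ∀ n, ∀ᵐ ω ∂P, u n ω < ⊤ := fun n =>
    ae_lt_top ((hum n).mono (𝓕.le n) le_rfl) (by
      rw [← setLIntegral_univ, ← hu n univ (@MeasurableSet.univ _ (𝓕 n))]
      exact measure_ne_top _ _)
  have hslab : ∀ n (A : Set Ω), slab H (n + 1) A ⊆ slab H n A := fun n A p hp =>
    ⟨hp.1, (show (n : ℕ∞) ≤ ((n + 1 : ℕ) : ℕ∞) by exact_mod_cast Nat.le_succ n).trans hp.2⟩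
  have hwu : ∀ n, ∀ᵐ ω ∂P, w n ω ≤ u n ω := fun n => by
    refine ae_of_ae_trim (𝓕.le n) (ae_le_of_forall_setLIntegral_le_of_sigmaFinite (hwm n)
      fun A hA _ => ?_)
    rw [restrict_trim (𝓕.le n) _ hA, lintegral_trim (𝓕.le n) (hwm n),
      lintegral_trim (𝓕.le n) (hum n), ← hw n A hA, ← hu n A hA]
    exact measure_mono (hslab n A)
  obtain ⟨D, M, hD0, hM0, hDm, hDnn, hDanti, hMm, hmart, hDu, hDw⟩ :=
    exists_discount_density hum hwm hfin hwu fun n A hA => by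
      rw [← hw n A hA, ← hu (n + 1) A (𝓕.mono (Nat.le_succ n) _ hA)]
  have hM1 : ∫⁻ ω, M 0 ω ∂P = 1 := by
    rw [hM0, ← setLIntegral_univ, ← hu 0 univ (@MeasurableSet.univ _ (𝓕 0))]
    have : (univ ×ˢ {s : H.Time | ((0 : ℕ) : ℕ∞) ≤ s.1} : Set (OmegaBar Ω H)) = univ := by
      ext p; simp
    rw [this, measure_univ]
  obtain ⟨Q, hQ, hQM⟩ := exists_measure_sigmaEnd h𝓕 hMm hM1 hmart
  -- the stopped discounting process
  set d : ℕ → Ω → ℝ := fun n ω => if (n : ℕ∞) ∈ H.times then D n ω else 0 with hd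
  have h0t : ((0 : ℕ) : ℕ∞) ∈ H.times := by
    cases H with
    | finite T => exact (zero_le : (0 : ℕ∞) ≤ T)
    | nat => exact ENat.natCast_lt_top _
    | natInfty => trivial
  have hd0 : ∀ ω, d 0 ω = 1 := fun ω => by simp only [hd]; rw [if_pos h0t, hD0]
  have hdnn : ∀ n ω, 0 ≤ d n ω := fun n ω => by
    simp only [hd]; split_ifs
    · exact hDnn n ω
    · exact le_rfl
  have hdanti : ∀ ω, Antitone fun n => d n ω := fun ω => antitone_nat_of_succ_le fun n => by
    by_cases h : ((n + 1 : ℕ) : ℕ∞) ∈ H.times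
    · simp only [hd]
      rw [if_pos h, if_pos (H.natCast_mem_times_of_le (Nat.le_succ n) h)]
      exact hDanti n ω
    · have : d (n + 1) ω = 0 := if_neg h
      rw [this]; exact hdnn n ω
  have hdsm : ∀ n, Measurable[𝓕 n] (d (n + 1)) := fun n => by
    by_cases h : ((n + 1 : ℕ) : ℕ∞) ∈ H.times
    · simp only [hd, if_pos h]; exact hDm n
    · simp only [hd, if_neg h]; exact measurable_const
  have hdm : ∀ n, Measurable[𝓕 n] (d n) := fun n => by
    cases n with
    | zero => rw [funext hd0]; exact measurable_const
    | succ n => exact (hdsm n).mono (𝓕.mono (Nat.le_succ n)) le_rfl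
  have hQf : ∀ n : ℕ, (n : ℕ∞) ∈ H.times → ∀ f : Ω → ℝ≥0∞, Measurable[𝓕 n] f → ∀ A,
      MeasurableSet[𝓕 n] A → ∫⁻ ω in A, f ω ∂Q = ∫⁻ ω in A, f ω * M n ω ∂P := by
    intro n hn f hf A hA
    have hle := filtration_le_sigmaEnd (𝓕 := 𝓕) hn
    have h1 : Q.trim hle = (P.trim (𝓕.le n)).withDensity (M n) := by
      refine @Measure.ext _ (𝓕 n) _ _ fun s hs => ?_
      rw [trim_measurableSet_eq hle hs, hQM n hn s hs, withDensity_apply _ hs,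
        restrict_trim (𝓕.le n) _ hs, lintegral_trim (𝓕.le n) (hMm n)]
    rw [← lintegral_trim hle hf, ← restrict_trim hle _ hA, h1,
      setLIntegral_withDensity_eq_setLIntegral_mul _ (hMm n) hf hA,
      restrict_trim (𝓕.le n) _ hA, lintegral_trim (𝓕.le n) ((hMm n).mul hf)]
    exact lintegral_congr fun ω => mul_comm _ _
  have hC1 : ∀ n : ℕ, (n : ℕ∞) ∈ H.times → ∀ A, MeasurableSet[𝓕 n] A →
      ∫⁻ ω in A, ENNReal.ofReal (d n ω) ∂Q = R (slab H n A) := by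
    intro n hn A hA
    rw [hQf n hn _ (hdm n).ennreal_ofReal A hA, hu n A hA]
    refine lintegral_congr_ae (ae_restrict_of_ae ?_)
    filter_upwards [hDu n] with ω h
    simp only [hd, if_pos hn]
    exact h
  have hC2 : ∀ n : ℕ, (n : ℕ∞) ∈ H.times → ∀ A, MeasurableSet[𝓕 n] A →
      ∫⁻ ω in A, ENNReal.ofReal (d (n + 1) ω) ∂Q = R (slab H (n + 1) A) := by
    intro n hn A hA
    -- Past a finite terminal date the slab is empty and d is zero, so that the whole remaining D_T
    -- is assigned to γ_T.
    by_cases h : ((n + 1 : ℕ) : ℕ∞) ∈ H.times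
    · rw [hQf n hn _ (hdsm n).ennreal_ofReal A hA, hw n A hA]
      refine lintegral_congr_ae (ae_restrict_of_ae ?_)
      filter_upwards [hDw n] with ω h'
      simp only [hd, if_pos h]
      exact h'
    · have h1 : slab H (n + 1) A = ∅ := by
        ext p
        simp only [mem_prod, mem_ofPred_eq, mem_empty_iff_false, iff_false, not_and]
        exact fun _ hp => h (H.mem_times_of_le hp p.2.2 (ENat.natCast_ne_top _))
      have h2 : ∀ ω, d (n + 1) ω = 0 := fun ω => if_neg h
      rw [h1, measure_empty]
      simp [h2]
  set γ : Proc Ω H := fun s ω => ENat.recTopCoe (C := fun _ => ℝ) (⨅ n, d n ω)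
    (fun n => d n ω - d (n + 1) ω) s.1 with hγ
  have hγn : ∀ (n : ℕ) (hn : (n : ℕ∞) ∈ H.times) ω, γ ⟨n, hn⟩ ω = d n ω - d (n + 1) ω :=
    fun n hn ω => by simp [hγ]
  have hγt : ∀ (h : (⊤ : ℕ∞) ∈ H.times) ω, γ ⟨⊤, h⟩ ω = ⨅ n, d n ω := fun h ω => by simp [hγ]
  have hbdd : ∀ ω, BddBelow (range fun n => d n ω) := fun ω =>
    ⟨0, by rintro _ ⟨n, rfl⟩; exact hdnn n ω⟩
  have hγ0 : ∀ s ω, 0 ≤ γ s ω := by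
    rintro ⟨s, hs⟩ ω
    induction s using ENat.recTopCoe with
    | coe n => rw [hγn]; exact sub_nonneg.2 (hdanti ω (Nat.le_succ n))
    | top => rw [hγt]; exact le_ciInf fun n => hdnn n ω
  have hγm : ∀ s : H.Time, Measurable[sigmaAt 𝓕 s.1] (γ s) := by
    rintro ⟨s, hs⟩
    induction s using ENat.recTopCoe with
    | coe n =>
      have : Measurable[𝓕 n] (γ ⟨n, hs⟩) := by
        rw [funext (hγn n hs)]; exact (hdm n).sub (hdsm n)
      exact this.mono (filtration_le_sigmaAt le_rfl) le_rfl
    | top =>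
      rw [funext (hγt hs)]
      exact Measurable.iInf fun n => (hdm n).mono (filtration_le_sigmaAt le_top) le_rfl
  have hlim : ∀ ω, Tendsto (fun n => d n ω) atTop (𝓝 (⨅ n, d n ω)) := fun ω =>
    tendsto_atTop_ciInf (hdanti ω) (hbdd ω)
  have hsec : ∀ (s : H.Time) A, MeasurableSet[sigmaAt 𝓕 s.1] A →
      ∫⁻ ω in A, ENNReal.ofReal (γ s ω) ∂Q = R (A ×ˢ {s}) := by
    rintro ⟨s, hs⟩ A hA
    induction s using ENat.recTopCoe with
    | coe n =>
      rw [sigmaAt_coe] at hA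
      have hA' := filtration_le_sigmaEnd hs _ hA
      have h1 := hC1 n hs A hA
      have h2 : slab H n A = A ×ˢ {⟨(n : ℕ∞), hs⟩} ∪ slab H (n + 1) A := by
        ext ⟨ω, s⟩
        have h3 : ((n + 1 : ℕ) : ℕ∞) ≤ s.1 ↔ (n : ℕ∞) < s.1 := by
          rw [Nat.cast_add, Nat.cast_one, ENat.add_one_le_iff (ENat.natCast_ne_top n)]
        simp only [mem_prod, mem_ofPred_eq, mem_union, mem_singleton_iff, Subtype.ext_iff]
        rw [h3, le_iff_eq_or_lt, ← and_or_left, eq_comm]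
      have h3 : Disjoint (A ×ˢ {(⟨(n : ℕ∞), hs⟩ : H.Time)}) (slab H (n + 1) A) := by
        refine disjoint_left.2 fun p hp hq => ?_
        have h4 : ((n + 1 : ℕ) : ℕ∞) ≤ p.2.1 := hq.2
        have h5 : p.2 = ⟨(n : ℕ∞), hs⟩ := hp.2
        rw [h5] at h4
        change ((n + 1 : ℕ) : ℕ∞) ≤ ((n : ℕ) : ℕ∞) at h4
        have h6 : n + 1 ≤ n := by exact_mod_cast h4
        omega
      rw [h2, measure_union h3 (measurableSet_slab (𝓕.mono (Nat.le_succ n) _ hA)),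
        ← hC2 n hs A hA] at h1
      have h4 : ∫⁻ ω in A, ENNReal.ofReal (d n ω) ∂Q = ∫⁻ ω in A, ENNReal.ofReal (γ ⟨n, hs⟩ ω) ∂Q
          + ∫⁻ ω in A, ENNReal.ofReal (d (n + 1) ω) ∂Q := by
        rw [← lintegral_add_left ((hγm ⟨n, hs⟩).mono (sigmaAt_le_sigmaEnd _) le_rfl).ennreal_ofReal]
        refine lintegral_congr fun ω => ?_
        rw [← ENNReal.ofReal_add (hγ0 _ ω) (hdnn _ ω), hγn]
        ring_nf
      rw [h4] at h1
      refine (ENNReal.add_left_inj ?_).1 h1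
      rw [hC2 n hs A hA]
      exact measure_ne_top _ _
    | top =>
      have hlast : H.last = ⊤ := top_le_iff.1 (Horizon.le_last hs)
      have hm : sigmaEnd H 𝓕 = ⨆ n, 𝓕 n := by rw [sigmaEnd, hlast, sigmaAt_top]
      have hnt : ∀ n : ℕ, (n : ℕ∞) ∈ H.times := fun n =>
        H.mem_times_of_le le_top hs (ENat.natCast_ne_top n)
      have hend : sigmaEnd H 𝓕 = sigmaAt 𝓕 ⊤ := by rw [sigmaEnd, hlast]
      obtain ⟨κ, hκf, hκ⟩ := exists_slice_measure (R := R) (sigmaEnd H 𝓕)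
        (S := {(⟨⊤, hs⟩ : H.Time)}) fun A hA =>
          MeasurableSpace.measurableSet_generateFrom ⟨⟨⊤, hs⟩, A, hend ▸ hA, rfl⟩
      have hgm : Measurable[sigmaEnd H 𝓕] fun ω => ENNReal.ofReal (γ ⟨⊤, hs⟩ ω) :=
        ((hγm ⟨⊤, hs⟩).mono (sigmaAt_le_sigmaEnd _) le_rfl).ennreal_ofReal
      have hle1 : ∀ n ω, d n ω ≤ 1 := fun n ω => hd0 ω ▸ hdanti ω (Nat.zero_le n)
      -- On events of a single 𝓕_n, both sides are limits of the slab identities, as d_k decreases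
      -- to γ_∞ and the slabs decrease to the section at ∞. These events form a π-system generating
      -- 𝓕_∞.
      have hgen : ∀ n, ∀ A, MeasurableSet[𝓕 n] A →
          ∫⁻ ω in A, ENNReal.ofReal (γ ⟨⊤, hs⟩ ω) ∂Q = κ A := by
        intro n A hA
        have hA' := filtration_le_sigmaEnd (hnt n) _ hA
        rw [hκ A hA']
        have h1 : Tendsto (fun k => ∫⁻ ω in A, ENNReal.ofReal (d k ω) ∂Q) atTop
            (𝓝 (∫⁻ ω in A, ENNReal.ofReal (γ ⟨⊤, hs⟩ ω) ∂Q)) := by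
          refine @tendsto_lintegral_of_dominated_convergence Ω (sigmaEnd H 𝓕) _ _ _ (fun _ => 1)
            (fun k => ((hdm k).mono (filtration_le_sigmaEnd (hnt k)) le_rfl).ennreal_ofReal)
            (fun k => ae_of_all _ fun ω => ?_) ?_ (ae_of_all _ fun ω => ?_)
          · simpa using hle1 k ω
          · simp
          · rw [hγt]
            exact (ENNReal.continuous_ofReal.tendsto _).comp (hlim ω)
        have h2 : Tendsto (fun k => R (slab H k A)) atTop (𝓝 (R (⋂ k, slab H (n + k) A))) := by
          refine (tendsto_add_atTop_iff_nat n).1 ?_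
          simp_rw [add_comm _ n]
          refine tendsto_measure_iInter_atTop (fun k => ?_) ?_ ⟨0, measure_ne_top _ _⟩
          · exact (measurableSet_slab (𝓕.mono (Nat.le_add_right n k) _ hA)).nullMeasurableSet
          · exact antitone_nat_of_succ_le fun k => hslab (n + k) A
        have h3 : (⋂ k, slab H (n + k) A) = A ×ˢ {(⟨⊤, hs⟩ : H.Time)} := by
          ext ⟨ω, s⟩
          simp only [mem_iInter, mem_prod, mem_ofPred_eq, mem_singleton_iff, Subtype.ext_iff]
          constructor
          · intro h
            refine ⟨(h 0).1, ENat.eq_top_iff_forall_ge.2 fun k => ?_⟩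
            refine le_trans ?_ (h k).2
            exact_mod_cast Nat.le_add_left k n
          · intro h k
            exact ⟨h.1, h.2 ▸ le_top⟩
        rw [h3] at h2
        refine tendsto_nhds_unique h1 (h2.congr' ?_)
        filter_upwards [eventually_ge_atTop n] with k hk
        exact (hC1 k (hnt k) A (𝓕.mono hk _ hA)).symm
      have heq : Q.withDensity (fun ω => ENNReal.ofReal (γ ⟨⊤, hs⟩ ω)) = κ := by
        have hfin' : IsFiniteMeasure (Q.withDensity fun ω => ENNReal.ofReal (γ ⟨⊤, hs⟩ ω)) := by
          refine isFiniteMeasure_withDensity ?_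
          rw [← setLIntegral_univ, hgen 0 univ (@MeasurableSet.univ _ (𝓕 0))]
          exact measure_ne_top _ _
        refine ext_of_generate_finite (⋃ n, {s | MeasurableSet[𝓕 n] s}) ?_ ?_ ?_ ?_
        · exact hm.trans (MeasurableSpace.generateFrom_iUnion_measurableSet _).symm
        · rintro A hA B hB -
          obtain ⟨i, hi⟩ := mem_iUnion.1 hA
          obtain ⟨j, hj⟩ := mem_iUnion.1 hB
          exact mem_iUnion.2 ⟨max i j, MeasurableSet.inter (𝓕.mono (le_max_left _ _) _ hi)
            (𝓕.mono (le_max_right _ _) _ hj)⟩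
        · intro A hA
          obtain ⟨i, hi⟩ := mem_iUnion.1 hA
          rw [withDensity_apply _ (filtration_le_sigmaEnd (hnt i) _ hi), hgen i A hi]
        · rw [withDensity_apply _ MeasurableSet.univ, hgen 0 univ (@MeasurableSet.univ _ (𝓕 0))]
      have hA' : MeasurableSet[sigmaEnd H 𝓕] A := hend ▸ hA
      rw [← hκ A hA', ← heq, withDensity_apply _ hA']
  have htensor : tensor 𝓕 Q γ = R := by
    refine @Measure.ext _ (optional H 𝓕) _ _ fun E hE => ?_
    rw [tensor_apply sigmaAt_le_sigmaEnd hE]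
    have hEs := measurableSet_optional_iff.1 hE
    have h1 : E = ⋃ s : H.Time, {ω | (ω, s) ∈ E} ×ˢ {s} := by
      ext ⟨ω, s⟩
      simp only [mem_iUnion, mem_prod, mem_ofPred_eq, mem_singleton_iff]
      exact ⟨fun h => ⟨s, h, rfl⟩, fun ⟨_, h, e⟩ => e ▸ h⟩
    conv_rhs => rw [h1]
    rw [measure_iUnion]
    · exact tsum_congr fun s => hsec s _ (hEs s)
    · exact fun s r hsr => disjoint_left.2 fun p hp hq => hsr (hp.2.symm.trans hq.2)
    · exact fun s => MeasurableSpace.measurableSet_generateFrom ⟨s, _, hEs s, rfl⟩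
  refine ⟨Q, γ, ⟨⟨hQ, fun t ht A hA hPA => ?_⟩, hγm, fun s => ae_of_all _ (hγ0 s), ?_, ?_⟩, htensor⟩
  · rw [hQM t ht A hA]; exact setLIntegral_measure_zero _ _ hPA
  · set f : ℕ∞ → Ω → ℝ := fun s ω => ENat.recTopCoe (C := fun _ => ℝ) (⨅ n, d n ω)
      (fun n => d n ω - d (n + 1) ω) s with hf
    have hf0 : ∀ s ω, 0 ≤ f s ω := fun s ω => by
      induction s using ENat.recTopCoe with
      | coe n => simpa [hf] using hdanti ω (Nat.le_succ n)
      | top => exact le_ciInf fun n => hdnn n ω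
    have hf1 : ∀ ω, HasSum (fun s => f s ω) 1 := fun ω => by
      have := hasSum_telescope (fun n => hdnn n ω) (hdanti ω)
      rwa [hd0 ω] at this
    have hs : ∀ ω, Summable fun s => γ s ω := fun ω => (hf1 ω).summable.subtype _
    -- Pointwise only ≤ 1 is clear: if ∞ is not in 𝕋, the limit of D is left out. That R has mass
    -- one then forces equality Q-a.s.
    have h1 : ∀ ω, ∑' s, ENNReal.ofReal (γ s ω) ≤ 1 := fun ω => by
      refine (ENNReal.tsum_comp_le_tsum_of_injective (f := fun s : H.Time => s.1)
        Subtype.val_injective (fun s => ENNReal.ofReal (f s ω))).trans ?_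
      rw [← ENNReal.ofReal_tsum_of_nonneg (fun s => hf0 s ω) (hf1 ω).summable, (hf1 ω).tsum_eq,
        ENNReal.ofReal_one]
    have h2 : ∫⁻ ω, ∑' s, ENNReal.ofReal (γ s ω) ∂Q = 1 := by
      have h3 := congrArg (fun ν : Measure[optional H 𝓕] _ => ν univ) htensor
      simp only [measure_univ] at h3
      rw [tensor_apply sigmaAt_le_sigmaEnd (@MeasurableSet.univ _ (optional H 𝓕))] at h3
      simp only [mem_univ, ofPred_true, Measure.restrict_univ] at h3
      rwa [lintegral_tsum fun s =>
        ((hγm s).mono (sigmaAt_le_sigmaEnd s) le_rfl).ennreal_ofReal.aemeasurable]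
    have h4 := ae_eq_of_ae_le_of_lintegral_le (μ := Q) (ae_of_all _ h1)
      (by rw [h2]; exact ENNReal.one_ne_top) aemeasurable_const (by rw [h2]; simp)
    filter_upwards [h4] with ω hω
    rw [← ENNReal.ofReal_tsum_of_nonneg (fun s => hγ0 s ω) (hs ω), ENNReal.ofReal_eq_one] at hω
    exact hω ▸ (hs ω).hasSum
  · intro h
    have hlast : H.last = ⊤ := top_le_iff.1 (Horizon.le_last h)
    have hend : sigmaEnd H 𝓕 = sigmaAt 𝓕 ⊤ := by rw [sigmaEnd, hlast]
    have hnt : ∀ n : ℕ, (n : ℕ∞) ∈ H.times := fun n =>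
      H.mem_times_of_le le_top h (ENat.natCast_ne_top n)
    refine ⟨M, fun n => ⟨hMm n, hQM n (hnt n)⟩, ?_⟩
    -- By Fatou U is P-null, so R does not charge U × {∞} and γ_∞ vanishes Q-a.s. on U. If M → ∞
    -- while γ_∞ > 0, then u n = d_n M_n ≥ γ_∞ M_n → ∞, which is the event U.
    set U : Set Ω := {ω | liminf (fun n => u n ω) atTop = ⊤} with hU
    have hUm : MeasurableSet[sigmaAt 𝓕 ⊤] U :=
      (Measurable.liminf fun n => (hum n).mono (filtration_le_sigmaAt le_top) le_rfl)
        (measurableSet_singleton ⊤)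
    have hPU : ∀ᵐ ω ∂P, ω ∉ U := by
      have h1 : ∫⁻ ω, liminf (fun n => u n ω) atTop ∂P ≤ 1 := by
        refine (lintegral_liminf_le fun n => (hum n).mono (𝓕.le n) le_rfl).trans ?_
        refine liminf_le_of_le (by isBoundedDefault) fun b hb => ?_
        obtain ⟨n, hn⟩ := hb.exists
        refine hn.trans ?_
        rw [← setLIntegral_univ, ← hu n univ (@MeasurableSet.univ _ (𝓕 n))]
        exact prob_le_one
      filter_upwards [ae_lt_top (Measurable.liminf fun n => (hum n).mono (𝓕.le n) le_rfl)
        (h1.trans_lt ENNReal.one_lt_top).ne] with ω hω hωU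
      exact hω.ne hωU
    have hUR : R (U ×ˢ {(⟨⊤, h⟩ : H.Time)}) = 0 := by
      have hm' : MeasurableSet[optional H 𝓕] (U ×ˢ {(⟨⊤, h⟩ : H.Time)}) :=
        MeasurableSpace.measurableSet_generateFrom ⟨⟨⊤, h⟩, U, hUm, rfl⟩
      refine hR.2 (measure_eq_zero_iff_ae_notMem.2 ?_)
      rw [hμ.ae_iff hm'.compl]
      filter_upwards [hPU] with ω hω s hs using hω hs.1
    rw [← hsec ⟨⊤, h⟩ U hUm, setLIntegral_eq_zero_iff (hend ▸ hUm)
      ((hγm ⟨⊤, h⟩).mono (sigmaAt_le_sigmaEnd _) le_rfl).ennreal_ofReal] at hUR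
    have hQu : ∀ᵐ ω ∂Q, ∀ n, ENNReal.ofReal (d n ω) * M n ω = u n ω := by
      refine ae_all_iff.2 fun n => ?_
      have hmn : MeasurableSet[𝓕 n] {ω | ENNReal.ofReal (d n ω) * M n ω = u n ω} :=
        measurableSet_eq_fun ((hdm n).ennreal_ofReal.mul (hMm n)) (hum n)
      have h1 : P {ω | ENNReal.ofReal (d n ω) * M n ω = u n ω}ᶜ = 0 := by
        refine ae_iff.1 ?_
        filter_upwards [hDu n] with ω hω
        simp only [hd, if_pos (hnt n)]
        exact hω
      refine ae_iff.2 ?_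
      change Q {ω | ENNReal.ofReal (d n ω) * M n ω = u n ω}ᶜ = 0
      rw [hQM n (hnt n) _ hmn.compl]
      exact setLIntegral_measure_zero _ _ h1
    filter_upwards [hUR, hQu] with ω h1 h2 h3
    by_contra hne
    have hpos : 0 < γ ⟨⊤, h⟩ ω := lt_of_le_of_ne (hγ0 _ ω) (Ne.symm hne)
    have h4 : Tendsto (fun n => u n ω) atTop (𝓝 ⊤) := by
      have h5 : Tendsto (fun n => ENNReal.ofReal (γ ⟨⊤, h⟩ ω) * M n ω) atTop (𝓝 ⊤) := by
        have := ENNReal.Tendsto.const_mul (a := ENNReal.ofReal (γ ⟨⊤, h⟩ ω)) h3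
          (Or.inl ENNReal.top_ne_zero)
        rwa [ENNReal.mul_top (by simpa using hpos)] at this
      refine tendsto_nhds_top_mono h5 (Eventually.of_forall fun n => ?_)
      change ENNReal.ofReal (γ ⟨⊤, h⟩ ω) * M n ω ≤ u n ω
      rw [← h2 n, hγt]
      exact mul_le_mul' (ENNReal.ofReal_le_ofReal (ciInf_le (hbdd ω) n)) le_rfl
    have h5 := h1 h4.liminf_eq
    simp only [ENNReal.ofReal_eq_zero] at h5
    exact absurd h5 (not_le.2 hpos)

end Decomposition

end RiskProc

namespace RiskProc

universe u

variable {Ω : Type u}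

/-! ### Zero-penalty measures -/

section ZeroPenalty

variable {m0 : MeasurableSpace Ω} {H : Horizon} {𝓕 : Filtration ℕ m0} {P : Measure Ω}
  {μ : Proc Ω H} {ρ : ℕ → Proc Ω H → Ω → ℝ} {t : ℕ}

theorem Horizon.zero_mem_times (H : Horizon) : ((0 : ℕ) : ℕ∞) ∈ H.times := by
  cases H with
  | finite T => exact (zero_le : (0 : ℕ∞) ≤ T)
  | nat => exact ENat.natCast_lt_top _
  | natInfty => trivial

theorem Horizon.mem_times_of_lt_last {H : Horizon} {t : ℕ} (ht : (t : ℕ∞) < H.last) :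
    (t : ℕ∞) ∈ H.times :=
  H.natCast_mem_times_of_le (Nat.le_succ t) (H.natCast_mem_times_of_lt_last ht)

theorem measurableSet_setOf_le {α : Type*} {m : MeasurableSpace α} {f g : α → ℝ}
    (hf : Measurable f) (hg : Measurable g) : MeasurableSet {x | f x ≤ g x} :=
  measurableSet_le hf hg

theorem measurableSet_onProd_le {X Y : Proc Ω H} (hX : X ∈ RInf H 𝓕 P) (hY : Y ∈ RInf H 𝓕 P) :
    MeasurableSet[optional H 𝓕] {p | onProd X p ≤ onProd Y p} :=
  measurableSet_setOf_le (measurable_optional_iff.2 hX.1) (measurable_optional_iff.2 hY.1)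

theorem exists_measurableSet_of_ae {α : Type*} {m : MeasurableSpace α} {ν : Measure α}
    {p : α → Prop} (h : ∀ᵐ x ∂ν, p x) :
    ∃ N, MeasurableSet N ∧ (∀ᵐ x ∂ν, x ∉ N) ∧ ∀ x, ¬ p x → x ∈ N := by
  obtain ⟨N, hN, hNm, hN0⟩ := exists_measurable_superset_of_null (ae_iff.1 h)
  exact ⟨N, hNm, measure_eq_zero_iff_ae_notMem.1 hN0, fun x hx => hN hx⟩

theorem IsReference.ae_of_ae (hμ : IsReference 𝓕 P μ) {p : OmegaBar Ω H → Prop}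
    (h : ∀ᵐ x ∂(tensor 𝓕 P μ), p x) : ∀ᵐ ω ∂P, ∀ s, p (ω, s) := by
  obtain ⟨N, hNm, hN0, hN⟩ := exists_measurableSet_of_ae h
  filter_upwards [(hμ.ae_iff hNm.compl).1 hN0] with ω hω s
  by_contra hp
  exact hω s (hN _ hp)

theorem IsReference.ae_onProd_le (hμ : IsReference 𝓕 P μ) {X Y : Proc Ω H}
    (hX : X ∈ RInf H 𝓕 P) (hY : Y ∈ RInf H 𝓕 P) (h : ∀ᵐ ω ∂P, ∀ s, X s ω ≤ Y s ω) :
    ∀ᵐ p ∂(tensor 𝓕 P μ), onProd X p ≤ onProd Y p :=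
  (hμ.ae_iff (measurableSet_onProd_le hX hY)).2 h

theorem MBar.integral_mono {R : Measure[optional H 𝓕] (OmegaBar Ω H)} (hR : R ∈ MBar 𝓕 P μ)
    (hμ : IsReference 𝓕 P μ) {X Y : Proc Ω H} (hX : X ∈ RInf H 𝓕 P) (hY : Y ∈ RInf H 𝓕 P)
    (h : ∀ᵐ ω ∂P, ∀ s, X s ω ≤ Y s ω) : ∫ p, onProd X p ∂ R ≤ ∫ p, onProd Y p ∂ R :=
  integral_mono_ae (MBar.integrable hR hμ hX) (MBar.integrable hR hμ hY)
    (hR.2 (hμ.ae_onProd_le hX hY h))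

theorem MBar.integral_congr {R : Measure[optional H 𝓕] (OmegaBar Ω H)} (hR : R ∈ MBar 𝓕 P μ)
    (hμ : IsReference 𝓕 P μ) {X Y : Proc Ω H} (hX : X ∈ RInf H 𝓕 P) (hY : Y ∈ RInf H 𝓕 P)
    (h : ∀ᵐ ω ∂P, ∀ s, X s ω = Y s ω) : ∫ p, onProd X p ∂ R = ∫ p, onProd Y p ∂ R :=
  le_antisymm (MBar.integral_mono hR hμ hX hY (h.mono fun _ h s => (h s).le))
    (MBar.integral_mono hR hμ hY hX (h.mono fun _ h s => (h s).ge))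

theorem MBar.integral_add {R : Measure[optional H 𝓕] (OmegaBar Ω H)} (hR : R ∈ MBar 𝓕 P μ)
    (hμ : IsReference 𝓕 P μ) {X Y : Proc Ω H} (hX : X ∈ RInf H 𝓕 P) (hY : Y ∈ RInf H 𝓕 P) :
    ∫ p, onProd (X + Y) p ∂ R = ∫ p, onProd X p ∂ R + ∫ p, onProd Y p ∂ R :=
  MeasureTheory.integral_add (MBar.integrable hR hμ hX) (MBar.integrable hR hμ hY)

theorem integral_onProd_neg {m : MeasurableSpace (OmegaBar Ω H)} (R : Measure[m] (OmegaBar Ω H))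
    (X : Proc Ω H) : ∫ p, onProd (-X) p ∂ R = -∫ p, onProd X p ∂ R :=
  integral_neg _

/-- The process associated with a function on the product space. -/
def ofProd (g : OmegaBar Ω H → ℝ) : Proc Ω H := fun s ω => g (ω, s)

theorem onProd_ofProd (g : OmegaBar Ω H → ℝ) : onProd (ofProd g) = g := rfl

theorem IsReference.ofProd_mem (hμ : IsReference 𝓕 P μ) {g : OmegaBar Ω H → ℝ}
    (hg : BddMeas (tensor 𝓕 P μ) g) : ofProd g ∈ RInf H 𝓕 P := hμ.mem_RInf_iff.2 hg

/-- `R` charges every position that is acceptable at time `t` nonnegatively. -/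
def ZeroPenalty (𝓕 : Filtration ℕ m0) (P : Measure Ω) (ρ : ℕ → Proc Ω H → Ω → ℝ) (t : ℕ)
    (R : Measure[optional H 𝓕] (OmegaBar Ω H)) : Prop :=
  ∀ Y ∈ RInf H 𝓕 P, (∀ᵐ ω ∂P, riskOf ρ t Y ω ≤ 0) → 0 ≤ ∫ p, onProd (proj t Y) p ∂ R

theorem proj_restr (t : ℕ) (A : Set Ω) (X : Proc Ω H) : proj t (restr t A X) = restr t A X :=
  proj_restr_of_le le_rfl A X

theorem IsCondCoherent.riskOf_restr_nonpos (hρ : IsCondCoherent 𝓕 P t (ρ t)) {Y : Proc Ω H}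
    (hY : Y ∈ RInf H 𝓕 P) (h : ∀ᵐ ω ∂P, riskOf ρ t Y ω ≤ 0) {A : Set Ω}
    (hA : MeasurableSet[𝓕 t] A) : ∀ᵐ ω ∂P, riskOf ρ t (restr t A Y) ω ≤ 0 := by
  filter_upwards [hρ.riskOf_restr hY hA, h] with ω h1 h2
  rw [h1]
  by_cases hω : ω ∈ A <;> simp [hω, h2]

theorem ZeroPenalty.restr_nonneg {R : Measure[optional H 𝓕] (OmegaBar Ω H)}
    (hR : ZeroPenalty 𝓕 P ρ t R) (hρ : IsCondCoherent 𝓕 P t (ρ t)) {Y : Proc Ω H}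
    (hY : Y ∈ RInf H 𝓕 P) (h : ∀ᵐ ω ∂P, riskOf ρ t Y ω ≤ 0) {A : Set Ω}
    (hA : MeasurableSet[𝓕 t] A) : 0 ≤ ∫ p, onProd (restr t A Y) p ∂ R := by
  rw [← proj_restr]
  exact hR _ (RInf.restr hY hA) (hρ.riskOf_restr_nonpos hY h hA)

theorem mem_acceptBar_iff (hμ : IsReference 𝓕 P μ) (hρ : IsCondCoherent 𝓕 P t (ρ t))
    (ht : (t : ℕ∞) ∈ H.times) {X : Proc Ω H} : X ∈ acceptBar 𝓕 P μ ρ t ↔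
      X ∈ RInf H 𝓕 P ∧ ∀ᵐ ω ∂P, (∀ s : H.Time, ¬ (t : ℕ∞) ≤ s.1 → 0 ≤ X s ω) ∧
        riskOf ρ t X ω ≤ 0 := by
  refine and_congr_right fun hX => ?_
  refine (hμ.ae_iff (measurableSet_onProd_le (hρ.rhoBar_mem hX) RInf.zero)).trans ?_
  refine eventually_congr (ae_of_all _ fun ω => ⟨fun h => ⟨fun s hs => ?_, ?_⟩, fun h s => ?_⟩)
  · have := h s
    simpa [onProd, rhoBar, hs] using this
  · have := h ⟨t, ht⟩
    simpa [onProd, rhoBar] using this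
  · by_cases hs : (t : ℕ∞) ≤ s.1
    · simpa [onProd, rhoBar, hs] using h.2
    · simpa [onProd, rhoBar, hs] using h.1 s hs

theorem acceptBar_indicator (hμ : IsReference 𝓕 P μ) (hρ : IsCondCoherent 𝓕 P t (ρ t))
    (ht : (t : ℕ∞) ∈ H.times) {X : Proc Ω H} (hX : X ∈ acceptBar 𝓕 P μ ρ t)
    {B : Set (OmegaBar Ω H)} (hB : MeasurableSet[optionalAt H 𝓕 t] B) :
    ofProd (B.indicator (onProd X)) ∈ acceptBar 𝓕 P μ ρ t := by
  rw [mem_acceptBar_iff hμ hρ ht] at hX ⊢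
  obtain ⟨hX, h⟩ := hX
  have hXB : ofProd (B.indicator (onProd X)) ∈ RInf H 𝓕 P :=
    hμ.ofProd_mem ((hμ.mem_RInf_iff.1 hX).indicator (optionalAt_le _ hB))
  refine ⟨hXB, ?_⟩
  obtain ⟨-, A, hA, hAs⟩ := measurableSet_optionalAt_iff.1 hB
  have h1 := hρ.riskOf_congr hXB (RInf.restr hX hA) (ae_of_all _ fun ω s hs => by
    have : (ω, s) ∈ B ↔ ω ∈ A := by rw [← hAs s hs]; rfl
    classical
    simp only [ofProd, restr, indicator_apply, if_pos hs, this]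
    rfl)
  filter_upwards [h, h1, hρ.riskOf_restr_nonpos hX (h.mono fun _ h => h.2) hA] with ω h2 h3 h4
  refine ⟨fun s hs => ?_, h3 ▸ h4⟩
  classical
  simp only [ofProd, indicator_apply]
  split_ifs
  · exact h2.1 s hs
  · exact le_rfl

theorem acceptBar_smul (hμ : IsReference 𝓕 P μ) (hρ : IsCondCoherent 𝓕 P t (ρ t))
    (ht : (t : ℕ∞) ∈ H.times) {X : Proc Ω H} (hX : X ∈ acceptBar 𝓕 P μ ρ t) {c : ℝ}
    (hc : 0 ≤ c) : c • X ∈ acceptBar 𝓕 P μ ρ t := by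
  rw [mem_acceptBar_iff hμ hρ ht] at hX ⊢
  refine ⟨RInf.smul hX.1 c, ?_⟩
  filter_upwards [hX.2, hρ.riskOf_smul hX.1 hc] with ω h1 h2
  refine ⟨fun s hs => mul_nonneg hc (h1.1 s hs), ?_⟩
  rw [h2]
  exact mul_nonpos_of_nonneg_of_nonpos hc h1.2

theorem zero_mem_acceptBar (hμ : IsReference 𝓕 P μ) (hρ : IsCondCoherent 𝓕 P t (ρ t))
    (ht : (t : ℕ∞) ∈ H.times) : (0 : Proc Ω H) ∈ acceptBar 𝓕 P μ ρ t :=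
  (mem_acceptBar_iff hμ hρ ht).2 ⟨RInf.zero, hρ.riskOf_zero.mono fun _ h =>
    ⟨fun _ _ => le_rfl, h.le⟩⟩

theorem onProd_neg_indicator (X : Proc Ω H) (B : Set (OmegaBar Ω H)) :
    onProd (-ofProd (B.indicator (onProd X))) = B.indicator (onProd (-X)) := by
  ext p
  by_cases hp : p ∈ B <;> simp [onProd, ofProd, hp]

/-- Before t an acceptable position for ρ̄_t is itself nonnegative and only helps, so the part from
t on decides. -/
theorem forall_acceptBar_iff (hμ : IsReference 𝓕 P μ) (hρ : IsCondCoherent 𝓕 P t (ρ t))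
    (ht : (t : ℕ∞) ∈ H.times) {R : Measure[optional H 𝓕] (OmegaBar Ω H)} (hR : R ∈ MBar 𝓕 P μ) :
    (∀ X ∈ acceptBar 𝓕 P μ ρ t, ∫ p, onProd (-X) p ∂ R ≤ 0) ↔ ZeroPenalty 𝓕 P ρ t R := by
  constructor
  · intro h Y hY hYρ
    have := h (proj t Y) ((mem_acceptBar_iff hμ hρ ht).2 ⟨RInf.proj hY t, hYρ.mono fun ω h =>
      ⟨fun s hs => by simp [proj, hs], by rwa [riskOf_proj]⟩⟩)
    rw [integral_onProd_neg] at this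
    linarith
  · intro h X hX
    obtain ⟨hX, h1⟩ := (mem_acceptBar_iff hμ hρ ht).1 hX
    rw [integral_onProd_neg, neg_nonpos]
    refine (h X hX (h1.mono fun _ h => h.2)).trans
      (MBar.integral_mono hR hμ (RInf.proj hX t) hX (h1.mono fun ω h s => ?_))
    by_cases hs : (t : ℕ∞) ≤ s.1
    · simp [proj, hs]
    · simpa [proj, hs] using h.1 s hs

theorem penaltyBar_eq_zero_iff (hμ : IsReference 𝓕 P μ) (hρ : IsCondCoherent 𝓕 P t (ρ t))
    (ht : (t : ℕ∞) ∈ H.times) {R : Measure[optional H 𝓕] (OmegaBar Ω H)} (hR : R ∈ MBar 𝓕 P μ) :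
    (∀ᵐ p ∂ R, penaltyBar 𝓕 P μ ρ t R p = 0) ↔ ZeroPenalty 𝓕 P ρ t R := by
  have hRp := hR.1
  rw [← forall_acceptBar_iff hμ hρ ht hR]
  have key := essSupFam_condFamily_eq_zero_iff_integral (R := R) (S := acceptBar 𝓕 P μ ρ t)
    (K := fun X => onProd (-X)) (optionalAt_le (t := t))
    (@MeasurableSet.univ _ (optionalAt H 𝓕 t))
    ⟨0, zero_mem_acceptBar hμ hρ ht, ae_of_all _ fun p => by simp [onProd]⟩
    (fun X hX => MBar.integrable hR hμ (RInf.neg hX.1))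
    fun X hX B hB => ⟨_, acceptBar_indicator hμ hρ ht hX hB,
      ae_of_all _ fun p => congrFun (onProd_neg_indicator X B) p⟩
  simp only [mem_univ, true_imp_iff, setIntegral_univ] at key
  exact key

/-- Acceptable positions form a cone, so a finite penalty is a vanishing one. This turns α_0 < ∞ in
the definition of 𝓠̄* into a linear condition. -/
theorem penaltyBar_lt_top_iff (hμ : IsReference 𝓕 P μ) (hρ : IsCondCoherent 𝓕 P t (ρ t))
    (ht : (t : ℕ∞) ∈ H.times) {R : Measure[optional H 𝓕] (OmegaBar Ω H)} (hR : R ∈ MBar 𝓕 P μ) :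
    (∀ᵐ p ∂ R, penaltyBar 𝓕 P μ ρ t R p < ⊤) ↔ ZeroPenalty 𝓕 P ρ t R := by
  have hRp := hR.1
  rw [← forall_acceptBar_iff hμ hρ ht hR]
  exact essSupFam_condFamily_lt_top_iff (R := R) (S := acceptBar 𝓕 P μ ρ t)
    (K := fun X => onProd (-X)) (optionalAt_le (t := t))
    ⟨0, zero_mem_acceptBar hμ hρ ht, ae_of_all _ fun p => by simp [onProd]⟩
    (fun X hX => MBar.integrable hR hμ (RInf.neg hX.1))
    (fun X hX B hB => ⟨_, acceptBar_indicator hμ hρ ht hX hB,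
      ae_of_all _ fun p => congrFun (onProd_neg_indicator X B) p⟩)
    fun X hX n => ⟨_, acceptBar_smul hμ hρ ht hX (Nat.cast_nonneg n),
      ae_of_all _ fun p => by simp [onProd]⟩

theorem measurableSet_penaltyOver_eq_zero {m : MeasurableSpace (OmegaBar Ω H)}
    (hm : optionalAt H 𝓕 t ≤ m) (R : Measure[m] (OmegaBar Ω H)) [IsFiniteMeasure R]
    (S : Set (Proc Ω H)) : MeasurableSet[optionalAt H 𝓕 t] {p | penaltyOver 𝓕 t S R p = 0} :=
  (isEssSup_essSupFam (optionalAt H 𝓕 t) hm R _).1 (measurableSet_singleton 0)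

/-- The event of zero penalty is 𝓕̄_t-measurable, so it has full measure under Q̄ exactly when it
does under R. -/
theorem mem_zeroSet_iff (hμ : IsReference 𝓕 P μ) (hρ : IsCondCoherent 𝓕 P t (ρ t))
    (ht : (t : ℕ∞) ∈ H.times) {m : MeasurableSpace (OmegaBar Ω H)}
    {Qb : Measure[m] (OmegaBar Ω H)} {R : Measure[optional H 𝓕] (OmegaBar Ω H)} :
    R ∈ zeroSet 𝓕 P μ ρ t Qb ↔
      R ∈ MBar 𝓕 P μ ∧ AgreeOn (optionalAt H 𝓕 t) R Qb ∧ ZeroPenalty 𝓕 P ρ t R := by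
  refine and_congr_right fun hR => and_congr_right fun h => ?_
  have hRp := hR.1
  rw [← penaltyBar_eq_zero_iff hμ hρ ht hR]
  exact (h.ae_iff (measurableSet_penaltyOver_eq_zero optionalAt_le R _)).symm

theorem mem_zeroSetStep_iff (hμ : IsReference 𝓕 P μ) (hρ : IsCondCoherent 𝓕 P t (ρ t))
    (ht : (t : ℕ∞) ∈ H.times) {r : ℕ} (htr : t ≤ r) {m : MeasurableSpace (OmegaBar Ω H)}
    {Qb : Measure[m] (OmegaBar Ω H)} {R : Measure[optionalAt H 𝓕 r] (OmegaBar Ω H)} :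
    R ∈ zeroSetStep 𝓕 P μ ρ t r Qb ↔ IsProbabilityMeasure R ∧
      AbsContOn (optionalAt H 𝓕 r) R (tensor 𝓕 P μ) ∧ AgreeOn (optionalAt H 𝓕 t) R Qb ∧
      ∀ X ∈ acceptBarStep 𝓕 P μ ρ t r, 0 ≤ ∫ p, onProd X p ∂ R := by
  refine and_congr_right fun hR => and_congr_right fun hac => and_congr_right fun h => ?_
  have hle : optionalAt H 𝓕 t ≤ optionalAt H 𝓕 r := optionalAt_mono htr
  have hint : ∀ X ∈ acceptBarStep 𝓕 P μ ρ t r, Integrable (onProd X) R := by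
    rintro X ⟨hX, hXm⟩
    obtain ⟨-, C, hC⟩ := hμ.mem_RInf_iff.1 hX.1
    exact Integrable.of_bound hXm.aestronglyMeasurable C
      (hac.ae (measurableSet_setOf_abs_le hXm C) hC)
  have key := essSupFam_condFamily_eq_zero_iff_integral (R := R)
    (S := acceptBarStep 𝓕 P μ ρ t r) (K := fun X => onProd (-X)) hle
    (@MeasurableSet.univ _ (optionalAt H 𝓕 t))
    ⟨0, ⟨zero_mem_acceptBar hμ hρ ht, measurable_const⟩, ae_of_all _ fun p => by simp [onProd]⟩
    (fun X hX => (hint X hX).neg)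
    fun X hX B hB => ⟨_, ⟨acceptBar_indicator hμ hρ ht hX.1 hB, hX.2.indicator (hle _ hB)⟩,
      ae_of_all _ fun p => congrFun (onProd_neg_indicator X B) p⟩
  simp only [mem_univ, true_imp_iff, setIntegral_univ, integral_onProd_neg, neg_nonpos] at key
  rw [← key]
  exact (h.ae_iff (measurableSet_penaltyOver_eq_zero hle R _)).symm

theorem mem_QStar_iff (hμ : IsReference 𝓕 P μ) (hρ : IsCondCoherent 𝓕 P 0 (ρ 0))
    {R : Measure[optional H 𝓕] (OmegaBar Ω H)} :
    R ∈ QStar 𝓕 P μ ρ ↔ R ∈ MBar 𝓕 P μ ∧ tensor 𝓕 P μ ≪ R ∧ ZeroPenalty 𝓕 P ρ 0 R :=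
  and_congr_right fun hR => and_congr_right fun _ =>
    penaltyBar_lt_top_iff hμ hρ H.zero_mem_times hR

end ZeroPenalty

end RiskProc

namespace RiskProc

universe u

variable {Ω : Type u}

/-! ### Existence of zero-penalty measures -/

section Existence

variable {m0 : MeasurableSpace Ω} {H : Horizon} {𝓕 : Filtration ℕ m0} {P : Measure Ω}
  {μ : Proc Ω H} {ρ : ℕ → Proc Ω H → Ω → ℝ} {t : ℕ}

theorem rhoBar_of_le {X : Proc Ω H} {s : H.Time} (hs : (t : ℕ∞) ≤ s.1) (ω : Ω) :
    rhoBar ρ t X s ω = riskOf ρ t X ω := by simp [rhoBar, hs]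

theorem rhoBar_of_not_le {X : Proc Ω H} {s : H.Time} (hs : ¬ (t : ℕ∞) ≤ s.1) (ω : Ω) :
    rhoBar ρ t X s ω = -X s ω := by simp [rhoBar, hs]

theorem measurableSet_setOf_tendsto {α : Type*} {m : MeasurableSpace α} {f : ℕ → α → ℝ}
    {g : α → ℝ} (hf : ∀ n, Measurable (f n)) (hg : Measurable g) :
    MeasurableSet {x | Tendsto (fun n => f n x) atTop (𝓝 (g x))} := by
  have : {x | Tendsto (fun n => f n x) atTop (𝓝 (g x))} =
      {x | Tendsto (fun n => f n x - g x) atTop (𝓝 0)} := by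
    ext x
    exact (tendsto_sub_nhds_zero_iff).symm
  rw [this]
  exact measurableSet_tendsto _ fun n => (hf n).sub hg

namespace IsCondCoherent

variable (hρ : IsCondCoherent 𝓕 P t (ρ t))
include hρ

theorem rhoBar_mono {X Y : Proc Ω H} (hX : X ∈ RInf H 𝓕 P) (hY : Y ∈ RInf H 𝓕 P)
    (h : ∀ᵐ ω ∂P, ∀ s, X s ω ≤ Y s ω) : ∀ᵐ ω ∂P, ∀ s, rhoBar ρ t Y s ω ≤ rhoBar ρ t X s ω := by
  filter_upwards [h, hρ.riskOf_mono hX hY (h.mono fun _ h s _ => h s)] with ω h1 h2 s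
  by_cases hs : (t : ℕ∞) ≤ s.1
  · simpa only [rhoBar_of_le hs] using h2
  · simpa only [rhoBar_of_not_le hs] using neg_le_neg (h1 s)

theorem rhoBar_add_const {X : Proc Ω H} (hX : X ∈ RInf H 𝓕 P) (c : ℝ)
    (hXc : (fun s ω => X s ω + c) ∈ RInf H 𝓕 P) :
    ∀ᵐ ω ∂P, ∀ s, rhoBar ρ t (fun s ω => X s ω + c) s ω = rhoBar ρ t X s ω - c := by
  have h1 := hρ.riskOf_congr hXc (RInf.add hX (RInf.constFrom (LInf.const t c)))
    (ae_of_all _ fun ω s hs => by simp [constFrom, hs])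
  filter_upwards [h1, hρ.riskOf_add_constFrom hX (LInf.const t c)] with ω h1 h2 s
  by_cases hs : (t : ℕ∞) ≤ s.1
  · rw [rhoBar_of_le hs, rhoBar_of_le hs, h1, h2]
  · rw [rhoBar_of_not_le hs, rhoBar_of_not_le hs]; ring

theorem rhoBar_add_le {X Y : Proc Ω H} (hX : X ∈ RInf H 𝓕 P) (hY : Y ∈ RInf H 𝓕 P) :
    ∀ᵐ ω ∂P, ∀ s, rhoBar ρ t (X + Y) s ω ≤ (rhoBar ρ t X + rhoBar ρ t Y) s ω := by
  filter_upwards [hρ.riskOf_add_le hX hY] with ω h s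
  simp only [Pi.add_apply]
  by_cases hs : (t : ℕ∞) ≤ s.1
  · simpa only [rhoBar_of_le hs] using h
  · simp only [rhoBar_of_not_le hs, Pi.add_apply]
    linarith

theorem rhoBar_smul {X : Proc Ω H} (hX : X ∈ RInf H 𝓕 P) {c : ℝ} (hc : 0 ≤ c) :
    ∀ᵐ ω ∂P, ∀ s, rhoBar ρ t (c • X) s ω = (c • rhoBar ρ t X) s ω := by
  filter_upwards [hρ.riskOf_smul hX hc] with ω h s
  simp only [Pi.smul_apply, smul_eq_mul]
  by_cases hs : (t : ℕ∞) ≤ s.1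
  · simpa only [rhoBar_of_le hs] using h
  · simp [rhoBar_of_not_le hs]

/-- Integration against R makes ρ̄_t scalar, and the sign change turns continuity from above into
continuity from below; monotone limits pass through the integral by domination. -/
theorem isUpperExp_integral_rhoBar (hμ : IsReference 𝓕 P μ) (hc : ContFromAbove 𝓕 P ρ t)
    {R : Measure[optional H 𝓕] (OmegaBar Ω H)} (hR : R ∈ MBar 𝓕 P μ) :
    IsUpperExp (tensor 𝓕 P μ)
      (fun g => ∫ p, onProd (rhoBar ρ t (ofProd fun q => -g q)) p ∂ R) := by
  have hRp := hR.1
  have hmem : ∀ {g}, BddMeas (tensor 𝓕 P μ) g → ofProd (fun q => -g q) ∈ RInf H 𝓕 P := fun hg =>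
    RInf.neg (hμ.ofProd_mem hg)
  refine ⟨fun f g hf hg h => ?_, fun f hf c => ?_, fun f g hf hg => ?_, fun f hf c hc => ?_,
    fun f g hf hg h => ?_⟩
  · refine MBar.integral_mono hR hμ (hρ.rhoBar_mem (hmem hf)) (hρ.rhoBar_mem (hmem hg))
      (hρ.rhoBar_mono (hmem hg) (hmem hf) ?_)
    filter_upwards [hμ.ae_of_ae h] with ω hω s using neg_le_neg (hω s)
  · have h1 : (ofProd fun q => -(f q + c) : Proc Ω H) =
        fun s ω => ofProd (fun q => -f q) s ω + -c := by
      ext s ω; simp only [ofProd]; ring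
    have h2 := hmem (hf.add (BddMeas.const c))
    rw [h1] at h2 ⊢
    have h3 : (fun s ω => rhoBar ρ t (ofProd fun q => -f q) s ω + c) ∈ RInf H 𝓕 P :=
      hμ.mem_RInf_iff.2 ((hμ.mem_RInf_iff.1 (hρ.rhoBar_mem (hmem hf))).add (BddMeas.const c))
    rw [MBar.integral_congr hR hμ (hρ.rhoBar_mem h2) h3 ((hρ.rhoBar_add_const (hmem hf) (-c)
      h2).mono fun ω h s => by rw [h s, sub_neg_eq_add])]
    refine (MeasureTheory.integral_add (MBar.integrable hR hμ (hρ.rhoBar_mem (hmem hf)))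
      (integrable_const c)).trans ?_
    simp
  · have h1 : (ofProd fun q => -(f q + g q) : Proc Ω H) =
        ofProd (fun q => -f q) + ofProd (fun q => -g q) := by
      ext s ω; simp only [ofProd, Pi.add_apply]; ring
    rw [h1, ← MBar.integral_add hR hμ (hρ.rhoBar_mem (hmem hf)) (hρ.rhoBar_mem (hmem hg))]
    exact MBar.integral_mono hR hμ (hρ.rhoBar_mem (RInf.add (hmem hf) (hmem hg)))
      (RInf.add (hρ.rhoBar_mem (hmem hf)) (hρ.rhoBar_mem (hmem hg)))
      (hρ.rhoBar_add_le (hmem hf) (hmem hg))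
  · have h1 : (ofProd fun q => -(c * f q) : Proc Ω H) = c • ofProd (fun q => -f q) := by
      ext s ω; simp [ofProd]
    rw [h1, MBar.integral_congr hR hμ (hρ.rhoBar_mem (RInf.smul (hmem hf) c))
      (RInf.smul (hρ.rhoBar_mem (hmem hf)) c) (hρ.rhoBar_smul (hmem hf) hc)]
    exact integral_const_mul _ _
  · have hmono := hμ.ae_of_ae h
    have h1 := hc (fun n => ofProd fun q => -f n q) (ofProd fun q => -g q) (fun n => hmem (hf n))
      (hmem hg) fun s _ => by
        filter_upwards [hmono] with ω hω
        exact ⟨fun i j hij => neg_le_neg ((hω s).1 hij), (hω s).2.neg⟩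
    have hlim : ∀ᵐ p ∂(tensor 𝓕 P μ), Tendsto
        (fun n => onProd (rhoBar ρ t (ofProd fun q => -f n q)) p) atTop
        (𝓝 (onProd (rhoBar ρ t (ofProd fun q => -g q)) p)) := by
      refine (hμ.ae_iff (measurableSet_setOf_tendsto
        (fun n => measurable_optional_iff.2 (hρ.rhoBar_mem (hmem (hf n))).1)
        (measurable_optional_iff.2 (hρ.rhoBar_mem (hmem hg)).1))).2 ?_
      filter_upwards [h1, hmono] with ω h2 h3 s
      by_cases hs : (t : ℕ∞) ≤ s.1
      · simpa only [onProd, rhoBar_of_le hs] using h2.2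
      · simpa only [onProd, rhoBar_of_not_le hs, ofProd, neg_neg] using (h3 s).2
    have hlow : ∀ n, ∀ᵐ p ∂(tensor 𝓕 P μ), onProd (rhoBar ρ t (ofProd fun q => -f 0 q)) p ≤
        onProd (rhoBar ρ t (ofProd fun q => -f n q)) p := fun n =>
      hμ.ae_onProd_le (hρ.rhoBar_mem (hmem (hf 0))) (hρ.rhoBar_mem (hmem (hf n)))
        (hρ.rhoBar_mono (hmem (hf n)) (hmem (hf 0)) (hmono.mono fun ω h s =>
          neg_le_neg ((h s).1 (Nat.zero_le n))))
    have hup : ∀ n, ∀ᵐ p ∂(tensor 𝓕 P μ), onProd (rhoBar ρ t (ofProd fun q => -f n q)) p ≤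
        onProd (rhoBar ρ t (ofProd fun q => -g q)) p := fun n =>
      hμ.ae_onProd_le (hρ.rhoBar_mem (hmem (hf n))) (hρ.rhoBar_mem (hmem hg))
        (hρ.rhoBar_mono (hmem hg) (hmem (hf n)) (hmono.mono fun ω h s =>
          neg_le_neg ((h s).1.ge_of_tendsto (h s).2 n)))
    refine tendsto_integral_of_dominated_convergence
      (fun p => |onProd (rhoBar ρ t (ofProd fun q => -f 0 q)) p| +
        |onProd (rhoBar ρ t (ofProd fun q => -g q)) p|)
      (fun n => (MBar.integrable hR hμ (hρ.rhoBar_mem (hmem (hf n)))).aestronglyMeasurable)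
      ((MBar.integrable hR hμ (hρ.rhoBar_mem (hmem (hf 0)))).abs.add
        (MBar.integrable hR hμ (hρ.rhoBar_mem (hmem hg))).abs) (fun n => ?_) (hR.2 hlim)
    filter_upwards [hR.2 (hlow n), hR.2 (hup n)] with p h2 h3
    rw [Real.norm_eq_abs]
    refine (abs_le_max_abs_abs h2 h3).trans (max_le ?_ ?_)
    · exact le_add_of_nonneg_right (abs_nonneg _)
    · exact le_add_of_nonneg_left (abs_nonneg _)

/-- Known positions are priced linearly, which forces the dominated measures below to agree with R
on 𝓕̄_t. -/
theorem rhoBar_indicator_const (hμ : IsReference 𝓕 P μ) {B : Set (OmegaBar Ω H)}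
    (hB : MeasurableSet[optionalAt H 𝓕 t] B) (c : ℝ) :
    ∀ᵐ ω ∂P, ∀ s, rhoBar ρ t (ofProd (B.indicator fun _ => c)) s ω =
      ofProd (B.indicator fun _ => -c) s ω := by
  have hmem : ofProd (B.indicator fun _ => c) ∈ RInf H 𝓕 P :=
    hμ.ofProd_mem ((BddMeas.const c).indicator (optionalAt_le _ hB))
  obtain ⟨-, A, hA, hAs⟩ := measurableSet_optionalAt_iff.1 hB
  have hAl : LInf 𝓕 P t (A.indicator fun _ => c) := (LInf.const t c).indicator hA
  have hBA : ∀ (s : H.Time) ω, (t : ℕ∞) ≤ s.1 → ((ω, s) ∈ B ↔ ω ∈ A) := fun s ω hs => by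
    rw [← hAs s hs]; rfl
  classical
  have h1 := hρ.riskOf_congr hmem (RInf.constFrom hAl) (ae_of_all _ fun ω s hs => by
    simp only [ofProd, constFrom, if_pos hs, indicator_apply, hBA s ω hs])
  filter_upwards [h1, hρ.riskOf_constFrom hAl] with ω h2 h3 s
  by_cases hs : (t : ℕ∞) ≤ s.1
  · rw [rhoBar_of_le hs, h2, h3]
    simp only [ofProd, indicator_apply, hBA s ω hs]
    split_ifs <;> simp
  · rw [rhoBar_of_not_le hs]
    simp only [ofProd, indicator_apply]
    split_ifs <;> simp

/-- For each `R` there is a zero-penalty measure that coincides with `R` up to time `t` and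
almost attains the risk of a given process. -/
theorem exists_zeroPenalty [IsProbabilityMeasure P] (hμ : IsReference 𝓕 P μ)
    (hc : ContFromAbove 𝓕 P ρ t) {R : Measure[optional H 𝓕] (OmegaBar Ω H)}
    (hR : R ∈ MBar 𝓕 P μ) {X : Proc Ω H} (hX : X ∈ RInf H 𝓕 P) {ε : ℝ} (hε : 0 < ε) :
    ∃ R' ∈ MBar 𝓕 P μ, AgreeOn (optionalAt H 𝓕 t) R' R ∧ ZeroPenalty 𝓕 P ρ t R' ∧
      ∫ p, onProd (rhoBar ρ t X) p ∂ R - ε ≤ ∫ p, onProd (-X) p ∂ R' := by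
  have hRp := hR.1
  have hP := hμ.isProbabilityMeasure
  obtain ⟨Z, hZm, hZi, hZ0, hZ1, hZψ, hZX⟩ := (hρ.isUpperExp_integral_rhoBar hμ hc hR).exists_density
    (hμ.mem_RInf_iff.1 (RInf.neg hX)) hε
  set R' := (tensor 𝓕 P μ).withDensity fun p => ENNReal.ofReal (Z p) with hR'
  have hint : ∀ g : OmegaBar Ω H → ℝ, ∫ p, g p ∂ R' = ∫ p, Z p * g p ∂(tensor 𝓕 P μ) := by
    intro g
    rw [← setIntegral_univ, setIntegral_withDensity_real hZm.ennreal_ofReal (by simp) _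
      (@MeasurableSet.univ _ (optional H 𝓕)), setIntegral_univ]
    refine integral_congr_ae ?_
    filter_upwards [hZ0] with p hp
    rw [ENNReal.toReal_ofReal hp]
  have hR'p : IsProbabilityMeasure R' := ⟨by
    rw [hR', withDensity_apply _ MeasurableSet.univ, setLIntegral_univ,
      ← ofReal_integral_eq_lintegral_ofReal hZi hZ0, hZ1, ENNReal.ofReal_one]⟩
  have hR'M : R' ∈ MBar 𝓕 P μ := ⟨hR'p, withDensity_absolutelyContinuous _ _⟩
  have hle : ∀ Y ∈ RInf H 𝓕 P, ∫ p, onProd (-Y) p ∂ R' ≤ ∫ p, onProd (rhoBar ρ t Y) p ∂ R := by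
    intro Y hY
    rw [hint]
    refine (hZψ _ (hμ.mem_RInf_iff.1 (RInf.neg hY))).trans (le_of_eq ?_)
    have : (ofProd fun q => -onProd (-Y) q) = Y := by ext; simp [ofProd, onProd]
    rw [this]
  have hcst : ∀ B, MeasurableSet[optionalAt H 𝓕 t] B → ∀ c : ℝ,
      ofProd (B.indicator fun _ => c) ∈ RInf H 𝓕 P := fun B hB c =>
    hμ.ofProd_mem ((BddMeas.const c).indicator (optionalAt_le _ hB))
  -- With c = 1 and c = -1 this gives both inequalities between R' B and R B.
  have hreal : ∀ B, MeasurableSet[optionalAt H 𝓕 t] B → ∀ c : ℝ, -c * R'.real B ≤ -c * R.real B := by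
    intro B hB c
    have hB' : MeasurableSet[optional H 𝓕] B := optionalAt_le _ hB
    have h1 := hle _ (hcst B hB c)
    rw [MBar.integral_congr hR hμ (hρ.rhoBar_mem (hcst B hB c)) (hcst B hB (-c))
      (hρ.rhoBar_indicator_const hμ hB c), integral_onProd_neg, onProd_ofProd, onProd_ofProd,
      integral_indicator_const _ hB', integral_indicator_const _ hB', smul_eq_mul, smul_eq_mul]
      at h1
    linarith
  refine ⟨R', hR'M, fun B hB => ?_, fun Y hY hYρ => ?_, ?_⟩
  · have h1 := hreal B hB 1
    have h2 := hreal B hB (-1)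
    have h3 : R'.real B = R.real B := by linarith
    exact (ENNReal.toReal_eq_toReal_iff' (measure_ne_top _ _) (measure_ne_top _ _)).1 h3
  · have hpY := RInf.proj hY t
    have h1 := hle _ hpY
    have h2 := MBar.integral_mono hR hμ (hρ.rhoBar_mem hpY) RInf.zero (hYρ.mono fun ω h s => by
      by_cases hs : (t : ℕ∞) ≤ s.1
      · rw [rhoBar_of_le hs, riskOf_proj]; exact h
      · simp [rhoBar_of_not_le hs, proj, hs])
    have h3 : ∫ p, onProd (0 : Proc Ω H) p ∂ R = 0 := integral_zero _ _
    rw [integral_onProd_neg] at h1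
    linarith
  · rw [hint]
    have : (ofProd fun q => -onProd (-X) q) = X := by ext; simp [ofProd, onProd]
    rw [this] at hZX
    exact hZX

/-- Acceptability can be tested on zero-penalty measures. -/
theorem riskOf_nonpos_of_zeroPenalty [IsProbabilityMeasure P] (hμ : IsReference 𝓕 P μ)
    (hc : ContFromAbove 𝓕 P ρ t) (ht : (t : ℕ∞) ∈ H.times) {X : Proc Ω H} (hX : X ∈ RInf H 𝓕 P)
    (h : ∀ R ∈ MBar 𝓕 P μ, ZeroPenalty 𝓕 P ρ t R → ∀ A, MeasurableSet[𝓕 t] A →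
      0 ≤ ∫ p, onProd (restr t A X) p ∂ R) : ∀ᵐ ω ∂P, riskOf ρ t X ω ≤ 0 := by
  have hP := hμ.isProbabilityMeasure
  have hPM : tensor 𝓕 P μ ∈ MBar 𝓕 P μ := ⟨hP, Measure.AbsolutelyContinuous.rfl⟩
  -- The risk of 1_A X is the positive part of ρ_t(X). If every zero-penalty measure charges 1_A X
  -- nonnegatively, near-attainment makes the P̄-integral of this positive part from t on vanish.
  set A : Set Ω := {ω | 0 < riskOf ρ t X ω} with hA
  have hAm : MeasurableSet[𝓕 t] A := (hρ.linf hX).1 measurableSet_Ioi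
  have hXA := RInf.restr hX hAm
  set Y : Proc Ω H := constFrom t (A.indicator (riskOf ρ t X)) with hY
  have hYm : Y ∈ RInf H 𝓕 P := RInf.constFrom ((hρ.linf hX).indicator hAm)
  have h1 : ∫ p, onProd (rhoBar ρ t (restr t A X)) p ∂(tensor 𝓕 P μ) ≤ 0 := by
    refine le_of_forall_pos_le_add fun ε hε => ?_
    obtain ⟨R', hR', -, hz, hle⟩ := hρ.exists_zeroPenalty hμ hc hPM hXA hε
    rw [integral_onProd_neg] at hle
    linarith [h R' hR' hz A hAm]
  rw [MBar.integral_congr hPM hμ (hρ.rhoBar_mem hXA) hYm] at h1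
  · have hY0 : ∀ p, 0 ≤ onProd Y p := fun p => by
      classical
      simp only [onProd, hY, constFrom, indicator_apply]
      split_ifs with h2 h3
      · exact le_of_lt h3
      · exact le_rfl
      · exact le_rfl
    have h2 := (integral_eq_zero_iff_of_nonneg hY0 (MBar.integrable hPM hμ hYm)).1
      (le_antisymm h1 (integral_nonneg hY0))
    filter_upwards [hμ.ae_of_ae h2] with ω hω
    have h3 := hω ⟨t, ht⟩
    by_contra! h4
    have h5 : ω ∈ A := h4
    simp [onProd, hY, constFrom, h5] at h3
    exact h4.ne' h3
  · filter_upwards [hρ.riskOf_restr hX hAm] with ω h2 s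
    by_cases hs : (t : ℕ∞) ≤ s.1
    · rw [rhoBar_of_le hs, h2]; simp [hY, constFrom, hs]
    · simp [rhoBar_of_not_le hs, hY, constFrom, restr, hs]

end IsCondCoherent

end Existence

end RiskProc

namespace RiskProc

universe u

variable {Ω : Type u}

/-! ### One-step consistency -/

section Consistency

variable {m0 : MeasurableSpace Ω} {H : Horizon} {𝓕 : Filtration ℕ m0} {P : Measure Ω}
  {μ : Proc Ω H} {ρ : ℕ → Proc Ω H → Ω → ℝ} {t : ℕ}

theorem le_iff_eq_or_succ_le {t : ℕ} (ht : (t : ℕ∞) ∈ H.times) (s : H.Time) :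
    (t : ℕ∞) ≤ s.1 ↔ s = ⟨t, ht⟩ ∨ ((t + 1 : ℕ) : ℕ∞) ≤ s.1 := by
  rw [Nat.cast_add, Nat.cast_one, ENat.add_one_le_iff (ENat.natCast_ne_top t), le_iff_eq_or_lt,
    Subtype.ext_iff]
  exact or_congr_left eq_comm

theorem not_succ_le {t : ℕ} (ht : (t : ℕ∞) ∈ H.times) :
    ¬ ((t + 1 : ℕ) : ℕ∞) ≤ (⟨t, ht⟩ : H.Time).1 := by
  change ¬ ((t + 1 : ℕ) : ℕ∞) ≤ ((t : ℕ) : ℕ∞)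
  rw [Nat.cast_le]
  omega

theorem IsCondCoherent.riskOf_neg_rhoBar (hρ : IsCondCoherent 𝓕 P t (ρ t)) {X : Proc Ω H}
    (hX : X ∈ RInf H 𝓕 P) : ∀ᵐ ω ∂P, riskOf ρ t (-rhoBar ρ t X) ω = riskOf ρ t X ω := by
  have hl := (hρ.linf hX).neg
  filter_upwards [hρ.riskOf_congr (RInf.neg (hρ.rhoBar_mem hX)) (RInf.constFrom hl)
    (ae_of_all _ fun ω s hs => by simp [rhoBar_of_le hs, constFrom, hs]),
    hρ.riskOf_constFrom hl] with ω h1 h2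
  rw [h1, h2, neg_neg]

theorem coord_neg_rhoBar_succ (ht : (t : ℕ∞) ∈ H.times) (X : Proc Ω H) :
    coord (-rhoBar ρ (t + 1) X) t = coord X t := by
  rw [coord_eq _ ht, coord_eq _ ht]
  ext ω
  simp [rhoBar_of_not_le (not_succ_le ht)]

/-- The recursive form of time consistency: X and its one-step value share the payment at t and the
risk at t+1. -/
theorem TimeConsistent.riskOf_neg_rhoBar_succ (h : TimeConsistent 𝓕 P ρ)
    (hρ : IsDynCoherent 𝓕 P ρ) (ht : (t : ℕ∞) < H.last) {X : Proc Ω H} (hX : X ∈ RInf H 𝓕 P) :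
    ∀ᵐ ω ∂P, riskOf ρ t (-rhoBar ρ (t + 1) X) ω = riskOf ρ t X ω := by
  have hρ1 := hρ (t + 1) (H.natCast_mem_times_of_lt_last ht)
  have hW := RInf.neg (hρ1.rhoBar_mem hX)
  have hc := coord_neg_rhoBar_succ (ρ := ρ) (H.mem_times_of_lt_last ht) X
  have h1 := hρ1.riskOf_neg_rhoBar hX
  filter_upwards [h t ht _ hW _ hX (ae_of_all _ fun ω => by rw [hc]) (h1.mono fun _ h => h.le),
    h t ht _ hX _ hW (ae_of_all _ fun ω => by rw [hc]) (h1.mono fun _ h => h.ge)] with ω h2 h3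
  exact le_antisymm h2 h3

/-- For the converse, the first inclusion gives ρ_t(X) ≤ ρ_t(-ρ̄_{t+1}(X)) and the second the
opposite inequality; monotonicity compares the one-step values of X and Y. Both conditions involve
acceptance only, hence can be tested on zero-penalty measures. -/
theorem timeConsistent_iff (hρ : IsDynCoherent 𝓕 P ρ) :
    TimeConsistent 𝓕 P ρ ↔ ∀ t : ℕ, (t : ℕ∞) < H.last → ∀ X ∈ RInf H 𝓕 P,
      ((∀ᵐ ω ∂P, riskOf ρ (t + 1) X ω ≤ 0) → ∀ᵐ ω ∂P, riskOf ρ t (proj (t + 1) X) ω ≤ 0) ∧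
      ((∀ᵐ ω ∂P, riskOf ρ t X ω ≤ 0) →
        ∀ᵐ ω ∂P, riskOf ρ t (-rhoBar ρ (t + 1) X) ω ≤ 0) := by
  constructor
  · intro h t ht X hX
    have hρ0 := hρ t (H.mem_times_of_lt_last ht)
    have hρ1 := hρ (t + 1) (H.natCast_mem_times_of_lt_last ht)
    refine ⟨fun h1 => ?_, fun h1 => ?_⟩
    · have h2 := h t ht _ (RInf.proj hX (t + 1)) 0 RInf.zero (ae_of_all _ fun ω => by
        rw [coord_eq _ (H.mem_times_of_lt_last ht), coord_eq _ (H.mem_times_of_lt_last ht)]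
        simp only [proj]
        rw [if_neg (not_succ_le _)]
        rfl) (by
          filter_upwards [h1, hρ1.riskOf_zero] with ω h2 h3
          rw [riskOf_proj, h3]
          exact h2)
      filter_upwards [h2, hρ0.riskOf_zero] with ω h3 h4
      rwa [h4] at h3
    · filter_upwards [h.riskOf_neg_rhoBar_succ hρ ht hX, h1] with ω h2 h3
      rwa [h2]
  · intro h t ht X hX Y hY hXY hρXY
    have htt := H.mem_times_of_lt_last ht
    have hρ0 := hρ t htt
    have hρ1 := hρ (t + 1) (H.natCast_mem_times_of_lt_last ht)
    -- the risk of `Y` dominates that of its one-step value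
    have hl := hρ0.linf hY
    have hl1 := hl.mono (Nat.le_succ t)
    have hY' : Y + constFrom t (riskOf ρ t Y) ∈ RInf H 𝓕 P := RInf.add hY (RInf.constFrom hl)
    have hWY : ∀ᵐ ω ∂P, riskOf ρ t (-rhoBar ρ (t + 1) Y) ω ≤ riskOf ρ t Y ω := by
      have h1 := (h t ht _ hY').2 (by
        filter_upwards [hρ0.riskOf_add_constFrom hY hl] with ω h1
        rw [h1, sub_self])
      have hYs : ∀ᵐ ω ∂P, riskOf ρ (t + 1) (Y + constFrom t (riskOf ρ t Y)) ω =
          riskOf ρ (t + 1) Y ω - riskOf ρ t Y ω := by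
        filter_upwards [hρ1.riskOf_congr hY' (RInf.add hY (RInf.constFrom hl1))
          (ae_of_all _ fun ω s hs => by
            have : (t : ℕ∞) ≤ s.1 := (le_iff_eq_or_succ_le htt s).2 (Or.inr hs)
            simp only [Pi.add_apply, constFrom, if_pos this, if_pos hs]),
          hρ1.riskOf_add_constFrom hY hl1] with ω h2 h3
        rw [h2, h3]
      have h2 := hρ0.riskOf_congr (RInf.neg (hρ1.rhoBar_mem hY'))
        (RInf.add (RInf.neg (hρ1.rhoBar_mem hY)) (RInf.constFrom hl)) (by
          filter_upwards [hYs] with ω h2 s hs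
          simp only [Pi.neg_apply, Pi.add_apply, constFrom, if_pos hs]
          by_cases hs1 : ((t + 1 : ℕ) : ℕ∞) ≤ s.1
          · rw [rhoBar_of_le hs1, rhoBar_of_le hs1, h2]; ring
          · rw [rhoBar_of_not_le hs1, rhoBar_of_not_le hs1]
            simp [constFrom, hs])
      filter_upwards [h1, h2, hρ0.riskOf_add_constFrom (RInf.neg (hρ1.rhoBar_mem hY)) hl]
        with ω h3 h4 h5
      rw [h4, h5] at h3
      linarith
    have hlX := hρ1.linf hX
    have hX1 : X + constFrom (t + 1) (riskOf ρ (t + 1) X) ∈ RInf H 𝓕 P :=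
      RInf.add hX (RInf.constFrom hlX)
    -- X is its one-step value plus X + ρ_{t+1}(X) from t+1 on. The second summand is acceptable at
    -- t+1, hence at t, and subadditivity applies.
    have hWX : ∀ᵐ ω ∂P, riskOf ρ t X ω ≤ riskOf ρ t (-rhoBar ρ (t + 1) X) ω := by
      have h1 := (h t ht _ hX1).1 (by
        filter_upwards [hρ1.riskOf_add_constFrom hX hlX] with ω h1
        rw [h1, sub_self])
      have h2 := hρ0.riskOf_add_le (RInf.neg (hρ1.rhoBar_mem hX)) (RInf.proj hX1 (t + 1))
      have h3 : -rhoBar ρ (t + 1) X +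
          proj (t + 1) (X + constFrom (t + 1) (riskOf ρ (t + 1) X)) = X := by
        ext s ω
        simp only [Pi.add_apply, Pi.neg_apply, proj, constFrom]
        by_cases hs1 : ((t + 1 : ℕ) : ℕ∞) ≤ s.1
        · simp only [rhoBar_of_le hs1, if_pos hs1]; ring
        · simp only [rhoBar_of_not_le hs1, if_neg hs1]; ring
      rw [h3] at h2
      filter_upwards [h1, h2] with ω h4 h5
      linarith
    have hmono := hρ0.riskOf_mono (RInf.neg (hρ1.rhoBar_mem hY)) (RInf.neg (hρ1.rhoBar_mem hX)) (by
      filter_upwards [hXY, hρXY] with ω h1 h2 s hs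
      rcases (le_iff_eq_or_succ_le htt s).1 hs with rfl | hs1
      · rw [coord_eq _ htt, coord_eq _ htt] at h1
        simp [rhoBar_of_not_le (not_succ_le htt), h1]
      · simp only [Pi.neg_apply, rhoBar_of_le hs1]
        exact neg_le_neg h2)
    filter_upwards [hWX, hmono, hWY] with ω h1 h2 h3
    exact h1.trans (h2.trans h3)

/-! ### Integral inequalities under zero penalty, and pasting over the whole space -/

theorem integral_restr {R : Measure[optional H 𝓕] (OmegaBar Ω H)} {A : Set Ω}
    (hA : MeasurableSet[𝓕 t] A) (X : Proc Ω H) :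
    ∫ p, onProd (restr t A X) p ∂ R = ∫ p in slab H t A, onProd X p ∂ R := by
  rw [onProd_restr, integral_indicator (measurableSet_slab hA)]

theorem onProd_proj (t : ℕ) (X : Proc Ω H) :
    onProd (proj t X) = (slab H t univ).indicator (onProd X) := by
  rw [← restr_univ, onProd_restr]

/-- The integrated form of E_R[Y | 𝓕̄_t] ≥ -ρ̄_t(Y): adding the cash amount ρ_t(Y) makes Y
acceptable, and before t both sides are Y. -/
theorem ZeroPenalty.setIntegral_le {R : Measure[optional H 𝓕] (OmegaBar Ω H)}
    (hz : ZeroPenalty 𝓕 P ρ t R) (hR : R ∈ MBar 𝓕 P μ) (hμ : IsReference 𝓕 P μ)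
    (hρ : IsCondCoherent 𝓕 P t (ρ t)) {Y : Proc Ω H} (hY : Y ∈ RInf H 𝓕 P)
    {B : Set (OmegaBar Ω H)} (hB : MeasurableSet[optionalAt H 𝓕 t] B) :
    ∫ p in B, onProd (-rhoBar ρ t Y) p ∂ R ≤ ∫ p in B, onProd Y p ∂ R := by
  have hl := hρ.linf hY
  have hY' : Y + constFrom t (riskOf ρ t Y) ∈ RInf H 𝓕 P := RInf.add hY (RInf.constFrom hl)
  obtain ⟨-, A, hA, hAs⟩ := measurableSet_optionalAt_iff.1 hB
  have h1 := hz.restr_nonneg hρ hY' (by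
    filter_upwards [hρ.riskOf_add_constFrom hY hl] with ω h1
    rw [h1, sub_self]) hA
  have h2 : B.indicator (onProd Y) =
      B.indicator (onProd (-rhoBar ρ t Y)) +
        onProd (restr t A (Y + constFrom t (riskOf ρ t Y))) := by
    classical
    ext ⟨ω, s⟩
    simp only [Pi.add_apply, indicator_apply, onProd, restr, Pi.neg_apply, constFrom]
    by_cases hs : (t : ℕ∞) ≤ s.1
    · have hBA : (ω, s) ∈ B ↔ ω ∈ A := by rw [← hAs s hs]; rfl
      simp only [hBA, if_pos hs, rhoBar_of_le hs]
      split_ifs <;> ring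
    · simp only [if_neg hs, rhoBar_of_not_le hs]
      split_ifs <;> ring
  have hB' : MeasurableSet[optional H 𝓕] B := optionalAt_le _ hB
  rw [← integral_indicator hB', ← integral_indicator hB', h2]
  have h3 := integral_add' (μ := R) ((MBar.integrable hR hμ (RInf.neg (hρ.rhoBar_mem hY))).indicator hB')
    (MBar.integrable hR hμ (RInf.restr hY' hA))
  rw [h3]
  linarith

theorem measurable_onProd_proj_neg_rhoBar (hρ : IsCondCoherent 𝓕 P t (ρ t)) {X : Proc Ω H}
    (hX : X ∈ RInf H 𝓕 P) {r : ℕ} (hr : r ≤ t) :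
    Measurable[optionalAt H 𝓕 t] (onProd (proj r (-rhoBar ρ t X))) := by
  rw [onProd_proj]
  exact (measurable_onProd_rhoBar hρ hX).neg.indicator
    (optionalAt_mono hr _ (measurableSet_prod_from (@MeasurableSet.univ _ (𝓕 r))))

theorem IsCondCoherent.restr_neg_rhoBar (hρ : IsCondCoherent 𝓕 P t (ρ t)) {X : Proc Ω H}
    (hX : X ∈ RInf H 𝓕 P) {r : ℕ} (hr : r ≤ t) {A : Set Ω} (hA : MeasurableSet[𝓕 r] A) :
    ∀ᵐ ω ∂P, ∀ s, restr r A (-rhoBar ρ t X) s ω = (-rhoBar ρ t (restr r A X)) s ω := by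
  have hA' := 𝓕.mono hr _ hA
  have hle : ∀ s : H.Time, (t : ℕ∞) ≤ s.1 → (r : ℕ∞) ≤ s.1 := fun s =>
    (show (r : ℕ∞) ≤ t by exact_mod_cast hr).trans
  classical
  filter_upwards [hρ.riskOf_congr (RInf.restr hX hA) (RInf.restr hX hA') (ae_of_all _ fun ω s hs => by
    simp only [restr, if_pos hs, if_pos (hle s hs)]), hρ.riskOf_restr hX hA'] with ω h1 h2 s
  simp only [restr, Pi.neg_apply, indicator_apply]
  by_cases hs : (t : ℕ∞) ≤ s.1
  · rw [rhoBar_of_le hs, rhoBar_of_le hs, if_pos (hle s hs), h1, h2, indicator_apply]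
    split_ifs <;> simp
  · rw [rhoBar_of_not_le hs, rhoBar_of_not_le hs]
    simp only [restr, indicator_apply]
    split_ifs <;> simp

theorem IsCondCoherent.integral_restr_neg_rhoBar (hρ : IsCondCoherent 𝓕 P t (ρ t))
    (hμ : IsReference 𝓕 P μ) {R : Measure[optional H 𝓕] (OmegaBar Ω H)} (hR : R ∈ MBar 𝓕 P μ)
    {X : Proc Ω H} (hX : X ∈ RInf H 𝓕 P) {r : ℕ} (hr : r ≤ t) {A : Set Ω}
    (hA : MeasurableSet[𝓕 r] A) : ∫ p, onProd (restr r A (-rhoBar ρ t X)) p ∂ R =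
      -∫ p, onProd (rhoBar ρ t (restr r A X)) p ∂ R := by
  rw [← integral_onProd_neg]
  exact MBar.integral_congr hR hμ (RInf.restr (RInf.neg (hρ.rhoBar_mem hX)) hA)
    (RInf.neg (hρ.rhoBar_mem (RInf.restr hX hA))) (hρ.restr_neg_rhoBar hX hr hA)

/-- By the tower property, since Q₁ is only used to integrate an 𝓕̄_r-measurable function and agrees
there with Q₂. -/
theorem isPasting_univ_iff {r : ℕ} {m : MeasurableSpace (OmegaBar Ω H)}
    (hm : optionalAt H 𝓕 r ≤ m) {Q₁ : Measure[m] (OmegaBar Ω H)}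
    {Q₂ R : Measure[optional H 𝓕] (OmegaBar Ω H)} [IsProbabilityMeasure Q₂]
    (h : AgreeOn (optionalAt H 𝓕 r) Q₂ Q₁) : IsPasting 𝓕 r univ Q₁ Q₂ R ↔ R = Q₂ := by
  have key : ∀ A, MeasurableSet[optional H 𝓕] A →
      ENNReal.ofReal (∫ p, (univ.indicator (Q₂[A.indicator 1 | optionalAt H 𝓕 r]) p
        + (univᶜ ∩ A).indicator 1 p) ∂Q₁) = Q₂ A := by
    intro A hA
    have h1 : ∀ p, (univ.indicator (Q₂[A.indicator (1 : OmegaBar Ω H → ℝ) | optionalAt H 𝓕 r]) p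
        + (univᶜ ∩ A).indicator (1 : OmegaBar Ω H → ℝ) p) =
        (Q₂[A.indicator (1 : OmegaBar Ω H → ℝ) | optionalAt H 𝓕 r]) p := by
      intro p; simp
    refine (congrArg ENNReal.ofReal (integral_congr_ae (ae_of_all _ h1))).trans ?_
    rw [← h.integral_eq optionalAt_le hm stronglyMeasurable_condExp.measurable,
      integral_condExp optionalAt_le]
    have h2 : ∫ p, A.indicator (1 : OmegaBar Ω H → ℝ) p ∂Q₂ = Q₂.real A := integral_indicator_one hA
    rw [h2, ofReal_measureReal]
  constructor
  · intro hR
    refine @Measure.ext _ (optional H 𝓕) _ _ fun A hA => ?_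
    rw [hR A hA, key A hA]
  · rintro rfl A hA
    rw [key A hA]

end Consistency

/-! ### Decomposition of the zero-penalty sets -/

section ZeroSets

variable {m0 : MeasurableSpace Ω} {H : Horizon} {𝓕 : Filtration ℕ m0} {P : Measure Ω}
  {μ : Proc Ω H} {ρ : ℕ → Proc Ω H → Ω → ℝ} {t : ℕ}

theorem restr_proj_succ (A : Set Ω) (X : Proc Ω H) :
    restr t A (proj (t + 1) X) = restr (t + 1) A X := by
  classical
  ext s ω
  have : ((t + 1 : ℕ) : ℕ∞) ≤ s.1 → (t : ℕ∞) ≤ s.1 :=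
    (show (t : ℕ∞) ≤ ((t + 1 : ℕ) : ℕ∞) by exact_mod_cast Nat.le_succ t).trans
  simp only [restr, proj, indicator_apply]
  split_ifs <;> tauto

/-- The dual of the first inclusion: there are fewer acceptable positions at t+1 than at t, so fewer
constraints on R. -/
theorem TimeConsistent.zeroPenalty_succ (h : TimeConsistent 𝓕 P ρ) (hρ : IsDynCoherent 𝓕 P ρ)
    (ht : (t : ℕ∞) < H.last) {R : Measure[optional H 𝓕] (OmegaBar Ω H)}
    (hR : ZeroPenalty 𝓕 P ρ t R) : ZeroPenalty 𝓕 P ρ (t + 1) R := by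
  intro Y hY hYρ
  have h1 := hR _ (RInf.proj hY (t + 1)) (((timeConsistent_iff hρ).1 h t ht Y hY).1 hYρ)
  rwa [← restr_univ, restr_proj_succ, restr_univ] at h1

theorem agreeOn_trim {α : Type*} {m m0 : MeasurableSpace α} (hm : m ≤ m0) (R : Measure α) :
    AgreeOn m R (R.trim hm) := fun _ hE => (trim_measurableSet_eq hm hE).symm

theorem AgreeOn.trans {α : Type*} {m m1 m2 m3 : MeasurableSpace α} {Q₁ : Measure[m1] α}
    {Q₂ : Measure[m2] α} {Q₃ : Measure[m3] α} (h : AgreeOn m Q₁ Q₂) (h' : AgreeOn m Q₂ Q₃) :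
    AgreeOn m Q₁ Q₃ := fun E hE => (h E hE).trans (h' E hE)

theorem AgreeOn.mono {α : Type*} {m m' m1 m2 : MeasurableSpace α} (hm : m ≤ m') {Q₁ : Measure[m1] α}
    {Q₂ : Measure[m2] α} (h : AgreeOn m' Q₁ Q₂) : AgreeOn m Q₁ Q₂ := fun E hE => h E (hm E hE)

theorem trim_mem_zeroSetStep (hμ : IsReference 𝓕 P μ) (hρ : IsCondCoherent 𝓕 P t (ρ t))
    (ht : (t : ℕ∞) ∈ H.times) {R : Measure[optional H 𝓕] (OmegaBar Ω H)} (hR : R ∈ MBar 𝓕 P μ)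
    (hz : ZeroPenalty 𝓕 P ρ t R) {r : ℕ} (htr : t ≤ r)
    {R' : Measure[optionalAt H 𝓕 r] (OmegaBar Ω H)} (hRR' : AgreeOn (optionalAt H 𝓕 r) R R')
    {m : MeasurableSpace (OmegaBar Ω H)} {Qb : Measure[m] (OmegaBar Ω H)}
    (hag : AgreeOn (optionalAt H 𝓕 t) R Qb) :
    R' ∈ zeroSetStep 𝓕 P μ ρ t r Qb := by
  have hRp := hR.1
  rw [mem_zeroSetStep_iff hμ hρ ht htr]
  refine ⟨⟨?_⟩, fun E hE h0 => ?_, (hRR'.mono (optionalAt_mono htr)).symm.trans hag,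
    fun X hX => ?_⟩
  · rw [← hRR' univ MeasurableSet.univ, measure_univ]
  · rw [← hRR' E hE]; exact hR.2 h0
  · rw [← hRR'.integral_eq optionalAt_le le_rfl hX.2]
    have h1 := (forall_acceptBar_iff hμ hρ ht hR).2 hz X hX.1
    rw [integral_onProd_neg] at h1
    linarith

/-- As the pasting is Q₂ itself, the identity says that zero penalty at t is the same as zero
penalty at t on the σ-field at t+1 together with zero penalty at t+1. The two directions of this
correspond to the two inclusions in `timeConsistent_iff`. -/
theorem timeConsistent_iff_zeroSet [IsProbabilityMeasure P] (hμ : IsReference 𝓕 P μ)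
    (hρ : IsDynCoherent 𝓕 P ρ)
    (hcont : ∀ t : ℕ, (t : ℕ∞) ∈ H.times → ContFromAbove 𝓕 P ρ t) :
    TimeConsistent 𝓕 P ρ ↔
      ∀ t : ℕ, (t : ℕ∞) < H.last → ∀ Qb ∈ MBar 𝓕 P μ,
        zeroSet 𝓕 P μ ρ t Qb =
          {R | ∃ Q₁ ∈ zeroSetStep 𝓕 P μ ρ t (t + 1) Qb, ∃ Q₂ ∈ zeroSet 𝓕 P μ ρ (t + 1) Q₁,
            IsPasting 𝓕 (t + 1) Set.univ Q₁ Q₂ R} := by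
  constructor
  · intro h t ht Qb _
    have htt := H.mem_times_of_lt_last ht
    have htt1 := H.natCast_mem_times_of_lt_last ht
    have hρ0 := hρ t htt
    have hρ1 := hρ (t + 1) htt1
    ext R
    constructor
    · intro hR
      obtain ⟨hRM, hag, hz⟩ := (mem_zeroSet_iff hμ hρ0 htt).1 hR
      have hRp := hRM.1
      have htrim := agreeOn_trim (optionalAt_le (H := H) (𝓕 := 𝓕) (t := t + 1)) R
      refine ⟨R.trim optionalAt_le,
        trim_mem_zeroSetStep hμ hρ0 htt hRM hz (Nat.le_succ t) htrim hag, R,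
        (mem_zeroSet_iff hμ hρ1 htt1).2 ⟨hRM, htrim, h.zeroPenalty_succ hρ ht hz⟩,
        (isPasting_univ_iff le_rfl htrim).2 rfl⟩
    · rintro ⟨Q₁, hQ₁, Q₂, hQ₂, hp⟩
      obtain ⟨hQ₁p, -, hag, hstep⟩ := (mem_zeroSetStep_iff hμ hρ0 htt (Nat.le_succ t)).1 hQ₁
      obtain ⟨hQ₂M, hag2, hz⟩ := (mem_zeroSet_iff hμ hρ1 htt1).1 hQ₂
      have hQ₂p := hQ₂M.1
      rw [isPasting_univ_iff le_rfl hag2] at hp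
      subst hp
      refine (mem_zeroSet_iff hμ hρ0 htt).2 ⟨hQ₂M,
        (hag2.mono (optionalAt_mono (Nat.le_succ t))).trans hag, fun Y hY hYρ => ?_⟩
      -- The one-step value W of Y is acceptable at t and measurable at t+1, so Q₁ charges it
      -- nonnegatively; zero penalty at t+1 bounds the integral of Y below by that of W.
      have hW := RInf.neg (hρ1.rhoBar_mem hY)
      have hWρ := ((timeConsistent_iff hρ).1 h t ht Y hY).2 hYρ
      have hWm := measurable_onProd_proj_neg_rhoBar hρ1 hY (Nat.le_succ t)
      have h1 := hstep (proj t (-rhoBar ρ (t + 1) Y)) ⟨(mem_acceptBar_iff hμ hρ0 htt).2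
        ⟨RInf.proj hW t, hWρ.mono fun ω h1 => ⟨fun s hs => by simp [proj, hs], by
          rwa [riskOf_proj]⟩⟩, hWm⟩
      rw [← hag2.integral_eq optionalAt_le le_rfl hWm, onProd_proj,
        integral_indicator (measurableSet_slab (@MeasurableSet.univ _ (𝓕 t)))] at h1
      rw [onProd_proj, integral_indicator (measurableSet_slab (@MeasurableSet.univ _ (𝓕 t)))]
      exact h1.trans (hz.setIntegral_le hQ₂M hμ hρ1 hY
        (optionalAt_mono (Nat.le_succ t) _ (measurableSet_prod_from (@MeasurableSet.univ _ (𝓕 t)))))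
  · intro h
    refine (timeConsistent_iff hρ).2 fun t ht X hX => ?_
    have htt := H.mem_times_of_lt_last ht
    have htt1 := H.natCast_mem_times_of_lt_last ht
    have hρ0 := hρ t htt
    have hρ1 := hρ (t + 1) htt1
    refine ⟨fun hXρ => ?_, fun hXρ => ?_⟩
    · refine hρ0.riskOf_nonpos_of_zeroPenalty hμ (hcont t htt) htt (RInf.proj hX (t + 1))
        fun R hR hz A hA => ?_
      have h1 : R ∈ zeroSet 𝓕 P μ ρ t R :=
        (mem_zeroSet_iff hμ hρ0 htt).2 ⟨hR, fun _ _ => rfl, hz⟩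
      rw [h t ht R hR] at h1
      obtain ⟨Q₁, -, Q₂, hQ₂, hp⟩ := h1
      obtain ⟨hQ₂M, hag2, hz2⟩ := (mem_zeroSet_iff hμ hρ1 htt1).1 hQ₂
      have hQ₂p := hQ₂M.1
      rw [isPasting_univ_iff le_rfl hag2] at hp
      subst hp
      rw [restr_proj_succ]
      exact hz2.restr_nonneg hρ1 hX hXρ (𝓕.mono (Nat.le_succ t) _ hA)
    · have hW := RInf.neg (hρ1.rhoBar_mem hX)
      refine hρ0.riskOf_nonpos_of_zeroPenalty hμ (hcont t htt) htt hW fun R hR hz A hA => ?_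
      have hXA := RInf.restr hX hA
      have hRp := hR.1
      rw [hρ1.integral_restr_neg_rhoBar hμ hR hX (Nat.le_succ t) hA, neg_nonneg]
      refine le_of_forall_pos_le_add fun ε hε => ?_
      -- R' prices the future beyond t+1 almost at ρ_{t+1}, while R fixes everything up to t+1.
      -- Statement 2 gives R' zero penalty at t, so it charges the acceptable 1_A X nonnegatively.
      obtain ⟨R', hR'M, hag, hz', hle⟩ := hρ1.exists_zeroPenalty hμ (hcont _ htt1) hR hXA hε
      have hR'p := hR'M.1
      have htrim := agreeOn_trim (optionalAt_le (H := H) (𝓕 := 𝓕) (t := t + 1)) R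
      have h1 : R' ∈ zeroSet 𝓕 P μ ρ t R := by
        rw [h t ht R hR]
        exact ⟨R.trim optionalAt_le, trim_mem_zeroSetStep hμ hρ0 htt hR hz (Nat.le_succ t) htrim
          fun _ _ => rfl, R', (mem_zeroSet_iff hμ hρ1 htt1).2 ⟨hR'M, hag.trans htrim, hz'⟩,
          (isPasting_univ_iff le_rfl (hag.trans htrim)).2 rfl⟩
      have h2 := ((mem_zeroSet_iff hμ hρ0 htt).1 h1).2.2.restr_nonneg hρ0 hX hXρ hA
      rw [integral_onProd_neg] at hle
      linarith

end ZeroSets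

end RiskProc

namespace RiskProc

universe u

variable {Ω : Type u}

/-! ### Penalties and supermartingales in terms of models -/

section Models

variable {m0 : MeasurableSpace Ω} {H : Horizon} {𝓕 : Filtration ℕ m0} {P : Measure Ω}
  {μ : Proc Ω H} {ρ : ℕ → Proc Ω H → Ω → ℝ} {t : ℕ}

/-- The random variable `∑_{s ∈ 𝕋_t} γ_s X_s`. -/
noncomputable def weighted (γ X : Proc Ω H) (t : ℕ) : Ω → ℝ :=
  fun ω => ∑' s : H.Time, proj t γ s ω * X s ω

theorem weighted_neg (γ X : Proc Ω H) (t : ℕ) : weighted γ (-X) t = -weighted γ X t := by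
  ext ω
  simp [weighted, tsum_neg]

theorem weighted_proj (γ X : Proc Ω H) (t : ℕ) : weighted γ (proj t X) t = weighted γ X t := by
  ext ω
  refine tsum_congr fun s => ?_
  simp only [proj]
  split_ifs <;> simp

namespace IsModel

variable {Q : Measure[sigmaEnd H 𝓕] Ω} {γ : Proc Ω H}

theorem ae_disc (hQ : IsModel 𝓕 P Q γ) (ht : (t : ℕ∞) ∈ H.times) :
    ∀ᵐ ω ∂Q, 0 ≤ disc γ t ω ∧ disc γ t ω ≤ 1 := by
  filter_upwards [hQ.ae_hasSum] with ω h using disc_mem_Icc_of_hasSum h.2 h.1 ht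

theorem ae_hasSum_proj (hQ : IsModel 𝓕 P Q γ) (ht : (t : ℕ∞) ∈ H.times) :
    ∀ᵐ ω ∂Q, HasSum (fun s => proj t γ s ω) (disc γ t ω) := by
  filter_upwards [hQ.ae_hasSum] with ω h using hasSum_proj h.2 ht

/-- The bound on X holds (Q ⊗ γ)-a.e., that is, only where γ_s > 0; at ∞ it may fail under Q
elsewhere. This suffices because the weights vanish there. The bound C D_t makes division by D_t
harmless. -/
theorem ae_weighted [IsProbabilityMeasure P] (hQ : IsModel 𝓕 P Q γ) (hμ : IsReference 𝓕 P μ)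
    (ht : (t : ℕ∞) ∈ H.times) {X : Proc Ω H} (hX : X ∈ RInf H 𝓕 P) :
    ∃ C : ℝ, ∀ᵐ ω ∂Q, HasSum (fun s => proj t γ s ω * X s ω) (weighted γ X t ω) ∧
      |weighted γ X t ω| ≤ C * disc γ t ω := by
  obtain ⟨hXm, C, hC⟩ := MBar.bddMeas (hQ.tensor_mem_MBar hμ) hμ hX
  rw [ae_tensor_iff sigmaAt_le_sigmaEnd hQ.2.adapted (measurableSet_setOf_abs_le hXm C),
    ← ae_all_iff] at hC
  refine ⟨C, ?_⟩
  filter_upwards [hC, hQ.ae_hasSum, hQ.ae_hasSum_proj ht] with ω h1 h2 h3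
  have hb : ∀ s, |proj t γ s ω * X s ω| ≤ C * proj t γ s ω := fun s => by
    simp only [proj]
    split_ifs
    · rcases (h2.1 s).eq_or_lt with h4 | h4
      · simp [← h4]
      · rw [abs_mul, abs_of_pos h4, mul_comm]
        exact mul_le_mul_of_nonneg_right (h1 s h4) h4.le
    · simp
  have hs := h3.mul_left C
  have hs' : Summable fun s => proj t γ s ω * X s ω := Summable.of_norm_bounded hs.summable hb
  refine ⟨hs'.hasSum, ?_⟩
  have h5 : ‖∑' s, proj t γ s ω * X s ω‖ ≤ C * disc γ t ω :=
    tsum_of_norm_bounded hs (f := fun s => proj t γ s ω * X s ω) hb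
  exact h5

theorem integrable_weighted [IsProbabilityMeasure P] (hQ : IsModel 𝓕 P Q γ)
    (hμ : IsReference 𝓕 P μ) (ht : (t : ℕ∞) ∈ H.times) {X : Proc Ω H} (hX : X ∈ RInf H 𝓕 P) :
    Integrable (weighted γ X t) Q := by
  have hQp := hQ.isProbabilityMeasure
  obtain ⟨C, hC⟩ := hQ.ae_weighted hμ ht hX
  refine Integrable.of_bound (C := |C|) ?_ ?_
  · have hγm : ∀ s, Measurable[sigmaEnd H 𝓕] fun ω => proj t γ s ω * X s ω := fun s => by
      have h1 : Measurable[sigmaEnd H 𝓕] (γ s) := (hQ.2.adapted s).mono (sigmaAt_le_sigmaEnd s) le_rfl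
      have h2 : Measurable[sigmaEnd H 𝓕] (X s) := (hX.1 s).mono (sigmaAt_le_sigmaEnd s) le_rfl
      simp only [proj]
      split_ifs
      · exact h1.mul h2
      · simp
    refine aestronglyMeasurable_of_tendsto_ae (u := (atTop : Filter (Finset H.Time)))
      (f := fun F ω => ∑ s ∈ F, proj t γ s ω * X s ω) (fun F => ?_) ?_
    · exact (Finset.measurable_fun_sum F fun s _ => hγm s).aestronglyMeasurable
    · filter_upwards [hC] with ω h using h.1
  · filter_upwards [hC, hQ.ae_disc ht] with ω h1 h2
    rw [Real.norm_eq_abs]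
    refine h1.2.trans ((mul_le_mul_of_nonneg_right (le_abs_self C) h2.1).trans ?_)
    exact mul_le_of_le_one_right (abs_nonneg C) h2.2

theorem setIntegral_weighted [IsProbabilityMeasure P] (hQ : IsModel 𝓕 P Q γ)
    (hμ : IsReference 𝓕 P μ) (ht : (t : ℕ∞) ∈ H.times) {X : Proc Ω H} (hX : X ∈ RInf H 𝓕 P)
    {A : Set Ω} (hA : MeasurableSet[𝓕 t] A) :
    ∫ ω in A, weighted γ X t ω ∂Q = ∫ p, onProd (restr t A X) p ∂(tensor 𝓕 Q γ) := by
  have hXA := RInf.restr hX hA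
  rw [integral_tensor sigmaAt_le_sigmaEnd hQ.2.adapted hQ.2.nonneg hXA.1
    (MBar.integrable (hQ.tensor_mem_MBar hμ) hμ hXA),
    ← integral_indicator (filtration_le_sigmaEnd ht _ hA)]
  refine integral_congr_ae (ae_of_all _ fun ω => ?_)
  classical
  simp only [indicator_apply, weighted, restr, proj]
  split_ifs
  · refine tsum_congr fun s => ?_
    split_ifs <;> simp
  · simp

theorem ae_weighted_constFrom (hQ : IsModel 𝓕 P Q γ) (ht : (t : ℕ∞) ∈ H.times) (f : Ω → ℝ)
    {X : Proc Ω H} (hX : ∀ s : H.Time, (t : ℕ∞) ≤ s.1 → X s = f) :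
    ∀ᵐ ω ∂Q, weighted γ X t ω = disc γ t ω * f ω := by
  filter_upwards [hQ.ae_hasSum_proj ht] with ω h
  refine (HasSum.tsum_eq ?_)
  convert! h.mul_right (f ω) using 2 with s
  simp only [proj]
  split_ifs with hs
  · rw [hX s hs]
  · simp

/-- The weights are γ_t = D_t - D_{t+1} on X_t and D_{t+1} in total on -ρ_{t+1}(X); collecting terms
gives the expression of statement 3. -/
theorem ae_weighted_neg_rhoBar_succ (hQ : IsModel 𝓕 P Q γ) (ht : (t : ℕ∞) < H.last)
    (X : Proc Ω H) :
    ∀ᵐ ω ∂Q, weighted γ (-rhoBar ρ (t + 1) X) t ω = disc γ t ω * coord X t ω -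
      disc γ (t + 1) ω * (coord X t ω + riskOf ρ (t + 1) X ω) := by
  have htt := H.mem_times_of_lt_last ht
  filter_upwards [hQ.ae_hasSum_proj htt, hQ.ae_hasSum_proj (H.natCast_mem_times_of_lt_last ht)]
    with ω h1 h2
  refine HasSum.tsum_eq ?_
  convert! (h1.mul_right (coord X t ω)).sub
    (h2.mul_right (coord X t ω + riskOf ρ (t + 1) X ω)) using 2 with s
  simp only [proj, Pi.neg_apply]
  by_cases hs1 : ((t + 1 : ℕ) : ℕ∞) ≤ s.1
  · rw [if_pos hs1, if_pos ((le_iff_eq_or_succ_le htt s).2 (Or.inr hs1)), rhoBar_of_le hs1]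
    ring
  · rw [if_neg hs1, rhoBar_of_not_le hs1]
    split_ifs with hs
    · rcases (le_iff_eq_or_succ_le htt s).1 hs with rfl | hs'
      · rw [coord_eq X htt]; ring
      · exact absurd hs' hs1
    · ring

theorem integrable_disc_mul (hQ : IsModel 𝓕 P Q γ) {r k : ℕ} (hr : (r : ℕ∞) ∈ H.times)
    (hk : (k : ℕ∞) ∈ H.times) {f : Ω → ℝ} (hf : LInf 𝓕 P r f) :
    Integrable (fun ω => disc γ k ω * f ω) Q := by
  have hQp := hQ.isProbabilityMeasure
  obtain ⟨hfm, C, hC⟩ := hf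
  have hC' := hQ.ae_of_ae hr (measurableSet_setOf_abs_le hfm C) hC
  have h1 : Measurable[sigmaEnd H 𝓕] (disc γ k) :=
    (disc_measurable hQ.2.adapted hk).mono (filtration_le_sigmaEnd hk) le_rfl
  have h2 : Measurable[sigmaEnd H 𝓕] f := hfm.mono (filtration_le_sigmaEnd hr) le_rfl
  refine Integrable.of_bound (C := C) (h1.mul h2).aestronglyMeasurable ?_
  filter_upwards [hC', hQ.ae_disc hk] with ω h3 h4
  rw [Real.norm_eq_abs, abs_mul, abs_of_nonneg h4.1]
  exact (mul_le_of_le_one_left (abs_nonneg _) h4.2).trans h3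

/-- Dividing by the 𝓕_t-measurable D_t > 0 does not change the sign of a conditional expectation,
and on {D_t = 0} the weighted sums vanish, so the restriction to {D_t > 0} loses nothing. -/
theorem penalty_eq_zero_iff [IsProbabilityMeasure P] (hQ : IsModel 𝓕 P Q γ)
    (hμ : IsReference 𝓕 P μ) (hρ : IsCondCoherent 𝓕 P t (ρ t)) (ht : (t : ℕ∞) ∈ H.times) :
    (∀ᵐ ω ∂Q, 0 < disc γ t ω → penalty 𝓕 P ρ t Q γ ω = 0) ↔
      ZeroPenalty 𝓕 P ρ t (tensor 𝓕 Q γ) := by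
  have hQp := hQ.isProbabilityMeasure
  have hm := filtration_le_sigmaEnd (H := H) (𝓕 := 𝓕) ht
  have hDm := disc_measurable hQ.2.adapted ht
  set E : Set Ω := {ω | 0 < disc γ t ω} with hE
  have hEm : MeasurableSet[𝓕 t] E := hDm measurableSet_Ioi
  set K : Proc Ω H → Ω → ℝ := fun X ω =>
    ∑' s : H.Time, proj t (fun s ω => γ s ω / disc γ t ω) s ω * (-X) s ω with hK
  have hKX : ∀ X, K X = fun ω => (disc γ t ω)⁻¹ * weighted γ (-X) t ω := by
    intro X
    ext ω
    simp only [hK, weighted]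
    rw [← tsum_mul_left]
    refine tsum_congr fun s => ?_
    simp only [proj]
    split_ifs
    · ring
    · simp
  have h1 : (∀ᵐ ω ∂Q, 0 < disc γ t ω → penalty 𝓕 P ρ t Q γ ω = 0) ↔
      ∀ᵐ ω ∂Q, ω ∈ E → essSupFam (𝓕 t) Q (condFamily (𝓕 t) Q (accept 𝓕 P ρ t) K) ω = 0 := by
    refine eventually_congr (ae_of_all _ fun ω => forall_congr' fun hω => ?_)
    rw [penalty, if_pos hω]
    rfl
  rw [h1, essSupFam_condFamily_eq_zero_iff hm hEm ⟨0, mem_accept_iff.2 ⟨0, RInf.zero, by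
    ext; simp [proj], hρ.riskOf_zero.mono fun _ h => h.le⟩, ae_of_all _ fun ω => by
      simp [hK]⟩]
  have h2 : ∀ Y ∈ RInf H 𝓕 P, (∀ᵐ ω ∂Q, ω ∈ E → (Q[K (proj t Y) | 𝓕 t]) ω ≤ 0) ↔
      ∀ A, MeasurableSet[𝓕 t] A → 0 ≤ ∫ p, onProd (restr t (A ∩ E) Y) p ∂(tensor 𝓕 Q γ) := by
    intro Y hY
    have hi := hQ.integrable_weighted hμ ht (RInf.neg (RInf.proj hY t))
    have hi' : Integrable (fun ω => (disc γ t ω)⁻¹ * weighted γ (-proj t Y) t ω) Q := by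
      obtain ⟨C, hC⟩ := hQ.ae_weighted hμ ht (RInf.neg (RInf.proj hY t))
      refine Integrable.of_bound (C := |C|)
        ((hDm.mono hm le_rfl).inv.aestronglyMeasurable.mul hi.aestronglyMeasurable) ?_
      filter_upwards [hC, hQ.ae_disc ht] with ω h3 h4
      rw [Real.norm_eq_abs, abs_mul, abs_inv, abs_of_nonneg h4.1]
      rcases h4.1.eq_or_lt with h5 | h5
      · simp [← h5]
      · rw [inv_mul_le_iff₀ h5, mul_comm]
        exact h3.2.trans (mul_le_mul_of_nonneg_right (le_abs_self C) h4.1)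
    have h3 : Q[K (proj t Y) | 𝓕 t] =ᵐ[Q] fun ω =>
        (disc γ t ω)⁻¹ * (Q[weighted γ (-proj t Y) t | 𝓕 t]) ω := by
      rw [hKX]
      exact condExp_mul_of_stronglyMeasurable_left (f := fun ω => (disc γ t ω)⁻¹)
        hDm.inv.stronglyMeasurable hi' hi
    have h4 : (∀ᵐ ω ∂Q, ω ∈ E → (Q[K (proj t Y) | 𝓕 t]) ω ≤ 0) ↔
        ∀ᵐ ω ∂Q, ω ∈ E → (Q[weighted γ (-proj t Y) t | 𝓕 t]) ω ≤ 0 := by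
      refine eventually_congr ?_
      filter_upwards [h3] with ω h5
      refine forall_congr' fun hω => ?_
      rw [h5]
      have : 0 < (disc γ t ω)⁻¹ := inv_pos.2 hω
      constructor
      · intro h; by_contra! h'; exact absurd h (not_le.2 (mul_pos this h'))
      · intro h; exact mul_nonpos_of_nonneg_of_nonpos this.le h
    rw [h4, condExp_nonpos_on_iff hm hi hEm]
    refine forall₂_congr fun A hA => ?_
    rw [weighted_neg, weighted_proj]
    simp only [Pi.neg_apply]
    rw [integral_neg, neg_nonpos, hQ.setIntegral_weighted hμ ht hY (hA.inter hEm)]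
  constructor
  · intro h Y hY hYρ
    have h3 := (h2 Y hY).1 (h _ (mem_accept_iff.2 ⟨Y, hY, rfl, hYρ⟩)) univ
      (@MeasurableSet.univ _ (𝓕 t))
    rw [univ_inter, ← hQ.setIntegral_weighted hμ ht hY hEm] at h3
    rw [← restr_univ, ← hQ.setIntegral_weighted hμ ht hY (@MeasurableSet.univ _ (𝓕 t)),
      setIntegral_univ]
    rwa [setIntegral_eq_integral_of_ae_compl_eq_zero] at h3
    obtain ⟨C, hC⟩ := hQ.ae_weighted hμ ht hY
    filter_upwards [hC, hQ.ae_disc ht] with ω h4 h5 hω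
    have h6 : disc γ t ω = 0 := le_antisymm (not_lt.1 hω) h5.1
    rw [h6, mul_zero] at h4
    exact abs_nonpos_iff.1 h4.2
  · intro h X hX
    obtain ⟨Y, hY, rfl, hYρ⟩ := mem_accept_iff.1 hX
    exact (h2 Y hY).2 fun A hA => h.restr_nonneg hρ hY hYρ (hA.inter hEm)

end IsModel

/-- The one-step supermartingale inequality on `𝓕_t`-measurable events. -/
theorem IsModel.setIntegral_step_le [IsProbabilityMeasure P] {Q : Measure[sigmaEnd H 𝓕] Ω}
    {γ : Proc Ω H} (hQ : IsModel 𝓕 P Q γ) (hμ : IsReference 𝓕 P μ) (hρ : IsDynCoherent 𝓕 P ρ)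
    (h : TimeConsistent 𝓕 P ρ) (ht : (t : ℕ∞) < H.last)
    (hz : ZeroPenalty 𝓕 P ρ t (tensor 𝓕 Q γ)) {X : Proc Ω H} (hX : X ∈ RInf H 𝓕 P) {A : Set Ω}
    (hA : MeasurableSet[𝓕 t] A) :
    ∫ ω in A, disc γ (t + 1) ω * (coord X t ω + riskOf ρ (t + 1) X ω) ∂Q ≤
      ∫ ω in A, disc γ t ω * (coord X t ω + riskOf ρ t X ω) ∂Q := by
  have htt := H.mem_times_of_lt_last ht
  have htt1 := H.natCast_mem_times_of_lt_last ht
  have hρ0 := hρ t htt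
  have hρ1 := hρ (t + 1) htt1
  have hW := RInf.neg (hρ1.rhoBar_mem hX)
  have hRM := hQ.tensor_mem_MBar hμ
  have hX0 := RInf.coord hX htt
  have hl0 := hρ0.linf hX
  -- Zero penalty at t is applied to the one-step value of X, whose risk at t equals that of X by
  -- time consistency.
  have h1 := hz.setIntegral_le hRM hμ hρ0 hW (measurableSet_prod_from (H := H) hA)
  rw [← integral_restr hA, ← integral_restr hA,
    ← hQ.setIntegral_weighted hμ htt (RInf.neg (hρ0.rhoBar_mem hW)) hA,
    ← hQ.setIntegral_weighted hμ htt hW hA] at h1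
  have h2 : ∀ᵐ ω ∂Q, weighted γ (-rhoBar ρ t (-rhoBar ρ (t + 1) X)) t ω =
      -(disc γ t ω * riskOf ρ t X ω) := by
    filter_upwards [hQ.ae_weighted_constFrom htt
      (fun ω => -riskOf ρ t (-rhoBar ρ (t + 1) X) ω) (X := -rhoBar ρ t (-rhoBar ρ (t + 1) X))
      (fun s hs => by ext ω; simp [rhoBar_of_le hs]),
      hQ.ae_of_ae htt (p := fun ω => riskOf ρ t (-rhoBar ρ (t + 1) X) ω = riskOf ρ t X ω)
        (measurableSet_eq_fun (hρ0.linf hW).1 hl0.1)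
        (h.riskOf_neg_rhoBar_succ hρ ht hX)] with ω h3 h4
    rw [h3, h4, mul_neg]
  rw [integral_congr_ae (ae_restrict_of_ae h2),
    integral_congr_ae (ae_restrict_of_ae (hQ.ae_weighted_neg_rhoBar_succ ht X)), integral_neg,
    integral_sub (hQ.integrable_disc_mul htt htt hX0).integrableOn
      (hQ.integrable_disc_mul htt1 htt1 ((hX0.mono (Nat.le_succ t)).add (hρ1.linf hX))).integrableOn]
    at h1
  have h5 : ∀ ω, disc γ t ω * (coord X t ω + riskOf ρ t X ω) =
      disc γ t ω * coord X t ω + disc γ t ω * riskOf ρ t X ω := fun ω => mul_add _ _ _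
  simp_rw [h5]
  rw [integral_add (hQ.integrable_disc_mul htt htt hX0).integrableOn
    (hQ.integrable_disc_mul htt htt hl0).integrableOn]
  linarith

/-- This runs the previous computation backwards: for X acceptable at t, the right side of the
one-step inequality is at most the integral of D_t X_t. -/
theorem IsModel.restr_neg_rhoBar_nonneg [IsProbabilityMeasure P] {Q : Measure[sigmaEnd H 𝓕] Ω}
    {γ : Proc Ω H} (hQ : IsModel 𝓕 P Q γ) (hμ : IsReference 𝓕 P μ) (hρ : IsDynCoherent 𝓕 P ρ)
    (ht : (t : ℕ∞) < H.last) {X : Proc Ω H} (hX : X ∈ RInf H 𝓕 P)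
    (hXρ : ∀ᵐ ω ∂P, riskOf ρ t X ω ≤ 0) {A : Set Ω} (hA : MeasurableSet[𝓕 t] A)
    (hstep : ∫ ω in A, disc γ (t + 1) ω * (coord X t ω + riskOf ρ (t + 1) X ω) ∂Q ≤
      ∫ ω in A, disc γ t ω * (coord X t ω + riskOf ρ t X ω) ∂Q) :
    0 ≤ ∫ p, onProd (restr t A (-rhoBar ρ (t + 1) X)) p ∂(tensor 𝓕 Q γ) := by
  have htt := H.mem_times_of_lt_last ht
  have htt1 := H.natCast_mem_times_of_lt_last ht
  have hρ0 := hρ t htt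
  have hρ1 := hρ (t + 1) htt1
  have hX0 := RInf.coord hX htt
  rw [← hQ.setIntegral_weighted hμ htt (RInf.neg (hρ1.rhoBar_mem hX)) hA,
    integral_congr_ae (ae_restrict_of_ae (hQ.ae_weighted_neg_rhoBar_succ ht X)),
    integral_sub (hQ.integrable_disc_mul htt htt hX0).integrableOn
      (hQ.integrable_disc_mul htt1 htt1 ((hX0.mono (Nat.le_succ t)).add (hρ1.linf hX))).integrableOn]
  have h1 : ∫ ω in A, disc γ t ω * (coord X t ω + riskOf ρ t X ω) ∂Q ≤
      ∫ ω in A, disc γ t ω * coord X t ω ∂Q := by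
    refine integral_mono_ae (hQ.integrable_disc_mul htt htt (hX0.add (hρ0.linf hX))).integrableOn
      (hQ.integrable_disc_mul htt htt hX0).integrableOn (ae_restrict_of_ae ?_)
    filter_upwards [hQ.ae_disc htt, hQ.ae_of_ae htt (p := fun ω => riskOf ρ t X ω ≤ 0)
      ((hρ0.linf hX).1 measurableSet_Iic) hXρ] with ω h2 h3
    exact mul_le_mul_of_nonneg_left (by linarith) h2.1
  linarith

/-- The penalty clause is the dual of the first inclusion and the inequality that of the second. The
converse tests acceptance on zero-penalty measures, each of which is some Q ⊗ γ. -/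
theorem timeConsistent_iff_model [IsProbabilityMeasure P]
    (h𝓕 : H.last = ⊤ → FiltrationRegular 𝓕) (hμ : IsReference 𝓕 P μ)
    (hρ : IsDynCoherent 𝓕 P ρ)
    (hcont : ∀ t : ℕ, (t : ℕ∞) ∈ H.times → ContFromAbove 𝓕 P ρ t) :
    TimeConsistent 𝓕 P ρ ↔
      ∀ t : ℕ, (t : ℕ∞) < H.last → ∀ X ∈ RInf H 𝓕 P,
        ∀ (Q : Measure[sigmaEnd H 𝓕] Ω) (γ : Proc Ω H),
          IsModel 𝓕 P Q γ →
          (∀ᵐ ω ∂Q, 0 < disc γ t ω → penalty 𝓕 P ρ t Q γ ω = 0) →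
          (∀ᵐ ω ∂Q, (Q[fun ω' => disc γ (t + 1) ω' *
                (coord X t ω' + riskOf ρ (t + 1) X ω') | 𝓕 t]) ω
              ≤ disc γ t ω * (coord X t ω + riskOf ρ t X ω)) ∧
          (∀ᵐ ω ∂Q, 0 < disc γ (t + 1) ω → penalty 𝓕 P ρ (t + 1) Q γ ω = 0) := by
  have hcond : ∀ t : ℕ, (t : ℕ∞) < H.last → ∀ X ∈ RInf H 𝓕 P,
      ∀ (Q : Measure[sigmaEnd H 𝓕] Ω) (γ : Proc Ω H), IsModel 𝓕 P Q γ →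
      ((∀ᵐ ω ∂Q, (Q[fun ω' => disc γ (t + 1) ω' *
          (coord X t ω' + riskOf ρ (t + 1) X ω') | 𝓕 t]) ω
        ≤ disc γ t ω * (coord X t ω + riskOf ρ t X ω)) ↔ ∀ A, MeasurableSet[𝓕 t] A →
          ∫ ω in A, disc γ (t + 1) ω * (coord X t ω + riskOf ρ (t + 1) X ω) ∂Q ≤
          ∫ ω in A, disc γ t ω * (coord X t ω + riskOf ρ t X ω) ∂Q) := by
    intro t ht X hX Q γ hQ
    have hQp := hQ.isProbabilityMeasure
    have htt := H.mem_times_of_lt_last ht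
    have htt1 := H.natCast_mem_times_of_lt_last ht
    have hl := (RInf.coord hX htt).add ((hρ t htt).linf hX)
    exact condExp_le_iff (filtration_le_sigmaEnd htt)
      (hQ.integrable_disc_mul htt1 htt1 (((RInf.coord hX htt).mono (Nat.le_succ t)).add
        ((hρ _ htt1).linf hX))) (hQ.integrable_disc_mul htt htt hl)
      ((disc_measurable hQ.2.adapted htt).mul hl.1).stronglyMeasurable
  constructor
  · intro h t ht X hX Q γ hQ hpen
    have htt := H.mem_times_of_lt_last ht
    have htt1 := H.natCast_mem_times_of_lt_last ht
    have hz := (hQ.penalty_eq_zero_iff hμ (hρ t htt) htt).1 hpen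
    exact ⟨(hcond t ht X hX Q γ hQ).2 fun A hA => hQ.setIntegral_step_le hμ hρ h ht hz hX hA,
      (hQ.penalty_eq_zero_iff hμ (hρ _ htt1) htt1).2 (h.zeroPenalty_succ hρ ht hz)⟩
  · intro h
    refine (timeConsistent_iff hρ).2 fun t ht X hX => ?_
    have htt := H.mem_times_of_lt_last ht
    have htt1 := H.natCast_mem_times_of_lt_last ht
    have hρ0 := hρ t htt
    have hρ1 := hρ (t + 1) htt1
    refine ⟨fun hXρ => ?_, fun hXρ => ?_⟩
    · refine hρ0.riskOf_nonpos_of_zeroPenalty hμ (hcont t htt) htt (RInf.proj hX (t + 1))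
        fun R hR hz A hA => ?_
      obtain ⟨Q, γ, hQ, rfl⟩ := MBar.exists_isModel h𝓕 hμ hR
      have h1 := (h t ht X hX Q γ hQ ((hQ.penalty_eq_zero_iff hμ hρ0 htt).2 hz)).2
      rw [restr_proj_succ]
      exact ((hQ.penalty_eq_zero_iff hμ hρ1 htt1).1 h1).restr_nonneg hρ1 hX hXρ
        (𝓕.mono (Nat.le_succ t) _ hA)
    · refine hρ0.riskOf_nonpos_of_zeroPenalty hμ (hcont t htt) htt
        (RInf.neg (hρ1.rhoBar_mem hX)) fun R hR hz A hA => ?_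
      obtain ⟨Q, γ, hQ, rfl⟩ := MBar.exists_isModel h𝓕 hμ hR
      have h1 := (h t ht X hX Q γ hQ ((hQ.penalty_eq_zero_iff hμ hρ0 htt).2 hz)).1
      exact hQ.restr_neg_rhoBar_nonneg hμ hρ ht hX hXρ hA ((hcond t ht X hX Q γ hQ).1 h1 A hA)

end Models

end RiskProc

namespace RiskProc

universe u

variable {Ω : Type u}

/-! ### Pasting of zero-penalty measures -/

section Pasting

variable {m0 : MeasurableSpace Ω} {H : Horizon} {𝓕 : Filtration ℕ m0} {P : Measure Ω}
  {μ : Proc Ω H} {ρ : ℕ → Proc Ω H → Ω → ℝ} {t : ℕ}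

/-- The expectation of bounded functions under the pasting of `R₁` and `R₂` in `t` via `B`. -/
def HasPastedIntegral (𝓕 : Filtration ℕ m0) (t : ℕ) (B : Set (OmegaBar Ω H))
    (R₁ R₂ R : Measure[optional H 𝓕] (OmegaBar Ω H)) : Prop :=
  ∀ Y : OmegaBar Ω H → ℝ, BddMeas R₁ Y → BddMeas R₂ Y →
    ∫ p, Y p ∂ R = ∫ p in B, (R₂[Y | optionalAt H 𝓕 t]) p ∂ R₁ + ∫ p in Bᶜ, Y p ∂ R₁

theorem BddMeas.integrable {α : Type*} {m : MeasurableSpace α} {R : Measure α} [IsFiniteMeasure R]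
    {Y : α → ℝ} (hY : BddMeas R Y) : Integrable Y R :=
  Integrable.of_bound hY.1.aestronglyMeasurable hY.2.choose hY.2.choose_spec

theorem bddMeas_indicator_one {α : Type*} {m : MeasurableSpace α} (R : Measure α) {A : Set α}
    (hA : MeasurableSet A) : BddMeas R (A.indicator (1 : α → ℝ)) := by
  classical
  refine ⟨measurable_one.indicator hA, 1, ae_of_all _ fun x => ?_⟩
  rw [indicator_apply]
  split_ifs <;> simp

theorem measurable_indicator_one {α : Type*} {m : MeasurableSpace α} {A : Set α}
    (hA : MeasurableSet A) : Measurable (A.indicator (1 : α → ℝ)) := measurable_one.indicator hA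

theorem HasPastedIntegral.isPasting {B : Set (OmegaBar Ω H)}
    {R₁ R₂ R : Measure[optional H 𝓕] (OmegaBar Ω H)} [IsProbabilityMeasure R₁]
    [IsProbabilityMeasure R₂] [IsProbabilityMeasure R]
    (hB : MeasurableSet[optionalAt H 𝓕 t] B) (hac : AbsContOn (optionalAt H 𝓕 t) R₁ R₂)
    (h : HasPastedIntegral 𝓕 t B R₁ R₂ R) : IsPasting 𝓕 t B R₁ R₂ R := by
  intro A hA
  have hB' := optionalAt_le _ hB
  have h1 := h _ (bddMeas_indicator_one R₁ hA) (bddMeas_indicator_one R₂ hA)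
  have h2 : Integrable (R₂[A.indicator (1 : OmegaBar Ω H → ℝ) | optionalAt H 𝓕 t]) R₁ := by
    have h3 : ∀ᵐ p ∂ R₂, |(R₂[A.indicator (1 : OmegaBar Ω H → ℝ) | optionalAt H 𝓕 t]) p| ≤ 1 := by
      refine ae_bdd_abs_condExp_of_ae_bdd_abs (ae_of_all _ fun p => ?_)
      classical
      rw [indicator_apply]
      split_ifs <;> simp
    exact Integrable.of_bound
      (stronglyMeasurable_condExp.mono optionalAt_le).aestronglyMeasurable 1
      (hac.ae (measurableSet_setOf_abs_le stronglyMeasurable_condExp.measurable 1) h3)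
  have h4 : ∀ p, (B.indicator (R₂[A.indicator (1 : OmegaBar Ω H → ℝ) | optionalAt H 𝓕 t]) p
      + (Bᶜ ∩ A).indicator (1 : OmegaBar Ω H → ℝ) p) =
      B.indicator (R₂[A.indicator (1 : OmegaBar Ω H → ℝ) | optionalAt H 𝓕 t]) p +
        Bᶜ.indicator (A.indicator (1 : OmegaBar Ω H → ℝ)) p := fun p => by
    rw [indicator_indicator]
  have h5 := integral_congr_ae (μ := R₁) (ae_of_all _ h4)
  rw [integral_add (h2.indicator hB') ((bddMeas_indicator_one R₁ hA).integrable.indicator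
    hB'.compl), integral_indicator hB', integral_indicator hB'.compl, ← h1,
    integral_indicator_one hA] at h5
  rw [h5, ofReal_measureReal]

theorem exists_hasPastedIntegral {B : Set (OmegaBar Ω H)}
    {R₁ R₂ : Measure[optional H 𝓕] (OmegaBar Ω H)} [IsProbabilityMeasure R₁]
    [IsProbabilityMeasure R₂] (hac : AbsContOn (optionalAt H 𝓕 t) R₁ R₂)
    (hB : MeasurableSet[optionalAt H 𝓕 t] B) :
    ∃ R : Measure[optional H 𝓕] (OmegaBar Ω H), IsProbabilityMeasure R ∧
      (∀ A, MeasurableSet[optional H 𝓕] A → R₁ A = 0 → R₂ A = 0 → R A = 0) ∧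
      (R₁ ≪ R₂ → R₂ ≪ R₁ → R₁ ≪ R) ∧ HasPastedIntegral 𝓕 t B R₁ R₂ R := by
  obtain ⟨R, h1, h2, h3, h4⟩ := exists_pasting optionalAt_le hac hB
  exact ⟨R, h1, h2, h3, fun Y hY1 hY2 => h4 Y hY1.integrable hY2⟩

/-- The formula on sets determines a measure, and the pasting built from a density satisfies it; so
the two coincide and the formula extends to bounded functions. -/
theorem IsPasting.hasPastedIntegral {B : Set (OmegaBar Ω H)}
    {R₁ R₂ R : Measure[optional H 𝓕] (OmegaBar Ω H)} [IsProbabilityMeasure R₁]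
    [IsProbabilityMeasure R₂] (hB : MeasurableSet[optionalAt H 𝓕 t] B)
    (hac : AbsContOn (optionalAt H 𝓕 t) R₁ R₂) (h : IsPasting 𝓕 t B R₁ R₂ R) :
    HasPastedIntegral 𝓕 t B R₁ R₂ R := by
  obtain ⟨R', h1, -, -, h4⟩ := exists_hasPastedIntegral hac hB
  have h5 : R = R' := @Measure.ext _ (optional H 𝓕) _ _ fun A hA => by
    rw [h A hA, h4.isPasting hB hac A hA]
  rwa [h5]

theorem HasPastedIntegral.agreeOn {B : Set (OmegaBar Ω H)}
    {R₁ R₂ R : Measure[optional H 𝓕] (OmegaBar Ω H)} [IsProbabilityMeasure R₁]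
    [IsProbabilityMeasure R₂] [IsProbabilityMeasure R]
    (hB : MeasurableSet[optionalAt H 𝓕 t] B)
    (h : HasPastedIntegral 𝓕 t B R₁ R₂ R) : AgreeOn (optionalAt H 𝓕 t) R R₁ := by
  intro E hE
  have hE' := optionalAt_le _ hE
  have h1 := h _ (bddMeas_indicator_one R₁ hE') (bddMeas_indicator_one R₂ hE')
  rw [condExp_of_stronglyMeasurable optionalAt_le
    (measurable_indicator_one hE).stronglyMeasurable
    (bddMeas_indicator_one R₂ hE').integrable,
    integral_add_compl (optionalAt_le _ hB) (bddMeas_indicator_one R₁ hE').integrable,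
    integral_indicator_one hE', integral_indicator_one hE'] at h1
  exact (measureReal_eq_measureReal_iff).1 h1

theorem TimeConsistent.riskOf_zero_le (h : TimeConsistent 𝓕 P ρ) :
    ∀ t : ℕ, (t : ℕ∞) ∈ H.times → ∀ X ∈ RInf H 𝓕 P, ∀ Y ∈ RInf H 𝓕 P,
      (∀ s : H.Time, ¬ (t : ℕ∞) ≤ s.1 → X s = Y s) →
      (∀ᵐ ω ∂P, riskOf ρ t X ω ≤ riskOf ρ t Y ω) →
      ∀ᵐ ω ∂P, riskOf ρ 0 X ω ≤ riskOf ρ 0 Y ω := by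
  intro t
  induction t with
  | zero => intro _ X _ Y _ _ h0; exact h0
  | succ n ih =>
    intro hn X hX Y hY hXY h1
    have hn' := H.natCast_mem_times_of_le (Nat.le_succ n) hn
    have hlt : (n : ℕ∞) < H.last :=
      lt_of_lt_of_le (by exact_mod_cast Nat.lt_succ_self n) (H.le_last hn)
    refine ih hn' X hX Y hY (fun s hs => hXY s fun h' => hs ?_)
      (h n hlt X hX Y hY (ae_of_all _ fun ω => ?_) h1)
    · exact (show (n : ℕ∞) ≤ ((n + 1 : ℕ) : ℕ∞) by exact_mod_cast Nat.le_succ n).trans h'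
    · rw [coord_eq _ hn', coord_eq _ hn', hXY _ (not_succ_le hn')]

theorem TimeConsistent.zeroPenalty (h : TimeConsistent 𝓕 P ρ) (hρ : IsDynCoherent 𝓕 P ρ)
    {R : Measure[optional H 𝓕] (OmegaBar Ω H)} (hR : ZeroPenalty 𝓕 P ρ 0 R) :
    ∀ t : ℕ, (t : ℕ∞) ∈ H.times → ZeroPenalty 𝓕 P ρ t R := by
  intro t
  induction t with
  | zero => exact fun _ => hR
  | succ n ih =>
    intro hn
    exact h.zeroPenalty_succ hρ (lt_of_lt_of_le (by exact_mod_cast Nat.lt_succ_self n)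
      (H.le_last hn)) (ih (H.natCast_mem_times_of_le (Nat.le_succ n) hn))

theorem ZeroPenalty.ae_neg_rhoBar_le_condExp {R : Measure[optional H 𝓕] (OmegaBar Ω H)}
    (hz : ZeroPenalty 𝓕 P ρ t R) (hR : R ∈ MBar 𝓕 P μ) (hμ : IsReference 𝓕 P μ)
    (hρ : IsCondCoherent 𝓕 P t (ρ t)) {Y : Proc Ω H} (hY : Y ∈ RInf H 𝓕 P) :
    ∀ᵐ p ∂ R, onProd (-rhoBar ρ t Y) p ≤ (R[onProd Y | optionalAt H 𝓕 t]) p := by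
  have hRp := hR.1
  refine ae_le_of_setIntegral_le_of_measurable optionalAt_le
    (MBar.integrable hR hμ (RInf.neg (hρ.rhoBar_mem hY)))
    (measurable_onProd_rhoBar hρ hY).neg.stronglyMeasurable integrable_condExp
    stronglyMeasurable_condExp fun A hA => ?_
  rw [setIntegral_condExp optionalAt_le (MBar.integrable hR hμ hY) hA]
  exact hz.setIntegral_le hR hμ hρ hY hA

/-- R₂ is only required to have zero penalty at t, not at 0. If Y is acceptable at 0, then so is
-ρ̄_t(Y), which R₁ therefore charges nonnegatively. It is dominated in integral by Y: on B by the
conditional expectation under R₂, on Bᶜ because R₁ inherits zero penalty at t. -/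
theorem TimeConsistent.exists_mem_QStar (h : TimeConsistent 𝓕 P ρ) (hμ : IsReference 𝓕 P μ)
    (hρ : IsDynCoherent 𝓕 P ρ) (ht : (t : ℕ∞) ∈ H.times)
    {R₁ R₂ : Measure[optional H 𝓕] (OmegaBar Ω H)} (h1 : R₁ ∈ QStar 𝓕 P μ ρ)
    (h2 : R₂ ∈ MBar 𝓕 P μ) (h2' : tensor 𝓕 P μ ≪ R₂) (hz : ZeroPenalty 𝓕 P ρ t R₂)
    {B : Set (OmegaBar Ω H)} (hB : MeasurableSet[optionalAt H 𝓕 t] B) :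
    ∃ R ∈ QStar 𝓕 P μ ρ, HasPastedIntegral 𝓕 t B R₁ R₂ R := by
  have hρ0 := hρ 0 H.zero_mem_times
  have hρt := hρ t ht
  rw [mem_QStar_iff hμ hρ0] at h1
  obtain ⟨hM1, h1', hz0⟩ := h1
  have hp1 := hM1.1
  have hp2 := h2.1
  have hac : R₁ ≪ R₂ := hM1.2.trans h2'
  have hacOn : AbsContOn (optionalAt H 𝓕 t) R₁ R₂ := fun E _ hE => hac hE
  obtain ⟨R, hRp, hnull, hequiv, hint⟩ := exists_hasPastedIntegral hacOn hB
  refine ⟨R, (mem_QStar_iff hμ hρ0).2 ⟨⟨hRp, ?_⟩, ?_, ?_⟩, hint⟩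
  · exact Measure.AbsolutelyContinuous.mk fun A hA h0 => hnull A hA (hM1.2 h0) (h2.2 h0)
  · exact h1'.trans (hequiv hac (h2.2.trans h1'))
  · intro Y hY hYρ
    have hW := RInf.neg (hρt.rhoBar_mem hY)
    have h3 := h.riskOf_zero_le t ht _ hW _ hY (fun s hs => by
      ext ω; simp [rhoBar_of_not_le hs]) ((hρt.riskOf_neg_rhoBar hY).mono fun _ h => h.le)
    have h4 := hz0 _ hW (by filter_upwards [h3, hYρ] with ω h5 h6 using h5.trans h6)
    have hY1 := MBar.bddMeas hM1 hμ hY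
    have hY2 := MBar.bddMeas h2 hμ hY
    have h5 := hac.ae_le (hz.ae_neg_rhoBar_le_condExp h2 hμ hρt hY)
    have h6 : Integrable (R₂[onProd Y | optionalAt H 𝓕 t]) R₁ := by
      obtain ⟨C, hC⟩ := hY2.2
      exact Integrable.of_bound
        (stronglyMeasurable_condExp.mono optionalAt_le).aestronglyMeasurable _
        (hac.ae_le (ae_bdd_abs_condExp_of_ae_bdd_abs hC))
    rw [proj_zero] at h4 ⊢
    rw [hint _ hY1 hY2]
    rw [← integral_add_compl (optionalAt_le _ hB) (MBar.integrable hM1 hμ hW)] at h4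
    refine h4.trans (add_le_add ?_ ?_)
    · exact setIntegral_mono_ae (MBar.integrable hM1 hμ hW).integrableOn h6.integrableOn h5
    · exact (h.zeroPenalty hρ hz0 t ht).setIntegral_le hM1 hμ hρt hY hB.compl

theorem TimeConsistent.stable (h : TimeConsistent 𝓕 P ρ) (hμ : IsReference 𝓕 P μ)
    (hρ : IsDynCoherent 𝓕 P ρ) : Stable 𝓕 (QStar 𝓕 P μ ρ) := by
  intro R₁ h1 R₂ h2 t ht hac B hB
  have h2' := (mem_QStar_iff hμ (hρ 0 H.zero_mem_times)).1 h2
  obtain ⟨R, hR, hint⟩ := h.exists_mem_QStar hμ hρ ht h1 h2'.1 h2'.2.1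
    (h.zeroPenalty hρ h2'.2.2 t ht) hB
  have hp1 := h1.1.1
  have hp2 := h2.1.1
  have hp := hR.1.1
  exact ⟨R, hR, hint.isPasting hB hac⟩

theorem indicator_restr (t : ℕ) (A : Set Ω) (X : Proc Ω H) {B : Set (OmegaBar Ω H)}
    (hB : MeasurableSet[optionalAt H 𝓕 t] B) : ∃ A', MeasurableSet[𝓕 t] A' ∧
      B.indicator (onProd (restr t A X)) = onProd (restr t (A' ∩ A) X) := by
  obtain ⟨-, A', hA', hs⟩ := measurableSet_optionalAt_iff.1 hB
  refine ⟨A', hA', ?_⟩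
  classical
  ext ⟨ω, s⟩
  simp only [indicator_apply, onProd, restr]
  by_cases h : (t : ℕ∞) ≤ s.1
  · have : (ω, s) ∈ B ↔ ω ∈ A' := by rw [← hs s h]; rfl
    simp only [if_pos h, this, mem_inter_iff]
    split_ifs <;> tauto
  · simp [if_neg h]

theorem convexCombo_mem {R R' : Measure[optional H 𝓕] (OmegaBar Ω H)} (hR : R ∈ MBar 𝓕 P μ)
    (hR' : R' ∈ MBar 𝓕 P μ) (hP : tensor 𝓕 P μ ≪ R') (hμ : IsReference 𝓕 P μ) {l : ℝ}
    (hl : 0 < l) (hl1 : l ≤ 1) :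
    ∃ S ∈ MBar 𝓕 P μ, tensor 𝓕 P μ ≪ S ∧ ∀ X ∈ RInf H 𝓕 P,
      ∫ p, onProd X p ∂S = (1 - l) * ∫ p, onProd X p ∂ R + l * ∫ p, onProd X p ∂ R' := by
  have h1 := hR.1
  have h2 := hR'.1
  refine ⟨ENNReal.ofReal (1 - l) • R + ENNReal.ofReal l • R', ⟨⟨?_⟩, ?_⟩, ?_, fun X hX => ?_⟩
  · simp only [Measure.coe_add, Measure.coe_smul, Pi.add_apply, Pi.smul_apply, measure_univ,
      smul_eq_mul, mul_one]
    rw [← ENNReal.ofReal_add (by linarith) hl.le]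
    simp
  · refine Measure.AbsolutelyContinuous.mk fun A _ h0 => ?_
    simp [hR.2 h0, hR'.2 h0]
  · refine Measure.AbsolutelyContinuous.mk fun A _ h0 => hP ?_
    simp only [Measure.coe_add, Measure.coe_smul, Pi.add_apply, Pi.smul_apply, smul_eq_mul,
      add_eq_zero, mul_eq_zero, ENNReal.ofReal_eq_zero, not_le.2 hl, false_or] at h0
    exact h0.2
  · rw [integral_add_measure ((MBar.integrable hR hμ hX).smul_measure ENNReal.ofReal_ne_top)
      ((MBar.integrable hR' hμ hX).smul_measure ENNReal.ofReal_ne_top), integral_smul_measure,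
      integral_smul_measure, ENNReal.toReal_ofReal (by linarith), ENNReal.toReal_ofReal hl.le,
      smul_eq_mul, smul_eq_mul]

/-- A zero-penalty R need not be equivalent to P̄. Mixing in a fraction l of some R' from 𝓠̄* gives
an equivalent S; pasting R' with S at t lands in 𝓠̄*, so S prices the position nonnegatively given
𝓕̄_t, hence on average. Then l is made small. -/
theorem TimeConsistent.riskOf_nonpos [IsProbabilityMeasure P] (h : TimeConsistent 𝓕 P ρ)
    (hμ : IsReference 𝓕 P μ) (hρ : IsDynCoherent 𝓕 P ρ) (hne : (QStar 𝓕 P μ ρ).Nonempty)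
    (ht : (t : ℕ∞) ∈ H.times) (hc : ContFromAbove 𝓕 P ρ t) {Y : Proc Ω H} (hY : Y ∈ RInf H 𝓕 P)
    (hYR : ∀ R ∈ QStar 𝓕 P μ ρ, ∀ A, MeasurableSet[𝓕 t] A →
      0 ≤ ∫ p, onProd (restr t A Y) p ∂ R) : ∀ᵐ ω ∂P, riskOf ρ t Y ω ≤ 0 := by
  obtain ⟨R', hR'⟩ := hne
  have hR'2 := (mem_QStar_iff hμ (hρ 0 H.zero_mem_times)).1 hR'
  have hR'p := hR'.1.1
  refine (hρ t ht).riskOf_nonpos_of_zeroPenalty hμ hc ht hY fun R hR hz A hA => ?_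
  have hZ := RInf.restr hY hA
  have key : ∀ l : ℝ, 0 < l → l ≤ 1 → 0 ≤ (1 - l) * ∫ p, onProd (restr t A Y) p ∂ R +
      l * ∫ p, onProd (restr t A Y) p ∂ R' := by
    intro l hl hl1
    obtain ⟨S, hS, hPS, hSint⟩ := convexCombo_mem hR hR'.1 hR'.2.1 hμ hl hl1
    have hSp := hS.1
    rw [← hSint _ hZ]
    have hzS : ZeroPenalty 𝓕 P ρ t S := fun X hX hXρ => by
      rw [hSint _ (RInf.proj hX t)]
      exact add_nonneg (mul_nonneg (by linarith) (hz X hX hXρ))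
        (mul_nonneg hl.le (h.zeroPenalty hρ hR'2.2.2 t ht X hX hXρ))
    obtain ⟨R₃, hR₃, hint⟩ := h.exists_mem_QStar hμ hρ ht hR' hS hPS hzS
      (@MeasurableSet.univ _ (optionalAt H 𝓕 t))
    have hge : ∀ᵐ p ∂ R', 0 ≤ (S[onProd (restr t A Y) | optionalAt H 𝓕 t]) p := by
      have hi : Integrable (S[onProd (restr t A Y) | optionalAt H 𝓕 t]) R' := by
        obtain ⟨C, hC⟩ := (MBar.bddMeas hS hμ hZ).2
        exact Integrable.of_bound
          (stronglyMeasurable_condExp.mono optionalAt_le).aestronglyMeasurable _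
          ((hR'.1.2.trans hPS).ae_le (ae_bdd_abs_condExp_of_ae_bdd_abs hC))
      refine ae_nonneg_of_setIntegral_nonneg_of_measurable optionalAt_le hi
        stronglyMeasurable_condExp fun B hB => ?_
      -- From t on, B is cut out by an event of 𝓕_t, so the hypothesis on 𝓠̄* covers it.
      obtain ⟨A', hA', hBA⟩ := indicator_restr (𝓕 := 𝓕) t A Y hB
      have h3 := hYR R₃ hR₃ _ (hA'.inter hA)
      have hZ' := RInf.restr hY (hA'.inter hA)
      rw [hint _ (MBar.bddMeas hR'.1 hμ hZ') (MBar.bddMeas hS hμ hZ'), compl_univ,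
        setIntegral_empty, add_zero, setIntegral_univ, ← hBA,
        integral_congr_ae ((hR'.1.2.trans hPS).ae_le
          (condExp_indicator (MBar.integrable hS hμ hZ) hB)),
        integral_indicator (optionalAt_le _ hB)] at h3
      exact h3
    rw [← integral_condExp optionalAt_le]
    exact integral_nonneg_of_ae ((hS.2.trans hR'.2.1).ae_le hge)
  set a := ∫ p, onProd (restr t A Y) p ∂ R
  set b := ∫ p, onProd (restr t A Y) p ∂ R'
  by_contra! ha
  have hab : 0 < |b| - a := by linarith [abs_nonneg b]
  -- If a < 0, this weight gives (1 - l) a + l b ≤ a + l (|b| - a) = a/2 < 0.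
  set l := -a / (2 * (|b| - a)) with hl
  have hl0 : 0 < l := div_pos (by linarith) (by linarith)
  have hl2 : l * (|b| - a) = -a / 2 := by rw [hl]; field_simp
  have hl1 : l ≤ 1 := by
    rw [hl, div_le_one (by linarith)]
    linarith [abs_nonneg b]
  have := key l hl0 hl1
  have : l * b ≤ l * |b| := mul_le_mul_of_nonneg_left (le_abs_self b) hl0.le
  nlinarith

end Pasting

end RiskProc

namespace RiskProc

universe u

variable {Ω : Type u}

/-! ### Stability, representation and supermartingales -/

section Stability

variable {m0 : MeasurableSpace Ω} {H : Horizon} {𝓕 : Filtration ℕ m0} {P : Measure Ω}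
  {μ : Proc Ω H} {ρ : ℕ → Proc Ω H → Ω → ℝ} {t : ℕ}

/-- Pasting selects conditional expectations: that of R₂ on B, that of R₁ elsewhere. Taking for B
the set where the former is smaller produces minima. -/
theorem condExp_pasting_ae_eq {B : Set (OmegaBar Ω H)}
    {R₁ R₂ R : Measure[optional H 𝓕] (OmegaBar Ω H)} [IsProbabilityMeasure R₁]
    [IsProbabilityMeasure R₂] [IsProbabilityMeasure R]
    (hB : MeasurableSet[optionalAt H 𝓕 t] B) (hac : R₁ ≪ R₂)
    (h : HasPastedIntegral 𝓕 t B R₁ R₂ R) {Y : OmegaBar Ω H → ℝ} (h1 : BddMeas R₁ Y)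
    (h2 : BddMeas R₂ Y) (hR : BddMeas R Y) {f : OmegaBar Ω H → ℝ}
    (hf : Measurable[optionalAt H 𝓕 t] f) (hfi : Integrable f R)
    (hf1 : ∀ p ∈ B, f p = (R₂[Y | optionalAt H 𝓕 t]) p)
    (hf2 : ∀ p ∉ B, f p = (R₁[Y | optionalAt H 𝓕 t]) p) :
    f =ᵐ[R] R[Y | optionalAt H 𝓕 t] := by
  have hag := h.agreeOn hB
  have hB' := optionalAt_le _ hB
  refine ae_eq_condExp_of_forall_setIntegral_eq optionalAt_le hR.integrable
    (fun _ _ _ => hfi.integrableOn) (fun E hE _ => ?_) hf.stronglyMeasurable.aestronglyMeasurable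
  have hE' := optionalAt_le _ hE
  have hfE : Measurable[optionalAt H 𝓕 t] (E.indicator f) := hf.indicator hE
  have hfi1 : Integrable f R₁ := by
    obtain ⟨-, C₁, hC₁⟩ := h1
    obtain ⟨-, C₂, hC₂⟩ := h2
    have h3 : ∀ᵐ p ∂ R₁, |f p| ≤ C₁ + C₂ := by
      filter_upwards [hac.ae_le (ae_bdd_abs_condExp_of_ae_bdd_abs (m := optionalAt H 𝓕 t) hC₂),
        ae_bdd_abs_condExp_of_ae_bdd_abs (m := optionalAt H 𝓕 t) hC₁] with p h4 h5
      by_cases hp : p ∈ B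
      · rw [hf1 p hp]
        exact h4.trans (le_add_of_nonneg_left ((abs_nonneg _).trans h5))
      · rw [hf2 p hp]
        exact h5.trans (le_add_of_nonneg_right ((abs_nonneg _).trans h4))
    exact Integrable.of_bound (hf.mono optionalAt_le le_rfl).aestronglyMeasurable _ h3
  have hbdd : ∀ {S : Measure[optional H 𝓕] (OmegaBar Ω H)}, BddMeas S Y →
      BddMeas S (E.indicator Y) := fun hS => ⟨hS.1.indicator hE', hS.2.choose,
    hS.2.choose_spec.mono fun p hp => by
      classical
      rw [indicator_apply]
      split_ifs
      · exact hp
      · rw [abs_zero]; exact (abs_nonneg _).trans hp⟩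
  rw [← integral_indicator hE', ← integral_indicator hE', h _ (hbdd h1) (hbdd h2),
    hag.integral_eq optionalAt_le optionalAt_le hfE,
    ← integral_add_compl hB' (hfi1.indicator hE')]
  congr 1
  · refine setIntegral_congr_ae hB' ?_
    filter_upwards [hac.ae_le (condExp_indicator h2.integrable hE)] with p h3 hp
    classical
    rw [h3, indicator_apply, indicator_apply, hf1 p hp]
  · have h3 : ∫ p in Bᶜ, E.indicator f p ∂ R₁ =
        ∫ p in Bᶜ, E.indicator (R₁[Y | optionalAt H 𝓕 t]) p ∂ R₁ := by
      refine setIntegral_congr_fun hB'.compl fun p hp => ?_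
      classical
      rw [indicator_apply, indicator_apply, hf2 p hp]
    rw [h3, setIntegral_indicator hE', setIntegral_indicator hE',
      setIntegral_condExp optionalAt_le h1.integrable (hB.compl.inter hE)]

/-- `ρ_t` is determined by the measures in `𝓠̄*`. -/
def DeterminedByQStar (𝓕 : Filtration ℕ m0) (P : Measure Ω) (μ : Proc Ω H)
    (ρ : ℕ → Proc Ω H → Ω → ℝ) : Prop :=
  ∀ t : ℕ, (t : ℕ∞) ∈ H.times → (∀ R ∈ QStar 𝓕 P μ ρ, ZeroPenalty 𝓕 P ρ t R) ∧
    ∀ Y ∈ RInf H 𝓕 P, (∀ R ∈ QStar 𝓕 P μ ρ, ∀ A, MeasurableSet[𝓕 t] A →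
      0 ≤ ∫ p, onProd (restr t A Y) p ∂ R) → ∀ᵐ ω ∂P, riskOf ρ t Y ω ≤ 0

theorem TimeConsistent.determinedByQStar [IsProbabilityMeasure P] (h : TimeConsistent 𝓕 P ρ)
    (hμ : IsReference 𝓕 P μ) (hρ : IsDynCoherent 𝓕 P ρ)
    (hcont : ∀ t : ℕ, (t : ℕ∞) ∈ H.times → ContFromAbove 𝓕 P ρ t)
    (hne : (QStar 𝓕 P μ ρ).Nonempty) : DeterminedByQStar 𝓕 P μ ρ := fun t ht =>
  ⟨fun _ hR => h.zeroPenalty hρ ((mem_QStar_iff hμ (hρ 0 H.zero_mem_times)).1 hR).2.2 t ht,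
    fun _ hY hYR => h.riskOf_nonpos hμ hρ hne ht (hcont t ht) hY hYR⟩

theorem DeterminedByQStar.riskOf_proj_succ_nonpos (hd : DeterminedByQStar 𝓕 P μ ρ)
    (hρ : IsDynCoherent 𝓕 P ρ) (ht : (t : ℕ∞) < H.last) {X : Proc Ω H} (hX : X ∈ RInf H 𝓕 P)
    (hXρ : ∀ᵐ ω ∂P, riskOf ρ (t + 1) X ω ≤ 0) :
    ∀ᵐ ω ∂P, riskOf ρ t (proj (t + 1) X) ω ≤ 0 := by
  have htt1 := H.natCast_mem_times_of_lt_last ht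
  refine (hd t (H.mem_times_of_lt_last ht)).2 _ (RInf.proj hX _) fun R hR A hA => ?_
  rw [restr_proj_succ]
  exact ((hd _ htt1).1 R hR).restr_nonneg (hρ _ htt1) hX hXρ (𝓕.mono (Nat.le_succ t) _ hA)

theorem restr_restr (t : ℕ) (A A' : Set Ω) (X : Proc Ω H) :
    restr t A (restr t A' X) = restr t (A ∩ A') X := by
  classical
  ext s ω
  simp only [restr, indicator_apply, mem_inter_iff]
  split_ifs <;> tauto

/-- Under stability, the worst conditional expectation of an acceptable position is acceptable. -/
theorem DeterminedByQStar.integral_neg_rhoBar_nonneg (hd : DeterminedByQStar 𝓕 P μ ρ)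
    (hst : Stable 𝓕 (QStar 𝓕 P μ ρ)) (hμ : IsReference 𝓕 P μ) (hρ : IsDynCoherent 𝓕 P ρ)
    (ht : (t : ℕ∞) ∈ H.times) {R : Measure[optional H 𝓕] (OmegaBar Ω H)}
    (hR : R ∈ QStar 𝓕 P μ ρ) {X : Proc Ω H} (hX : X ∈ RInf H 𝓕 P)
    (hXR : ∀ R ∈ QStar 𝓕 P μ ρ, 0 ≤ ∫ p, onProd X p ∂ R) :
    0 ≤ ∫ p, onProd (-rhoBar ρ t X) p ∂ R := by
  have hρt := hρ t ht
  have hprob : ∀ R ∈ QStar 𝓕 P μ ρ, IsProbabilityMeasure R := fun R h => h.1.1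
  have hRp := hprob R hR
  have hac : ∀ R₁ ∈ QStar 𝓕 P μ ρ, ∀ R₂ ∈ QStar 𝓕 P μ ρ, R₁ ≪ R₂ := fun R₁ h1 R₂ h2 =>
    h1.1.2.trans h2.2.1
  have hpaste : ∀ R₁ ∈ QStar 𝓕 P μ ρ, ∀ R₂ ∈ QStar 𝓕 P μ ρ, ∀ B,
      MeasurableSet[optionalAt H 𝓕 t] B →
      ∃ R₃ ∈ QStar 𝓕 P μ ρ, HasPastedIntegral 𝓕 t B R₁ R₂ R₃ := by
    intro R₁ h1 R₂ h2 B hB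
    have hp1 := hprob R₁ h1
    have hp2 := hprob R₂ h2
    have hac' : AbsContOn (optionalAt H 𝓕 t) R₁ R₂ := fun E _ hE => hac R₁ h1 R₂ h2 hE
    obtain ⟨R₃, h3, h4⟩ := hst R₁ h1 R₂ h2 t ht hac' B hB
    exact ⟨R₃, h3, h4.hasPastedIntegral hB hac'⟩
  have hXb : ∀ R ∈ QStar 𝓕 P μ ρ, BddMeas R (onProd X) := fun R h => MBar.bddMeas h.1 hμ hX
  obtain ⟨-, C, hC⟩ := hμ.mem_RInf_iff.1 hX
  have hCR : ∀ R' ∈ QStar 𝓕 P μ ρ, ∀ R'' ∈ QStar 𝓕 P μ ρ,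
      ∀ᵐ p ∂ R'', |(R'[onProd X | optionalAt H 𝓕 t]) p| ≤ C := fun R' h' R'' h'' =>
    (hac R'' h'' R' h').ae_le (ae_bdd_abs_condExp_of_ae_bdd_abs (h'.1.2.ae_le hC))
  -- The worst conditional expectation of X over 𝓠̄*. Stability supplies both requirements: minima
  -- by pasting along {g ≤ f}, and nonnegative integrals under R because pasting R with R' at t over
  -- the whole space stays in 𝓠̄*.
  obtain ⟨h, hhm, hle, hhC, h0⟩ := exists_lower_bound_integral_nonneg (R := R) optionalAt_le
    (S := (fun R' : Measure[optional H 𝓕] (OmegaBar Ω H) =>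
      R'[onProd X | optionalAt H 𝓕 t]) '' QStar 𝓕 P μ ρ) ⟨_, R, hR, rfl⟩
    (by rintro _ ⟨R', -, rfl⟩; exact stronglyMeasurable_condExp.measurable) (C := C)
    (by rintro _ ⟨R', hR', rfl⟩; exact hCR R' hR' R hR)
    (by
      rintro _ ⟨R₁, h1, rfl⟩ _ ⟨R₂, h2, rfl⟩
      have hp1 := hprob R₁ h1
      have hp2 := hprob R₂ h2
      set f := R₁[onProd X | optionalAt H 𝓕 t] with hf
      set g := R₂[onProd X | optionalAt H 𝓕 t] with hg
      have hfm : Measurable[optionalAt H 𝓕 t] f := stronglyMeasurable_condExp.measurable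
      have hgm : Measurable[optionalAt H 𝓕 t] g := stronglyMeasurable_condExp.measurable
      have hB : MeasurableSet[optionalAt H 𝓕 t] {p | g p ≤ f p} := measurableSet_setOf_le hgm hfm
      obtain ⟨R₃, h3, hint⟩ := hpaste R₁ h1 R₂ h2 _ hB
      have hp3 := hprob R₃ h3
      refine ⟨_, ⟨R₃, h3, rfl⟩, ?_⟩
      have hmm : Measurable[optionalAt H 𝓕 t] fun p => min (f p) (g p) := hfm.min hgm
      have h4 : (fun p => min (f p) (g p)) =ᵐ[R₃] R₃[onProd X | optionalAt H 𝓕 t] := by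
        refine condExp_pasting_ae_eq hB (hac R₁ h1 R₂ h2) hint (hXb _ h1)
          (hXb _ h2) (hXb _ h3) hmm ?_ (fun p hp => ?_) fun p hp => ?_
        · refine Integrable.of_bound (hmm.mono optionalAt_le le_rfl).aestronglyMeasurable C ?_
          filter_upwards [hCR R₁ h1 R₃ h3, hCR R₂ h2 R₃ h3] with p h4 h5
          rw [Real.norm_eq_abs]
          rcases min_choice (f p) (g p) with h6 | h6 <;> rw [h6] <;> assumption
        · exact min_eq_right hp
        · exact min_eq_left (not_le.1 hp).le
      filter_upwards [(hac R hR R₃ h3).ae_le h4] with p h5 using h5.symm)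
    (by
      rintro _ ⟨R', h', rfl⟩
      obtain ⟨R₃, h3, hint⟩ := hpaste R hR R' h' _ (@MeasurableSet.univ _ (optionalAt H 𝓕 t))
      have h4 := hint _ (hXb R hR) (hXb R' h')
      rw [compl_univ, setIntegral_empty, add_zero, setIntegral_univ] at h4
      change 0 ≤ ∫ p, (R'[onProd X | optionalAt H 𝓕 t]) p ∂ R
      rw [← h4]
      exact hXR R₃ h3)
  have hhP : ∀ᵐ p ∂(tensor 𝓕 P μ), |h p| ≤ C := hR.2.1.ae_le hhC
  have hhR : ofProd h ∈ RInf H 𝓕 P := hμ.ofProd_mem ⟨hhm.mono optionalAt_le le_rfl, C, hhP⟩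
  -- Being 𝓕̄_t-measurable, h equals one 𝓕_t-measurable k at all times from t on.
  have hk := measurable_of_measurable_optionalAt ht (X := ofProd h) hhm
  set k : Ω → ℝ := ofProd h ⟨t, ht⟩ with hkdef
  have hkl : LInf 𝓕 P t k := by
    have := RInf.coord hhR ht
    rwa [coord_eq _ ht] at this
  have hY : X + constFrom t (fun ω => -k ω) ∈ RInf H 𝓕 P := RInf.add hX (RInf.constFrom hkl.neg)
  have hW := RInf.neg (hρt.rhoBar_mem hX)
  -- X - k is charged nonnegatively from t on by every element of 𝓠̄*, hence acceptable; that is, k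
  -- ≤ -ρ_t(X).
  have hYρ := (hd t ht).2 _ hY fun R' hR' A hA => by
    have hp' := hprob R' hR'
    have hYA : onProd (restr t A (X + constFrom t fun ω => -k ω)) =
        (slab H t A).indicator fun p => onProd X p - h p := by
      classical
      ext ⟨ω, s⟩
      rw [onProd_restr, indicator_apply, indicator_apply]
      split_ifs with hp
      · have hs : (t : ℕ∞) ≤ s.1 := hp.2
        have := congrFun (hk.2 s hs) ω
        simp only [onProd, Pi.add_apply, constFrom, if_pos hs]
        change X s ω + -k ω = X s ω - ofProd h s ω
        rw [this]
        ring
      · rfl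
    have hhi : Integrable h R' := Integrable.of_bound
      (hhm.mono optionalAt_le le_rfl).aestronglyMeasurable C (hR'.1.2.ae_le hhP)
    rw [hYA, integral_indicator (measurableSet_slab hA),
      integral_sub (hXb R' hR').integrable.integrableOn hhi.integrableOn, sub_nonneg,
      ← setIntegral_condExp optionalAt_le (hXb R' hR').integrable (measurableSet_prod_from hA)]
    exact setIntegral_mono_ae hhi.integrableOn integrable_condExp.integrableOn
      ((hac R' hR' R hR).ae_le (hle _ ⟨R', hR', rfl⟩))
  have hhi : Integrable h R := Integrable.of_bound
    (hhm.mono optionalAt_le le_rfl).aestronglyMeasurable C hhC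
  have hS := measurableSet_prod_from (H := H) (@MeasurableSet.univ _ (𝓕 t))
  refine h0.trans ?_
  -- From t on, h = k ≤ -ρ_t(X). Before t, -ρ̄_t(X) is X itself, and h lies below its conditional
  -- expectation under R.
  rw [← integral_add_compl (optionalAt_le _ hS) hhi,
    ← integral_add_compl (optionalAt_le _ hS) (MBar.integrable hR.1 hμ hW)]
  refine add_le_add ?_ ?_
  · refine setIntegral_mono_on_ae hhi.integrableOn (MBar.integrable hR.1 hμ hW).integrableOn
      (optionalAt_le _ hS) ?_
    have h1 : ∀ᵐ ω ∂P, ∀ s, onProd (restr t univ (ofProd h)) (ω, s) ≤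
        onProd (restr t univ (-rhoBar ρ t X)) (ω, s) := by
      filter_upwards [hYρ, hρt.riskOf_add_constFrom hX hkl.neg] with ω h2 h3 s
      classical
      simp only [onProd, restr]
      split_ifs with hs
      · have := congrFun (hk.2 s hs) ω
        rw [indicator_of_mem (mem_univ _), indicator_of_mem (mem_univ _), this, Pi.neg_apply,
          Pi.neg_apply, rhoBar_of_le hs]
        linarith
      · exact le_rfl
    have h2 := hR.1.2.ae_le (hμ.ae_onProd_le (RInf.restr hhR (@MeasurableSet.univ _ (𝓕 t)))
      (RInf.restr hW (@MeasurableSet.univ _ (𝓕 t))) h1)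
    filter_upwards [h2] with p h3 hp
    rw [onProd_restr, onProd_restr, indicator_of_mem (show p ∈ slab H t univ from hp),
      indicator_of_mem (show p ∈ slab H t univ from hp)] at h3
    exact h3
  · have h1 : ∫ p in (univ ×ˢ {s : H.Time | (t : ℕ∞) ≤ s.1})ᶜ, onProd (-rhoBar ρ t X) p ∂ R =
        ∫ p in (univ ×ˢ {s : H.Time | (t : ℕ∞) ≤ s.1})ᶜ, onProd X p ∂ R := by
      refine setIntegral_congr_fun (optionalAt_le _ hS).compl ?_
      rintro ⟨ω, s⟩ hp
      have hs : ¬ (t : ℕ∞) ≤ s.1 := fun hs => hp ⟨mem_univ _, hs⟩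
      simp [onProd, rhoBar_of_not_le hs]
    rw [h1, ← setIntegral_condExp optionalAt_le (hXb R hR).integrable hS.compl]
    exact setIntegral_mono_ae hhi.integrableOn integrable_condExp.integrableOn
      (hle _ ⟨R, hR, rfl⟩)

theorem DeterminedByQStar.timeConsistent_of_stable (hd : DeterminedByQStar 𝓕 P μ ρ)
    (hst : Stable 𝓕 (QStar 𝓕 P μ ρ)) (hμ : IsReference 𝓕 P μ) (hρ : IsDynCoherent 𝓕 P ρ) :
    TimeConsistent 𝓕 P ρ := by
  refine (timeConsistent_iff hρ).2 fun t ht X hX => ⟨hd.riskOf_proj_succ_nonpos hρ ht hX,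
    fun hXρ => ?_⟩
  have htt := H.mem_times_of_lt_last ht
  have htt1 := H.natCast_mem_times_of_lt_last ht
  refine (hd t htt).2 _ (RInf.neg ((hρ _ htt1).rhoBar_mem hX)) fun R hR A hA => ?_
  rw [(hρ _ htt1).integral_restr_neg_rhoBar hμ hR.1 hX (Nat.le_succ t) hA, ← integral_onProd_neg]
  exact hd.integral_neg_rhoBar_nonneg hst hμ hρ htt1 hR (RInf.restr hX hA) fun R' hR' =>
    ((hd t htt).1 R' hR').restr_nonneg (hρ t htt) hX hXρ hA

end Stability

end RiskProc

namespace RiskProc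

universe u

variable {Ω : Type u}

/-! ### The robust representation and the supermartingale property -/

section Supermartingale

variable {m0 : MeasurableSpace Ω} {H : Horizon} {𝓕 : Filtration ℕ m0} {P : Measure Ω}
  {μ : Proc Ω H} {ρ : ℕ → Proc Ω H → Ω → ℝ} {t : ℕ}

namespace IsModel

variable {Q : Measure[sigmaEnd H 𝓕] Ω} {γ : Proc Ω H}

/-- Where D_t ≤ 0 no weight is left from t on, so the slab over A is null for Q ⊗ γ, hence for P̄,
and its section at t is P-null. Thus P ≪ Q on 𝓕_t and D_t > 0 P-a.s. for equivalent models. -/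
theorem ae_notMem_of_disc_nonpos (hQ : IsModel 𝓕 P Q γ) (hμ : IsReference 𝓕 P μ)
    (hP : tensor 𝓕 P μ ≪ tensor 𝓕 Q γ) (ht : (t : ℕ∞) ∈ H.times) {A : Set Ω}
    (hA : MeasurableSet[𝓕 t] A) (h : ∀ᵐ ω ∂Q, ω ∈ A → disc γ t ω ≤ 0) : ∀ᵐ ω ∂P, ω ∉ A := by
  have hS := measurableSet_slab (H := H) hA
  have h1 : ∀ᵐ p ∂(tensor 𝓕 Q γ), p ∉ slab H t A := by
    rw [ae_tensor_iff sigmaAt_le_sigmaEnd hQ.2.adapted hS.compl]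
    intro s
    filter_upwards [h, hQ.ae_hasSum, hQ.ae_hasSum_proj ht] with ω h2 h3 h4 h5 hp
    have hs : (t : ℕ∞) ≤ s.1 := hp.2
    have h6 := le_hasSum h4 s fun r _ => by
      simp only [proj]
      split_ifs
      · exact h3.1 r
      · exact le_rfl
    simp only [proj, if_pos hs] at h6
    linarith [h2 hp.1]
  filter_upwards [hμ.ae_of_ae (hP.ae_le h1)] with ω h2 hω
  exact h2 ⟨t, ht⟩ ⟨hω, show (t : ℕ∞) ≤ (t : ℕ∞) from le_rfl⟩

theorem ae_of_ae_model (hQ : IsModel 𝓕 P Q γ) (hμ : IsReference 𝓕 P μ)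
    (hP : tensor 𝓕 P μ ≪ tensor 𝓕 Q γ) (ht : (t : ℕ∞) ∈ H.times) {p : Ω → Prop}
    (hp : MeasurableSet[𝓕 t] {ω | p ω}) (h : ∀ᵐ ω ∂Q, p ω) : ∀ᵐ ω ∂P, p ω := by
  filter_upwards [hQ.ae_notMem_of_disc_nonpos hμ hP ht hp.compl
    (h.mono fun ω h1 h2 => absurd h1 h2)] with ω h1
  exact not_not.1 h1

theorem ae_disc_pos (hQ : IsModel 𝓕 P Q γ) (hμ : IsReference 𝓕 P μ)
    (hP : tensor 𝓕 P μ ≪ tensor 𝓕 Q γ) (ht : (t : ℕ∞) ∈ H.times) :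
    ∀ᵐ ω ∂P, 0 < disc γ t ω := by
  filter_upwards [hQ.ae_notMem_of_disc_nonpos hμ hP ht
    (disc_measurable hQ.2.adapted ht measurableSet_Iic) (ae_of_all _ fun ω h => h)] with ω h1
  exact not_le.1 h1

theorem ae_weighted_add_constFrom [IsProbabilityMeasure P] (hQ : IsModel 𝓕 P Q γ)
    (hμ : IsReference 𝓕 P μ) (ht : (t : ℕ∞) ∈ H.times) {X : Proc Ω H} (hX : X ∈ RInf H 𝓕 P)
    (g : Ω → ℝ) : ∀ᵐ ω ∂Q, weighted γ (X + constFrom t g) t ω =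
      weighted γ X t ω + disc γ t ω * g ω := by
  obtain ⟨C, hC⟩ := hQ.ae_weighted hμ ht hX
  filter_upwards [hC, hQ.ae_hasSum_proj ht] with ω h1 h2
  refine HasSum.tsum_eq ?_
  convert! h1.1.add (h2.mul_right (g ω)) using 2 with s
  simp only [Pi.add_apply, proj, constFrom]
  split_ifs <;> ring

/-- The value of a model at time `t` is dominated by `g` on `E` if and only if the model charges
`X + g 1_{𝕋_t}` nonnegatively on `E`. -/
theorem value_le_iff [IsProbabilityMeasure P] (hQ : IsModel 𝓕 P Q γ) (hμ : IsReference 𝓕 P μ)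
    (hP : tensor 𝓕 P μ ≪ tensor 𝓕 Q γ) (ht : (t : ℕ∞) ∈ H.times) {X : Proc Ω H}
    (hX : X ∈ RInf H 𝓕 P) {g : Ω → ℝ} (hg : LInf 𝓕 P t g) {E : Set Ω}
    (hE : MeasurableSet[𝓕 t] E) :
    (∀ᵐ ω ∂P, ω ∈ E → 1 / disc γ t ω * condWeighted 𝓕 Q γ (-X) t ω ≤ g ω) ↔
      ∀ A, MeasurableSet[𝓕 t] A →
        0 ≤ ∫ p, onProd (restr t (A ∩ E) (X + constFrom t g)) p ∂(tensor 𝓕 Q γ) := by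
  have hQp := hQ.isProbabilityMeasure
  have hm := filtration_le_sigmaEnd (H := H) (𝓕 := 𝓕) ht
  have hDm := disc_measurable hQ.2.adapted ht
  have hY := RInf.add hX (RInf.constFrom (H := H) hg)
  have hcm : Measurable[𝓕 t] (condWeighted 𝓕 Q γ (-X) t) :=
    stronglyMeasurable_condExp.measurable
  have hmeas : MeasurableSet[𝓕 t]
      {ω | ω ∈ E → condWeighted 𝓕 Q γ (-X) t ω - disc γ t ω * g ω ≤ 0} :=
    (hE.compl.union (measurableSet_setOf_le hcm (hDm.mul hg.1))).congr
      (by ext ω; simp [imp_iff_not_or])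
  have h1 : (∀ᵐ ω ∂P, ω ∈ E → 1 / disc γ t ω * condWeighted 𝓕 Q γ (-X) t ω ≤ g ω) ↔
      ∀ᵐ ω ∂P, ω ∈ E → condWeighted 𝓕 Q γ (-X) t ω - disc γ t ω * g ω ≤ 0 := by
    refine eventually_congr ?_
    filter_upwards [hQ.ae_disc_pos hμ hP ht] with ω h2
    rw [one_div, inv_mul_le_iff₀ h2, sub_nonpos]
  have h2 : (∀ᵐ ω ∂P, ω ∈ E → condWeighted 𝓕 Q γ (-X) t ω - disc γ t ω * g ω ≤ 0) ↔
      ∀ᵐ ω ∂Q, ω ∈ E → condWeighted 𝓕 Q γ (-X) t ω - disc γ t ω * g ω ≤ 0 :=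
    ⟨hQ.ae_of_ae ht hmeas, hQ.ae_of_ae_model hμ hP ht hmeas⟩
  have hDg := hQ.integrable_disc_mul ht ht hg
  have h3 : Q[weighted γ (-(X + constFrom t g)) t | 𝓕 t] =ᵐ[Q] fun ω =>
      condWeighted 𝓕 Q γ (-X) t ω - disc γ t ω * g ω := by
    have h4 : weighted γ (-(X + constFrom t g)) t =ᵐ[Q]
        weighted γ (-X) t - fun ω => disc γ t ω * g ω := by
      filter_upwards [hQ.ae_weighted_add_constFrom hμ ht hX g] with ω h5
      rw [weighted_neg, weighted_neg, Pi.neg_apply, h5, Pi.sub_apply, Pi.neg_apply]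
      ring
    have h5 := condExp_sub (hQ.integrable_weighted hμ ht (RInf.neg hX)) hDg (𝓕 t)
    rw [condExp_of_stronglyMeasurable (f := fun ω => disc γ t ω * g ω) hm
      (hDm.mul hg.1).stronglyMeasurable hDg] at h5
    exact (condExp_congr_ae h4).trans h5
  have h4 : (∀ᵐ ω ∂Q, ω ∈ E → condWeighted 𝓕 Q γ (-X) t ω - disc γ t ω * g ω ≤ 0) ↔
      ∀ᵐ ω ∂Q, ω ∈ E → (Q[weighted γ (-(X + constFrom t g)) t | 𝓕 t]) ω ≤ 0 :=
    eventually_congr (h3.mono fun ω h => by rw [h])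
  rw [h1, h2, h4, condExp_nonpos_on_iff hm (hQ.integrable_weighted hμ ht (RInf.neg hY)) hE]
  refine forall₂_congr fun A hA => ?_
  rw [weighted_neg]
  simp only [Pi.neg_apply]
  rw [integral_neg, neg_nonpos, hQ.setIntegral_weighted hμ ht hY (hA.inter hE)]

end IsModel

/-- That ρ_t(X) is an upper bound holds because adding the cash ρ_t(X) makes X acceptable. It is the
smallest: where another bound h is at most g = ρ_t(X) - 1/(n+1), all of 𝓠̄* charges X + g
nonnegatively, so it would be acceptable although its risk is 1/(n+1). -/
theorem DeterminedByQStar.represented [IsProbabilityMeasure P]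
    (hd : DeterminedByQStar 𝓕 P μ ρ) (h𝓕 : H.last = ⊤ → FiltrationRegular 𝓕)
    (hμ : IsReference 𝓕 P μ) (hρ : IsDynCoherent 𝓕 P ρ) : RepresentedByQStar 𝓕 P μ ρ := by
  intro t ht X hX
  have hρt := hρ t ht
  have hl := hρt.linf hX
  refine ⟨measurable_coe_real_ereal.comp hl.1, ?_, fun h hh hub => ?_⟩
  · rintro _ ⟨Q, γ, hQ, hR, rfl⟩
    have h1 := (hQ.value_le_iff hμ hR.2.1 ht hX hl (@MeasurableSet.univ _ (𝓕 t))).2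
      fun A hA => ((hd t ht).1 _ hR).restr_nonneg hρt (RInf.add hX (RInf.constFrom hl)) (by
        filter_upwards [hρt.riskOf_add_constFrom hX hl] with ω h1
        rw [h1, sub_self]) (hA.inter (@MeasurableSet.univ _ (𝓕 t)))
    filter_upwards [h1] with ω h2
    exact EReal.coe_le_coe_iff.2 (h2 (mem_univ ω))
  · have key : ∀ n : ℕ, ∀ᵐ ω ∂P, ¬ h ω ≤ ((riskOf ρ t X ω - 1 / ((n : ℝ) + 1) : ℝ) : EReal) := by
      intro n
      have hg : LInf 𝓕 P t fun ω => riskOf ρ t X ω - 1 / ((n : ℝ) + 1) := by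
        simpa only [sub_eq_add_neg] using hl.add (LInf.const t (-(1 / ((n : ℝ) + 1))))
      set g : Ω → ℝ := fun ω => riskOf ρ t X ω - 1 / ((n : ℝ) + 1) with hgdef
      have hE : MeasurableSet[𝓕 t] {ω | h ω ≤ (g ω : EReal)} :=
        @measurableSet_le _ _ _ _ _ (𝓕 t) _ _ _ _ _ hh (measurable_coe_real_ereal.comp hg.1)
      set E : Set Ω := {ω | h ω ≤ (g ω : EReal)} with hEdef
      have hY := RInf.add hX (RInf.constFrom (H := H) hg)
      have h1 := (hd t ht).2 _ (RInf.restr hY hE) fun R hR A hA => by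
        obtain ⟨Q, γ, hQ, rfl⟩ := MBar.exists_isModel h𝓕 hμ hR.1
        rw [restr_restr]
        refine (hQ.value_le_iff hμ hR.2.1 ht hX hg hE).1 ?_ A hA
        filter_upwards [hub _ ⟨Q, γ, hQ, hR, rfl⟩] with ω h2 hω
        exact EReal.coe_le_coe_iff.1 (h2.trans hω)
      filter_upwards [h1, hρt.riskOf_restr hY hE, hρt.riskOf_add_constFrom hX hg]
        with ω h2 h3 h4 hω
      rw [h3, indicator_of_mem (show ω ∈ E from hω), h4] at h2
      have : 0 < 1 / ((n : ℝ) + 1) := by positivity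
      simp only [hgdef] at h2
      linarith
    filter_upwards [ae_all_iff.2 key] with ω h1
    by_contra! hlt
    obtain ⟨z, hz, hz'⟩ := EReal.lt_iff_exists_real_btwn.1 hlt
    obtain ⟨n, hn⟩ := exists_nat_one_div_lt (sub_pos.2 (EReal.coe_lt_coe_iff.1 hz'))
    exact h1 n (hz.le.trans (EReal.coe_le_coe_iff.2 (by linarith)))

theorem RepresentedByQStar.determined [IsProbabilityMeasure P]
    (hr : RepresentedByQStar 𝓕 P μ ρ) (h𝓕 : H.last = ⊤ → FiltrationRegular 𝓕)
    (hμ : IsReference 𝓕 P μ) : DeterminedByQStar 𝓕 P μ ρ := by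
  intro t ht
  have h0 : LInf 𝓕 P t (0 : Ω → ℝ) := LInf.const t 0
  have hc : ∀ Y : Proc Ω H, Y + constFrom t (0 : Ω → ℝ) = Y := fun Y => by
    ext s ω; simp [constFrom]
  refine ⟨fun R hR Y hY hYρ => ?_, fun Y hY hYR => ?_⟩
  · obtain ⟨Q, γ, hQ, rfl⟩ := MBar.exists_isModel h𝓕 hμ hR.1
    have h1 := (hr t ht Y hY).2.1 _ ⟨Q, γ, hQ, hR, rfl⟩
    have h2 := (hQ.value_le_iff hμ hR.2.1 ht hY h0 (@MeasurableSet.univ _ (𝓕 t))).1 (by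
      filter_upwards [h1, hYρ] with ω h3 h4 _
      exact (EReal.coe_le_coe_iff.1 h3).trans h4) univ (@MeasurableSet.univ _ (𝓕 t))
    rwa [hc, univ_inter, restr_univ] at h2
  · have h1 := (hr t ht Y hY).2.2 (fun _ => ((0 : ℝ) : EReal)) measurable_const (by
      rintro _ ⟨Q, γ, hQ, hR, rfl⟩
      have h2 := (hQ.value_le_iff hμ hR.2.1 ht hY h0 (@MeasurableSet.univ _ (𝓕 t))).2
        fun A hA => by
          rw [hc]
          exact hYR _ hR _ (hA.inter (@MeasurableSet.univ _ (𝓕 t)))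
      filter_upwards [h2] with ω h3
      exact EReal.coe_le_coe_iff.2 (h3 (mem_univ ω)))
    filter_upwards [h1] with ω h2 using EReal.coe_le_coe_iff.1 h2

/-- The process `D_t ρ_t(X - X_t 1_{𝕋_t}) - ∑_{s ≤ t} D_s (X_s - X_{s-1})`. -/
noncomputable def discountedRisk (ρ : ℕ → Proc Ω H → Ω → ℝ) (γ X : Proc Ω H) (t : ℕ) : Ω → ℝ :=
  fun ω => disc γ t ω * riskOf ρ t (X - constFrom t (coord X t)) ω
    - ∑ s ∈ Finset.range (t + 1), disc γ s ω * incr X s ω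

theorem RInf.incr {X : Proc Ω H} (hX : X ∈ RInf H 𝓕 P) (ht : (t : ℕ∞) ∈ H.times) :
    LInf 𝓕 P t (incr X t) := by
  cases t with
  | zero => exact RInf.coord hX ht
  | succ n =>
    have := (RInf.coord hX ht).add
      ((RInf.coord hX (H.natCast_mem_times_of_le (Nat.le_succ n) ht)).mono (Nat.le_succ n)).neg
    simp only [← sub_eq_add_neg] at this
    exact this

theorem RInf.sub_constFrom_coord {X : Proc Ω H} (hX : X ∈ RInf H 𝓕 P)
    (ht : (t : ℕ∞) ∈ H.times) : X - RiskProc.constFrom t (RiskProc.coord X t) ∈ RInf H 𝓕 P :=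
  RInf.sub hX (RInf.constFrom (RInf.coord hX ht))

theorem IsCondCoherent.riskOf_sub_constFrom_coord (hρ : IsCondCoherent 𝓕 P t (ρ t))
    (ht : (t : ℕ∞) ∈ H.times) {X : Proc Ω H} (hX : X ∈ RInf H 𝓕 P) :
    ∀ᵐ ω ∂P, riskOf ρ t (X - constFrom t (coord X t)) ω = coord X t ω + riskOf ρ t X ω := by
  have hl := (RInf.coord hX ht).neg
  have h1 : X - constFrom t (coord X t) = X + constFrom t (fun ω => -coord X t ω) := by
    ext s ω
    simp only [Pi.sub_apply, Pi.add_apply, constFrom]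
    split_ifs <;> ring
  filter_upwards [hρ.riskOf_add_constFrom hX hl] with ω h2
  rw [h1, h2]
  ring

/-! ### The discounted risk process along a model -/

namespace IsModel

variable {Q : Measure[sigmaEnd H 𝓕] Ω} {γ : Proc Ω H}

theorem measurable_discountedRisk (hQ : IsModel 𝓕 P Q γ) (hρ : IsDynCoherent 𝓕 P ρ)
    (ht : (t : ℕ∞) ∈ H.times) {X : Proc Ω H} (hX : X ∈ RInf H 𝓕 P) :
    Measurable[𝓕 t] (discountedRisk ρ γ X t) := by
  refine ((disc_measurable hQ.2.adapted ht).mul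
    ((hρ t ht).linf (RInf.sub_constFrom_coord hX ht)).1).sub
    (Finset.measurable_sum _ fun s hs => ?_)
  have hst := Nat.lt_succ_iff.1 (Finset.mem_range.1 hs)
  have hs' := H.natCast_mem_times_of_le hst ht
  exact ((disc_measurable hQ.2.adapted hs').mul (RInf.incr hX hs').1).mono (𝓕.mono hst) le_rfl

theorem integrable_discountedRisk (hQ : IsModel 𝓕 P Q γ) (hρ : IsDynCoherent 𝓕 P ρ)
    (ht : (t : ℕ∞) ∈ H.times) {X : Proc Ω H} (hX : X ∈ RInf H 𝓕 P) :
    Integrable (discountedRisk ρ γ X t) Q := by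
  refine (hQ.integrable_disc_mul ht ht ((hρ t ht).linf (RInf.sub_constFrom_coord hX ht))).sub
    (integrable_finsetSum _ fun s hs => ?_)
  have hs' := H.natCast_mem_times_of_le (Nat.lt_succ_iff.1 (Finset.mem_range.1 hs)) ht
  exact hQ.integrable_disc_mul hs' hs' (RInf.incr hX hs')

/-- Cash additivity gives ρ_t(X - X_t 1_{𝕋_t}) = X_t + ρ_t(X), and the new summand D_{t+1}(X_{t+1} -
X_t) replaces X_{t+1} by X_t. The increment is thus the defect in the inequality of statement 3. -/
theorem ae_discountedRisk_succ (hQ : IsModel 𝓕 P Q γ) (hρ : IsDynCoherent 𝓕 P ρ)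
    (ht : (t : ℕ∞) < H.last) {X : Proc Ω H} (hX : X ∈ RInf H 𝓕 P) :
    ∀ᵐ ω ∂Q, discountedRisk ρ γ X (t + 1) ω = discountedRisk ρ γ X t ω +
      (disc γ (t + 1) ω * (coord X t ω + riskOf ρ (t + 1) X ω) -
        disc γ t ω * (coord X t ω + riskOf ρ t X ω)) := by
  have hae : ∀ r : ℕ, (r : ℕ∞) ∈ H.times → ∀ᵐ ω ∂Q,
      riskOf ρ r (X - constFrom r (coord X r)) ω = coord X r ω + riskOf ρ r X ω := fun r hr =>
    hQ.ae_of_ae hr (measurableSet_eq_fun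
      ((hρ r hr).linf (RInf.sub_constFrom_coord hX hr)).1
      ((RInf.coord hX hr).add ((hρ r hr).linf hX)).1)
      ((hρ r hr).riskOf_sub_constFrom_coord hr hX)
  filter_upwards [hae t (H.mem_times_of_lt_last ht),
    hae (t + 1) (H.natCast_mem_times_of_lt_last ht)] with ω h1 h2
  simp only [discountedRisk]
  rw [h1, h2, Finset.sum_range_succ _ (t + 1)]
  simp only [incr, Pi.sub_apply]
  ring

theorem setIntegral_discountedRisk_succ_le_iff (hQ : IsModel 𝓕 P Q γ)
    (hρ : IsDynCoherent 𝓕 P ρ) (ht : (t : ℕ∞) < H.last) {X : Proc Ω H} (hX : X ∈ RInf H 𝓕 P)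
    (A : Set Ω) :
    ∫ ω in A, discountedRisk ρ γ X (t + 1) ω ∂Q ≤ ∫ ω in A, discountedRisk ρ γ X t ω ∂Q ↔
      ∫ ω in A, disc γ (t + 1) ω * (coord X t ω + riskOf ρ (t + 1) X ω) ∂Q ≤
        ∫ ω in A, disc γ t ω * (coord X t ω + riskOf ρ t X ω) ∂Q := by
  have htt := H.mem_times_of_lt_last ht
  have htt1 := H.natCast_mem_times_of_lt_last ht
  have h1 := hQ.integrable_disc_mul htt1 htt1 (((RInf.coord hX htt).mono (Nat.le_succ t)).add
    ((hρ _ htt1).linf hX))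
  have h2 := hQ.integrable_disc_mul htt htt ((RInf.coord hX htt).add ((hρ _ htt).linf hX))
  have h3 := MeasureTheory.integral_add (μ := Q.restrict A)
    (hQ.integrable_discountedRisk hρ htt hX).integrableOn (h1.sub h2).integrableOn
  have h4 := MeasureTheory.integral_sub (μ := Q.restrict A) h1.integrableOn h2.integrableOn
  simp only [Pi.sub_apply] at h3
  rw [integral_congr_ae (ae_restrict_of_ae (hQ.ae_discountedRisk_succ hρ ht hX)), h3, h4,
    add_le_iff_nonpos_right, sub_nonpos]

theorem isSupermart_discountedRisk_iff (hQ : IsModel 𝓕 P Q γ) (hρ : IsDynCoherent 𝓕 P ρ)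
    {X : Proc Ω H} (hX : X ∈ RInf H 𝓕 P) :
    IsSupermart H 𝓕 Q (discountedRisk ρ γ X) ↔ ∀ t : ℕ, (t : ℕ∞) < H.last →
      ∀ A, MeasurableSet[𝓕 t] A →
        ∫ ω in A, disc γ (t + 1) ω * (coord X t ω + riskOf ρ (t + 1) X ω) ∂Q ≤
          ∫ ω in A, disc γ t ω * (coord X t ω + riskOf ρ t X ω) ∂Q := by
  have hQp := hQ.isProbabilityMeasure
  have hcond : ∀ s t : ℕ, s ≤ t → (t : ℕ∞) ∈ H.times →
      ((∀ᵐ ω ∂Q, (Q[discountedRisk ρ γ X t | 𝓕 s]) ω ≤ discountedRisk ρ γ X s ω) ↔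
        ∀ A, MeasurableSet[𝓕 s] A → ∫ ω in A, discountedRisk ρ γ X t ω ∂Q ≤
          ∫ ω in A, discountedRisk ρ γ X s ω ∂Q) := by
    intro s t hst ht
    have hs := H.natCast_mem_times_of_le hst ht
    exact condExp_le_iff (filtration_le_sigmaEnd hs) (hQ.integrable_discountedRisk hρ ht hX)
      (hQ.integrable_discountedRisk hρ hs hX)
      (hQ.measurable_discountedRisk hρ hs hX).stronglyMeasurable
  constructor
  · intro h t ht A hA
    have htt1 := H.natCast_mem_times_of_lt_last ht
    exact (hQ.setIntegral_discountedRisk_succ_le_iff hρ ht hX A).1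
      ((hcond t (t + 1) (Nat.le_succ t) htt1).1 (h.2 t (t + 1) (Nat.le_succ t) htt1) A hA)
  · intro h
    refine ⟨fun t ht => ⟨hQ.measurable_discountedRisk hρ ht hX,
      hQ.integrable_discountedRisk hρ ht hX⟩, fun s t hst ht => (hcond s t hst ht).2 ?_⟩
    intro A hA
    induction t, hst using Nat.le_induction with
    | base => exact le_rfl
    | succ n hn ih =>
      have hlt : (n : ℕ∞) < H.last :=
        lt_of_lt_of_le (by exact_mod_cast Nat.lt_succ_self n) (H.le_last ht)
      exact ((hQ.setIntegral_discountedRisk_succ_le_iff hρ hlt hX A).2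
        (h n hlt A (𝓕.mono hn _ hA))).trans (ih (H.mem_times_of_lt_last hlt))

end IsModel

/-! ### The characterizations through equivalent measures -/

theorem timeConsistent_iff_stable [IsProbabilityMeasure P]
    (h𝓕 : H.last = ⊤ → FiltrationRegular 𝓕) (hμ : IsReference 𝓕 P μ)
    (hρ : IsDynCoherent 𝓕 P ρ)
    (hcont : ∀ t : ℕ, (t : ℕ∞) ∈ H.times → ContFromAbove 𝓕 P ρ t)
    (hne : (QStar 𝓕 P μ ρ).Nonempty) :
    TimeConsistent 𝓕 P ρ ↔
      Stable 𝓕 (QStar 𝓕 P μ ρ) ∧ RepresentedByQStar 𝓕 P μ ρ :=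
  ⟨fun h => ⟨h.stable hμ hρ, (h.determinedByQStar hμ hρ hcont hne).represented h𝓕 hμ hρ⟩,
    fun h => (h.2.determined h𝓕 hμ).timeConsistent_of_stable h.1 hμ hρ⟩

/-- The representation alone yields the first one-step inclusion. The supermartingale property gives
the inequality of statement 3 for models in 𝓠̄*, and these suffice to test the second. -/
theorem timeConsistent_iff_isSupermart [IsProbabilityMeasure P]
    (h𝓕 : H.last = ⊤ → FiltrationRegular 𝓕) (hμ : IsReference 𝓕 P μ)
    (hρ : IsDynCoherent 𝓕 P ρ)
    (hcont : ∀ t : ℕ, (t : ℕ∞) ∈ H.times → ContFromAbove 𝓕 P ρ t)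
    (hne : (QStar 𝓕 P μ ρ).Nonempty) :
    TimeConsistent 𝓕 P ρ ↔ RepresentedByQStar 𝓕 P μ ρ ∧ ∀ X ∈ RInf H 𝓕 P,
      ∀ (Q : Measure[sigmaEnd H 𝓕] Ω) (γ : Proc Ω H), IsModel 𝓕 P Q γ →
        tensor 𝓕 Q γ ∈ QStar 𝓕 P μ ρ → IsSupermart H 𝓕 Q (discountedRisk ρ γ X) := by
  constructor
  · intro h
    have hd := h.determinedByQStar hμ hρ hcont hne
    refine ⟨hd.represented h𝓕 hμ hρ, fun X hX Q γ hQ hR =>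
      (hQ.isSupermart_discountedRisk_iff hρ hX).2 fun t ht A hA => ?_⟩
    exact hQ.setIntegral_step_le hμ hρ h ht ((hd t (H.mem_times_of_lt_last ht)).1 _ hR) hX hA
  · rintro ⟨hr, hs⟩
    have hd := hr.determined h𝓕 hμ
    refine (timeConsistent_iff hρ).2 fun t ht X hX => ⟨hd.riskOf_proj_succ_nonpos hρ ht hX,
      fun hXρ => (hd t (H.mem_times_of_lt_last ht)).2 _
        (RInf.neg ((hρ _ (H.natCast_mem_times_of_lt_last ht)).rhoBar_mem hX))
        fun R hR A hA => ?_⟩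
    obtain ⟨Q, γ, hQ, rfl⟩ := MBar.exists_isModel h𝓕 hμ hR.1
    exact hQ.restr_neg_rhoBar_nonneg hμ hρ ht hX hXρ hA
      ((hQ.isSupermart_discountedRisk_iff hρ hX).1 (hs X hX Q γ hQ hR) t ht A hA)

end Supermartingale

end RiskProc

theorem theorem4p9 {Ω : Type*} {m0 : MeasurableSpace Ω} (H : RiskProc.Horizon)
    (𝓕 : Filtration ℕ m0) (h𝓕0 : 𝓕 0 = ⊥)
    (P : Measure Ω) [IsProbabilityMeasure P]
    (h𝓕 : H.last = ⊤ → RiskProc.FiltrationRegular 𝓕)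
    (μ : RiskProc.Proc Ω H) (hμ : RiskProc.IsReference 𝓕 P μ)
    (ρ : ℕ → RiskProc.Proc Ω H → Ω → ℝ)
    (hρ : RiskProc.IsDynCoherent 𝓕 P ρ)
    (hcont : ∀ t : ℕ, (t : ℕ∞) ∈ H.times → RiskProc.ContFromAbove 𝓕 P ρ t) :
    -- time consistency ⇔ pasting decomposition of the zero-penalty sets
    (RiskProc.TimeConsistent 𝓕 P ρ ↔
      ∀ t : ℕ, (t : ℕ∞) < H.last → ∀ Qb ∈ RiskProc.MBar 𝓕 P μ,
        RiskProc.zeroSet 𝓕 P μ ρ t Qb =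
          {R | ∃ Q₁ ∈ RiskProc.zeroSetStep 𝓕 P μ ρ t (t + 1) Qb,
            ∃ Q₂ ∈ RiskProc.zeroSet 𝓕 P μ ρ (t + 1) Q₁,
              RiskProc.IsPasting 𝓕 (t + 1) Set.univ Q₁ Q₂ R}) ∧
    -- time consistency ⇔ supermartingale condition on zero-penalty models
    (RiskProc.TimeConsistent 𝓕 P ρ ↔
      ∀ t : ℕ, (t : ℕ∞) < H.last → ∀ X ∈ RiskProc.RInf H 𝓕 P,
        ∀ (Q : Measure[RiskProc.sigmaEnd H 𝓕] Ω) (γ : RiskProc.Proc Ω H),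
          RiskProc.IsModel 𝓕 P Q γ →
          (∀ᵐ ω ∂Q, 0 < RiskProc.disc γ t ω → RiskProc.penalty 𝓕 P ρ t Q γ ω = 0) →
          (∀ᵐ ω ∂Q, (Q[fun ω' => RiskProc.disc γ (t + 1) ω' *
                (RiskProc.coord X t ω' + RiskProc.riskOf ρ (t + 1) X ω') | 𝓕 t]) ω
              ≤ RiskProc.disc γ t ω * (RiskProc.coord X t ω + RiskProc.riskOf ρ t X ω)) ∧
          (∀ᵐ ω ∂Q, 0 < RiskProc.disc γ (t + 1) ω →
            RiskProc.penalty 𝓕 P ρ (t + 1) Q γ ω = 0)) ∧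
    ((RiskProc.QStar 𝓕 P μ ρ).Nonempty →
      -- time consistency ⇔ stability and representation
      (RiskProc.TimeConsistent 𝓕 P ρ ↔
        RiskProc.Stable 𝓕 (RiskProc.QStar 𝓕 P μ ρ) ∧ RiskProc.RepresentedByQStar 𝓕 P μ ρ) ∧
      -- time consistency ⇔ representation and supermartingale property
      (RiskProc.TimeConsistent 𝓕 P ρ ↔
        RiskProc.RepresentedByQStar 𝓕 P μ ρ ∧
        ∀ X ∈ RiskProc.RInf H 𝓕 P,
          ∀ (Q : Measure[RiskProc.sigmaEnd H 𝓕] Ω) (γ : RiskProc.Proc Ω H),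
            RiskProc.IsModel 𝓕 P Q γ →
            RiskProc.tensor 𝓕 Q γ ∈ RiskProc.QStar 𝓕 P μ ρ →
            RiskProc.IsSupermart H 𝓕 Q (fun t ω =>
              RiskProc.disc γ t ω *
                  RiskProc.riskOf ρ t (X - RiskProc.constFrom t (RiskProc.coord X t)) ω
                - ∑ s ∈ Finset.range (t + 1), RiskProc.disc γ s ω * RiskProc.incr X s ω))) :=
  ⟨RiskProc.timeConsistent_iff_zeroSet hμ hρ hcont,
    RiskProc.timeConsistent_iff_model h𝓕 hμ hρ hcont, fun hne =>
    ⟨RiskProc.timeConsistent_iff_stable h𝓕 hμ hρ hcont hne,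
      RiskProc.timeConsistent_iff_isSupermart h𝓕 hμ hρ hcont hne⟩⟩
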